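/- **Setting.** Let $\hbar\in\mathbb C$ be such that $q=e^{\hbar}$ is not a root of unity; put $q^x=e^{\hbar x}$ and $[x]_q=\frac{q^x-q^{-x}}{q-q^{-1}}$ for $x\in\mathbb C$. Let $l\ge 0$, $P\ge 1$, $N=2l+2+P$, $n=[N/2]$, $p=[P/2]$, so $n=l+1+p$. Let $\mathfrak g=\mathfrak{so}(N)$ with orthonormal weights $\varepsilon_1,\dots,\varepsilon_n$, $\varepsilon_{N+1-i}=-\varepsilon_i$ (so $\varepsilon_{n+1}=0$ for odd $N$), and simple roots $\alpha_i=\varepsilon_i-\varepsilon_{i+1}$ for $i<n$, with $\alpha_n=\varepsilon_n$ for odd $N$ and $\alpha_n=\varepsilon_{n-1}+\varepsilon_n$ for even $N$. $U_q(\mathfrak g)$ is the $\mathbb C$-algebra with generators $e_\alpha,f_\alpha,t_\alpha^{\pm1}=q^{\pm h_\alpha}$ ($\alpha$ simple), commuting $t_\alpha$, relations $t_\alpha e_\beta=q^{(\alpha,\beta)}e_\beta t_\alpha$, $t_\alpha f_\beta=q^{-(\alpha,\beta)}f_\beta t_\alpha$, $[e_\alpha,f_\beta]=\delta_{\alpha\beta}\frac{t_\alpha-t_\alpha^{-1}}{q-q^{-1}}$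 and the $q$-Serre relations (with $q_\alpha=q^{(\alpha,\alpha)/2}$), and with coproduct $\Delta(e_\alpha)=e_\alpha\otimes1+t_\alpha\otimes e_\alpha$, $\Delta(f_\alpha)=f_\alpha\otimes t_\alpha^{-1}+1\otimes f_\alpha$, $\Delta(t_\alpha)=t_\alpha\otimes t_\alpha$. The natural module $\mathbb C^N$ has basis $w_1,\dots,w_N$ with $w_i$ of weight $\varepsilon_i$; whenever $\alpha=\varepsilon_j-\varepsilon_k$ is a simple root, $f_\alpha w_j=(-1)^{\epsilon_j}w_k$ and $e_\alpha w_k=(-1)^{\epsilon_j}w_j$, where $\epsilon_j=0$ if $j<N/2$ and $\epsilon_j=1$ otherwise; all other $e_\alpha w_k$, $f_\alpha w_j$ are zero. Let $\lambda$ be a complex weight, put $\lambda_i=(\lambda,\varepsilon_i)$ and suppose that $\lambda_i=0$ for $l+2\le i\le n$. Let $\hat M_\lambda$ be the parabolic Verma module with respect to the Levi subalgebra $\mathfrak h+\mathfrak{so}(P)$, with highest weight $\lambda$ and canonical generator $v_\lambda$; that is, the quotient of $U_q(\mathfrak g)$ by the left ideal generated by all $e_\alpha$, all $t_\alpha-q^{(\lambda,\alpha)}$,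 and $f_\alpha$ for those simple $\alpha$ that are roots of $\mathfrak{so}(P)$ (i.e. have no component along $\varepsilon_1,\dots,\varepsilon_{l+1}$). Let $\hat V_m\subset\mathbb C^N\otimes\hat M_\lambda$ be the submodule generated by $w_k\otimes v_\lambda$, $1\le k\le m$. **Generating coefficient.** Write $f_i=f_{\alpha_{l+i}}$ for $0\le i\le p+1$ ($f_0$ is used only for $l\ge1$), $D_a=f_af_{a-1}\cdots f_1$ ($D_0=1$). For odd $P$ and $1\le m\le p+1$ let $\phi_m=D_m\,(f_{m+1}f_{m+2}\cdots f_{p+1})\,D_{p+1}$. For even $P$ let $\phi_m=D_m\,(f_{m+1}\cdots f_{p-1})\,f_pf_{p+1}\,D_{p-1}$ for $1\le m<p$, $\phi_p=f_pD_{p-1}f_{p+1}D_{p-1}$ and $\phi_{p+1}=f_{p+1}D_{p-1}f_pD_{p-1}$. Let $\phi^1_m=f_0\phi_m$, $\phi^3_m=\phi_mf_0$, and let $\phi_m^2$ be obtained from $\phi_m$ by inserting $f_0$ immediately before its last (rightmost) factor. Let $d=p+1$ for odd $P$ and $d=p$ for even $P$. Put $x=\lambda_{l+1}$ and $$f_{2\varepsilon_{l+1}}=\sum_{m=1}^{d}(-1)^{m-1}\big[\tfrac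 P2-m+1\big]_q\phi_m,\qquad f_{\varepsilon_l+\varepsilon_{l+1}}=\sum_{m=1}^{d}A^1_m\phi^1_m+\sum_{m=1}^{p+1}A^2_m\phi^2_m+\sum_{m=1}^{d}A^3_m\phi^3_m,$$ $$A^1_m=(-1)^{m+1}[x+P-m]_q[x+\tfrac P2]_q,\quad A^3_m=(-1)^{m+1}[x+m-1]_q[x+\tfrac P2-1]_q,$$ $$A^2_m=(-1)^m\big(q^{m-\frac P2}+q^{-m+\frac P2}\big)[x+\tfrac P2-1]_q[x+\tfrac P2]_q,$$ except that for even $P$ and $m\in\{p,p+1\}$ one puts $A^2_m=(-1)^p[x+\frac P2-1]_q[x+\frac P2]_q$. For $k=l-1,\dots,1$ define recursively $$f_{\varepsilon_k+\varepsilon_{l+1}}=[\lambda_{k+1}+x+P+l-k]_q\,f_{\alpha_k}f_{\varepsilon_{k+1}+\varepsilon_{l+1}}-[\lambda_{k+1}+x+P+l-k-1]_q\,f_{\varepsilon_{k+1}+\varepsilon_{l+1}}f_{\alpha_k}.$$ ($f_{\varepsilon_1+\varepsilon_{l+1}}$ means $f_{2\varepsilon_1}$ if $l=0$.) **Proposition.**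 There is a unique singular vector (a non-zero weight vector annihilated by all $e_\alpha$) $\hat u_{N-l}=\sum_{i=1}^N w_i\otimes y_i\in\mathbb C^N\otimes\hat M_\lambda$ of weight $\lambda-\varepsilon_{l+1}$ with $y_1=f_{\varepsilon_1+\varepsilon_{l+1}}v_\lambda$. It satisfies $$\hat u_{N-l}=\hat C_{N-l}\,w_{N-l}\otimes v_\lambda\mod\hat V_{N-l-1},$$ $$\hat C_{N-l}=(-1)^{[\frac{P+1}2]+l}\Big[\lambda_{l+1}+\frac P2\Big]_q\prod_{\substack{1\le j\le l+2\\ j\ne l+1}}[\lambda_j+\lambda_{l+1}+P+1+l-j]_q,$$ where $\lambda_{l+2}=0$ (for $P=1$ this is the convention $\varepsilon_{n+1}=0$). -/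

import Mathlib

open scoped TensorProduct

noncomputable section

namespace BorderlineSO

/-! ### q-numbers; here `q = exp hb` -/

/-- `q ^ x` for a complex exponent `x`, where `q = exp hb`. -/
def qpow (hb x : ℂ) : ℂ := Complex.exp (hb * x)

/-- `[x]_q = (q ^ x - q ^ (-x)) / (q - q⁻¹)`, where `q = exp hb`. -/
def qnum (hb x : ℂ) : ℂ := (qpow hb x - qpow hb (-x)) / (qpow hb 1 - qpow hb (-1))

/-- `[m]_q!` -/
def qfact (hb : ℂ) (m : ℕ) : ℂ := ∏ k ∈ Finset.range m, qnum hb (k + 1)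

/-- The symmetric Gaussian binomial coefficient. -/
def qbinom (hb : ℂ) (m k : ℕ) : ℂ := qfact hb m / (qfact hb k * qfact hb (m - k))

/-! ### Roots and weights of `so(N)`, of rank `n = N / 2`

Weights are written in coordinates with respect to the orthonormal basis `ε_1, ..., ε_n`; the
coordinate along `ε_{k+1}` is the value at `k : Fin n`. -/

/-- The weight `ε_i` of the natural representation, `1 ≤ i ≤ N`, so that `ε_{N+1-i} = -ε_i`
and `ε_{n+1} = 0` if `N = 2 n + 1`. -/
def natWeight (N i : ℕ) : Fin (N / 2) → ℤ := fun k =>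
  if i = k + 1 then 1 else if i + (k + 1) = N + 1 then -1 else 0

/-- The simple root `α_i`, `1 ≤ i ≤ n`: it is `ε_i - ε_{i+1}` for `i < n`, while `α_n` is
`ε_{n-1} + ε_n` for even `N` and `ε_n = ε_n - ε_{n+1}` for odd `N`. -/
def simpleRootAt (N i : ℕ) : Fin (N / 2) → ℤ :=
  if i = N / 2 ∧ Even N then natWeight N (i - 1) + natWeight N i
  else natWeight N i - natWeight N (i + 1)

/-- The simple roots indexed by `Fin n`: the index `a` stands for `α_{a+1}`. -/
def simpleRoot (N : ℕ) (a : Fin (N / 2)) : Fin (N / 2) → ℤ := simpleRootAt N (a + 1)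

/-- The canonical inner product on the weight lattice. -/
def ip {N : ℕ} (x y : Fin (N / 2) → ℤ) : ℤ := ∑ k, x k * y k

/-- The inner product of a complex weight with an integral one. -/
def pair {N : ℕ} (lam : Fin (N / 2) → ℂ) (y : Fin (N / 2) → ℤ) : ℂ := ∑ k, lam k * (y k : ℂ)

/-- `λ_i = (λ, ε_i)`. -/
def coord {N : ℕ} (lam : Fin (N / 2) → ℂ) (i : ℕ) : ℂ := pair lam (natWeight N i)

/-! ### The quantum group `U_q(so(N))` -/

/-- The generators `e_α`, `f_α`, `t_α = q ^ h_α` and `t_α⁻¹ = q ^ (-h_α)`. -/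
inductive Gen (N : ℕ) : Type
  | e (a : Fin (N / 2)) : Gen N
  | f (a : Fin (N / 2)) : Gen N
  | t (a : Fin (N / 2)) : Gen N
  | tinv (a : Fin (N / 2)) : Gen N

/-- The q-Serre polynomial `∑ k, (-1) ^ k * binom(m, k) • x ^ (m - k) * y * x ^ k`, where
`m = 1 - 2 (α_a, α_b) / (α_a, α_a)` and the binomial coefficient is taken with respect to
`q_a = q ^ ((α_a, α_a) / 2)`. -/
def serre {A : Type} [Ring A] [Algebra ℂ A] (hb : ℂ) (N : ℕ) (a b : Fin (N / 2)) (x y : A) : A :=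
  let m : ℕ := (1 - 2 * ip (simpleRoot N a) (simpleRoot N b) /
    ip (simpleRoot N a) (simpleRoot N a)).toNat
  let hba : ℂ := hb * (ip (simpleRoot N a) (simpleRoot N a) : ℂ) / 2
  ∑ k ∈ Finset.range (m + 1), ((-1) ^ k * qbinom hba m k) • (x ^ (m - k) * y * x ^ k)

/-- The defining relations of `U_q(so(N))`. -/
inductive Rel (hb : ℂ) (N : ℕ) : FreeAlgebra ℂ (Gen N) → FreeAlgebra ℂ (Gen N) → Prop
  | t_tinv (a : Fin (N / 2)) :
      Rel hb N (FreeAlgebra.ι ℂ (Gen.t a) * FreeAlgebra.ι ℂ (Gen.tinv a)) 1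
  | tinv_t (a : Fin (N / 2)) :
      Rel hb N (FreeAlgebra.ι ℂ (Gen.tinv a) * FreeAlgebra.ι ℂ (Gen.t a)) 1
  | t_t (a b : Fin (N / 2)) :
      Rel hb N (FreeAlgebra.ι ℂ (Gen.t a) * FreeAlgebra.ι ℂ (Gen.t b))
        (FreeAlgebra.ι ℂ (Gen.t b) * FreeAlgebra.ι ℂ (Gen.t a))
  | t_e (a b : Fin (N / 2)) :
      Rel hb N (FreeAlgebra.ι ℂ (Gen.t a) * FreeAlgebra.ι ℂ (Gen.e b))
        (qpow hb (ip (simpleRoot N a) (simpleRoot N b)) •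
          (FreeAlgebra.ι ℂ (Gen.e b) * FreeAlgebra.ι ℂ (Gen.t a)))
  | t_f (a b : Fin (N / 2)) :
      Rel hb N (FreeAlgebra.ι ℂ (Gen.t a) * FreeAlgebra.ι ℂ (Gen.f b))
        (qpow hb (-ip (simpleRoot N a) (simpleRoot N b)) •
          (FreeAlgebra.ι ℂ (Gen.f b) * FreeAlgebra.ι ℂ (Gen.t a)))
  | e_f (a : Fin (N / 2)) :
      Rel hb N (FreeAlgebra.ι ℂ (Gen.e a) * FreeAlgebra.ι ℂ (Gen.f a)
          - FreeAlgebra.ι ℂ (Gen.f a) * FreeAlgebra.ι ℂ (Gen.e a))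
        ((qpow hb 1 - qpow hb (-1))⁻¹ •
          (FreeAlgebra.ι ℂ (Gen.t a) - FreeAlgebra.ι ℂ (Gen.tinv a)))
  | e_f_ne (a b : Fin (N / 2)) (h : a ≠ b) :
      Rel hb N (FreeAlgebra.ι ℂ (Gen.e a) * FreeAlgebra.ι ℂ (Gen.f b))
        (FreeAlgebra.ι ℂ (Gen.f b) * FreeAlgebra.ι ℂ (Gen.e a))
  | serre_e (a b : Fin (N / 2)) (h : a ≠ b) :
      Rel hb N (serre hb N a b (FreeAlgebra.ι ℂ (Gen.e a)) (FreeAlgebra.ι ℂ (Gen.e b))) 0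
  | serre_f (a b : Fin (N / 2)) (h : a ≠ b) :
      Rel hb N (serre hb N a b (FreeAlgebra.ι ℂ (Gen.f a)) (FreeAlgebra.ι ℂ (Gen.f b))) 0

/-- The quantum group `U_q(so(N))` over `ℂ`, `q = exp hb`. -/
abbrev Uq (hb : ℂ) (N : ℕ) : Type := RingQuot (Rel hb N)

/-- The image of a generator in `U_q(so(N))`. -/
def gen (hb : ℂ) {N : ℕ} (x : Gen N) : Uq hb N :=
  RingQuot.mkAlgHom ℂ (Rel hb N) (FreeAlgebra.ι ℂ x)

/-! ### Parabolic Verma modules relative to the Levi subalgebra `h + so(P)`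

Here `N = 2 l + 2 + P`, and `so(P)` sits in the coordinates `ε_{l+2}, ..., ε_n`. -/

/-- The simple root with index `a` is a root of `so(P)`: it has no component along
`ε_1, ..., ε_{l+1}`. -/
def IsLevi (N l : ℕ) (a : Fin (N / 2)) : Prop :=
  ∀ k : Fin (N / 2), (k : ℕ) ≤ l → simpleRoot N a k = 0

/-- The left ideal of `U_q(so(N))` generated by the kernel of the one-dimensional representation
of the parabolic subalgebra that sends `t_α` to `q ^ (λ, α)`, all `e_α` to zero, and `f_α` to zero
if `α` is a root of `so(P)`. -/
def vermaIdeal (hb : ℂ) (N l : ℕ) (lam : Fin (N / 2) → ℂ) : Submodule (Uq hb N) (Uq hb N) :=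
  Submodule.span (Uq hb N)
    (Set.range (fun a : Fin (N / 2) => gen hb (Gen.e a)) ∪
     Set.range (fun a : Fin (N / 2) => gen hb (Gen.t a) -
        algebraMap ℂ (Uq hb N) (qpow hb (pair lam (simpleRoot N a)))) ∪
     (fun a : Fin (N / 2) => gen hb (Gen.f a)) '' {a | IsLevi N l a})

/-- The parabolic Verma module of highest weight `λ`. -/
abbrev Verma (hb : ℂ) (N l : ℕ) (lam : Fin (N / 2) → ℂ) : Type :=
  Uq hb N ⧸ vermaIdeal hb N l lam

/-- The canonical generator `v_λ`. -/
def vacuum (hb : ℂ) (N l : ℕ) (lam : Fin (N / 2) → ℂ) : Verma hb N l lam :=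
  Submodule.Quotient.mk 1

/-- The action of a generator on the parabolic Verma module. -/
def act (hb : ℂ) (N l : ℕ) (lam : Fin (N / 2) → ℂ) (x : Gen N) :
    Verma hb N l lam →ₗ[ℂ] Verma hb N l lam :=
  Algebra.lsmul ℂ ℂ (Verma hb N l lam) (gen hb x)

/-! ### The natural representation on `ℂ ^ N` -/

/-- The standard basis vector `w_i`, `1 ≤ i ≤ N`. -/
def w (N i : ℕ) : Fin N → ℂ := fun j => if (j : ℕ) + 1 = i then 1 else 0

/-- The sign `(-1) ^ ϵ_i`, where `ϵ_i = 0` if `i < N / 2` (a rational number) and `ϵ_i = 1`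
otherwise. -/
def sgn (N i : ℕ) : ℂ := if 2 * i < N then 1 else -1

/-- The matrix of a generator: if `α = ε_j - ε_k` is a simple root, then
`e_α w_k = (-1) ^ ϵ_j w_j`, `f_α w_j = (-1) ^ ϵ_j w_k`, and `t_α w_j = q ^ (α, ε_j) w_j`. -/
def natMatrix (hb : ℂ) (N : ℕ) : Gen N → Matrix (Fin N) (Fin N) ℂ
  | Gen.e a => Matrix.of fun j k =>
      if natWeight N (j + 1) - natWeight N (k + 1) = simpleRoot N a then sgn N (j + 1) else 0
  | Gen.f a => Matrix.of fun k j =>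
      if natWeight N (j + 1) - natWeight N (k + 1) = simpleRoot N a then sgn N (j + 1) else 0
  | Gen.t a => Matrix.diagonal fun j => qpow hb (ip (simpleRoot N a) (natWeight N (j + 1)))
  | Gen.tinv a => Matrix.diagonal fun j => qpow hb (-ip (simpleRoot N a) (natWeight N (j + 1)))

/-- The natural representation of `U_q(so(N))` on generators. -/
def nat (hb : ℂ) (N : ℕ) (x : Gen N) : (Fin N → ℂ) →ₗ[ℂ] (Fin N → ℂ) :=
  Matrix.toLin' (natMatrix hb N x)

/-! ### The tensor product of the natural representation with a parabolic Verma module -/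

/-- `ℂ ^ N ⊗ M_λ` -/
abbrev Tens (hb : ℂ) (N l : ℕ) (lam : Fin (N / 2) → ℂ) : Type :=
  (Fin N → ℂ) ⊗[ℂ] Verma hb N l lam

/-- The action of a generator on the tensor product through the coproduct
`Δ(e) = e ⊗ 1 + t ⊗ e`, `Δ(f) = f ⊗ t⁻¹ + 1 ⊗ f`, `Δ(t) = t ⊗ t`, `Δ(t⁻¹) = t⁻¹ ⊗ t⁻¹`. -/
def tact (hb : ℂ) (N l : ℕ) (lam : Fin (N / 2) → ℂ) :
    Gen N → (Tens hb N l lam →ₗ[ℂ] Tens hb N l lam)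
  | Gen.e a => TensorProduct.map (nat hb N (Gen.e a)) LinearMap.id
      + TensorProduct.map (nat hb N (Gen.t a)) (act hb N l lam (Gen.e a))
  | Gen.f a => TensorProduct.map (nat hb N (Gen.f a)) (act hb N l lam (Gen.tinv a))
      + TensorProduct.map LinearMap.id (act hb N l lam (Gen.f a))
  | Gen.t a => TensorProduct.map (nat hb N (Gen.t a)) (act hb N l lam (Gen.t a))
  | Gen.tinv a => TensorProduct.map (nat hb N (Gen.tinv a)) (act hb N l lam (Gen.tinv a))

/-- A singular vector of weight `mu`: a non-zero vector of weight `mu` that is annihilated by all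
`e_α`. -/
def IsSingular (hb : ℂ) (N l : ℕ) (lam mu : Fin (N / 2) → ℂ) (u : Tens hb N l lam) : Prop :=
  u ≠ 0 ∧
  (∀ a, tact hb N l lam (Gen.t a) u = qpow hb (pair mu (simpleRoot N a)) • u) ∧
  ∀ a, tact hb N l lam (Gen.e a) u = 0

/-- The coefficient `y_1` in the expansion `u = ∑ i, w_i ⊗ y_i`. -/
def firstCoeff (hb : ℂ) (N l : ℕ) (lam : Fin (N / 2) → ℂ) :
    Tens hb N l lam →ₗ[ℂ] Verma hb N l lam :=
  (TensorProduct.lid ℂ (Verma hb N l lam)).toLinearMap ∘ₗ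
    LinearMap.rTensor (Verma hb N l lam) (∑ j : Fin N, w N 1 j • LinearMap.proj j)

/-- The submodule of `ℂ ^ N ⊗ M_λ` generated by `w_1 ⊗ v_λ, ..., w_m ⊗ v_λ`. -/
def filt (hb : ℂ) (N l : ℕ) (lam : Fin (N / 2) → ℂ) (m : ℕ) : Submodule ℂ (Tens hb N l lam) :=
  sInf {S | (∀ k, 1 ≤ k → k ≤ m → w N k ⊗ₜ[ℂ] vacuum hb N l lam ∈ S) ∧
    ∀ x : Gen N, ∀ u ∈ S, tact hb N l lam x u ∈ S}

/-! ### The generating coefficient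

Words in the `f_α` are lists of natural numbers. The letter `m` stands for `f_{α_{l+m}}`: the
letters `1, ..., p + 1`, with `p = P / 2` rounded down, are the simple roots of `so(2 + P)`, and
the letter `0` is the simple root `α_l` next to them. -/

/-- `[a, a + 1, ..., b]`, empty if `b < a`. -/
def up (a b : ℕ) : List ℕ := List.range' a (b + 1 - a)

/-- `[a, a - 1, ..., b]`, empty if `a < b`. -/
def down (a b : ℕ) : List ℕ := (up b a).reverse

/-- The words `φ_m` of weight `-2 ε_{l+1}`, `1 ≤ m ≤ p + 1`. -/
def phi (P m : ℕ) : List ℕ :=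
  let p := P / 2
  if Odd P then down m 1 ++ up (m + 1) (p + 1) ++ down (p + 1) 1
  else if m < p then down m 1 ++ up (m + 1) (p - 1) ++ [p, p + 1] ++ down (p - 1) 1
  else if m = p then [p] ++ down (p - 1) 1 ++ [p + 1] ++ down (p - 1) 1
  else [p + 1] ++ down (p - 1) 1 ++ [p] ++ down (p - 1) 1

/-- `φ_m` with the letter `0` put on the left. -/
def phi1 (P m : ℕ) : List ℕ := 0 :: phi P m

/-- `φ_m` with the letter `0` inserted before the last letter. -/
def phi2 (P m : ℕ) : List ℕ :=
  (phi P m).dropLast ++ 0 :: (phi P m).drop ((phi P m).length - 1)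

/-- `φ_m` with the letter `0` put on the right. -/
def phi3 (P m : ℕ) : List ℕ := phi P m ++ [0]

/-- `f_{α_k}`, `1 ≤ k ≤ n` (zero, and not used, for other `k`). -/
def fAt (hb : ℂ) (N k : ℕ) : Uq hb N :=
  if h : 1 ≤ k ∧ k ≤ N / 2 then gen hb (Gen.f ⟨k - 1, by omega⟩) else 0

/-- The element of `U_q(so(N))` given by a word. -/
def word (hb : ℂ) (N l : ℕ) (L : List ℕ) : Uq hb N := (L.map fun m => fAt hb N (l + m)).prod

/-- The number of independent words `φ_m`: it is `p + 1` for odd `P` and `p` for even `P`. -/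
def dim0 (P : ℕ) : ℕ := (P + 1) / 2

/-- The coefficients of the element of weight `-2 ε_{l+1}`. -/
def A0 (hb : ℂ) (P m : ℕ) : ℂ := (-1) ^ (m - 1) * qnum hb ((P : ℂ) / 2 - m + 1)

/-- The coefficients of the element of weight `-ε_l - ε_{l+1}`; here `x = λ_{l+1}`. -/
def A1 (hb : ℂ) (P : ℕ) (x : ℂ) (m : ℕ) : ℂ :=
  (-1) ^ (m + 1) * qnum hb (x + P - m) * qnum hb (x + (P : ℂ) / 2)

def A2 (hb : ℂ) (P : ℕ) (x : ℂ) (m : ℕ) : ℂ :=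
  if Even P ∧ P / 2 ≤ m then
    (-1) ^ (P / 2) * qnum hb (x + (P : ℂ) / 2 - 1) * qnum hb (x + (P : ℂ) / 2)
  else
    (-1) ^ m * (qpow hb (m - (P : ℂ) / 2) + qpow hb (-m + (P : ℂ) / 2)) *
      qnum hb (x + (P : ℂ) / 2 - 1) * qnum hb (x + (P : ℂ) / 2)

def A3 (hb : ℂ) (P : ℕ) (x : ℂ) (m : ℕ) : ℂ :=
  (-1) ^ (m + 1) * qnum hb (x + m - 1) * qnum hb (x + (P : ℂ) / 2 - 1)

/-- For `0 ≤ d ≤ l` and `k = l + 1 - d`, this is the element of weight `-ε_k - ε_{l+1}` in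
`U_q(so(N))`, evaluated at the weight `λ`. For `d ≥ 2` it is
`f_{α_k} F [λ_{k+1} + λ_{l+1} + P + l - k]_q - F f_{α_k} [λ_{k+1} + λ_{l+1} + P + l - k - 1]_q`,
where `F` is the element of weight `-ε_{k+1} - ε_{l+1}`. -/
def fRoot (hb : ℂ) (N l P : ℕ) (lam : Fin (N / 2) → ℂ) : ℕ → Uq hb N
  | 0 => ∑ m ∈ Finset.Icc 1 (dim0 P), A0 hb P m • word hb N l (phi P m)
  | 1 => ∑ m ∈ Finset.Icc 1 (dim0 P), A1 hb P (coord lam (l + 1)) m • word hb N l (phi1 P m)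
      + ∑ m ∈ Finset.Icc 1 (P / 2 + 1), A2 hb P (coord lam (l + 1)) m • word hb N l (phi2 P m)
      + ∑ m ∈ Finset.Icc 1 (dim0 P), A3 hb P (coord lam (l + 1)) m • word hb N l (phi3 P m)
  | d + 2 =>
      let k := l + 1 - (d + 2)
      qnum hb (coord lam (k + 1) + coord lam (l + 1) + P + l - k) •
          (fAt hb N k * fRoot hb N l P lam (d + 1))
        - qnum hb (coord lam (k + 1) + coord lam (l + 1) + P + l - k - 1) •
          (fRoot hb N l P lam (d + 1) * fAt hb N k)

/-- The generating coefficient of weight `λ - ε_1 - ε_{l+1}` in the parabolic Verma module. -/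
def genCoeff (hb : ℂ) (N l P : ℕ) (lam : Fin (N / 2) → ℂ) : Verma hb N l lam :=
  fRoot hb N l P lam l • vacuum hb N l lam

/-- `u` is the singular vector of weight `λ - ε_{l+1}`, normalized by its generating coefficient. -/
def IsSingularHat (hb : ℂ) (N l P : ℕ) (lam : Fin (N / 2) → ℂ) (u : Tens hb N l lam) : Prop :=
  IsSingular hb N l lam (fun k => lam k - (natWeight N (l + 1) k : ℂ)) u ∧
  firstCoeff hb N l lam u = genCoeff hb N l P lam

/-- The coefficient `Ĉ_{N-l}`. -/
def Chat (hb : ℂ) (N l P : ℕ) (lam : Fin (N / 2) → ℂ) : ℂ :=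
  (-1) ^ ((P + 1) / 2 + l) * qnum hb (coord lam (l + 1) + (P : ℂ) / 2) *
    ∏ j ∈ (Finset.Icc 1 (l + 2)).erase (l + 1),
      qnum hb (coord lam j + coord lam (l + 1) + P + 1 + l - j)

end BorderlineSO

end

set_option linter.unusedSectionVars false

noncomputable section

namespace BorderlineSO

/-! ### Weights -/

/-! The singular vector is written down completely. Let u = Σ w_j ⊗ y_j. Since Δ(e_α) = e_α ⊗ 1 +
t_α ⊗ e_α, the equations e_α u = 0 say that e_α sends y_j to an explicit multiple of y_k if α = ε_j
− ε_k, and to 0 if there is no such k (`SingEq`, `singEq_iff`). Each y_k with k > 1 is therefore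
determined by earlier coefficients, which gives uniqueness (`eq_zero_of_singEq`). Existence means
knowing every e_α on y_1 and on its successors.

The heart is a computation for so(P + 2). If y is killed by the Levi generators, then f_{α_{l+1}} y
generates a copy of the natural module of so(P), with basis D_a y, E_m y (and one more vector for
even P), and φ_m y = D_m E_m y. A generator e_j of so(P) away from the end of the Dynkin diagram
sends the terms m = j − 1, j, j + 1 to the same vector, with factors 1, [2], 1 (`QSys.e_T`). So
annihilation by these e_j is a three-term recursion for the coefficients, with boundary conditions
at the end of the diagram; the q-numbers in the definition of the generating element solve them.
What remains is e_{α_{l+1}} f_{2ε_{l+1}} v = [x + P/2 − 1] E_1 v (`QSys.e_one_Phi`) and e_{α_l}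
f_{ε_l+ε_{l+1}} v = [λ_l + x + P] f_{2ε_{l+1}} v (`QSys.e_zero_FL`). The other elements
f_{ε_k+ε_{l+1}} follow by induction from the recursion (`e_fRoot_succ`). The coefficients y_j are
then those of `sing`, and `singEq_sing` verifies the equations.

That y_1 is not zero needs a proof, since the Verma module is given only as a quotient by a left
ideal. `exists_hom_verma` realizes it on words in the f_α modulo the q-Serre and Levi relations, so
it maps to any space with operators satisfying these relations. A module with monomial operators,
built from the natural module of so(P + 2) and the subsets of {1, …, l}, is chosen so that y_1 goes
to a non-zero multiple of a basis vector (`test_fRoot`, `genCoeff_ne_zero`).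

For the coefficient, let S be a subspace stable under the f_α and containing w_i ⊗ v for i < N − l.
From Δ(f_α)(w_i ⊗ x) ∈ S one gets w_i ⊗ f_α x ≡ −(f_α w_i) ⊗ t_α⁻¹ x, so the letters of a word can
be moved one at a time to the left factor (`tmul_f_smul_mem`). Most words cannot carry w_i down to
w_{N−l} and vanish modulo S; each w_j ⊗ y_j becomes an explicit multiple of w_{N−l} ⊗ v. Summed from
the largest index downwards, these multiples collapse by [x + 1] = q[x] + q^{−x} to a product of
q-numbers (`eqMod_singTail_low`), which for the full sum is the asserted coefficient. -/

/-- The pairs `(j, k)` with `ε_j - ε_k = α_a`. -/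
def rootPair (N a j k : ℕ) : Prop :=
  if a = N / 2 ∧ Even N then (j = a - 1 ∧ k = a + 1) ∨ (j = a ∧ k = a + 2)
  else (j = a ∧ k = a + 1) ∨ (j = N - a ∧ k = N + 1 - a)

/-- The coordinates of the weights of the natural module. -/
def natZ (N i : ℕ) : ℕ → ℤ := fun k => if i = k then 1 else if i + k = N + 1 then -1 else 0

theorem natZ_cases (N i k : ℕ) : (i = k ∧ natZ N i k = 1) ∨
    (i ≠ k ∧ i + k = N + 1 ∧ natZ N i k = -1) ∨ (i ≠ k ∧ i + k ≠ N + 1 ∧ natZ N i k = 0) := by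
  unfold natZ; split_ifs <;> simp [*]

theorem natWeight_apply (N i k : ℕ) (h1 : 1 ≤ k) (h2 : k ≤ N / 2) :
    natWeight N i ⟨k - 1, by omega⟩ = natZ N i k := by
  simp [natWeight, natZ, Nat.sub_add_cancel h1]

theorem natWeight_reflect {N i : ℕ} (h : i ≤ N) :
    natWeight N (N + 1 - i) = - natWeight N i := by
  funext k
  have := k.2
  simp only [natWeight, Pi.neg_apply]
  split_ifs <;> omega

/-- A simple root is a difference of two weights of the natural module in exactly two ways,
interchanged by i ↦ N + 1 − i. Comparing the coordinates at a and at its neighbour singles these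
out, except for the short root ε_n of odd N, where all the other coordinates have to be compared. -/
theorem natWeight_sub_eq_iff {N a j k : ℕ} (ha : 1 ≤ a) (han : a ≤ N / 2) (hN : 3 ≤ N)
    (hj : 1 ≤ j) (hjN : j ≤ N) (hk : 1 ≤ k) (hkN : k ≤ N) :
    natWeight N j - natWeight N k = simpleRootAt N a ↔ rootPair N a j k := by
  have key : natWeight N j - natWeight N k = simpleRootAt N a →
      ∀ i, ∀ h1 : 1 ≤ i, ∀ h : i ≤ N / 2, natZ N j i - natZ N k i =
        simpleRootAt N a ⟨i - 1, by omega⟩ := by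
    intro h i h1 h2
    rw [← h, Pi.sub_apply, natWeight_apply _ _ _ h1 h2, natWeight_apply _ _ _ h1 h2]
  unfold simpleRootAt at *
  unfold rootPair
  by_cases hc : a = N / 2 ∧ Even N
  · rw [if_pos hc] at key ⊢
    rw [if_pos hc]
    obtain ⟨hca, n, hn⟩ := hc
    have hNa : N = 2 * a := by omega
    clear hn n
    constructor
    · intro h
      have h1 := key h (a - 1) (by omega) (by omega)
      have h2 := key h a (by omega) (by omega)
      rw [Pi.add_apply, natWeight_apply _ _ _ (by omega) (by omega),
        natWeight_apply _ _ _ (by omega) (by omega)] at h1 h2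
      clear h key
      have r1 : natZ N (a - 1) (a - 1) + natZ N a (a - 1) = 1 := by
        rcases natZ_cases N (a - 1) (a - 1) with h | h | h <;>
          rcases natZ_cases N a (a - 1) with h' | h' | h' <;> omega
      have r2 : natZ N (a - 1) a + natZ N a a = 1 := by
        rcases natZ_cases N (a - 1) a with h | h | h <;>
          rcases natZ_cases N a a with h' | h' | h' <;> omega
      have d1 : j = a - 1 ∨ k = a + 2 := by
        rcases natZ_cases N j (a - 1) with h | h | h <;>
          rcases natZ_cases N k (a - 1) with h' | h' | h' <;> omega
      have d2 : j = a ∨ k = a + 1 := by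
        rcases natZ_cases N j a with h | h | h <;>
          rcases natZ_cases N k a with h' | h' | h' <;> omega
      omega
    · rintro (⟨rfl, rfl⟩ | ⟨rfl, rfl⟩)
      · rw [show a + 1 = N + 1 - a by omega, natWeight_reflect (by omega),
          sub_neg_eq_add]
      · rw [show j + 2 = N + 1 - (j - 1) by omega, natWeight_reflect (by omega),
          sub_neg_eq_add, add_comm]
  · rw [if_neg hc] at key ⊢
    rw [if_neg hc]
    have hc' : a = N / 2 → N = 2 * a + 1 := by
      intro h
      rcases Nat.even_or_odd N with h' | h'
      · exact absurd ⟨h, h'⟩ hc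
      · obtain ⟨m, rfl⟩ := h'; omega
    constructor
    · intro h
      have h1 := key h a (by omega) (by omega)
      rw [Pi.sub_apply, natWeight_apply _ _ _ (by omega) (by omega),
        natWeight_apply _ _ _ (by omega) (by omega)] at h1
      have r1 : natZ N a a - natZ N (a + 1) a = 1 := by
        rcases natZ_cases N a a with h | h | h <;>
          rcases natZ_cases N (a + 1) a with h' | h' | h' <;> omega
      have d1 : (j = a ∧ k ≠ N + 1 - a) ∨ (j ≠ a ∧ k = N + 1 - a) := by
        rcases natZ_cases N j a with h | h | h <;>
          rcases natZ_cases N k a with h' | h' | h' <;> omega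
      by_cases hlt : a < N / 2
      · have h2 := key h (a + 1) (by omega) (by omega)
        rw [Pi.sub_apply, natWeight_apply _ _ _ (by omega) (by omega),
          natWeight_apply _ _ _ (by omega) (by omega)] at h2
        have r2 : natZ N a (a + 1) - natZ N (a + 1) (a + 1) = -1 := by
          rcases natZ_cases N a (a + 1) with h | h | h <;>
            rcases natZ_cases N (a + 1) (a + 1) with h' | h' | h' <;> omega
        have d2 : j = N - a ∨ k = a + 1 := by
          rcases natZ_cases N j (a + 1) with h | h | h <;>
            rcases natZ_cases N k (a + 1) with h' | h' | h' <;> omega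
        omega
      · have hN' := hc' (by omega)
        have h2 : ∀ i, 1 ≤ i → i < a → natZ N j i - natZ N k i = 0 := by
          intro i hi1 hi2
          rw [key h i hi1 (by omega), Pi.sub_apply, natWeight_apply _ _ _ hi1 (by omega),
            natWeight_apply _ _ _ hi1 (by omega)]
          rcases natZ_cases N a i with h | h | h <;>
            rcases natZ_cases N (a + 1) i with h' | h' | h' <;> omega
        clear h key
        rcases d1 with ⟨hja, hk'⟩ | ⟨hja, hk'⟩
        · left
          refine ⟨hja, ?_⟩
          by_contra hk2
          have hka : k ≠ a := by
            rintro rfl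
            rw [hja] at h1; omega
          -- This is the coordinate in which ε_k is non-zero. The difference ε_j − ε_k has to vanish
          -- there, which leaves only the zero weight for ε_k.
          have h3 := h2 (if k ≤ a then k else N + 1 - k) (by split_ifs <;> omega)
            (by split_ifs <;> omega)
          split_ifs at h3
          · rcases natZ_cases N j k with h | h | h <;>
              rcases natZ_cases N k k with h' | h' | h' <;> omega
          · rcases natZ_cases N j (N + 1 - k) with h | h | h <;>
              rcases natZ_cases N k (N + 1 - k) with h' | h' | h' <;> omega
        · right
          refine ⟨?_, hk'⟩
          by_contra hj2
          have hka : j ≠ k := by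
            rintro rfl
            omega
          have h3 := h2 (if j ≤ a then j else N + 1 - j) (by split_ifs <;> omega)
            (by split_ifs <;> omega)
          split_ifs at h3
          · rcases natZ_cases N j j with h | h | h <;>
              rcases natZ_cases N k j with h' | h' | h' <;> omega
          · rcases natZ_cases N j (N + 1 - j) with h | h | h <;>
              rcases natZ_cases N k (N + 1 - j) with h' | h' | h' <;> omega
    · rintro (⟨rfl, rfl⟩ | ⟨rfl, rfl⟩)
      · rfl
      · rw [natWeight_reflect (by omega), show N - a = N + 1 - (a + 1) by omega,
          natWeight_reflect (by omega)]
        abel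

/-- The symmetrized Cartan matrix of `so(2 r + 1)` (if `r = c + 1`) or `so(2 r)` (if
`r = c + 2`). -/
def car (c r j k : ℕ) : ℤ :=
  if j = k then (if r = c + 1 ∧ j = c + 1 then 1 else 2)
  else if r = c + 2 ∧ (j = r ∨ k = r) then (if j = c ∨ k = c then -1 else 0)
  else if j + 1 = k ∨ k + 1 = j then -1 else 0

theorem car_comm (c r j k : ℕ) : car c r j k = car c r k j := by
  unfold car; split_ifs <;> omega

/-- The pairing of the weight `∑ μ_i ε_i` with a simple root. -/
def hp (c r : ℕ) (μ : ℕ → ℂ) (k : ℕ) : ℂ :=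
  if k ≤ c then μ k - μ (k + 1) else if r = c + 1 then μ (c + 1)
  else if k = c + 1 then μ (c + 1) - μ (c + 2) else μ (c + 1) + μ (c + 2)

/-- The standard basis of the weight lattice. -/
def δ (i : ℕ) : ℕ → ℂ := fun j => if j = i then 1 else 0

/-- The coordinates of the simple roots. -/
def rt (c j : ℕ) : ℕ → ℂ := if j ≤ c + 1 then δ j - δ (j + 1) else δ (c + 1) + δ (c + 2)

/-- Ties the Cartan matrix to ε-coordinates, so that weights can be followed as functions of the
coordinate. There is no lower bound on the indices: 0 stands for the node α_l next to so(P + 2),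
which is attached to both end nodes when r = 2 and c = 0. -/
theorem hp_rt {c r j k : ℕ} (hr : r = c + 1 ∨ r = c + 2) (hj : j ≤ r) (hk : k ≤ r) :
    hp c r (rt c j) k = car c r j k := by
  unfold hp rt car δ
  rcases hr with rfl | rfl <;> 
  · split_ifs <;> (try simp only [Pi.sub_apply, Pi.add_apply]) <;> (try split_ifs) <;>
      (try omega) <;> norm_num

theorem hp_sub (c r : ℕ) (μ ν : ℕ → ℂ) (k : ℕ) : hp c r (μ - ν) k = hp c r μ k - hp c r ν k := by
  unfold hp; split_ifs <;> simp only [Pi.sub_apply] <;> ring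

theorem hp_add (c r : ℕ) (μ ν : ℕ → ℂ) (k : ℕ) : hp c r (μ + ν) k = hp c r μ k + hp c r ν k := by
  unfold hp; split_ifs <;> simp only [Pi.add_apply] <;> ring

theorem ip_natWeight {N i : ℕ} (h1 : 1 ≤ i) (h2 : i ≤ N / 2) (y : Fin (N / 2) → ℤ) :
    ip (natWeight N i) y = y ⟨i - 1, by omega⟩ := by
  unfold ip
  rw [Finset.sum_eq_single ⟨i - 1, by omega⟩]
  · simp [natWeight, Nat.sub_add_cancel h1]
  · intro b _ hb
    have : i ≠ b + 1 := fun h => hb (by ext; simp [h])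
    have h3 : ¬ (i + (b + 1) = N + 1) := by omega
    simp [natWeight, this, h3]
  · simp

theorem ip_sub_left {N : ℕ} (x x' y : Fin (N / 2) → ℤ) : ip (x - x') y = ip x y - ip x' y := by
  simp [ip, sub_mul, Finset.sum_sub_distrib]

theorem ip_add_left {N : ℕ} (x x' y : Fin (N / 2) → ℤ) : ip (x + x') y = ip x y + ip x' y := by
  simp [ip, add_mul, Finset.sum_add_distrib]

theorem natWeight_center {N : ℕ} (hN : Odd N) : natWeight N (N / 2 + 1) = 0 := by
  obtain ⟨m, rfl⟩ := hN
  funext k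
  have := k.2
  simp only [natWeight, Pi.zero_apply]
  split_ifs <;> omega

/-- `N` is the dimension of the natural module of the orthogonal algebra of rank `r` with Cartan
matrix `car c r`. -/
def IsDim (N c r : ℕ) : Prop := (r = c + 1 ∧ N = 2 * r + 1) ∨ (r = c + 2 ∧ N = 2 * r)

theorem IsDim.half {N c r : ℕ} (h : IsDim N c r) : N / 2 = r := by
  rcases h with ⟨_, _⟩ | ⟨_, _⟩ <;> omega

theorem ip_simpleRootAt_left {N c r : ℕ} (h : IsDim N c r) {k : ℕ} (hk : 1 ≤ k) (hkr : k ≤ r)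
    (y : Fin (N / 2) → ℤ) (y' : ℕ → ℤ)
    (hy : ∀ i, ∀ h1 : 1 ≤ i, ∀ h : i ≤ N / 2, y ⟨i - 1, by omega⟩ = y' i) :
    ip (simpleRootAt N k) y = if k ≤ c then y' k - y' (k + 1) else if r = c + 1 then y' (c + 1)
      else if k = c + 1 then y' (c + 1) - y' (c + 2) else y' (c + 1) + y' (c + 2) := by
  have hh := h.half
  have hy' : ∀ i, 1 ≤ i → i ≤ r → ip (natWeight N i) y = y' i := by
    intro i h1 h2
    rw [ip_natWeight h1 (by omega), hy i h1 (by omega)]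
  unfold simpleRootAt
  rcases h with ⟨hr, hN⟩ | ⟨hr, hN⟩
  · have ho : ¬ Even N := by rw [hN]; simp
    rw [if_neg (by tauto), ip_sub_left, hy' k hk hkr]
    by_cases hkc : k ≤ c
    · rw [if_pos hkc, hy' (k + 1) (by omega) (by omega)]
    · have : k = r := by omega
      have h0 : natWeight N (k + 1) = 0 := by
        rw [this, ← hh]; exact natWeight_center (by rw [hN]; simp)
      rw [if_neg hkc, if_pos hr, h0]
      have : k = c + 1 := by omega
      simp [ip, this]
  · have ho : Even N := by rw [hN]; simp
    by_cases hkc : k = r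
    · rw [if_pos ⟨by omega, ho⟩, ip_add_left, hy' k hk hkr, hy' (k - 1) (by omega) (by omega),
        if_neg (by omega), if_neg (by omega), if_neg (by omega)]
      have h1 : k - 1 = c + 1 := by omega
      have h2 : k = c + 2 := by omega
      rw [h1, h2]
    · rw [if_neg (by omega), ip_sub_left, hy' k hk hkr, hy' (k + 1) (by omega) (by omega)]
      split_ifs with h1 h2 h3
      · rfl
      · omega
      · rw [h3]
      · omega

/-- The integral coordinates of the simple roots. -/
def rtZ (c j : ℕ) : ℕ → ℤ := fun i =>
  if j ≤ c + 1 then (if i = j then 1 else 0) - (if i = j + 1 then 1 else 0)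
  else (if i = c + 1 then 1 else 0) + (if i = c + 2 then 1 else 0)

theorem simpleRootAt_apply {N c r : ℕ} (h : IsDim N c r) {k : ℕ} (hk : 1 ≤ k) (hkr : k ≤ r)
    (i : ℕ) (h1 : 1 ≤ i) (h2 : i ≤ N / 2) :
    simpleRootAt N k ⟨i - 1, by omega⟩ = rtZ c k i := by
  have hh := h.half
  unfold simpleRootAt rtZ
  rcases h with ⟨hr, hN⟩ | ⟨hr, hN⟩
  · have ho : ¬ Even N := by rw [hN]; simp
    rw [if_neg (by tauto), if_pos (by omega)]
    simp only [Pi.sub_apply, natWeight]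
    split_ifs <;> omega
  · have ho : Even N := by rw [hN]; simp
    by_cases hkc : k = r
    · rw [if_pos ⟨by omega, ho⟩, if_neg (by omega)]
      simp only [Pi.add_apply, natWeight]
      split_ifs <;> omega
    · rw [if_neg (by omega), if_pos (by omega)]
      simp only [Pi.sub_apply, natWeight]
      split_ifs <;> omega

theorem ip_simpleRootAt {N c r : ℕ} (h : IsDim N c r) {j k : ℕ} (hj : 1 ≤ j) (hjr : j ≤ r)
    (hk : 1 ≤ k) (hkr : k ≤ r) :
    ip (simpleRootAt N j) (simpleRootAt N k) = car c r j k := by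
  rw [ip_simpleRootAt_left h hj hjr _ (rtZ c k) (fun i h1 h2 => simpleRootAt_apply h hk hkr i h1 h2)]
  have hr : r = c + 1 ∨ r = c + 2 := by rcases h with h | h <;> omega
  have hz : ∀ i, rt c k i = (rtZ c k i : ℂ) := by
    intro i
    unfold rt rtZ δ
    split_ifs <;> simp_all
  have := hp_rt (k := j) hr hkr hjr
  rw [car_comm] at this
  apply Int.cast_injective (α := ℂ)
  rw [← this]
  unfold hp
  simp only [hz]
  split_ifs <;> push_cast <;> rfl

theorem pair_sub {N : ℕ} (lam : Fin (N / 2) → ℂ) (x y : Fin (N / 2) → ℤ) :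
    pair lam (x - y) = pair lam x - pair lam y := by
  simp [pair, mul_sub, Finset.sum_sub_distrib]

theorem pair_add {N : ℕ} (lam : Fin (N / 2) → ℂ) (x y : Fin (N / 2) → ℤ) :
    pair lam (x + y) = pair lam x + pair lam y := by
  simp [pair, mul_add, Finset.sum_add_distrib]

theorem pair_simpleRootAt {N c r : ℕ} (h : IsDim N c r) {k : ℕ} (hk : 1 ≤ k) (hkr : k ≤ r)
    (lam : Fin (N / 2) → ℂ) :
    pair lam (simpleRootAt N k) = hp c r (coord lam) k := by
  have hh := h.half
  unfold simpleRootAt hp coord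
  rcases h with ⟨hr, hN⟩ | ⟨hr, hN⟩
  · have ho : ¬ Even N := by rw [hN]; simp
    rw [if_neg (by tauto), pair_sub]
    by_cases hkc : k ≤ c
    · rw [if_pos hkc]
    · have h0 : natWeight N (k + 1) = 0 := by
        rw [show k = r by omega, ← hh]; exact natWeight_center (by rw [hN]; simp)
      rw [if_neg hkc, if_pos hr, h0]
      have : k = c + 1 := by omega
      simp [pair, this]
  · have ho : Even N := by rw [hN]; simp
    by_cases hkc : k = r
    · rw [if_pos ⟨by omega, ho⟩, pair_add, if_neg (by omega), if_neg (by omega), if_neg (by omega)]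
      have h1 : k - 1 = c + 1 := by omega
      have h2 : k = c + 2 := by omega
      rw [h1, h2]
    · rw [if_neg (by omega), pair_sub]
      split_ifs with h1 h2 h3
      · rfl
      · omega
      · rw [h3]
      · omega

theorem ip_simpleRootAt_natWeight {N c r : ℕ} (h : IsDim N c r) {k : ℕ} (hk : 1 ≤ k) (hkr : k ≤ r)
    (i : ℕ) :
    ip (simpleRootAt N k) (natWeight N i) = if k ≤ c then natZ N i k - natZ N i (k + 1)
      else if r = c + 1 then natZ N i (c + 1)
      else if k = c + 1 then natZ N i (c + 1) - natZ N i (c + 2)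
      else natZ N i (c + 1) + natZ N i (c + 2) := by
  apply ip_simpleRootAt_left h hk hkr
  intro j h1 h2
  simp [natWeight, natZ, Nat.sub_add_cancel h1]

theorem isLevi_of_lt {N c r l : ℕ} (h : IsDim N c r) (hl : l < c) {a : Fin (N / 2)}
    (ha : l + 2 ≤ (a : ℕ) + 1) : IsLevi N l a := by
  have hh := h.half
  have ha' := a.2
  intro k hk
  have key := simpleRootAt_apply h (k := a + 1) (by omega) (by omega) (k + 1) (by omega) (by omega)
  simp only [Nat.add_sub_cancel] at key
  rw [simpleRoot, key]
  unfold rtZ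
  split_ifs <;> omega

/-- For P = 1 and P = 2 every simple root involves one of ε_1, …, ε_{l+1}, so the Levi subalgebra
has no simple roots; this is where l < c comes from. -/
theorem lt_of_isLevi {N c r l : ℕ} (h : IsDim N c r) (hl : l ≤ c) {a : Fin (N / 2)}
    (ha : IsLevi N l a) : l + 2 ≤ (a : ℕ) + 1 ∧ l < c := by
  have hh := h.half
  have hr : r = c + 1 ∨ r = c + 2 := by rcases h with h | h <;> omega
  have ha' := a.2
  have key : ∀ i, 1 ≤ i → i ≤ l + 1 → rtZ c (a + 1) i = 0 := by
    intro i h1 h2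
    have h3 : i ≤ N / 2 := by omega
    rw [← simpleRootAt_apply h (k := a + 1) (by omega) (by omega) i h1 h3]
    exact ha _ (by simp; omega)
  have h1 : l + 2 ≤ (a : ℕ) + 1 := by
    by_contra hcon
    have := key (a + 1) (by omega) (by omega)
    unfold rtZ at this
    split_ifs at this <;> omega
  refine ⟨h1, ?_⟩
  by_contra hcon
  have := key (l + 1) (by omega) (by omega)
  unfold rtZ at this
  split_ifs at this <;> omega

/-! ### Identities for q-numbers -/

theorem qpow_add (hb x y : ℂ) : qpow hb (x + y) = qpow hb x * qpow hb y := by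
  simp [qpow, mul_add, Complex.exp_add]

theorem qpow_neg (hb x : ℂ) : qpow hb (-x) = (qpow hb x)⁻¹ := by
  simp [qpow, Complex.exp_neg]

theorem qpow_sub (hb x y : ℂ) : qpow hb (x - y) = qpow hb x * (qpow hb y)⁻¹ := by
  rw [sub_eq_add_neg, qpow_add, qpow_neg]

theorem qpow_ne_zero (hb x : ℂ) : qpow hb x ≠ 0 := Complex.exp_ne_zero _

theorem qpow_zero (hb : ℂ) : qpow hb 0 = 1 := by simp [qpow]

theorem qpow_two (hb : ℂ) : qpow hb 2 = qpow hb 1 * qpow hb 1 := by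
  rw [← qpow_add]; norm_num

theorem qnum_zero (hb : ℂ) : qnum hb 0 = 0 := by simp [qnum]

theorem qnum_neg (hb x : ℂ) : qnum hb (-x) = - qnum hb x := by
  simp [qnum, ← neg_div]

/-- The complex number `q = exp hb` is not a root of unity. -/
def Generic (hb : ℂ) : Prop := ∀ m : ℕ, 0 < m → Complex.exp hb ^ m ≠ 1

/-- If q^{m/2} = q^{−m/2}, then q^m = 1. Half-integral exponents are needed because of P/2 and
because q_α = q^{1/2} for the short root. -/
theorem Generic.sub_ne_zero {hb : ℂ} (hq : Generic hb) {m : ℕ} (hm : 0 < m) :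
    qpow hb ((m : ℂ) / 2) - qpow hb (-((m : ℂ) / 2)) ≠ 0 := by
  intro h
  apply hq m hm
  rw [sub_eq_zero, qpow_neg] at h
  have h1 : qpow hb ((m : ℂ) / 2) * qpow hb ((m : ℂ) / 2) = 1 := by
    nth_rewrite 2 [h]
    exact mul_inv_cancel₀ (qpow_ne_zero _ _)
  rw [← qpow_add, add_halves] at h1
  rw [← Complex.exp_nat_mul, mul_comm]
  exact h1

theorem Generic.one_sub_ne_zero {hb : ℂ} (hq : Generic hb) :
    qpow hb 1 - qpow hb (-1) ≠ 0 := by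
  have := hq.sub_ne_zero (m := 2) (by norm_num)
  norm_num at this
  exact this

theorem Generic.inv_ne_zero {hb : ℂ} (hq : Generic hb) :
    qpow hb 1 - (qpow hb 1)⁻¹ ≠ 0 := by
  rw [← qpow_neg]; exact hq.one_sub_ne_zero

theorem Generic.sq_ne_one {hb : ℂ} (hq : Generic hb) : qpow hb 1 ^ 2 - 1 ≠ 0 := by
  have h := hq 2 (by norm_num)
  rw [_root_.sub_ne_zero]
  simpa [qpow] using h

theorem Generic.qnum_half_ne_zero {hb : ℂ} (hq : Generic hb) {m : ℕ} (hm : 0 < m) :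
    qnum hb ((m : ℂ) / 2) ≠ 0 :=
  div_ne_zero (hq.sub_ne_zero hm) hq.one_sub_ne_zero

theorem Generic.qnum_two_ne_zero {hb : ℂ} (hq : Generic hb) : qnum hb 2 ≠ 0 := by
  have := hq.qnum_half_ne_zero (m := 4) (by norm_num)
  norm_num at this
  exact this

theorem Generic.qnum_one {hb : ℂ} (hq : Generic hb) : qnum hb 1 = 1 :=
  div_self hq.one_sub_ne_zero

theorem qnum_eq_mul (hb x : ℂ) :
    qnum hb x = (qpow hb x - (qpow hb x)⁻¹) * (qpow hb 1 - (qpow hb 1)⁻¹)⁻¹ := by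
  rw [qnum, qpow_neg, qpow_neg, div_eq_mul_inv]

theorem Generic.qnum_two {hb : ℂ} (hq : Generic hb) : qnum hb 2 = qpow hb 1 + qpow hb (-1) := by
  have h1 := qpow_ne_zero hb 1
  have h2 := hq.sq_ne_one
  rw [qnum, qpow_two, qpow_neg, qpow_neg, qpow_two]
  field_simp
  ring

theorem Generic.qnum_add_one_add_sub_one {hb : ℂ} (hq : Generic hb) (a : ℂ) :
    qnum hb (a - 1) + qnum hb (a + 1) = qnum hb 2 * qnum hb a := by
  have h1 := qpow_ne_zero hb 1
  have h2 := hq.sq_ne_one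
  have h3 := qpow_ne_zero hb a
  rw [hq.qnum_two]
  simp only [qnum, qpow_neg, qpow_add, qpow_sub]
  field_simp
  ring

/-- The rule by which a difference f F [a] − F f [a − 1] yields a single q-number under the e that
removes f. It governs the recursion in `fRoot` and the value of e_1 on f_{2ε}. -/
theorem Generic.qnum_mul_sub_mul {hb : ℂ} (hq : Generic hb) (a r : ℂ) :
    qnum hb a * qnum hb (r + 1) - qnum hb (a - 1) * qnum hb r = qnum hb (a + r) := by
  have h1 := qpow_ne_zero hb 1
  have h2 := hq.sq_ne_one
  have h3 := qpow_ne_zero hb a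
  have h4 := qpow_ne_zero hb r
  simp only [qnum, qpow_neg, qpow_add, qpow_sub]
  field_simp
  ring

/-- For X = x + P/2 and μ = P/2 − m the products in front of [r + 2], [r + 1], [r] are, up to a
common sign, the coefficients A1_m, B2_m, A3_m. -/
theorem Generic.qnum_three_term {hb : ℂ} (hq : Generic hb) (X μ r : ℂ) :
    qnum hb (X + μ) * qnum hb X * qnum hb (r + 2)
      - (qpow hb μ + qpow hb (-μ)) * qnum hb (X - 1) * qnum hb X * qnum hb (r + 1)
      + qnum hb (X - 1 - μ) * qnum hb (X - 1) * qnum hb r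
      = qnum hb (μ + 1) * qnum hb (2 * X + r) := by
  have h1 := qpow_ne_zero hb 1
  have h2 := hq.sq_ne_one
  have h3 := qpow_ne_zero hb X
  have h4 := qpow_ne_zero hb r
  have h5 := qpow_ne_zero hb μ
  rw [two_mul]
  simp only [qnum, qpow_neg, qpow_add, qpow_sub, qpow_two]
  field_simp
  ring

/-! ### Words -/

theorem mem_down {a b k : ℕ} : k ∈ down a b ↔ b ≤ k ∧ k ≤ a := by
  simp [down, up, List.mem_range'_1]; omega

theorem mem_up {a b k : ℕ} : k ∈ up a b ↔ a ≤ k ∧ k ≤ b := by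
  simp [up, List.mem_range'_1]; omega

theorem up_cons {a b : ℕ} (h : a ≤ b) : up a b = a :: up (a + 1) b := by
  unfold up
  rw [show b + 1 - a = (b - a) + 1 by omega, List.range'_succ]
  congr 2; omega

theorem up_nil {a b : ℕ} (h : b < a) : up a b = [] := by
  unfold up
  rw [show b + 1 - a = 0 by omega, List.range'_zero]

theorem up_append {a b c : ℕ} (h : a ≤ b + 1) (h' : b ≤ c) : up a c = up a b ++ up (b + 1) c := by
  unfold up
  have := List.range'_append_1 (s := a) (m := b + 1 - a) (n := c + 1 - (b + 1))
  rw [show a + (b + 1 - a) = b + 1 by omega] at this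
  rw [this]
  congr 1; omega

theorem down_nil {a b : ℕ} (h : a < b) : down a b = [] := by
  rw [down, up_nil h, List.reverse_nil]

theorem down_append {a b c : ℕ} (h : a ≤ b + 1) (h' : b ≤ c) :
    down c a = down c (b + 1) ++ down b a := by
  rw [down, up_append h h', List.reverse_append]; rfl

theorem down_self (a : ℕ) : down a a = [a] := by
  rw [down, up_cons le_rfl, up_nil (by omega)]; rfl

theorem down_cons {a b : ℕ} (h : b ≤ a + 1) : down (a + 1) b = (a + 1) :: down a b := by
  rw [down_append h (by omega), down_self]; rfl

theorem down_concat {a b : ℕ} (h : b ≤ a) : down a b = down a (b + 1) ++ [b] := by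
  rw [down_append (b := b) (by omega) h, down_self]

/-! ### Operators satisfying the relations of the quantum group -/

/-- Operators on a module that satisfy those relations of the quantum group with Cartan matrix
`car c r` that involve the simple roots with numbers from `lo` to `r`. -/
structure QSys (hb : ℂ) (c r lo : ℕ) (M : Type) [AddCommGroup M] [Module ℂ M] where
  e : ℕ → M →ₗ[ℂ] M
  f : ℕ → M →ₗ[ℂ] M
  t : ℕ → M →ₗ[ℂ] M
  ti : ℕ → M →ₗ[ℂ] M
  t_f : ∀ j k, lo ≤ j → j ≤ r → lo ≤ k → k ≤ r → ∀ y,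
    t j (f k y) = qpow hb (-(car c r j k : ℂ)) • f k (t j y)
  ti_f : ∀ j k, lo ≤ j → j ≤ r → lo ≤ k → k ≤ r → ∀ y,
    ti j (f k y) = qpow hb (car c r j k : ℂ) • f k (ti j y)
  e_f : ∀ j, lo ≤ j → j ≤ r → ∀ y,
    e j (f j y) = f j (e j y) + (qpow hb 1 - qpow hb (-1))⁻¹ • (t j y - ti j y)
  e_f_ne : ∀ j k, lo ≤ j → j ≤ r → lo ≤ k → k ≤ r → j ≠ k → ∀ y, e j (f k y) = f k (e j y)
  comm : ∀ j k, lo ≤ j → j ≤ r → lo ≤ k → k ≤ r → car c r j k = 0 → ∀ y,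
    f j (f k y) = f k (f j y)
  -- Only the cubic relation is recorded: the quartic one at the short root of odd N plays no role
  -- in computing the singular vector.
  serre : ∀ j k, lo ≤ j → j ≤ r → lo ≤ k → k ≤ r → car c r j j = 2 → car c r j k = -1 → ∀ y,
    f j (f j (f k y)) - qnum hb 2 • f j (f k (f j y)) + f k (f j (f j y)) = 0

namespace QSys

variable {hb : ℂ} {c r lo : ℕ} {M : Type} [AddCommGroup M] [Module ℂ M] (S : QSys hb c r lo M)

/-- A weight vector with respect to the `t_j`, `a ≤ j`. -/
def Wt (a : ℕ) (μ : ℕ → ℂ) (y : M) : Prop := ∀ j, a ≤ j → j ≤ r →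
  S.t j y = qpow hb (hp c r μ j) • y ∧ S.ti j y = qpow hb (-hp c r μ j) • y

variable {S} in
theorem Wt.mono {a b : ℕ} {μ : ℕ → ℂ} {y : M} (h : S.Wt a μ y) (hab : a ≤ b) : S.Wt b μ y :=
  fun j hj hjr => h j (hab.trans hj) hjr

variable {S} in
theorem Wt.congr {a : ℕ} {μ ν : ℕ → ℂ} {y : M} (h : S.Wt a μ y)
    (hμ : ∀ j, a ≤ j → j ≤ r → hp c r μ j = hp c r ν j) : S.Wt a ν y := by
  intro j h1 h2
  rw [← hμ j h1 h2]
  exact h j h1 h2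

variable {S} in
theorem Wt.f {a k : ℕ} {μ : ℕ → ℂ} {y : M} (h : S.Wt a μ y) (hr : r = c + 1 ∨ r = c + 2)
    (ha : lo ≤ a) (hk : lo ≤ k) (hkr : k ≤ r) : S.Wt a (μ - rt c k) (S.f k y) := by
  intro j h1 h2
  obtain ⟨h3, h4⟩ := h j h1 h2
  rw [S.t_f j k (by omega) h2 hk hkr, S.ti_f j k (by omega) h2 hk hkr, h3, h4, map_smul, map_smul,
    smul_smul, smul_smul, ← qpow_add, ← qpow_add, hp_sub, hp_rt hr hkr h2, car_comm c r k j]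
  constructor <;> congr 2 <;> ring

theorem e_f_wt {a j : ℕ} {μ : ℕ → ℂ} {y : M} (h : S.Wt a μ y) (ha : lo ≤ a) (hj : a ≤ j)
    (hjr : j ≤ r) : S.e j (S.f j y) = S.f j (S.e j y) + qnum hb (hp c r μ j) • y := by
  obtain ⟨h3, h4⟩ := h j hj hjr
  rw [S.e_f j (by omega) hjr, h3, h4, ← sub_smul, smul_smul, qnum, div_eq_inv_mul]

/-- The operator given by a word. -/
def W : List ℕ → M →ₗ[ℂ] M
  | [] => LinearMap.id
  | j :: L => S.f j ∘ₗ W L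

@[simp] theorem W_nil (y : M) : S.W [] y = y := rfl

@[simp] theorem W_cons (j : ℕ) (L : List ℕ) (y : M) : S.W (j :: L) y = S.f j (S.W L y) := rfl

theorem W_append (L L' : List ℕ) (y : M) : S.W (L ++ L') y = S.W L (S.W L' y) := by
  induction L with
  | nil => rfl
  | cons j L ih => simp [ih]

theorem W_comm (A : M →ₗ[ℂ] M) (L : List ℕ) (h : ∀ k ∈ L, ∀ y, A (S.f k y) = S.f k (A y)) (y : M) :
    A (S.W L y) = S.W L (A y) := by
  induction L with
  | nil => rfl
  | cons j L ih =>
    rw [W_cons, W_cons, h j (by simp), ih (fun k hk => h k (by simp [hk]))]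

theorem f_W {j : ℕ} {L : List ℕ} (hj : lo ≤ j) (hjr : j ≤ r)
    (h : ∀ k ∈ L, lo ≤ k ∧ k ≤ r ∧ car c r j k = 0) (y : M) :
    S.f j (S.W L y) = S.W L (S.f j y) :=
  S.W_comm _ _ (fun k hk y => S.comm j k hj hjr (h k hk).1 (h k hk).2.1 (h k hk).2.2 y) y

theorem e_W {j : ℕ} {L : List ℕ} (hj : lo ≤ j) (hjr : j ≤ r)
    (h : ∀ k ∈ L, lo ≤ k ∧ k ≤ r ∧ j ≠ k) (y : M) :
    S.e j (S.W L y) = S.W L (S.e j y) :=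
  S.W_comm _ _ (fun k hk y => S.e_f_ne j k hj hjr (h k hk).1 (h k hk).2.1 (h k hk).2.2 y) y

/-- `f_a f_{a-1} ⋯ f_1` -/
def D (a : ℕ) : M →ₗ[ℂ] M := S.W (down a 1)

/-- `f_{m+1} ⋯ f_{c+1} f_r f_c ⋯ f_1` -/
def E (m : ℕ) : M →ₗ[ℂ] M := S.W (up (m + 1) (c + 1) ++ r :: down c 1)

theorem D_zero (y : M) : S.D 0 y = y := rfl

theorem D_succ (a : ℕ) (y : M) : S.D (a + 1) y = S.f (a + 1) (S.D a y) := by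
  rw [D, down_cons (by omega)]; rfl

theorem E_top (y : M) : S.E (c + 1) y = S.f r (S.D c y) := by
  rw [E, up_nil (by omega)]; rfl

theorem E_eq {m : ℕ} (h : m ≤ c) (y : M) : S.E m y = S.f (m + 1) (S.E (m + 1) y) := by
  rw [E, up_cons (by omega)]; rfl

/-- A vector of trivial weight for the Levi subalgebra, annihilated by it. -/
structure LeviHW (y : M) : Prop where
  wt : S.Wt 2 0 y
  e_zero : ∀ j, 2 ≤ j → j ≤ r → S.e j y = 0
  f_zero : ∀ j, 2 ≤ j → j ≤ r → S.f j y = 0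

/-! ### The copy of the natural module of so(P) generated by f_1 y. -/

section Levi

variable {S} {y : M} (hq : Generic hb) (hr : r = c + 1 ∨ r = c + 2) (hlo : lo ≤ 1) (hc : 1 ≤ c)
  (hy : S.LeviHW y)
include hq hr hlo hc hy

/-- Only the middle term of the cubic q-Serre relation survives on z, and [2] is invertible. -/
theorem serre_mid {j k : ℕ} (hj : lo ≤ j) (hjr : j ≤ r) (hk : lo ≤ k) (hkr : k ≤ r)
    (h1 : car c r j j = 2) (h2 : car c r j k = -1) {z : M} (hz : S.f k z = 0)
    (hz' : S.f j (S.f j z) = 0) : S.f j (S.f k (S.f j z)) = 0 := by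
  have := S.serre j k hj hjr hk hkr h1 h2 z
  rw [hz, hz', map_zero, map_zero, map_zero, add_zero, zero_sub, neg_eq_zero, smul_eq_zero] at this
  exact this.resolve_left hq.qnum_two_ne_zero

theorem f_D_of_comm {j a : ℕ} (hj : 2 ≤ j) (hjr : j ≤ r) (hac : a ≤ c) (hja : a + 1 < j)
    (h : a ≠ c) : S.f j (S.D a y) = 0 := by
  rw [D, S.f_W (by omega) hjr, hy.f_zero j hj hjr, map_zero]
  intro k hk
  rw [mem_down] at hk
  refine ⟨by omega, by omega, ?_⟩
  unfold car
  split_ifs <;> omega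

/-- Together with the lemmas that follow, this says that D_1 y, …, D_c y, f_{c+1} D_c y, f_r D_c y,
E_c y, …, E_1 y behave under so(P) like the weight basis of its natural module (for odd P the two
middle vectors coincide). Here a letter f_j that does not continue the chain gives zero: it commutes
past to y, or it is caught by a q-Serre relation when j = a or j = a − 1. -/
theorem f_D {j a : ℕ} (hj : 2 ≤ j) (hjr : j ≤ r) (hac : a ≤ c) (hja : j ≠ a + 1)
    (h : a = c → j ≤ c) : S.f j (S.D a y) = 0 := by
  induction a generalizing j with
  | zero => exact hy.f_zero j hj hjr
  | succ a ih =>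
    by_cases h1 : a + 1 + 1 < j
    · exact f_D_of_comm hq hr hlo hc hy hj hjr hac h1 (by omega)
    rw [D_succ]
    by_cases h2 : j = a + 1
    · subst h2
      obtain ⟨b, rfl⟩ : ∃ b, a = b + 1 := ⟨a - 1, by omega⟩
      have h3 : S.f (b + 1 + 1) (S.D b y) = 0 :=
        f_D_of_comm hq hr hlo hc hy hj hjr (by omega) (by omega) (by omega)
      have := S.serre (b + 1 + 1) (b + 1) (by omega) hjr (by omega) (by omega)
        (by unfold car; split_ifs <;> omega) (by unfold car; split_ifs <;> omega) (S.D b y)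
      rw [h3] at this
      simpa [D_succ] using this
    by_cases h3 : j = a
    · subst h3
      obtain ⟨b, rfl⟩ : ∃ b, j = b + 1 := ⟨j - 1, by omega⟩
      rw [D_succ]
      apply serre_mid hq hr hlo hc hy (by omega) hjr (by omega) (by omega)
        (by unfold car; split_ifs <;> omega) (by unfold car; split_ifs <;> omega)
      · exact f_D_of_comm hq hr hlo hc hy (by omega) (by omega) (by omega) (by omega) (by omega)
      · rw [← D_succ]
        exact ih (by omega) (by omega) (by omega) (by omega) (by omega)
    · rw [S.comm j (a + 1) (by omega) hjr (by omega) (by omega)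
        (by unfold car; split_ifs <;> omega), ih hj hjr (by omega) (by omega) (by omega), map_zero]

theorem f_f_D {j b : ℕ} (hj : 2 ≤ j) (hjc : j ≤ c) (hb' : b = c + 1 ∨ b = r) :
    S.f j (S.f b (S.D c y)) = 0 := by
  by_cases h : j = c
  · subst h
    obtain ⟨d, rfl⟩ : ∃ d, j = d + 1 := ⟨j - 1, by omega⟩
    rw [D_succ]
    apply serre_mid hq hr hlo hc hy (by omega) (by omega) (by omega) (by omega)
      (by unfold car; split_ifs <;> omega) (by unfold car; split_ifs <;> omega)
    · exact f_D_of_comm hq hr hlo hc hy (by omega) (by omega) (by omega) (by omega) (by omega)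
    · rw [← D_succ]
      exact f_D hq hr hlo hc hy (by omega) (by omega) (by omega) (by omega) (by omega)
  · rw [S.comm j b (by omega) (by omega) (by omega) (by omega)
        (by unfold car; split_ifs <;> omega),
      f_D hq hr hlo hc hy hj (by omega) le_rfl (by omega) (by omega), map_zero]

theorem f_E {j m : ℕ} (hj : 2 ≤ j) (hjm : j < m) (hm : m ≤ c + 1) : S.f j (S.E m y) = 0 := by
  obtain ⟨i, hi⟩ : ∃ i, m + i = c + 1 := ⟨c + 1 - m, by omega⟩
  induction i generalizing m with
  | zero =>
    obtain rfl : m = c + 1 := by omega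
    rw [E_top]
    exact f_f_D hq hr hlo hc hy hj (by omega) (Or.inr rfl)
  | succ i ih =>
    rw [E_eq S (by omega), S.comm j (m + 1) (by omega) (by omega) (by omega) (by omega)
        (by unfold car; split_ifs <;> omega), ih (by omega) (by omega) (by omega), map_zero]

/-- Only the t_j with j ≥ 2 are seen. For them y has weight zero and f_1 y has weight ε_2, from
which each further letter moves on to the next ε. -/
theorem wt_D {a : ℕ} (ha : 1 ≤ a) (hac : a ≤ c) : S.Wt 2 (δ (a + 1)) (S.D a y) := by
  induction a with
  | zero => omega
  | succ a ih =>
    rw [D_succ]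
    rcases Nat.eq_zero_or_pos a with rfl | h
    · refine (hy.wt.f hr (by omega) (by omega) (by omega)).congr ?_
      intro j h1 h2
      rw [D_zero] at *
      unfold hp rt δ
      split_ifs <;> (try simp only [Pi.sub_apply, Pi.zero_apply]) <;> (try split_ifs) <;>
        (try omega) <;> norm_num
    · refine ((ih h (by omega)).f hr (by omega) (by omega) (by omega)).congr ?_
      intro j h1 h2
      rw [rt, if_pos (by omega)]
      congr 1
      abel

theorem wt_f_D {b : ℕ} (hb' : b = c + 1 ∨ b = r) :
    S.Wt 2 (δ (c + 1) - rt c b) (S.f b (S.D c y)) :=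
  (wt_D hq hr hlo hc hy hc le_rfl).f hr (by omega) (by omega) (by omega)

theorem wt_E {m : ℕ} (hm : 1 ≤ m) (hmc : m ≤ c + 1) : S.Wt 2 (-δ (m + 1)) (S.E m y) := by
  obtain ⟨i, hi⟩ : ∃ i, m + i = c + 1 := ⟨c + 1 - m, by omega⟩
  induction i generalizing m with
  | zero =>
    obtain rfl : m = c + 1 := by omega
    rw [E_top]
    refine (wt_f_D hq hr hlo hc hy (Or.inr rfl)).congr ?_
    intro j h1 h2
    unfold hp rt δ
    rcases hr with hr | hr <;> 
    split_ifs <;> (try simp only [Pi.sub_apply, Pi.add_apply, Pi.neg_apply]) <;>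
      (try split_ifs) <;> (try omega) <;> norm_num
  | succ i ih =>
    rw [E_eq S (by omega)]
    refine ((ih (by omega) (by omega) (by omega)).f hr (by omega) (by omega) (by omega)).congr ?_
    intro j h1 h2
    rw [rt, if_pos (by omega)]
    congr 1
    abel

theorem e_D {j a : ℕ} (hj : 2 ≤ j) (hjr : j ≤ r) (hac : a ≤ c) :
    S.e j (S.D a y) = if j = a then S.D (a - 1) y else 0 := by
  induction a with
  | zero => rw [if_neg (by omega), D_zero, hy.e_zero j hj hjr]
  | succ a ih =>
    rw [D_succ]
    by_cases h : j = a + 1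
    · subst h
      rw [S.e_f_wt (wt_D hq hr hlo hc hy (by omega) (by omega)) (by omega) hj hjr, ih (by omega),
        if_neg (by omega), if_pos rfl, map_zero, zero_add]
      have : hp c r (δ (a + 1)) (a + 1) = 1 := by
        unfold hp δ; rw [if_pos (by omega), if_pos rfl, if_neg (by omega)]; norm_num
      rw [this, hq.qnum_one, one_smul, Nat.add_sub_cancel]
    · rw [S.e_f_ne j (a + 1) (by omega) hjr (by omega) (by omega) h, ih (by omega), if_neg h]
      split_ifs with h2
      · exact f_D hq hr hlo hc hy (by omega) (by omega) (by omega) (by omega) (by omega)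
      · exact map_zero _

theorem e_f_D {j b : ℕ} (hj : 2 ≤ j) (hjr : j ≤ r) (hb' : b = c + 1 ∨ b = r) :
    S.e j (S.f b (S.D c y)) = if j = b then S.D c y else 0 := by
  by_cases h : j = b
  · subst h
    rw [S.e_f_wt (wt_D hq hr hlo hc hy hc le_rfl) (by omega) hj hjr,
      e_D hq hr hlo hc hy hj hjr le_rfl, if_neg (by omega), if_pos rfl, map_zero, zero_add]
    have : hp c r (δ (c + 1)) j = 1 := by
      unfold hp δ
      split_ifs <;> (try omega) <;> norm_num
    rw [this, hq.qnum_one, one_smul]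
  · rw [S.e_f_ne j b (by omega) hjr (by omega) (by omega) h, e_D hq hr hlo hc hy hj hjr le_rfl,
      if_neg h]
    split_ifs with h2
    · exact f_D hq hr hlo hc hy (by omega) (by omega) (by omega) (by omega) (by omega)
    · exact map_zero _

theorem e_E {j m : ℕ} (hj : 2 ≤ j) (hjc : j ≤ c) (hm : 1 ≤ m) (hmc : m ≤ c + 1) :
    S.e j (S.E m y) = if j = m + 1 then S.E (m + 1) y else 0 := by
  obtain ⟨i, hi⟩ : ∃ i, m + i = c + 1 := ⟨c + 1 - m, by omega⟩
  induction i generalizing m with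
  | zero =>
    obtain rfl : m = c + 1 := by omega
    rw [E_top, e_f_D hq hr hlo hc hy hj (by omega) (Or.inr rfl), if_neg (by omega),
      if_neg (by omega)]
  | succ i ih =>
    rw [E_eq S (by omega)]
    by_cases h : j = m + 1
    · subst h
      rw [S.e_f_wt (wt_E hq hr hlo hc hy (by omega) (by omega)) (by omega) hj (by omega),
        ih (by omega) (by omega) (by omega), if_neg (by omega), if_pos rfl, map_zero, zero_add]
      have : hp c r (-δ (m + 1 + 1)) (m + 1) = 1 := by
        unfold hp
        rw [if_pos (by omega)]
        simp [δ]
      rw [this, hq.qnum_one, one_smul]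
    · rw [S.e_f_ne j (m + 1) (by omega) (by omega) (by omega) (by omega) h,
        ih (by omega) (by omega) (by omega), if_neg h]
      split_ifs with h2
      · exact f_E hq hr hlo hc hy (by omega) (by omega) (by omega)
      · exact map_zero _

theorem e_E_center {b : ℕ} (hb' : b = c + 1 ∨ b = r) {m : ℕ} (hm : 1 ≤ m) (hmc : m ≤ c) :
    S.e b (S.E m y) = if m = c then S.f (if b = c + 1 then r else c + 1) (S.D c y) else 0 := by
  -- For odd P the vector E_{c+1} y is the zero weight vector of the natural module, so the Cartan
  -- term drops out; for even P it contributes [1].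
  have hw : hp c r (-δ (c + 1 + 1)) (c + 1) = if r = c + 1 then 0 else 1 := by
    unfold hp δ
    split_ifs <;> (try simp only [Pi.neg_apply]) <;> (try split_ifs) <;> (try omega) <;> norm_num
  have key : S.e b (S.E c y) = S.f (if b = c + 1 then r else c + 1) (S.D c y) := by
    rw [E_eq S le_rfl]
    by_cases h : b = c + 1
    · rw [if_pos h, h, S.e_f_wt (wt_E hq hr hlo hc hy (by omega) (by omega)) (by omega) (by omega)
        (by omega), E_top, e_f_D hq hr hlo hc hy (by omega) (by omega) (Or.inr rfl), hw]
      by_cases h2 : r = c + 1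
      · rw [if_pos h2.symm, if_pos h2, qnum_zero, zero_smul, add_zero, congrArg S.f h2]
      · rw [if_neg (Ne.symm h2), if_neg h2, hq.qnum_one, one_smul, map_zero, zero_add]
    · rw [if_neg h, S.e_f_ne b (c + 1) (by omega) (by omega) (by omega) (by omega) h, E_top,
        e_f_D hq hr hlo hc hy (by omega) (by omega) (Or.inr rfl), if_pos (by omega)]
  obtain ⟨i, hi⟩ : ∃ i, m + i = c := ⟨c - m, by omega⟩
  induction i generalizing m with
  | zero =>
    obtain rfl : m = c := by omega
    rw [if_pos rfl, key]
  | succ i ih =>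
    rw [if_neg (by omega), E_eq S (by omega), S.e_f_ne b (m + 1) (by omega) (by omega) (by omega)
      (by omega) (by omega), ih (by omega) (by omega) (by omega)]
    split_ifs
    · exact f_f_D hq hr hlo hc hy (by omega) (by omega) (Or.inr rfl)
    · exact f_f_D hq hr hlo hc hy (by omega) (by omega) (Or.inl rfl)
    · exact map_zero _

end Levi

end QSys

theorem car_zero_right {c r j : ℕ} (hc : 1 ≤ c) (hj : 2 ≤ j) : car c r j 0 = 0 := by
  unfold car
  rw [if_neg (by omega), if_neg (show ¬ (j + 1 = 0 ∨ 0 + 1 = j) by omega)]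
  split_ifs <;> omega

/-! ### The action of the e_j of so(P) on terms f_m ⋯ f_2 X E_m y, where X stands for f_1, f_0 f_1
or f_1 f_0. -/

namespace QSys

variable {hb : ℂ} {c r lo : ℕ} {M : Type} [AddCommGroup M] [Module ℂ M] (S : QSys hb c r lo M)

/-- An operator that transforms under the Levi subalgebra like `f_1`. -/
structure LeviOp (X : M →ₗ[ℂ] M) : Prop where
  comm_f : ∀ j, 2 ≤ j → j ≤ r → car c r j 1 = 0 → ∀ z, S.f j (X z) = X (S.f j z)
  comm_e : ∀ j, 2 ≤ j → j ≤ r → ∀ z, S.e j (X z) = X (S.e j z)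
  wt : ∀ μ z, S.Wt 2 μ z → S.Wt 2 (μ + δ 2) (X z)

/-- `f_m ⋯ f_2 X f_{m+1} ⋯ f_{c+1} f_r f_c ⋯ f_1` -/
def T (m : ℕ) (X : M →ₗ[ℂ] M) (y : M) : M := S.W (down m 2) (X (S.E m y))

theorem W_comm_W {L L' : List ℕ} (h : ∀ j ∈ L, ∀ k ∈ L', lo ≤ j ∧ j ≤ r ∧ lo ≤ k ∧ k ≤ r ∧
    car c r j k = 0) (z : M) : S.W L (S.W L' z) = S.W L' (S.W L z) := by
  refine S.W_comm (S.W L) L' (fun k hk z => ?_) z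
  refine (S.W_comm (S.f k) L (fun j hj z => ?_) z).symm
  obtain ⟨h1, h2, h3, h4, h5⟩ := h j hj k hk
  exact (S.comm j k h1 h2 h3 h4 h5 z).symm

section Levi

variable {S} {y : M} (hq : Generic hb) (hr : r = c + 1 ∨ r = c + 2) (hlo : lo ≤ 1) (hc : 1 ≤ c)
  (hy : S.LeviHW y)
include hq hr hlo hc hy

theorem W_levi_zero {L : List ℕ} (hL : L ≠ []) (h : ∀ j ∈ L, 2 ≤ j ∧ j ≤ r) : S.W L y = 0 := by
  induction L with
  | nil => exact absurd rfl hL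
  | cons j L ih =>
    rw [W_cons]
    rcases eq_or_ne L [] with rfl | h'
    · exact hy.f_zero j (h j (by simp)).1 (h j (by simp)).2
    · rw [ih h' (fun k hk => h k (by simp [hk])), map_zero]

omit hq hc hy in
theorem wt_W_X {X : M →ₗ[ℂ] M} (hX : S.LeviOp X) {μ : ℕ → ℂ} {z : M} (hz : S.Wt 2 μ z) {j : ℕ}
    (hj : 1 ≤ j) (hjc : j ≤ c + 1) : S.Wt 2 (μ + δ (j + 1)) (S.W (down j 2) (X z)) := by
  induction j with
  | zero => omega
  | succ j ih =>
    rcases Nat.eq_zero_or_pos j with rfl | h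
    · rw [down_nil (by omega)]
      exact hX.wt _ _ hz
    · rw [down_cons (by omega), W_cons]
      refine ((ih h (by omega)).f hr (by omega) (by omega) (by omega)).congr ?_
      intro k h1 h2
      rw [rt, if_pos (by omega)]
      congr 1
      abel

omit hq hr hc hy in
theorem e_W_X {X : M →ₗ[ℂ] M} (hX : S.LeviOp X) (z : M) {j m : ℕ} (hj : 2 ≤ j) (hjr : j ≤ r)
    (hjm : m < j) :
    S.e j (S.W (down m 2) (X z)) = S.W (down m 2) (X (S.e j z)) := by
  rw [S.e_W (by omega) hjr, hX.comm_e j hj hjr]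
  intro k hk
  rw [mem_down] at hk
  omega

/-- The rightmost letter f_{j+1} acts first and kills E_m y as soon as j + 1 < m. -/
theorem W_E {j m : ℕ} (hj : 1 ≤ j) (hjm : j ≤ m) (hm : m ≤ c + 1) :
    S.W (down m (j + 1)) (S.E m y) = if m ≤ j + 1 then S.E j y else 0 := by
  split_ifs with h
  · rcases (by omega : m = j ∨ m = j + 1) with rfl | rfl
    · rw [down_nil (by omega)]; rfl
    · rw [down_self]; exact (E_eq S (by omega) y).symm
  · rw [down_concat (by omega), W_append, W_cons, W_nil,
      f_E hq hr hlo hc hy (by omega) (by omega) hm, map_zero]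

/-- For m = j − 1 the generator e_j removes the first letter of E_m. For m ≥ j it removes the letter
f_j on the left of X; the letters f_m ⋯ f_{j+1} that stood before it then commute past everything
down to E_m y and leave a non-zero vector only for m ≤ j + 1. All three surviving terms are
multiples of the same vector, with factors 1, [2], 1, so a combination Σ C_m T_m is killed once
C_{j−1} + [2] C_j + C_{j+1} = 0. -/
theorem e_T {X : M →ₗ[ℂ] M} (hX : S.LeviOp X) {j m : ℕ} (hj : 2 ≤ j) (hjc : j ≤ c) (hm : 1 ≤ m)
    (hmc : m ≤ c + 1) :
    S.e j (S.T m X y) = (if m + 1 = j then 1 else if m = j then qnum hb 2 else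
      if m = j + 1 then 1 else 0 : ℂ) • S.W (down (j - 1) 2) (X (S.E j y)) := by
  unfold T
  rcases lt_or_ge m j with h | h
  · rw [e_W_X hlo hX _ hj (by omega) h, e_E hq hr hlo hc hy hj hjc hm hmc]
    by_cases h1 : j = m + 1
    · rw [if_pos h1, if_pos h1.symm, one_smul, h1]
      rfl
    · rw [if_neg h1, if_neg (by omega), if_neg (by omega), if_neg (by omega), zero_smul, map_zero,
        map_zero]
  · obtain ⟨i, rfl⟩ : ∃ i, j = i + 1 := ⟨j - 1, by omega⟩
    rw [down_append (b := i + 1) (by omega) h, down_cons (by omega), W_append, W_cons,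
      S.e_W (by omega) (by omega), S.e_f_wt (wt_W_X hr hlo hX
        (wt_E hq hr hlo hc hy hm hmc) (by omega) (by omega)) (by omega) hj (by omega),
      e_W_X hlo hX _ hj (by omega) (by omega), e_E hq hr hlo hc hy hj hjc hm hmc,
      if_neg (by omega), map_zero, map_zero, map_zero, zero_add, map_smul, W_comm_W,
      ← S.W_comm X, W_E hq hr hlo hc hy (by omega) h hmc]
    · have : hp c r (-δ (m + 1) + δ (i + 1)) (i + 1) = if m = i + 1 then 2 else 1 := by
        unfold hp δ
        rw [if_pos hjc]
        simp only [Pi.add_apply, Pi.neg_apply]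
        split_ifs <;> (try omega) <;> norm_num
      rw [this, if_neg (show ¬ (m + 1 = i + 1) by omega)]
      by_cases h1 : m = i + 1
      · rw [if_pos h1, if_pos h1, if_pos (by omega)]; rfl
      · rw [if_neg h1, if_neg h1, hq.qnum_one]
        by_cases h2 : m = i + 1 + 1
        · rw [if_pos h2, if_pos (by omega)]; rfl
        · rw [if_neg h2, if_neg (by omega), map_zero, map_zero, smul_zero, zero_smul]
    · intro k hk z
      rw [mem_down] at hk
      exact (hX.comm_f k (by omega) (by omega) (by unfold car; split_ifs <;> omega) z).symm
    · intro k hk k' hk'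
      rw [mem_down] at hk hk'
      refine ⟨by omega, by omega, by omega, by omega, ?_⟩
      unfold car
      split_ifs <;> omega
    · intro k hk
      rw [mem_down] at hk
      omega

theorem e_sum_T {X : M →ₗ[ℂ] M} (hX : S.LeviOp X) {j : ℕ} (hj : 2 ≤ j) (hjc : j ≤ c) (C : ℕ → ℂ) :
    S.e j (∑ m ∈ Finset.Icc 1 (c + 1), C m • S.T m X y) =
      (C (j - 1) + qnum hb 2 * C j + C (j + 1)) • S.W (down (j - 1) 2) (X (S.E j y)) := by
  obtain ⟨i, rfl⟩ : ∃ i, j = i + 1 := ⟨j - 1, by omega⟩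
  have hsub : ({i, i + 1, i + 2} : Finset ℕ) ⊆ Finset.Icc 1 (c + 1) := by
    intro k hk
    simp only [Finset.mem_insert, Finset.mem_singleton] at hk
    rw [Finset.mem_Icc]
    omega
  rw [map_sum, ← Finset.sum_subset hsub]
  · rw [Finset.sum_insert (by simp), Finset.sum_insert (by simp), Finset.sum_singleton,
      map_smul, map_smul, map_smul, e_T hq hr hlo hc hy hX hj hjc (by omega) (by omega),
      e_T hq hr hlo hc hy hX hj hjc (by omega) (by omega),
      e_T hq hr hlo hc hy hX hj hjc (by omega) (by omega),
      if_pos rfl, if_neg (by omega), if_pos rfl, if_neg (by omega), if_neg (by omega), if_pos rfl,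
      Nat.add_sub_cancel]
    module
  · intro m hm hm'
    simp only [Finset.mem_insert, Finset.mem_singleton, Finset.mem_Icc, not_or] at hm hm'
    rw [map_smul, e_T hq hr hlo hc hy hX hj hjc hm.1 hm.2, if_neg (by omega), if_neg (by omega),
      if_neg (by omega), zero_smul, smul_zero]

theorem e_center_T {X : M →ₗ[ℂ] M} (hX : S.LeviOp X) {b m : ℕ} (hb' : b = c + 1 ∨ b = r)
    (hm : 1 ≤ m) (hmc : m ≤ c) :
    S.e b (S.T m X y) = if m = c then
      S.W (down c 2) (X (S.f (if b = c + 1 then r else c + 1) (S.D c y))) else 0 := by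
  unfold T
  rw [e_W_X hlo hX _ (by omega) (by omega) (by omega), e_E_center hq hr hlo hc hy hb' hm hmc]
  by_cases h : m = c
  · rw [if_pos h, if_pos h, h]
  · rw [if_neg h, if_neg h, map_zero, map_zero]

/-- The end nodes c + 1 and r coincide for odd P, where both summands occur at once. The argument 2
− car(b₂, b) is the weight in front of f_{b₁}: 1 at the short root, 2 when b = b₁ and b₂ are the two
different ends of the fork. -/
theorem e_f_W_X {X : M →ₗ[ℂ] M} (hX : S.LeviOp X) {b b₁ b₂ : ℕ} (hb' : b = c + 1 ∨ b = r)
    (hb₁ : b₁ = c + 1 ∨ b₁ = r) (hb₂ : b₂ = c + 1 ∨ b₂ = r) :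
    S.e b (S.f b₁ (S.W (down c 2) (X (S.f b₂ (S.D c y))))) =
      (if b = b₂ then S.f b₁ (S.W (down c 2) (X (S.D c y))) else 0) +
      (if b = b₁ then qnum hb (2 - car c r b₂ b) • S.W (down c 2) (X (S.f b₂ (S.D c y))) else 0) := by
  have key : S.f b₁ (S.e b (S.W (down c 2) (X (S.f b₂ (S.D c y))))) =
      if b = b₂ then S.f b₁ (S.W (down c 2) (X (S.D c y))) else 0 := by
    rw [e_W_X hlo hX _ (by omega) (by omega) (by omega),
      e_f_D hq hr hlo hc hy (by omega) (by omega) hb₂]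
    split_ifs
    · rfl
    · simp
  by_cases h : b = b₁
  · subst h
    rw [S.e_f_wt (wt_W_X hr hlo hX (wt_f_D hq hr hlo hc hy hb₂) (by omega) (by omega)) (by omega)
      (by omega) (by omega), key, if_pos rfl]
    congr 3
    rw [hp_add, hp_sub, hp_rt hr (by omega) (by omega)]
    have : hp c r (δ (c + 1)) b = 1 := by
      unfold hp δ
      split_ifs <;> (try omega) <;> norm_num
    rw [this]
    ring
  · rw [if_neg h, add_zero, S.e_f_ne b b₁ (by omega) (by omega) (by omega) (by omega) h, key]

theorem T_top (X : M →ₗ[ℂ] M) :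
    S.T (c + 1) X y = S.f (c + 1) (S.W (down c 2) (X (S.f r (S.D c y)))) := by
  rw [T, E_top, down_cons (by omega), W_cons]

theorem e_center_sum_T {X : M →ₗ[ℂ] M} (hX : S.LeviOp X) {b : ℕ} (hb' : b = c + 1 ∨ b = r)
    (C : ℕ → ℂ) :
    S.e b (∑ m ∈ Finset.Icc 1 (c + 1), C m • S.T m X y) =
      C c • S.W (down c 2) (X (S.f (if b = c + 1 then r else c + 1) (S.D c y))) +
      C (c + 1) • S.e b (S.f (c + 1) (S.W (down c 2) (X (S.f r (S.D c y))))) := by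
  have hsub : ({c, c + 1} : Finset ℕ) ⊆ Finset.Icc 1 (c + 1) := by
    intro k hk
    simp only [Finset.mem_insert, Finset.mem_singleton] at hk
    rw [Finset.mem_Icc]
    omega
  rw [map_sum, ← Finset.sum_subset hsub]
  · rw [Finset.sum_insert (by simp), Finset.sum_singleton,
      map_smul, map_smul, e_center_T hq hr hlo hc hy hX hb' hc le_rfl, if_pos rfl,
      T_top hq hr hlo hc hy]
  · intro m hm hm'
    simp only [Finset.mem_insert, Finset.mem_singleton, Finset.mem_Icc, not_or] at hm hm'
    rw [map_smul, e_center_T hq hr hlo hc hy hX hb' hm.1 (by omega), if_neg (by omega), smul_zero]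

/-! ### Squares -/

omit hq in
theorem f_D_D_eq_zero {a b : ℕ} (hb' : b ≤ r) (ha : a ≤ c)
    (h : ∀ k, 1 ≤ k → k ≤ a → car c r b k = 0) (hb2 : 2 ≤ b) :
    S.f b (S.D a (S.D a y)) = 0 := by
  have h' : ∀ k ∈ down a 1, lo ≤ k ∧ k ≤ r ∧ car c r b k = 0 := by
    intro k hk
    rw [mem_down] at hk
    exact ⟨by omega, by omega, h k hk.1 hk.2⟩
  rw [D, S.f_W (by omega) hb' h', S.f_W (by omega) hb' h', hy.f_zero b hb2 hb', map_zero, map_zero]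

/-- On y the element D_a satisfies the cubic q-Serre relation with f_b, as a simple root generator
would; the term in which f_b reaches y vanishes. The induction passes through [2] D_{a+1}² y =
f_{a+1}² D_a² y. -/
theorem f_D_D {a b : ℕ} (ha : 1 ≤ a) (hac : a ≤ c) (hab : a < b) (hbr : b ≤ r)
    (h : car c r a b = -1) :
    S.f b (S.D a (S.D a y)) = qnum hb 2 • S.D a (S.f b (S.D a y)) := by
  induction a generalizing b with
  | zero => omega
  | succ a ih =>
    have hcar : car c r (a + 1) (a + 1) = 2 := by unfold car; split_ifs <;> omega
    rcases Nat.eq_zero_or_pos a with rfl | h0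
    · have := S.serre 1 b (by omega) (by omega) (by omega) hbr hcar h y
      rw [hy.f_zero b (by omega) hbr, map_zero, map_zero, zero_sub, neg_add_eq_sub, sub_eq_zero]
        at this
      exact this
    have hbk : ∀ k, 1 ≤ k → k ≤ a → car c r b k = 0 := by
      intro k h1 h2
      unfold car at h ⊢
      split_ifs at h <;> split_ifs <;> omega
    have hsq : qnum hb 2 • S.D (a + 1) (S.D (a + 1) y) =
        S.f (a + 1) (S.f (a + 1) (S.D a (S.D a y))) := by
      rw [ih (b := a + 1) h0 (by omega) (by omega) (by omega) (by unfold car; split_ifs <;> omega),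
        map_smul, D_succ, D_succ]
    have hs := S.serre (a + 1) b (by omega) (by omega) (by omega) hbr hcar h (S.D a (S.D a y))
    rw [f_D_D_eq_zero hr hlo hc hy hbr (by omega) hbk (by omega), map_zero, map_zero, zero_sub,
      neg_add_eq_sub, sub_eq_zero, ← hsq, ih (b := a + 1) h0 (by omega) (by omega) (by omega)
        (by unfold car; split_ifs <;> omega), map_smul, map_smul, map_smul] at hs
    have hs' := smul_right_injective M hq.qnum_two_ne_zero hs
    rw [hs']
    congr 1
    rw [D_succ, D_succ, D, S.f_W (by omega) hbr]
    intro k hk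
    rw [mem_down] at hk
    exact ⟨by omega, by omega, hbk k hk.1 hk.2⟩

omit hq in
theorem LeviHW.f_zero_smul (hlo0 : lo = 0) : S.LeviHW (S.f 0 y) := by
  refine ⟨(hy.wt.f hr (by omega) (by omega) (by omega)).congr ?_, ?_, ?_⟩
  · intro j h1 h2
    rw [rt, if_pos (by omega)]
    unfold hp δ
    split_ifs <;> (try simp only [Pi.sub_apply, Pi.zero_apply]) <;> (try split_ifs) <;>
      (try omega) <;> (try contradiction) <;> norm_num
  · intro j h1 h2
    rw [S.e_f_ne j 0 (by omega) h2 (by omega) (by omega) (by omega), hy.e_zero j h1 h2, map_zero]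
  · intro j h1 h2
    rw [S.comm j 0 (by omega) h2 (by omega) (by omega) (car_zero_right hc h1),
      hy.f_zero j h1 h2, map_zero]

/-- The cubic relation for the pair D_a, f_0. Here f_0 y need not vanish, so all three terms stay.
The induction multiplies by [2] and again trades the square of D_{a+1} for f_{a+1}² D_a². -/
theorem D_f_D (hlo0 : lo = 0) {a : ℕ} (ha : 1 ≤ a) (hac : a ≤ c) :
    qnum hb 2 • S.D a (S.f 0 (S.D a y)) =
      S.f 0 (S.D a (S.D a y)) + S.D a (S.D a (S.f 0 y)) := by
  induction a with
  | zero => omega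
  | succ a ih =>
    have hcar : car c r (a + 1) (a + 1) = 2 := by unfold car; split_ifs <;> omega
    rcases Nat.eq_zero_or_pos a with rfl | h0
    · have := S.serre 1 0 (by omega) (by omega) (by omega) (by omega) hcar
        (by unfold car; split_ifs <;> omega) y
      rw [sub_add_eq_add_sub, sub_eq_zero] at this
      exact this.symm.trans (add_comm _ _)
    obtain ⟨d, rfl⟩ : ∃ d, a = d + 1 := ⟨a - 1, by omega⟩
    have hcar' : car c r (d + 1 + 1) (d + 1) = -1 := by unfold car; split_ifs <;> omega
    have hy0 := hy.f_zero_smul hr hlo hc hlo0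
    have hf0 : ∀ z, S.f (d + 1 + 1) (S.f 0 z) = S.f 0 (S.f (d + 1 + 1) z) :=
      S.comm _ _ (by omega) (by omega) (by omega) (by omega) (car_zero_right hc (by omega))
    have hfD : ∀ z, S.f (d + 1 + 1) (S.D d z) = S.D d (S.f (d + 1 + 1) z) := by
      intro z
      rw [D, S.f_W (by omega) (by omega)]
      intro k hk
      rw [mem_down] at hk
      refine ⟨by omega, by omega, ?_⟩
      unfold car
      split_ifs <;> omega
    have hsq : ∀ z, S.LeviHW z → qnum hb 2 • S.D (d + 1 + 1) (S.D (d + 1 + 1) z) =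
        S.f (d + 1 + 1) (S.f (d + 1 + 1) (S.D (d + 1) (S.D (d + 1) z))) := by
      intro z hz
      rw [f_D_D hq hr hlo hc hz (a := d + 1) (b := d + 1 + 1) (by omega) (by omega) (by omega)
        (by omega) (by rw [car_comm]; exact hcar'), map_smul, S.D_succ (d + 1), S.D_succ (d + 1)]
    have hz : S.f (d + 1 + 1) (S.f (d + 1 + 1) (S.D d (S.f 0 (S.D (d + 1) y)))) = 0 := by
      rw [hfD, hfD, hf0, hf0, ← S.D_succ (d + 1), f_D hq hr hlo hc hy (by omega) (by omega)
        (by omega) (by omega) (by omega), map_zero, map_zero]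
    have hs := S.serre (d + 1 + 1) (d + 1) (by omega) (by omega) (by omega) (by omega) hcar hcar'
      (S.D d (S.f 0 (S.D (d + 1) y)))
    rw [hz, map_zero, add_zero, sub_eq_zero, hfD, hf0] at hs
    have hs' : S.f (d + 1 + 1) (S.f (d + 1 + 1) (S.D (d + 1) (S.f 0 (S.D (d + 1) y)))) =
        qnum hb 2 • S.D (d + 1 + 1) (S.f 0 (S.D (d + 1 + 1) y)) := by
      rw [S.D_succ d (S.f 0 (S.D (d + 1) y)), S.D_succ (d + 1) (S.f 0 (S.D (d + 1 + 1) y)),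
        S.D_succ d (S.f 0 (S.D (d + 1 + 1) y)), S.D_succ (d + 1) y]
      exact hs
    apply smul_right_injective M hq.qnum_two_ne_zero
    simp only
    rw [← hs', smul_add, ← map_smul (S.f 0), hsq y hy, hsq _ hy0, ← map_smul, ← map_smul,
      ih (by omega) (by omega), map_add, map_add, hf0, hf0]

/-- Applying f_b to the previous relation and dividing by [2]. At the end of the diagram this
expresses the words with f_0 in the middle by those with f_0 on the left and on the right, so that
coefficients can be compared. -/
theorem f_D_f_D (hlo0 : lo = 0) {b : ℕ} (hb' : b = c + 1 ∨ b = r) :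
    S.f b (S.D c (S.f 0 (S.D c y))) =
      S.f 0 (S.D c (S.f b (S.D c y))) + S.D c (S.f b (S.D c (S.f 0 y))) := by
  have hcar : car c r c b = -1 := by unfold car; split_ifs <;> omega
  have hy0 := hy.f_zero_smul hr hlo hc hlo0
  apply smul_right_injective M hq.qnum_two_ne_zero
  simp only
  rw [← map_smul, D_f_D hq hr hlo hc hy hlo0 hc le_rfl, map_add,
    S.comm b 0 (by omega) (by omega) (by omega) (by omega) (car_zero_right hc (by omega)),
    f_D_D hq hr hlo hc hy hc le_rfl (by omega) (by omega) hcar,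
    f_D_D hq hr hlo hc hy0 hc le_rfl (by omega) (by omega) hcar, map_smul, smul_add]

end Levi

end QSys

/-! ### The coefficients of the generating element -/

/-- The ranks of `so(2 + P)`. -/
def IsRank (P c r : ℕ) : Prop := (r = c + 1 ∧ P = 2 * c + 1) ∨ (r = c + 2 ∧ P = 2 * c + 2)

theorem IsRank.or {P c r : ℕ} (h : IsRank P c r) : r = c + 1 ∨ r = c + 2 := by
  rcases h with h | h <;> omega

theorem IsRank.dim0 {P c r : ℕ} (h : IsRank P c r) : dim0 P = c + 1 := by
  unfold BorderlineSO.dim0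
  rcases h with h | h <;> omega

theorem IsRank.half {P c r : ℕ} (h : IsRank P c r) : P / 2 + 1 = r := by
  rcases h with h | h <;> omega

/-- The generic expression for the coefficients `A2`. -/
def B2 (hb : ℂ) (P : ℕ) (x : ℂ) (m : ℕ) : ℂ :=
  (-1) ^ m * (qpow hb (m - (P : ℂ) / 2) + qpow hb (-m + (P : ℂ) / 2)) *
    qnum hb (x + (P : ℂ) / 2 - 1) * qnum hb (x + (P : ℂ) / 2)

theorem A2_eq_B2 {P c r : ℕ} (h : IsRank P c r) (hb x : ℂ) {m : ℕ} (hm : r = c + 1 ∨ m ≤ c) :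
    A2 hb P x m = B2 hb P x m := by
  unfold A2 B2
  rw [if_neg]
  rintro ⟨h1, h2⟩
  rcases h with h | h
  · rw [h.2] at h1
    exact absurd h1 (by simp)
  · omega

/-- For even P the generic value at m = p, where both powers of q are 1, is split evenly between the
words φ²_p and φ²_{p+1}, in which the two ends of the fork are exchanged. -/
theorem two_mul_A2 {P c r : ℕ} (h : IsRank P c r) (hb x : ℂ) {m : ℕ} (hr : r = c + 2)
    (hm : c + 1 ≤ m) : A2 hb P x m + A2 hb P x m = B2 hb P x (c + 1) := by
  have hP : P = 2 * c + 2 := by rcases h with h | h <;> omega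
  have hP2 : P / 2 = c + 1 := by omega
  unfold A2 B2
  rw [if_pos ⟨by rw [hP]; exact ⟨c + 1, by ring⟩, by omega⟩, hP2, hP]
  have : ((2 * c + 2 : ℕ) : ℂ) / 2 = c + 1 := by push_cast; ring
  rw [this]
  push_cast
  rw [show ((c : ℂ) + 1 - (c + 1)) = 0 by ring, show (-((c : ℂ) + 1) + (c + 1)) = 0 by ring,
    qpow_zero]
  ring

theorem A2_succ {P c r : ℕ} (h : IsRank P c r) (hb x : ℂ) (hr : r = c + 2) :
    A2 hb P x (c + 2) = A2 hb P x (c + 1) := by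
  have hP : P = 2 * c + 2 := by rcases h with h | h <;> omega
  have he : Even P := by rw [hP]; exact ⟨c + 1, by ring⟩
  unfold A2
  rw [if_pos ⟨he, by omega⟩, if_pos ⟨he, by omega⟩]

section Coefficients

variable {hb : ℂ} (hq : Generic hb)
include hq

/-- The identities of this section are the conditions for annihilation, generator by generator: the
recursions `A0_rec`, `A1_rec`, `A3_rec`, `B2_rec` for e_j with 2 ≤ j ≤ c, the lemmas `_odd` and
`_even` for the end nodes, those ending in `_one_two` for e_1, and `A_zero` for e_0. -/
theorem A0_rec (P : ℕ) {m : ℕ} (hm : 1 ≤ m) :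
    A0 hb P m + qnum hb 2 * A0 hb P (m + 1) + A0 hb P (m + 2) = 0 := by
  obtain ⟨k, rfl⟩ : ∃ k, m = k + 1 := ⟨m - 1, by omega⟩
  have := hq.qnum_add_one_add_sub_one ((P : ℂ) / 2 - (k + 1))
  unfold A0
  simp only [show k + 1 - 1 = k by omega, show k + 1 + 1 - 1 = k + 1 by omega,
    show k + 1 + 2 - 1 = k + 2 by omega]
  push_cast
  rw [show (P : ℂ) / 2 - (k + 1) + 1 = (P : ℂ) / 2 - (k + 1) + 1 by ring,
    show (P : ℂ) / 2 - (k + 1 + 1) + 1 = (P : ℂ) / 2 - (k + 1) by ring,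
    show (P : ℂ) / 2 - (k + 1 + 2) + 1 = (P : ℂ) / 2 - (k + 1) - 1 by ring]
  linear_combination (-1) ^ k * this

theorem A1_rec (P : ℕ) (x : ℂ) (m : ℕ) :
    A1 hb P x m + qnum hb 2 * A1 hb P x (m + 1) + A1 hb P x (m + 2) = 0 := by
  have := hq.qnum_add_one_add_sub_one (x + P - (m + 1))
  unfold A1
  push_cast
  rw [show x + P - (m : ℂ) = x + P - (m + 1) + 1 by ring,
    show x + P - ((m : ℂ) + 2) = x + P - (m + 1) - 1 by ring]
  linear_combination (-1) ^ (m + 1) * qnum hb (x + (P : ℂ) / 2) * this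

theorem A3_rec (P : ℕ) (x : ℂ) (m : ℕ) :
    A3 hb P x m + qnum hb 2 * A3 hb P x (m + 1) + A3 hb P x (m + 2) = 0 := by
  have := hq.qnum_add_one_add_sub_one (x + m)
  unfold A3
  push_cast
  rw [show x + ((m : ℂ) + 1) - 1 = x + m by ring,
    show x + ((m : ℂ) + 2) - 1 = x + m + 1 by ring]
  linear_combination (-1) ^ (m + 1) * qnum hb (x + (P : ℂ) / 2 - 1) * this

theorem qpow_three_term (u : ℂ) : (qpow hb u + qpow hb (-u)) -
    qnum hb 2 * (qpow hb (u + 1) + qpow hb (-(u + 1))) + (qpow hb (u + 2) + qpow hb (-(u + 2)))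
     = 0 := by
  have h1 := qpow_ne_zero hb 1
  have h3 := qpow_ne_zero hb u
  rw [hq.qnum_two]
  simp only [qpow_neg, qpow_add, qpow_two]
  field_simp
  ring

theorem B2_rec (P : ℕ) (x : ℂ) (m : ℕ) :
    B2 hb P x m + qnum hb 2 * B2 hb P x (m + 1) + B2 hb P x (m + 2) = 0 := by
  have := qpow_three_term hq (m - (P : ℂ) / 2)
  unfold B2
  push_cast
  rw [show (m : ℂ) - (P : ℂ) / 2 + 1 = m + 1 - (P : ℂ) / 2 by ring,
    show (m : ℂ) - (P : ℂ) / 2 + 2 = m + 2 - (P : ℂ) / 2 by ring,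
    show -((m : ℂ) - (P : ℂ) / 2) = -m + (P : ℂ) / 2 by ring,
    show -((m : ℂ) + 1 - (P : ℂ) / 2) = -(m + 1) + (P : ℂ) / 2 by ring,
    show -((m : ℂ) + 2 - (P : ℂ) / 2) = -(m + 2) + (P : ℂ) / 2 by ring] at this
  linear_combination (-1) ^ m * qnum hb (x + (P : ℂ) / 2 - 1) * qnum hb (x + (P : ℂ) / 2) * this

theorem qnum_half_three : qnum hb (3 / 2) = qnum hb (1 / 2) * (1 + qnum hb 2) := by
  have h1 := qpow_ne_zero hb (1 / 2)
  have h2 := hq.sq_ne_one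
  have e1 : qpow hb 1 = qpow hb (1 / 2) * qpow hb (1 / 2) := by rw [← qpow_add]; norm_num
  have e2 : qpow hb (3 / 2) = qpow hb (1 / 2) * qpow hb (1 / 2) * qpow hb (1 / 2) := by
    rw [← qpow_add, ← qpow_add]; norm_num
  rw [hq.qnum_two]
  rw [e1] at h2
  simp only [qnum, qpow_neg, e1, e2]
  field_simp
  ring

/-- At the short root the recursion is replaced by C_c + (1 + [2]) C_{c+1} = 0. The factor [2] comes
from the relation `QSys.f_D_D` and the 1 from the weight. Writing c + 1 for c keeps the truncated
exponent m − 1 harmless. -/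
theorem A0_odd (c : ℕ) : A0 hb (2 * (c + 1) + 1) (c + 1) +
    A0 hb (2 * (c + 1) + 1) (c + 2) * (1 + qnum hb 2) = 0 := by
  have := qnum_half_three hq
  unfold A0
  simp only [show c + 1 - 1 = c by omega, show c + 2 - 1 = c + 1 by omega]
  push_cast
  rw [show ((2 : ℂ) * (c + 1) + 1) / 2 - (c + 1) + 1 = 3 / 2 by ring,
    show ((2 : ℂ) * (c + 1) + 1) / 2 - (c + 2) + 1 = 1 / 2 by ring]
  linear_combination (-1) ^ c * this

theorem A0_even (c : ℕ) : A0 hb (2 * (c + 1) + 2) (c + 1) +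
    A0 hb (2 * (c + 1) + 2) (c + 2) * qnum hb 2 = 0 := by
  unfold A0
  simp only [show c + 1 - 1 = c by omega, show c + 2 - 1 = c + 1 by omega]
  push_cast
  rw [show ((2 : ℂ) * (c + 1) + 2) / 2 - (c + 1) + 1 = 2 by ring,
    show ((2 : ℂ) * (c + 1) + 2) / 2 - (c + 2) + 1 = 1 by ring, hq.qnum_one]
  ring

theorem half_identity (X : ℂ) : qnum hb (X + 1 / 2) - qnum hb (X - 1 / 2) * (1 + qnum hb 2) +
    (qpow hb (1 / 2) + qpow hb (-(1 / 2))) * qnum hb (X - 1) = 0 := by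
  have h1 := qpow_ne_zero hb (1 / 2)
  have h2 := hq.sq_ne_one
  have h3 := qpow_ne_zero hb X
  have e1 : qpow hb 1 = qpow hb (1 / 2) * qpow hb (1 / 2) := by rw [← qpow_add]; norm_num
  rw [hq.qnum_two]
  rw [e1] at h2
  simp only [qnum, qpow_neg, qpow_add, qpow_sub, e1]
  field_simp
  ring

theorem half_identity' (X : ℂ) : qnum hb (X - 3 / 2) - qnum hb (X - 1 / 2) * (1 + qnum hb 2) +
    (qpow hb (1 / 2) + qpow hb (-(1 / 2))) * qnum hb X = 0 := by
  have := half_identity hq (1 - X)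
  rw [show 1 - X + 1 / 2 = -(X - 3 / 2) by ring, show 1 - X - 1 / 2 = -(X - 1 / 2) by ring,
    show 1 - X - 1 = -X by ring, qnum_neg, qnum_neg, qnum_neg] at this
  linear_combination - this

/-- The coefficient B2 enters because `QSys.f_D_f_D` rewrites one vector coming from the middle
words in terms of those with f_0 on the left and on the right. -/
theorem A1_odd (c : ℕ) (x : ℂ) : A1 hb (2 * c + 1) x c +
    A1 hb (2 * c + 1) x (c + 1) * (1 + qnum hb 2) + B2 hb (2 * c + 1) x (c + 1) = 0 := by
  have := half_identity hq (x + (2 * c + 1) / 2)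
  unfold A1 B2
  push_cast
  rw [show x + (2 * c + 1 : ℂ) - c = x + (2 * c + 1) / 2 + 1 / 2 by ring,
    show x + (2 * c + 1 : ℂ) - (c + 1) = x + (2 * c + 1) / 2 - 1 / 2 by ring,
    show (c + 1 : ℂ) - (2 * c + 1) / 2 = 1 / 2 by ring,
    show -(c + 1 : ℂ) + (2 * c + 1) / 2 = - (1 / 2) by ring]
  linear_combination (-1) ^ (c + 1) * qnum hb (x + (2 * c + 1) / 2) * this

theorem A3_odd (c : ℕ) (x : ℂ) : A3 hb (2 * c + 1) x c +
    A3 hb (2 * c + 1) x (c + 1) * (1 + qnum hb 2) + B2 hb (2 * c + 1) x (c + 1) = 0 := by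
  have := half_identity' hq (x + (2 * c + 1) / 2)
  unfold A3 B2
  push_cast
  rw [show x + (c : ℂ) - 1 = x + (2 * c + 1) / 2 - 3 / 2 by ring,
    show x + (c + 1 : ℂ) - 1 = x + (2 * c + 1) / 2 - 1 / 2 by ring,
    show (c + 1 : ℂ) - (2 * c + 1) / 2 = 1 / 2 by ring,
    show -(c + 1 : ℂ) + (2 * c + 1) / 2 = - (1 / 2) by ring]
  linear_combination (-1) ^ (c + 1) * qnum hb (x + (2 * c + 1) / 2 - 1) * this

omit hq in
theorem B2_odd (c : ℕ) (x : ℂ) : B2 hb (2 * c + 1) x c + B2 hb (2 * c + 1) x (c + 1) = 0 := by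
  unfold B2
  push_cast
  rw [show (c : ℂ) - (2 * c + 1) / 2 = - (1 / 2) by ring,
    show -(c : ℂ) + (2 * c + 1) / 2 = 1 / 2 by ring,
    show (c + 1 : ℂ) - (2 * c + 1) / 2 = 1 / 2 by ring,
    show -(c + 1 : ℂ) + (2 * c + 1) / 2 = - (1 / 2) by ring]
  ring

theorem A1_even (c : ℕ) (x : ℂ) : A1 hb (2 * c + 2) x c +
    A1 hb (2 * c + 2) x (c + 1) * qnum hb 2 + A2 hb (2 * c + 2) x (c + 1) = 0 := by
  have := hq.qnum_add_one_add_sub_one (x + (c + 1))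
  unfold A1 A2
  rw [if_pos ⟨⟨c + 1, by ring⟩, by omega⟩, show (2 * c + 2) / 2 = c + 1 by omega]
  push_cast
  rw [show x + (2 * c + 2 : ℂ) - c = x + (c + 1) + 1 by ring,
    show x + (2 * c + 2 : ℂ) - (c + 1) = x + (c + 1) by ring,
    show (2 * c + 2 : ℂ) / 2 = c + 1 by ring]
  linear_combination (-1) ^ (c + 1) * qnum hb (x + (c + 1)) * this

theorem A3_even (c : ℕ) (x : ℂ) : A3 hb (2 * c + 2) x c +
    A3 hb (2 * c + 2) x (c + 1) * qnum hb 2 + A2 hb (2 * c + 2) x (c + 1) = 0 := by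
  have := hq.qnum_add_one_add_sub_one (x + c)
  unfold A3 A2
  rw [if_pos ⟨⟨c + 1, by ring⟩, by omega⟩, show (2 * c + 2) / 2 = c + 1 by omega]
  push_cast
  rw [show (2 * c + 2 : ℂ) / 2 = c + 1 by ring, show x + ((c : ℂ) + 1) - 1 = x + c by ring,
    show x + ((c : ℂ) + 1) = x + c + 1 by ring]
  linear_combination (-1) ^ (c + 1) * qnum hb (x + c) * this

theorem A2_even (c : ℕ) (x : ℂ) : A2 hb (2 * c + 2) x c +
    A2 hb (2 * c + 2) x (c + 1) * qnum hb 2 = 0 := by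
  unfold A2
  rw [if_neg (by omega), if_pos ⟨⟨c + 1, by ring⟩, by omega⟩, show (2 * c + 2) / 2 = c + 1 by omega,
    hq.qnum_two]
  push_cast
  rw [show (2 * c + 2 : ℂ) / 2 = c + 1 by ring, show (c : ℂ) - (c + 1) = -1 by ring,
    show -(c : ℂ) + (c + 1) = 1 by ring]
  ring

theorem A0_one_two (P : ℕ) (x : ℂ) :
    A0 hb P 1 * qnum hb x + A0 hb P 2 * qnum hb (x - 1) = qnum hb (x + (P : ℂ) / 2 - 1) := by
  have := hq.qnum_mul_sub_mul ((P : ℂ) / 2) (x - 1)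
  unfold A0
  rw [show x + (P : ℂ) / 2 - 1 = (P : ℂ) / 2 + (x - 1) by ring, ← this]
  norm_num
  rw [show (P : ℂ) / 2 - 2 + 1 = (P : ℂ) / 2 - 1 by ring]
  ring

theorem A12_one_two (P : ℕ) (x : ℂ) :
    A1 hb P x 1 * qnum hb x + A1 hb P x 2 * qnum hb (x - 1) +
      (B2 hb P x 1 * qnum hb (x + 1) + B2 hb P x 2 * qnum hb x) = 0 := by
  have key : ∀ u : ℂ, qnum hb (x + 2 * u - 1) * qnum hb x - qnum hb (x + 2 * u - 2) * qnum hb (x - 1)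
      - qnum hb (x + u - 1) * ((qpow hb (1 - u) + qpow hb (u - 1)) * qnum hb (x + 1) -
        (qpow hb (2 - u) + qpow hb (u - 2)) * qnum hb x) = 0 := by
    intro u
    have h1 := qpow_ne_zero hb 1
    have h2 := hq.sq_ne_one
    have h3 := qpow_ne_zero hb x
    have h4 := qpow_ne_zero hb u
    rw [two_mul u]
    simp only [qnum, qpow_neg, qpow_add, qpow_sub, qpow_two]
    field_simp
    ring
  have h := key ((P : ℂ) / 2)
  unfold A1 B2
  push_cast
  rw [show x + 2 * ((P : ℂ) / 2) - 1 = x + P - 1 by ring,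
    show x + 2 * ((P : ℂ) / 2) - 2 = x + P - 2 by ring] at h
  rw [show -(1 : ℂ) + (P : ℂ) / 2 = P / 2 - 1 by ring, show -(2 : ℂ) + (P : ℂ) / 2 = P / 2 - 2 by ring]
  linear_combination qnum hb (x + (P : ℂ) / 2) * h

omit hq in
theorem A3_one_two (P : ℕ) (x : ℂ) :
    A3 hb P x 1 * qnum hb (x + 1) + A3 hb P x 2 * qnum hb x = 0 := by
  unfold A3
  push_cast
  rw [show x + 1 - 1 = x by ring, show x + 2 - 1 = x + 1 by ring]
  ring

/-- With r = λ_l − λ_{l+1} these are the contributions of the three words belonging to the same m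
when e_0 removes f_0: the weight in front of f_0 drops by 1 for each of the two letters f_1 that no
longer stand to its right. -/
theorem A_zero {P : ℕ} (x r : ℂ) {m : ℕ} (hm : 1 ≤ m) :
    A1 hb P x m * qnum hb (r + 2) + B2 hb P x m * qnum hb (r + 1) + A3 hb P x m * qnum hb r =
      A0 hb P m * qnum hb (r + 2 * x + P) := by
  have := hq.qnum_three_term (x + (P : ℂ) / 2) ((P : ℂ) / 2 - m) r
  obtain ⟨k, rfl⟩ : ∃ k, m = k + 1 := ⟨m - 1, by omega⟩
  unfold A0 A1 A3 B2
  rw [show k + 1 - 1 = k by omega]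
  push_cast at this ⊢
  rw [show x + (P : ℂ) / 2 + ((P : ℂ) / 2 - (k + 1)) = x + P - (k + 1) by ring,
    show x + (P : ℂ) / 2 - 1 - ((P : ℂ) / 2 - (k + 1)) = x + (k + 1) - 1 by ring,
    show -((P : ℂ) / 2 - (k + 1)) = k + 1 - P / 2 by ring,
    show (P : ℂ) / 2 - (k + 1) = - (k + 1) + P / 2 by ring,
    show 2 * (x + (P : ℂ) / 2) + r = r + 2 * x + P by ring] at this
  rw [show (P : ℂ) / 2 - (k + 1) + 1 = - (k + 1) + P / 2 + 1 by ring]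
  linear_combination (-1) ^ k * this

end Coefficients

/-! ### The words of the generating element -/

/-- Both parities fit the pattern φ_m = D_m E_m. The only word outside it is φ_{p+1} for even P. -/
theorem phi_eq {P c r : ℕ} (h : IsRank P c r) {m : ℕ} (hmc : m ≤ c + 1) :
    phi P m = down m 1 ++ (up (m + 1) (c + 1) ++ r :: down c 1) := by
  unfold phi
  rcases h with ⟨rfl, rfl⟩ | ⟨rfl, rfl⟩
  · rw [if_pos (by simp), show (2 * c + 1) / 2 = c by omega, List.append_assoc,
      down_cons (a := c) (by omega)]
  · rw [if_neg (by simp [Nat.odd_add]), show (2 * c + 2) / 2 = c + 1 by omega]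
    rcases Nat.lt_or_ge m (c + 1) with h | h
    · simp only [if_pos h, Nat.add_sub_cancel]
      rw [up_append (a := m + 1) (b := c) (c := c + 1) (by omega) (by omega), up_cons le_rfl,
        up_nil (a := c + 1 + 1) (by omega)]
      simp
    · obtain rfl : m = c + 1 := by omega
      simp only [Nat.add_sub_cancel, lt_irrefl, if_false, if_true]
      rw [up_nil (by omega), down_cons (by omega)]
      simp

theorem phi_last {c : ℕ} : phi (2 * c + 2) (c + 2) =
    (c + 2) :: (down c 1 ++ (c + 1) :: down c 1) := by
  unfold phi
  rw [if_neg (by simp [Nat.odd_add]), show (2 * c + 2) / 2 = c + 1 by omega]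
  simp only [Nat.add_sub_cancel]
  rw [if_neg (by omega), if_neg (by omega)]
  simp

theorem hp_congr {c r j : ℕ} {μ ν : ℕ → ℂ} (hc : 1 ≤ c) (hj : 2 ≤ j)
    (h : ∀ i, 2 ≤ i → μ i = ν i) : hp c r μ j = hp c r ν j := by
  unfold hp
  rw [h j hj, h (j + 1) (by omega), h (c + 1) (by omega), h (c + 2) (by omega)]

theorem hp_top {c r j : ℕ} (hr : r = c + 1 ∨ r = c + 2) (hj : j ≤ r) :
    hp c r (δ (c + 1) - rt c r + δ (c + 2)) j = 0 := by
  rcases hr with rfl | rfl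
  · have : δ (c + 1) - rt c (c + 1) + δ (c + 2) = δ (c + 2) + δ (c + 2) := by
      rw [rt, if_pos le_rfl]; abel
    rw [this, hp_add]
    have : hp c (c + 1) (δ (c + 2)) j = 0 := by
      unfold hp δ
      split_ifs <;> (try omega) <;> norm_num
    rw [this, add_zero]
  · have : δ (c + 1) - rt c (c + 2) + δ (c + 2) = 0 := by
      rw [rt, if_neg (by omega)]; abel
    rw [this]
    unfold hp
    simp

namespace QSys

variable {hb : ℂ} {c r lo : ℕ} {M : Type} [AddCommGroup M] [Module ℂ M] (S : QSys hb c r lo M)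

theorem W_phi {P : ℕ} (h : IsRank P c r) {m : ℕ} (hmc : m ≤ c + 1) (y : M) :
    S.W (phi P m) y = S.D m (S.E m y) := by
  rw [phi_eq h hmc, W_append]; rfl

theorem W_phi1 {P : ℕ} (h : IsRank P c r) {m : ℕ} (hmc : m ≤ c + 1) (y : M) :
    S.W (phi1 P m) y = S.f 0 (S.D m (S.E m y)) := by
  rw [phi1, W_cons, W_phi S h hmc]

theorem W_phi3 {P : ℕ} (h : IsRank P c r) {m : ℕ} (hmc : m ≤ c + 1) (y : M) :
    S.W (phi3 P m) y = S.D m (S.E m (S.f 0 y)) := by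
  rw [phi3, W_append, W_phi S h hmc]; rfl

theorem phi2_of_concat {P m : ℕ} {L : List ℕ} {k : ℕ} (h : phi P m = L ++ [k]) :
    phi2 P m = L ++ [0, k] := by
  rw [phi2, h]
  simp

/-- The letter f_0 commutes with all letters of index at least 2, so it can be moved from its place
before the last letter to the left end of E_m. For c = 0 the word E_1 is a single letter and nothing
has to be moved. -/
theorem W_phi2 {P : ℕ} (h : IsRank P c r) (hlo : lo = 0) {m : ℕ} (hm : 1 ≤ m) (hmc : m ≤ c + 1)
    (y : M) : S.W (phi2 P m) y = S.D m (S.f 0 (S.E m y)) := by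
  have hr := h.or
  rcases Nat.eq_zero_or_pos c with rfl | hc
  · obtain rfl : m = 1 := by omega
    have : phi P 1 = [1] ++ [r] := by
      rw [phi_eq h hmc, down_self, up_nil (by omega), down_nil (by omega)]; rfl
    rw [phi2_of_concat this]
    rfl
  · have : phi P m = (down m 1 ++ (up (m + 1) (c + 1) ++ r :: down c 2)) ++ [1] := by
      rw [phi_eq h hmc, down_concat (a := c) (b := 1) hc]; simp
    rw [phi2_of_concat this, W_append, W_append, E, down_concat (a := c) (b := 1) hc]
    rw [← List.cons_append, ← List.append_assoc, W_append _ _ [1], S.f_W (j := 0) (by omega)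
      (by omega)]
    · rfl
    · intro k hk
      simp only [List.mem_append, List.mem_cons, mem_up, mem_down] at hk
      refine ⟨by omega, by omega, ?_⟩
      rw [car_comm]
      exact car_zero_right hc (by omega)

theorem W_phi2_last (hr : r = c + 2) (hlo : lo = 0) (y : M) :
    S.W (phi2 (2 * c + 2) (c + 2)) y = S.f r (S.D c (S.f 0 (S.f (c + 1) (S.D c y)))) := by
  rcases Nat.eq_zero_or_pos c with rfl | hc
  · have : phi (2 * 0 + 2) (0 + 2) = [2] ++ [1] := by
      rw [phi_last, down_nil (by omega)]; rfl
    rw [phi2_of_concat this, congrArg S.f hr]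
    rfl
  · have : phi (2 * c + 2) (c + 2) = (r :: (down c 1 ++ (c + 1) :: down c 2)) ++ [1] := by
      rw [phi_last, hr]
      conv_lhs => rw [down_concat (a := c) (b := 1) hc]
      conv_rhs => rw [down_concat (a := c) (b := 1) hc]
      simp
    rw [phi2_of_concat this, W_append, W_cons, W_append, W_cons, W_cons, W_cons, W_nil]
    have h1 : ∀ z, S.f 0 (S.W (down c 2) z) = S.W (down c 2) (S.f 0 z) := by
      intro z
      rw [S.f_W (by omega) (by omega)]
      intro k hk
      rw [mem_down] at hk
      refine ⟨by omega, by omega, ?_⟩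
      rw [car_comm]
      exact car_zero_right hc (by omega)
    rw [S.comm 0 (c + 1) (by omega) (by omega) (by omega) (by omega)
      (by rw [car_comm]; exact car_zero_right hc (by omega)), D, down_concat (a := c) (b := 1) hc,
      W_append, W_append, W_cons, W_nil, W_cons, W_nil, W_append, h1]
    rfl

/-- The element of weight `-2 ε_1`. -/
def Phi (P : ℕ) (y : M) : M :=
  ∑ m ∈ Finset.Icc 1 (dim0 P), A0 hb P m • S.W (phi P m) y

/-- The element of weight `-ε_0 - ε_1`. -/
def FL (P : ℕ) (x : ℂ) (y : M) : M :=
  ∑ m ∈ Finset.Icc 1 (dim0 P), A1 hb P x m • S.W (phi1 P m) y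
    + ∑ m ∈ Finset.Icc 1 (P / 2 + 1), A2 hb P x m • S.W (phi2 P m) y
    + ∑ m ∈ Finset.Icc 1 (dim0 P), A3 hb P x m • S.W (phi3 P m) y

theorem Phi_eq {P : ℕ} (h : IsRank P c r) (y : M) :
    S.Phi P y = ∑ m ∈ Finset.Icc 1 (c + 1), A0 hb P m • S.D m (S.E m y) := by
  unfold Phi
  rw [h.dim0]
  refine Finset.sum_congr rfl fun m hm => ?_
  rw [Finset.mem_Icc] at hm
  rw [W_phi S h hm.2]

theorem FL_eq {P : ℕ} (h : IsRank P c r) (hlo : lo = 0) (x : ℂ) (y : M) :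
    S.FL P x y = ∑ m ∈ Finset.Icc 1 (c + 1), A1 hb P x m • S.f 0 (S.D m (S.E m y))
    + ∑ m ∈ Finset.Icc 1 (c + 1), A2 hb P x m • S.D m (S.f 0 (S.E m y))
    + (if r = c + 2 then A2 hb P x (c + 1) • S.f r (S.D c (S.f 0 (S.f (c + 1) (S.D c y)))) else 0)
    + ∑ m ∈ Finset.Icc 1 (c + 1), A3 hb P x m • S.D m (S.E m (S.f 0 y)) := by
  have hr := h.or
  unfold FL
  rw [h.dim0, h.half]
  congr 1
  · rw [add_assoc]
    congr 1
    · refine Finset.sum_congr rfl fun m hm => ?_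
      rw [Finset.mem_Icc] at hm
      rw [W_phi1 S h hm.2]
    · have key : ∑ m ∈ Finset.Icc 1 (c + 1), A2 hb P x m • S.W (phi2 P m) y =
          ∑ m ∈ Finset.Icc 1 (c + 1), A2 hb P x m • S.D m (S.f 0 (S.E m y)) := by
        refine Finset.sum_congr rfl fun m hm => ?_
        rw [Finset.mem_Icc] at hm
        rw [W_phi2 S h hlo hm.1 hm.2]
      by_cases h2 : r = c + 2
      · have hP : P = 2 * c + 2 := by rcases h with h | h <;> omega
        rw [if_pos h2, ← key, congrArg (Finset.Icc 1) h2, Finset.sum_Icc_succ_top (by omega)]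
        congr 1
        rw [← A2_succ h hb x h2, ← W_phi2_last S h2 hlo, hP]
      · rw [if_neg h2, add_zero, ← key, congrArg (Finset.Icc 1) (show r = c + 1 by omega)]
  · refine Finset.sum_congr rfl fun m hm => ?_
    rw [Finset.mem_Icc] at hm
    rw [W_phi3 S h hm.2]

/-- A highest weight vector for the `e_j`, `a ≤ j`, that is annihilated by the Levi subalgebra. -/
structure HW (a : ℕ) (μ : ℕ → ℂ) (y : M) : Prop where
  wt : S.Wt a μ y
  e_zero : ∀ j, a ≤ j → j ≤ r → S.e j y = 0
  -- For P = 2, that is c = 0 and r = 2, the index 2 does not belong to a root of so(P), so nothing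
  -- may be required there.
  f_zero : 1 ≤ c → ∀ j, 2 ≤ j → j ≤ r → S.f j y = 0
  zero : ∀ i, 2 ≤ i → i ≤ r → μ i = 0

variable {S}

theorem HW.levi {a : ℕ} {μ : ℕ → ℂ} {y : M} (h : S.HW a μ y) (ha : a ≤ 2)
    (hr : r = c + 1 ∨ r = c + 2) (hc : 1 ≤ c) :
    S.LeviHW y := by
  refine ⟨(h.wt.mono ha).congr ?_, fun j hj => h.e_zero j (ha.trans hj), h.f_zero hc⟩
  intro j h1 h2
  unfold hp
  split_ifs
  · rw [h.zero j h1 h2, h.zero _ (by omega) (by omega)]; rfl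
  · rw [h.zero _ (by omega) (by omega)]; rfl
  · rw [h.zero _ (by omega) (by omega), h.zero _ (by omega) (by omega)]; rfl
  · rw [h.zero _ (by omega) (by omega), h.zero _ (by omega) (by omega)]; rfl

theorem Wt.D {a b : ℕ} {μ : ℕ → ℂ} {y : M} (h : S.Wt a μ y) (hr : r = c + 1 ∨ r = c + 2)
    (ha : lo ≤ a) (hlo : lo ≤ 1) (hb' : b ≤ c + 1) : S.Wt a (μ - δ 1 + δ (b + 1)) (S.D b y) := by
  induction b with
  | zero => rw [D_zero]; simpa using h
  | succ b ih =>
    rw [D_succ]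
    refine ((ih (by omega)).f hr ha (by omega) (by omega)).congr ?_
    intro j _ _
    rw [rt, if_pos (by omega)]
    congr 1
    abel

theorem Wt.E {a m : ℕ} {μ : ℕ → ℂ} {y : M} (h : S.Wt a μ y) (hr : r = c + 1 ∨ r = c + 2)
    (ha : lo ≤ a) (hlo : lo ≤ 1) (hm : 1 ≤ m) (hmc : m ≤ c + 1) :
    S.Wt a (μ - δ 1 - δ (m + 1)) (S.E m y) := by
  obtain ⟨i, hi⟩ : ∃ i, m + i = c + 1 := ⟨c + 1 - m, by omega⟩
  induction i generalizing m with
  | zero =>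
    obtain rfl : m = c + 1 := by omega
    rw [E_top]
    refine ((h.D hr ha hlo (by omega)).f hr ha (by omega) (by omega)).congr ?_
    intro j h1 h2
    have := hp_top hr h2
    simp only [hp_sub, hp_add] at this ⊢
    linear_combination this
  | succ i ih =>
    rw [E_eq S (by omega)]
    refine ((ih (by omega) (by omega) (by omega)).f hr (by omega) (by omega) (by omega)).congr ?_
    intro j h1 h2
    rw [rt, if_pos (by omega)]
    congr 1
    abel

theorem leviOp_f_one (hr : r = c + 1 ∨ r = c + 2) (hlo : lo ≤ 1) (hc : 1 ≤ c) :
    S.LeviOp (S.f 1) := by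
  refine ⟨fun j h1 h2 h3 z => S.comm j 1 (by omega) h2 (by omega) (by omega) h3 z,
    fun j h1 h2 z => S.e_f_ne j 1 (by omega) h2 (by omega) (by omega) (by omega) z,
    fun μ z hz => (hz.f hr (by omega) (by omega) (by omega)).congr ?_⟩
  intro j h1 h2
  apply hp_congr hc h1
  intro i hi
  rw [rt, if_pos (by omega)]
  simp only [δ, Pi.sub_apply, Pi.add_apply]
  rw [if_neg (by omega)]
  ring

theorem wt_f_zero (hr : r = c + 1 ∨ r = c + 2) (hlo : lo = 0) (hc : 1 ≤ c) {μ : ℕ → ℂ} {z : M}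
    (hz : S.Wt 2 μ z) : S.Wt 2 μ (S.f 0 z) := by
  refine (hz.f hr (by omega) (by omega) (by omega)).congr ?_
  intro j h1 h2
  rw [hp_sub, hp_rt hr (by omega) h2, car_comm, car_zero_right hc h1]
  simp

theorem LeviOp.f_zero_comp {X : M →ₗ[ℂ] M} (hX : S.LeviOp X) (hr : r = c + 1 ∨ r = c + 2)
    (hlo : lo = 0) (hc : 1 ≤ c) : S.LeviOp (S.f 0 ∘ₗ X) := by
  refine ⟨fun j h1 h2 h3 z => ?_, fun j h1 h2 z => ?_, fun μ z hz => ?_⟩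
  · rw [LinearMap.comp_apply, LinearMap.comp_apply, ← hX.comm_f j h1 h2 h3, S.comm j 0 (by omega) h2
      (by omega) (by omega) (car_zero_right hc h1)]
  · rw [LinearMap.comp_apply, LinearMap.comp_apply, ← hX.comm_e j h1 h2, S.e_f_ne j 0 (by omega) h2
      (by omega) (by omega) (by omega)]
  · exact wt_f_zero hr hlo hc (hX.wt μ z hz)

theorem LeviOp.comp_f_zero {X : M →ₗ[ℂ] M} (hX : S.LeviOp X) (hr : r = c + 1 ∨ r = c + 2)
    (hlo : lo = 0) (hc : 1 ≤ c) : S.LeviOp (X ∘ₗ S.f 0) := by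
  refine ⟨fun j h1 h2 h3 z => ?_, fun j h1 h2 z => ?_, fun μ z hz => ?_⟩
  · rw [LinearMap.comp_apply, LinearMap.comp_apply, hX.comm_f j h1 h2 h3, S.comm j 0 (by omega) h2
      (by omega) (by omega) (car_zero_right hc h1)]
  · rw [LinearMap.comp_apply, LinearMap.comp_apply, hX.comm_e j h1 h2, S.e_f_ne j 0 (by omega) h2
      (by omega) (by omega) (by omega)]
  · exact hX.wt _ _ (wt_f_zero hr hlo hc hz)

theorem D_eq_W {m : ℕ} (hm : 1 ≤ m) (z : M) : S.D m z = S.W (down m 2) (S.f 1 z) := by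
  rw [D, down_concat hm, W_append]; rfl

theorem D_E_eq_T {m : ℕ} (hm : 1 ≤ m) (y : M) : S.D m (S.E m y) = S.T m (S.f 1) y :=
  D_eq_W hm _

theorem D_f_E_eq_T {m : ℕ} (hm : 1 ≤ m) (y : M) :
    S.D m (S.f 0 (S.E m y)) = S.T m (S.f 1 ∘ₗ S.f 0) y :=
  D_eq_W hm _

theorem f_zero_W_down (hr : r = c + 1 ∨ r = c + 2) (hlo : lo = 0) (hc : 1 ≤ c) {m : ℕ}
    (hm : m ≤ c + 1) (z : M) : S.f 0 (S.W (down m 2) z) = S.W (down m 2) (S.f 0 z) := by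
  rw [S.f_W (by omega) (by omega)]
  intro k hk
  rw [mem_down] at hk
  refine ⟨by omega, by omega, ?_⟩
  rw [car_comm]
  exact car_zero_right hc (by omega)

theorem f_D_E_eq_T (hr : r = c + 1 ∨ r = c + 2) (hlo : lo = 0) (hc : 1 ≤ c) {m : ℕ} (hm : 1 ≤ m)
    (hmc : m ≤ c + 1) (y : M) :
    S.f 0 (S.D m (S.E m y)) = S.T m (S.f 0 ∘ₗ S.f 1) y := by
  rw [D_eq_W hm, f_zero_W_down hr hlo hc hmc]; rfl

end QSys

/-! ### Annihilation of the generating elements by so(P). -/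

namespace QSys

variable {hb : ℂ} {c r lo : ℕ} {M : Type} [AddCommGroup M] [Module ℂ M] {S : QSys hb c r lo M}

section Levi

variable {y : M} (hq : Generic hb) (hr : r = c + 1 ∨ r = c + 2) (hlo : lo ≤ 1) (hc : 1 ≤ c)
  (hy : S.LeviHW y)
include hq hr hlo hc hy

/-- The extra word for even P behaves under e_c as the term m = c + 1 does. Its coefficient A2_{c+1}
then adds to that term and completes the generic value B2_{c+1} required by the recursion. -/
theorem e_f_W_X_last {X : M →ₗ[ℂ] M} (hX : S.LeviOp X) {j : ℕ} (hj : 2 ≤ j) (hjc : j ≤ c)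
    (hr2 : r = c + 2) :
    S.e j (S.f r (S.W (down c 2) (X (S.f (c + 1) (S.D c y))))) =
      if j = c then S.W (down (c - 1) 2) (X (S.E c y)) else 0 := by
  obtain ⟨i, rfl⟩ : ∃ i, j = i + 1 := ⟨j - 1, by omega⟩
  have hw := wt_W_X hr hlo hX (wt_f_D hq hr hlo hc hy (b := c + 1) (Or.inl rfl)) (j := i)
    (by omega) (by omega)
  have hval : hp c r (δ (c + 1) - rt c (c + 1) + δ (i + 1)) (i + 1) = 1 := by
    rw [rt, if_pos le_rfl]
    unfold hp δ
    rw [if_pos hjc]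
    simp only [Pi.add_apply, Pi.sub_apply]
    split_ifs <;> (try omega) <;> norm_num
  rw [S.e_f_ne (i + 1) r (by omega) (by omega) (by omega) le_rfl (by omega),
    down_append (b := i + 1) (by omega) hjc, down_cons (by omega), W_append, W_cons,
    S.e_W (by omega) (by omega), S.e_f_wt hw (by omega) hj (by omega),
    e_W_X hlo hX _ hj (by omega) (by omega), e_f_D hq hr hlo hc hy hj (by omega) (Or.inl rfl),
    if_neg (by omega), map_zero, map_zero, map_zero, zero_add, hval, hq.qnum_one, one_smul]
  · rw [W_comm_W S (L := down c (i + 1 + 1)) (L' := down i 2), ← S.W_comm X (down c (i + 1 + 1))]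
    · by_cases h : i + 1 = c
      · subst h
        rw [if_pos rfl, down_nil (show i + 1 < i + 1 + 1 by omega), W_nil, Nat.add_sub_cancel,
          S.f_W (by omega) (by omega),
          hX.comm_f r (by omega) le_rfl (by unfold car; split_ifs <;> omega),
          S.comm r (i + 1 + 1) (by omega) le_rfl (by omega) (by omega)
            (by unfold car; split_ifs <;> omega), E_eq S le_rfl, E_top]
        · intro k hk
          rw [mem_down] at hk
          refine ⟨by omega, by omega, ?_⟩
          unfold car
          split_ifs <;> omega
      · rw [if_neg h, down_concat (show i + 1 + 1 ≤ c by omega), W_append, W_cons, W_nil,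
          f_f_D hq hr hlo hc hy (by omega) (by omega) (Or.inl rfl), map_zero, map_zero, map_zero,
          map_zero]
    · intro k hk z
      rw [mem_down] at hk
      exact (hX.comm_f k (by omega) (by omega) (by unfold car; split_ifs <;> omega) z).symm
    · intro k hk k' hk'
      rw [mem_down] at hk hk'
      refine ⟨by omega, by omega, by omega, by omega, ?_⟩
      unfold car
      split_ifs <;> omega
  · intro k hk
    rw [mem_down] at hk
    omega

theorem f_W_f_one {b : ℕ} (hb' : b = c + 1 ∨ b = r) :
    S.f b (S.W (down c 2) (S.f 1 (S.D c y))) =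
      qnum hb 2 • S.W (down c 2) (S.f 1 (S.f b (S.D c y))) := by
  rw [← D_eq_W hc, ← D_eq_W hc]
  exact f_D_D hq hr hlo hc hy hc le_rfl (by omega) (by omega) (by unfold car; split_ifs <;> omega)

theorem f_W_f_zero_one (hlo0 : lo = 0) {b : ℕ} (hb' : b = c + 1 ∨ b = r) :
    S.f b (S.W (down c 2) ((S.f 0 ∘ₗ S.f 1) (S.D c y))) =
      qnum hb 2 • S.W (down c 2) ((S.f 0 ∘ₗ S.f 1) (S.f b (S.D c y))) := by
  rw [LinearMap.comp_apply, LinearMap.comp_apply, ← f_zero_W_down hr hlo0 hc (by omega),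
    ← f_zero_W_down hr hlo0 hc (by omega), S.comm b 0 (by omega) (by omega) (by omega) (by omega)
      (car_zero_right hc (by omega)), f_W_f_one hq hr hlo hc hy hb', map_smul]

theorem f_W_f_one_zero (hlo0 : lo = 0) {b : ℕ} (hb' : b = c + 1 ∨ b = r) :
    S.f b (S.W (down c 2) ((S.f 1 ∘ₗ S.f 0) (S.D c y))) =
      S.W (down c 2) ((S.f 0 ∘ₗ S.f 1) (S.f b (S.D c y))) +
      S.W (down c 2) (S.f 1 (S.f b (S.D c (S.f 0 y)))) := by
  rw [LinearMap.comp_apply, LinearMap.comp_apply, ← f_zero_W_down hr hlo0 hc (by omega),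
    ← D_eq_W hc, ← D_eq_W hc, ← D_eq_W hc]
  exact f_D_f_D hq hr hlo hc hy hlo0 hb'

end Levi

theorem Phi_eq_T {P : ℕ} (h : IsRank P c r) (y : M) :
    S.Phi P y = ∑ m ∈ Finset.Icc 1 (c + 1), A0 hb P m • S.T m (S.f 1) y := by
  rw [Phi_eq S h]
  refine Finset.sum_congr rfl fun m hm => ?_
  rw [Finset.mem_Icc] at hm
  rw [D_E_eq_T hm.1]

/-- For j ≤ c this is the recursion for A0. At the end nodes f_b D_c f_1 ⋯ is reduced by `f_W_f_one`
to a single vector whose coefficient vanishes by `A0_odd` or `A0_even`. -/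
theorem e_Phi_levi {P : ℕ} {y : M} (hq : Generic hb) (h : IsRank P c r) (hlo : lo ≤ 1) (hc : 1 ≤ c)
    (hy : S.LeviHW y) {j : ℕ} (hj : 2 ≤ j) (hjr : j ≤ r) : S.e j (S.Phi P y) = 0 := by
  have hr := h.or
  have hX : S.LeviOp (S.f 1) := leviOp_f_one hr hlo hc
  rw [Phi_eq_T h]
  by_cases hjc : j ≤ c
  · rw [e_sum_T hq hr hlo hc hy hX hj hjc]
    have := A0_rec hq P (m := j - 1) (by omega)
    rw [show j - 1 + 1 = j by omega, show j - 1 + 2 = j + 1 by omega] at this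
    rw [this, zero_smul]
  · have hb' : j = c + 1 ∨ j = r := by omega
    rw [e_center_sum_T hq hr hlo hc hy hX hb', e_f_W_X hq hr hlo hc hy hX hb' (Or.inl rfl)
      (Or.inr rfl), f_W_f_one hq hr hlo hc hy (Or.inl rfl)]
    obtain ⟨d, rfl⟩ : ∃ d, c = d + 1 := ⟨c - 1, by omega⟩
    rcases h with ⟨rfl, rfl⟩ | ⟨rfl, rfl⟩
    · obtain rfl : j = d + 1 + 1 := by omega
      have h2 : car (d + 1) (d + 1 + 1) (d + 1 + 1) (d + 1 + 1) = 1 := by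
        unfold car; split_ifs <;> omega
      simp only [if_true, h2]
      rw [show (2 : ℂ) - (1 : ℤ) = 1 by norm_num, hq.qnum_one]
      have := A0_odd hq d
      linear_combination (norm := module) this • S.W (down (d + 1) 2) (S.f 1 (S.f (d + 1 + 1) (S.D (d + 1) y)))
    · have := A0_even hq d
      by_cases h3 : j = d + 1 + 1
      · subst h3
        have h2 : car (d + 1) (d + 1 + 2) (d + 1 + 2) (d + 1 + 1) = 0 := by
          unfold car; split_ifs <;> omega
        rw [if_pos rfl, if_neg (by omega), if_pos rfl, h2, Int.cast_zero, sub_zero, zero_add,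
          smul_smul, ← add_smul, this, zero_smul]
      · rw [if_neg h3, if_pos (by omega), if_neg h3, add_zero, smul_smul, ← add_smul, this,
          zero_smul]

theorem FL_eq_T {P : ℕ} (h : IsRank P c r) (hlo : lo = 0) (hc : 1 ≤ c) (x : ℂ) (y : M) :
    S.FL P x y = ∑ m ∈ Finset.Icc 1 (c + 1), A1 hb P x m • S.T m (S.f 0 ∘ₗ S.f 1) y
    + ∑ m ∈ Finset.Icc 1 (c + 1), A2 hb P x m • S.T m (S.f 1 ∘ₗ S.f 0) y
    + (if r = c + 2 then A2 hb P x (c + 1) •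
        S.f r (S.W (down c 2) ((S.f 1 ∘ₗ S.f 0) (S.f (c + 1) (S.D c y)))) else 0)
    + ∑ m ∈ Finset.Icc 1 (c + 1), A3 hb P x m • S.T m (S.f 1) (S.f 0 y) := by
  rw [FL_eq S h hlo, D_eq_W hc]
  congr 1
  · congr 1
    congr 1
    all_goals
      refine Finset.sum_congr rfl fun m hm => ?_
      rw [Finset.mem_Icc] at hm
    · rw [f_D_E_eq_T h.or hlo hc hm.1 hm.2]
    · rw [D_f_E_eq_T hm.1]
  · refine Finset.sum_congr rfl fun m hm => ?_
    rw [Finset.mem_Icc] at hm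
    rw [D_E_eq_T hm.1]

theorem e_FL_levi_of_le {P : ℕ} {y : M} (hq : Generic hb) (h : IsRank P c r) (hlo : lo = 0)
    (hc : 1 ≤ c) (hy : S.LeviHW y) (x : ℂ) {j : ℕ} (hj : 2 ≤ j) (hjc : j ≤ c) :
    S.e j (S.FL P x y) = 0 := by
  have hr := h.or
  have hX : S.LeviOp (S.f 1) := leviOp_f_one hr (by omega) hc
  have hX01 := hX.f_zero_comp hr hlo hc
  have hX10 := hX.comp_f_zero hr hlo hc
  have hy0 := hy.f_zero_smul hr (by omega) hc hlo
  have h1 := A1_rec hq P x (j - 1)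
  have h2 := B2_rec hq P x (j - 1)
  have h3 := A3_rec hq P x (j - 1)
  rw [show j - 1 + 1 = j by omega, show j - 1 + 2 = j + 1 by omega] at h1 h2 h3
  rw [FL_eq_T h hlo hc, map_add, map_add, map_add, e_sum_T hq hr (by omega) hc hy hX01 hj hjc,
    e_sum_T hq hr (by omega) hc hy hX10 hj hjc, e_sum_T hq hr (by omega) hc hy0 hX hj hjc, h1, h3,
    zero_smul, zero_smul, zero_add, add_zero, A2_eq_B2 h hb x (m := j - 1) (by omega),
    A2_eq_B2 h hb x (m := j) (by omega)]
  by_cases hr2 : r = c + 2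
  · rw [if_pos hr2, map_smul, e_f_W_X_last hq hr (by omega) hc hy hX10 hj hjc hr2]
    by_cases hj2 : j = c
    · have h4 := two_mul_A2 h hb x hr2 (m := c + 1) le_rfl
      rw [if_pos hj2, hj2, ← add_smul]
      rw [hj2, ← h4] at h2
      rw [add_assoc, h2, zero_smul]
    · rw [if_neg hj2, smul_zero, add_zero, A2_eq_B2 h hb x (m := j + 1) (by omega), h2, zero_smul]
  · rw [if_neg hr2, map_zero, add_zero, A2_eq_B2 h hb x (m := j + 1) (by omega), h2, zero_smul]

/-- After `f_W_f_one_zero` everything is a combination of three vectors, with f_0 to the left of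
both letters f_1, between them, and to their right. Their coefficients vanish separately. For even P
each end of the fork is hit by both the term m = c + 1 and the extra word, one through its left and
the other through its right occurrence. -/
theorem e_FL_center {P : ℕ} {y : M} (hq : Generic hb) (h : IsRank P c r) (hlo : lo = 0)
    (hc : 1 ≤ c) (hy : S.LeviHW y) (x : ℂ) {j : ℕ} (hb' : j = c + 1 ∨ j = r) :
    S.e j (S.FL P x y) = 0 := by
  have hr := h.or
  have hX : S.LeviOp (S.f 1) := leviOp_f_one hr (by omega) hc
  have hX01 := hX.f_zero_comp hr hlo hc
  have hX10 := hX.comp_f_zero hr hlo hc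
  have hy0 := hy.f_zero_smul hr (by omega) hc hlo
  have hlo1 : lo ≤ 1 := by omega
  rw [FL_eq_T h hlo hc, map_add, map_add, map_add, e_center_sum_T hq hr hlo1 hc hy hX01 hb',
    e_center_sum_T hq hr hlo1 hc hy hX10 hb', e_center_sum_T hq hr hlo1 hc hy0 hX hb',
    e_f_W_X hq hr hlo1 hc hy hX01 hb' (Or.inl rfl) (Or.inr rfl),
    e_f_W_X hq hr hlo1 hc hy hX10 hb' (Or.inl rfl) (Or.inr rfl),
    e_f_W_X hq hr hlo1 hc hy0 hX hb' (Or.inl rfl) (Or.inr rfl),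
    f_W_f_one hq hr hlo1 hc hy0 (Or.inl rfl), f_W_f_zero_one hq hr hlo1 hc hy hlo (Or.inl rfl),
    f_W_f_one_zero hq hr hlo1 hc hy hlo (Or.inl rfl)]
  rcases h with ⟨rfl, rfl⟩ | ⟨rfl, rfl⟩
  · obtain rfl : j = c + 1 := by omega
    have h2 : car c (c + 1) (c + 1) (c + 1) = 1 := by
      unfold car; split_ifs <;> omega
    simp only [if_true, h2]
    rw [show (2 : ℂ) - (1 : ℤ) = 1 by norm_num, hq.qnum_one, if_neg (by omega),
      A2_eq_B2 (Or.inl ⟨rfl, rfl⟩) hb x (m := c) (Or.inl rfl),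
      A2_eq_B2 (Or.inl ⟨rfl, rfl⟩) hb x (m := c + 1) (Or.inl rfl), map_zero]
    generalize S.W (down c 2) ((S.f 0 ∘ₗ S.f 1) (S.f (c + 1) (S.D c y))) = V1
    generalize S.W (down c 2) ((S.f 1 ∘ₗ S.f 0) (S.f (c + 1) (S.D c y))) = V2
    generalize S.W (down c 2) (S.f 1 (S.f (c + 1) (S.D c (S.f 0 y)))) = V3
    have e1 := A1_odd hq c x
    have e2 := B2_odd (hb := hb) c x
    have e3 := A3_odd hq c x
    linear_combination (norm := module) e1 • V1 + e2 • V2 + e3 • V3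
  · have e1 := A1_even hq c x
    have e2 := A2_even hq c x
    have e3 := A3_even hq c x
    rw [if_pos rfl, map_smul, e_f_W_X hq hr hlo1 hc hy hX10 hb' (Or.inr rfl) (Or.inl rfl),
      f_W_f_one_zero hq hr hlo1 hc hy hlo (Or.inr rfl)]
    by_cases h3 : j = c + 1
    · subst h3
      have h2 : car c (c + 2) (c + 2) (c + 1) = 0 := by
        unfold car; split_ifs <;> omega
      simp only [if_true, h2, if_neg (show ¬ (c + 1 = c + 2) by omega)]
      rw [Int.cast_zero, sub_zero]
      linear_combination (norm := module) e1 • S.W (down c 2) ((S.f 0 ∘ₗ S.f 1) (S.f (c + 2) (S.D c y))) +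
        e2 • S.W (down c 2) ((S.f 1 ∘ₗ S.f 0) (S.f (c + 2) (S.D c y))) +
        e3 • S.W (down c 2) (S.f 1 (S.f (c + 2) (S.D c (S.f 0 y))))
    · obtain rfl : j = c + 2 := by omega
      have h2 : car c (c + 2) (c + 1) (c + 2) = 0 := by
        unfold car; split_ifs <;> omega
      simp only [if_true, h2, if_neg (show ¬ (c + 2 = c + 1) by omega)]
      rw [Int.cast_zero, sub_zero]
      linear_combination (norm := module) e1 • S.W (down c 2) ((S.f 0 ∘ₗ S.f 1) (S.f (c + 1) (S.D c y))) +
        e2 • S.W (down c 2) ((S.f 1 ∘ₗ S.f 0) (S.f (c + 1) (S.D c y))) +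
        e3 • S.W (down c 2) (S.f 1 (S.f (c + 1) (S.D c (S.f 0 y))))

end QSys

theorem sum_Icc_eq_one_add_two {M : Type*} [AddCommMonoid M] {n : ℕ} (hn : 2 ≤ n) (F : ℕ → M)
    (h : ∀ m, 2 < m → F m = 0) : ∑ m ∈ Finset.Icc 1 n, F m = F 1 + F 2 := by
  rw [← Finset.sum_pair (by norm_num : (1 : ℕ) ≠ 2)]
  symm
  apply Finset.sum_subset
  · intro m hm
    simp only [Finset.mem_insert, Finset.mem_singleton] at hm
    rw [Finset.mem_Icc]
    omega
  · intro m hm hm'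
    simp only [Finset.mem_insert, Finset.mem_singleton] at hm'
    rw [Finset.mem_Icc] at hm
    exact h m (by omega)

/-! ### The action of e_1 on the generating elements. -/

namespace QSys

variable {hb : ℂ} {c r lo : ℕ} {M : Type} [AddCommGroup M] [Module ℂ M] {S : QSys hb c r lo M}

theorem e_one_sum (hc : 1 ≤ c) {G : ℕ → M} {α β : ℂ} {V : M} (C : ℕ → ℂ)
    (h : ∀ m, 1 ≤ m → m ≤ c + 1 → S.e 1 (G m) =
      if m = 1 then α • V else if m = 2 then β • V else 0) :
    S.e 1 (∑ m ∈ Finset.Icc 1 (c + 1), C m • G m) = (C 1 * α + C 2 * β) • V := by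
  have h1 : ∀ m ∈ Finset.Icc 1 (c + 1), S.e 1 (C m • G m) =
      C m • if m = 1 then α • V else if m = 2 then β • V else 0 := fun m hm => by
    rw [Finset.mem_Icc] at hm
    rw [map_smul, h m hm.1 hm.2]
  rw [map_sum, Finset.sum_congr rfl h1, sum_Icc_eq_one_add_two (by omega)]
  · rw [if_pos rfl, if_neg (by norm_num), if_pos rfl]
    module
  · intro m hm
    rw [if_neg (by omega), if_neg (by omega), smul_zero]

theorem e_one_D (hr : r = c + 1 ∨ r = c + 2) (hlo : lo ≤ 1) {μ : ℕ → ℂ} {z : M} (hz : S.Wt 1 μ z)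
    (he : S.e 1 z = 0) {m : ℕ} (hm : 1 ≤ m) (hmc : m ≤ c + 1) :
    S.e 1 (S.D m z) = qnum hb (hp c r μ 1) • S.W (down m 2) z := by
  rw [D_eq_W hm, S.e_W hlo (by omega), S.e_f_wt hz hlo le_rfl (by omega), he, map_zero, zero_add,
    map_smul]
  intro k hk
  rw [mem_down] at hk
  omega

section

variable {y : M} {μ : ℕ → ℂ} (hq : Generic hb) (hr : r = c + 1 ∨ r = c + 2) (hlo : lo ≤ 1)
  (hc : 1 ≤ c) (hy : S.HW 1 μ y)
include hq hr hlo hc hy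

/-- The generator e_1 removes the only f_1 of the word, and the remaining letters belong to so(P)
and kill y. The hypothesis c ≥ 1 matters: for c = 0 and r = 1 there are two ways for e_1 to meet a
letter of f_1 E_1. -/
theorem e_one_E {m : ℕ} (hm : 1 ≤ m) : S.e 1 (S.E m y) = 0 := by
  have hL := hy.levi (by omega) hr hc
  have h1 : S.E m y = S.W (up (m + 1) (c + 1) ++ [r]) (S.D c y) := by
    rw [E, D, ← W_append, List.append_assoc]
    rfl
  rw [h1, S.e_W hlo (by omega), e_one_D hr hlo hy.wt (hy.e_zero 1 le_rfl (by omega)) hc (by omega),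
    map_smul, ← W_append, W_levi_zero hq hr hlo hc hL (by simp), smul_zero]
  · intro k hk
    simp only [List.mem_append, mem_up, mem_down, List.mem_singleton] at hk
    omega
  · intro k hk
    simp only [List.mem_append, mem_up, List.mem_singleton] at hk
    omega

theorem W_down_two_E {m : ℕ} (hm : 1 ≤ m) (hmc : m ≤ c + 1) :
    S.W (down m 2) (S.E m y) = if m ≤ 2 then S.E 1 y else 0 :=
  W_E hq hr hlo hc (hy.levi (by omega) hr hc) le_rfl hm hmc

/-- Once e_1 has removed the f_1 of D_m, the letters f_m ⋯ f_2 act on E_m y, which leaves E_1 y for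
m ≤ 2 and zero otherwise. The factors are the values of α_1 on the weights of E_1 y and E_2 y. -/
theorem e_one_D_E {m : ℕ} (hm : 1 ≤ m) (hmc : m ≤ c + 1) :
    S.e 1 (S.D m (S.E m y)) =
      if m = 1 then qnum hb (μ 1) • S.E 1 y else
      if m = 2 then qnum hb (μ 1 - 1) • S.E 1 y else 0 := by
  have h2 := hy.zero 2 le_rfl (by omega)
  rw [e_one_D hr hlo (hy.wt.E hr hlo hlo hm hmc) (e_one_E hq hr hlo hc hy hm) hm hmc,
    W_down_two_E hq hr hlo hc hy hm hmc]
  by_cases h : m = 1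
  · subst h
    rw [if_pos (by omega), if_pos rfl]
    simp [hp, δ, hc, h2]
  · rw [if_neg h]
    by_cases h' : m = 2
    · subst h'
      rw [if_pos le_rfl, if_pos rfl]
      simp [hp, δ, hc, h2]
    · rw [if_neg (by omega), if_neg h', smul_zero]

theorem e_one_Phi_of_pos {P : ℕ} (h : IsRank P c r) :
    S.e 1 (S.Phi P y) = qnum hb (μ 1 + (P : ℂ) / 2 - 1) • S.E 1 y := by
  rw [Phi_eq S h, e_one_sum hc _ fun m => e_one_D_E hq hr hlo hc hy, A0_one_two hq P (μ 1)]

end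

theorem HW.f_zero_smul {y : M} {μ : ℕ → ℂ} (hr : r = c + 1 ∨ r = c + 2) (hlo : lo = 0)
    (hy : S.HW 1 μ y) : S.HW 1 (μ - δ 0 + δ 1) (S.f 0 y) := by
  refine ⟨(hy.wt.f hr (by omega) (by omega) (by omega)).congr ?_, fun j h1 h2 => ?_,
    fun hc j h1 h2 => ?_, fun i h1 h2 => ?_⟩
  · intro j _ _
    rw [rt, if_pos (by omega)]
    congr 1
    abel
  · rw [S.e_f_ne j 0 (by omega) h2 (by omega) (by omega) (by omega), hy.e_zero j h1 h2, map_zero]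
  · rw [S.comm j 0 (by omega) h2 (by omega) (by omega) (car_zero_right hc h1),
      hy.f_zero hc j h1 h2, map_zero]
  · have := hy.zero i h1 h2
    simp only [δ, Pi.add_apply, Pi.sub_apply]
    rw [if_neg (by omega), if_neg (by omega), this]
    ring

section

variable {y : M} {μ : ℕ → ℂ} (hq : Generic hb) (hr : r = c + 1 ∨ r = c + 2) (hlo : lo = 0)
  (hc : 1 ≤ c) (hy : S.HW 1 μ y)
include hq hr hlo hc hy

theorem e_one_f_zero_D_E {m : ℕ} (hm : 1 ≤ m) (hmc : m ≤ c + 1) :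
    S.e 1 (S.f 0 (S.D m (S.E m y))) =
      if m = 1 then qnum hb (μ 1) • S.f 0 (S.E 1 y) else
      if m = 2 then qnum hb (μ 1 - 1) • S.f 0 (S.E 1 y) else 0 := by
  rw [S.e_f_ne 1 0 (by omega) (by omega) (by omega) (by omega) (by omega),
    e_one_D_E hq hr (by omega) hc hy hm hmc]
  split_ifs <;> simp

theorem e_one_D_f_zero_E {m : ℕ} (hm : 1 ≤ m) (hmc : m ≤ c + 1) :
    S.e 1 (S.D m (S.f 0 (S.E m y))) =
      if m = 1 then qnum hb (μ 1 + 1) • S.f 0 (S.E 1 y) else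
      if m = 2 then qnum hb (μ 1) • S.f 0 (S.E 1 y) else 0 := by
  have h2 := hy.zero 2 le_rfl (by omega)
  have hE := (hy.wt.E hr (by omega) (by omega) hm hmc).f hr (by omega) (k := 0) (by omega)
    (by omega)
  rw [e_one_D hr (by omega) hE _ hm hmc, ← f_zero_W_down hr hlo hc hmc,
    W_down_two_E hq hr (by omega) hc hy hm hmc]
  · by_cases h : m = 1
    · subst h
      rw [if_pos (by omega), if_pos rfl]
      simp [hp, δ, hc, h2, rt]
    · rw [if_neg h]
      by_cases h' : m = 2
      · subst h'
        rw [if_pos le_rfl, if_pos rfl]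
        simp [hp, δ, hc, h2, rt]
      · rw [if_neg (by omega), if_neg h', map_zero, smul_zero]
  · rw [S.e_f_ne 1 0 (by omega) (by omega) (by omega) (by omega) (by omega),
      e_one_E hq hr (by omega) hc hy hm, map_zero]

theorem e_one_D_E_f_zero {m : ℕ} (hm : 1 ≤ m) (hmc : m ≤ c + 1) :
    S.e 1 (S.D m (S.E m (S.f 0 y))) =
      if m = 1 then qnum hb (μ 1 + 1) • S.E 1 (S.f 0 y) else
      if m = 2 then qnum hb (μ 1) • S.E 1 (S.f 0 y) else 0 := by
  rw [e_one_D_E hq hr (by omega) hc (hy.f_zero_smul hr hlo) hm hmc]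
  simp [δ]

/-- For c ≥ 2 the letter f_2 reaches f_{c+1} D_c y and kills it. Only for c = 1, that is P = 4, is
there a contribution; it makes up the other half of B2_2. -/
theorem e_one_last (hr2 : r = c + 2) :
    S.e 1 (S.f r (S.D c (S.f 0 (S.f (c + 1) (S.D c y))))) =
      if c = 1 then qnum hb (μ 1) • S.f 0 (S.E 1 y) else 0 := by
  have h2 := hy.zero 2 le_rfl (by omega)
  have hw := ((hy.wt.D hr (by omega) (by omega) (b := c) (by omega)).f hr (by omega) (k := c + 1)
    (by omega) (by omega)).f hr (by omega) (k := 0) (by omega) (by omega)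
  rw [S.e_f_ne 1 r (by omega) (by omega) (by omega) le_rfl (by omega), e_one_D hr (by omega) hw _ hc
    (by omega), ← f_zero_W_down hr hlo hc (by omega), map_smul, S.comm r 0 (by omega) le_rfl
    (by omega) (by omega) (car_zero_right hc (by omega))]
  · by_cases h : c = 1
    · subst h
      rw [if_pos rfl, down_nil (by norm_num), W_nil, S.comm r (1 + 1) (by omega) le_rfl (by omega)
        (by omega) (by unfold car; split_ifs <;> omega), E_eq S le_rfl, E_top]
      simp [hp, δ, h2, rt]
    · rw [if_neg h, down_concat (by omega), W_append, W_cons, W_nil,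
        f_f_D hq hr (by omega) hc (hy.levi (by omega) hr hc) le_rfl (by omega) (Or.inl rfl)]
      simp
  · rw [S.e_f_ne 1 0 (by omega) (by omega) (by omega) (by omega) (by omega),
      S.e_f_ne 1 (c + 1) (by omega) (by omega) (by omega) (by omega) (by omega),
      e_one_D hr (by omega) hy.wt (hy.e_zero 1 le_rfl (by omega)) hc (by omega), map_smul,
      ← W_cons, ← down_cons (by omega),
      W_levi_zero hq hr (by omega) hc (hy.levi (by omega) hr hc), smul_zero, map_zero]
    · rw [down_cons (by omega)]; simp
    · intro k hk
      rw [mem_down] at hk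
      omega

theorem e_one_FL_of_pos {P : ℕ} (h : IsRank P c r) : S.e 1 (S.FL P (μ 1) y) = 0 := by
  rw [FL_eq S h hlo]
  rw [map_add, map_add, map_add, e_one_sum hc _ fun m => e_one_f_zero_D_E hq hr hlo hc hy,
    e_one_sum hc _ fun m => e_one_D_f_zero_E hq hr hlo hc hy,
    e_one_sum hc _ fun m => e_one_D_E_f_zero hq hr hlo hc hy]
  have h12 := A12_one_two hq P (μ 1)
  have h3 := A3_one_two (hb := hb) P (μ 1)
  have h1 : A2 hb P (μ 1) 1 = B2 hb P (μ 1) 1 := A2_eq_B2 h hb _ (by omega)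
  by_cases hr2 : r = c + 2
  · rw [if_pos hr2, map_smul, e_one_last hq hr hlo hc hy hr2, h1]
    by_cases hc1 : c = 1
    · have h4 := two_mul_A2 h hb (μ 1) hr2 (m := c + 1) le_rfl
      subst hc1
      rw [if_pos rfl]
      norm_num at h4 ⊢
      rw [← h4] at h12
      linear_combination (norm := module) h12 • S.f 0 (S.E 1 y) + h3 • S.E 1 (S.f 0 y)
    · rw [if_neg hc1, A2_eq_B2 h hb _ (m := 2) (by omega)]
      linear_combination (norm := module) h12 • S.f 0 (S.E 1 y) + h3 • S.E 1 (S.f 0 y)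
  · rw [if_neg hr2, map_zero, h1, A2_eq_B2 h hb _ (m := 2) (by omega)]
    linear_combination (norm := module) h12 • S.f 0 (S.E 1 y) + h3 • S.E 1 (S.f 0 y)

end

end QSys

/-! ### The cases P = 1 and P = 2, and the action of e_0. -/

theorem half_add {hb : ℂ} (hq : Generic hb) (x : ℂ) :
    qnum hb (1 / 2) * (qnum hb x + qnum hb (x - 1)) = qnum hb (x - 1 / 2) := by
  have h := hq.qnum_mul_sub_mul (1 / 2) (x - 1)
  rw [show (1 / 2 : ℂ) - 1 = -(1 / 2) by ring, qnum_neg, sub_add_cancel] at h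
  rw [show x - 1 / 2 = 1 / 2 + (x - 1) by ring, ← h]
  ring

theorem half_mul {hb : ℂ} (hq : Generic hb) (x : ℂ) :
    (qpow hb (1 / 2) + qpow hb (-(1 / 2))) * qnum hb (x - 1 / 2) = qnum hb x + qnum hb (x - 1) := by
  have h1 : qpow hb x = qpow hb (x - 1 / 2) * qpow hb (1 / 2) := by rw [← qpow_add]; ring_nf
  have h2 : qpow hb (x - 1) = qpow hb (x - 1 / 2) * (qpow hb (1 / 2))⁻¹ := by
    rw [← qpow_sub]; ring_nf
  rw [qnum_eq_mul hb x, qnum_eq_mul hb (x - 1), qnum_eq_mul hb (x - 1 / 2), h1, h2, qpow_neg]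
  have h3 := qpow_ne_zero hb (1 / 2)
  have h4 := qpow_ne_zero hb (x - 1 / 2)
  have h5 := hq.inv_ne_zero
  have h6 := qpow_ne_zero hb 1
  generalize (qpow hb 1 - (qpow hb 1)⁻¹)⁻¹ = K
  field_simp
  ring

theorem IsRank.cases_zero {P r : ℕ} (h : IsRank P 0 r) : (r = 1 ∧ P = 1) ∨ (r = 2 ∧ P = 2) := by
  rcases h with h | h <;> omega

namespace QSys

variable {hb : ℂ} {c r lo : ℕ} {M : Type} [AddCommGroup M] [Module ℂ M]

theorem Phi_one {r lo : ℕ} {S : QSys hb 0 r lo M} (h : IsRank 1 0 r) (y : M) :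
    S.Phi 1 y = qnum hb (1 / 2) • S.f 1 (S.f 1 y) := by
  obtain rfl : r = 1 := by rcases h with h | h <;> omega
  rw [Phi_eq S h]
  simp [A0, E_top S, D_succ, D_zero]

theorem Phi_two {r lo : ℕ} {S : QSys hb 0 r lo M} (hq : Generic hb) (h : IsRank 2 0 r) (y : M) :
    S.Phi 2 y = S.f 1 (S.f 2 y) := by
  obtain rfl : r = 2 := by rcases h with h | h <;> omega
  rw [Phi_eq S h]
  simp [A0, D_succ, D_zero, show S.E 1 y = S.f 2 (S.D 0 y) from E_top S y, hq.qnum_one]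

theorem FL_one {r lo : ℕ} {S : QSys hb 0 r lo M} (h : IsRank 1 0 r) (hlo : lo = 0) (x : ℂ)
    (y : M) : S.FL 1 x y = (qnum hb x * qnum hb (x + 1 / 2)) • S.f 0 (S.f 1 (S.f 1 y))
      - ((qpow hb (1 / 2) + qpow hb (-(1 / 2))) * qnum hb (x - 1 / 2) * qnum hb (x + 1 / 2)) •
        S.f 1 (S.f 0 (S.f 1 y))
      + (qnum hb x * qnum hb (x - 1 / 2)) • S.f 1 (S.f 1 (S.f 0 y)) := by
  have hE : ∀ y, S.E 1 y = S.f r (S.D 0 y) := E_top S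
  rw [FL_eq S h hlo, A2_eq_B2 h hb x (m := 0 + 1) (by rcases h with h | h <;> omega)]
  obtain rfl : r = 1 := by rcases h with h | h <;> omega
  simp only [zero_add, Finset.Icc_self, Finset.sum_singleton, A2_eq_B2 h hb x (Or.inl rfl)]
  simp only [A1, A3, B2, D_succ, D_zero, hE, Nat.cast_one, add_sub_cancel_right, pow_one,
    if_neg (show ¬ (1 = 0 + 2) by norm_num), zero_add]
  rw [show (1 : ℂ) - 1 / 2 = 1 / 2 by norm_num, show -(1 : ℂ) + 1 / 2 = -(1 / 2) by norm_num,
    show x + 1 / 2 - 1 = x - 1 / 2 by ring]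
  module

theorem FL_two {r lo : ℕ} {S : QSys hb 0 r lo M} (h : IsRank 2 0 r) (hlo : lo = 0) (x : ℂ)
    (y : M) : S.FL 2 x y = (qnum hb (x + 1) * qnum hb (x + 1)) • S.f 0 (S.f 1 (S.f 2 y))
      - (qnum hb x * qnum hb (x + 1)) • S.f 1 (S.f 0 (S.f 2 y))
      - (qnum hb x * qnum hb (x + 1)) • S.f 2 (S.f 0 (S.f 1 y))
      + (qnum hb x * qnum hb x) • S.f 1 (S.f 2 (S.f 0 y)) := by
  have hE : ∀ y, S.E 1 y = S.f r (S.D 0 y) := E_top S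
  rw [FL_eq S h hlo]
  obtain rfl : r = 2 := by rcases h with h | h <;> omega
  simp only [zero_add, Finset.Icc_self, Finset.sum_singleton]
  simp only [A1, A3, A2, D_succ, D_zero, hE, Nat.cast_one, Nat.cast_ofNat, add_sub_cancel_right,
    if_true, zero_add]
  norm_num
  rw [show x + 2 - 1 = x + 1 by ring]
  module

section

variable {y : M} {μ : ℕ → ℂ} {S : QSys hb c r lo M} (hq : Generic hb) {P : ℕ} (h : IsRank P c r)

include hq h

/-- For c = 0 there are no Levi roots and the generating elements have words with only two letters
in so(P + 2); the formula is then checked directly, with identities in q^{1/2} for P = 1. -/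
theorem e_one_Phi (hlo : lo ≤ 1) (hy : S.HW 1 μ y) :
    S.e 1 (S.Phi P y) = qnum hb (μ 1 + (P : ℂ) / 2 - 1) • S.E 1 y := by
  by_cases hc : 1 ≤ c
  · exact e_one_Phi_of_pos hq h.or hlo hc hy h
  · obtain rfl : c = 0 := by omega
    have hE : ∀ y, S.E 1 y = S.f r (S.D 0 y) := E_top S
    rcases h.cases_zero with ⟨rfl, rfl⟩ | ⟨rfl, rfl⟩
    · have h1 := hy.wt.f (Or.inl rfl) hlo (k := 1) hlo le_rfl
      rw [Phi_one (Or.inl ⟨rfl, rfl⟩), map_smul, S.e_f_wt h1 hlo le_rfl le_rfl,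
        S.e_f_wt hy.wt hlo le_rfl le_rfl, hy.e_zero 1 le_rfl le_rfl, hE, D_zero]
      simp only [hp, rt, map_zero, map_smul, zero_add, Pi.sub_apply]
      norm_num [δ]
      rw [show μ 1 + 1 / 2 - 1 = μ 1 - 1 / 2 by ring, ← half_add hq]
      module
    · have h1 := hy.wt.f (Or.inr rfl) hlo (k := 2) (by omega) le_rfl
      have h2 := hy.zero 2 le_rfl le_rfl
      rw [Phi_two hq (Or.inr ⟨rfl, rfl⟩), S.e_f_wt h1 hlo le_rfl (by omega),
        S.e_f_ne 1 2 hlo (by omega) (by omega) le_rfl (by omega), hy.e_zero 1 le_rfl (by omega), hE,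
        D_zero]
      simp only [hp, rt, map_zero, zero_add, Pi.sub_apply]
      norm_num [δ, h2]

theorem e_Phi_levi_of_pos (hlo : lo ≤ 1) (hc : 1 ≤ c) (hy : S.HW 1 μ y) {j : ℕ} (hj : 2 ≤ j)
    (hjr : j ≤ r) : S.e j (S.Phi P y) = 0 :=
  e_Phi_levi hq h hlo hc (hy.levi (by omega) h.or hc) hj hjr

theorem e_two_Phi (hlo : lo ≤ 1) (hc : c = 0) (hy : S.HW 1 μ y) (hr : 2 ≤ r) :
    S.e 2 (S.Phi P y) = qnum hb (μ 1 + (P : ℂ) / 2 - 1) • S.f 1 y := by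
  subst hc
  rcases h.cases_zero with ⟨rfl, rfl⟩ | ⟨rfl, rfl⟩
  · omega
  · have h2 := hy.zero 2 le_rfl le_rfl
    rw [Phi_two hq (Or.inr ⟨rfl, rfl⟩), S.e_f_ne 2 1 (by omega) le_rfl hlo
      (by omega) (by omega), S.e_f_wt hy.wt hlo (by omega) le_rfl, hy.e_zero 2 (by omega) le_rfl]
    simp only [hp, map_zero, zero_add, map_smul]
    norm_num [h2]

theorem e_FL (hlo : lo = 0) (hy : S.HW 1 μ y) {j : ℕ} (hj : 1 ≤ j)
    (hjr : j ≤ r) : S.e j (S.FL P (μ 1) y) = 0 := by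
  by_cases hc : 1 ≤ c
  · have hL := hy.levi (by omega) h.or hc
    rcases Nat.lt_or_ge 1 j with hj1 | hj1
    · rcases Nat.lt_or_ge c j with hjc | hjc
      · exact e_FL_center hq h hlo hc hL _ (by have := h.or; omega)
      · exact e_FL_levi_of_le hq h hlo hc hL _ hj1 hjc
    · obtain rfl : j = 1 := by omega
      exact e_one_FL_of_pos hq h.or hlo hc hy h
  · obtain rfl : c = 0 := by omega
    subst hlo
    rcases h.cases_zero with ⟨rfl, rfl⟩ | ⟨rfl, rfl⟩
    · obtain rfl : j = 1 := by omega
      have hr : 1 = 0 + 1 ∨ 1 = 0 + 2 := Or.inl rfl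
      have w1 := hy.wt.f hr (k := 1) (by omega) (by omega) (by omega)
      have w0 := hy.wt.f hr (k := 0) (by omega) (by omega) (by omega)
      have w01 := w1.f hr (k := 0) (by omega) (by omega) (by omega)
      have w10 := w0.f hr (k := 1) (by omega) (by omega) (by omega)
      have n0 := fun y => S.e_f_ne 1 0 (by omega) le_rfl le_rfl (by omega) (by omega) y
      rw [FL_one (Or.inl ⟨rfl, rfl⟩) rfl]
      simp only [map_add, map_sub, map_smul, n0, S.e_f_wt w1 (Nat.zero_le _) le_rfl le_rfl,
        S.e_f_wt w0 (Nat.zero_le _) le_rfl le_rfl, S.e_f_wt hy.wt (Nat.zero_le _) le_rfl le_rfl,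
        S.e_f_wt w01 (Nat.zero_le _) le_rfl le_rfl, S.e_f_wt w10 (Nat.zero_le _) le_rfl le_rfl,
        hy.e_zero 1 le_rfl le_rfl]
      simp only [hp, rt, map_zero, zero_add, Pi.sub_apply]
      norm_num [δ]
      have e1 := half_mul hq (μ 1)
      have e2 := half_mul hq (μ 1 + 1)
      rw [show μ 1 + 1 - 1 / 2 = μ 1 + 1 / 2 by ring, show μ 1 + 1 - 1 = μ 1 by ring] at e2
      norm_num at e1 e2
      linear_combination (norm := module)
        (-(qnum hb (μ 1) * qnum hb (μ 1 + 1 / 2)) • e1) • S.f 0 (S.f 1 y) +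
        (-(qnum hb (μ 1) * qnum hb (μ 1 - 1 / 2)) • e2) • S.f 1 (S.f 0 y)
    · have hr : 2 = 0 + 1 ∨ 2 = 0 + 2 := Or.inr rfl
      have h2 := hy.zero 2 le_rfl le_rfl
      have w1 := hy.wt.f hr (k := 1) (by omega) (by omega) (by omega)
      have w2 := hy.wt.f hr (k := 2) (by omega) (by omega) (by omega)
      have w0 := hy.wt.f hr (k := 0) (by omega) (by omega) (by omega)
      have w01 := w1.f hr (k := 0) (by omega) (by omega) (by omega)
      have w02 := w2.f hr (k := 0) (by omega) (by omega) (by omega)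
      have w20 := w0.f hr (k := 2) (by omega) (by omega) (by omega)
      have n10 := fun y => S.e_f_ne 1 0 (by omega) (by omega) le_rfl (by omega) (by omega) y
      have n20 := fun y => S.e_f_ne 2 0 (by omega) (by omega) le_rfl (by omega) (by omega) y
      have n21 := fun y => S.e_f_ne 2 1 (by omega) (by omega) (by omega) (by omega) (by omega) y
      have n12 := fun y => S.e_f_ne 1 2 (by omega) (by omega) (by omega) (by omega) (by omega) y
      have z1 := hy.e_zero 1 le_rfl (by omega)
      have z2 := hy.e_zero 2 (by omega) (by omega)
      have hle : ∀ {z ν}, S.Wt 1 ν z → S.e 1 (S.f 1 z) = _ := fun hz =>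
        S.e_f_wt hz (Nat.zero_le _) le_rfl (by omega)
      have hle2 : ∀ {z ν}, S.Wt 1 ν z → S.e 2 (S.f 2 z) = _ := fun hz =>
        S.e_f_wt hz (Nat.zero_le _) (by omega) le_rfl
      rw [FL_two (Or.inr ⟨rfl, rfl⟩) rfl]
      rcases (by omega : j = 1 ∨ j = 2) with rfl | rfl
      · simp only [map_add, map_sub, map_smul, n10, n12, hle w2, hle w02, hle hy.wt, hle w20, z1]
        simp only [hp, rt, map_zero, zero_add, Pi.sub_apply]
        norm_num [δ, h2]
        module
      · simp only [map_add, map_sub, map_smul, n20, n21, hle2 w0, hle2 w01, hle2 hy.wt, z2]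
        simp only [hp, rt, map_zero, zero_add, Pi.sub_apply]
        norm_num [δ, h2]
        module

/-- By `f_D_D` both sides become f_r f_{c+1} D_c D_c y after multiplication by [2], and the two ends
of the fork commute. Hence φ_{p+1} and φ_p agree on y, and for even P the sums without an inserted
f_0 need only m ≤ p. -/
theorem f_D_f_D_comm (hlo : lo ≤ 1) (hr : r = c + 2) (hy : S.HW 1 μ y) :
    S.f r (S.D c (S.f (c + 1) (S.D c y))) = S.D (c + 1) (S.E (c + 1) y) := by
  have hcar : car c r r (c + 1) = 0 := by unfold car; split_ifs <;> omega
  rw [D_succ, E_top]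
  by_cases hc : 1 ≤ c
  · have hL := hy.levi (by omega) h.or hc
    have h1 := f_D_D hq h.or hlo hc hL (b := c + 1) hc le_rfl (by omega) (by omega)
      (by unfold car; split_ifs <;> omega)
    have h2 := f_D_D hq h.or hlo hc hL (b := r) hc le_rfl (by omega) (by omega)
      (by unfold car; split_ifs <;> omega)
    apply smul_right_injective M hq.qnum_two_ne_zero
    simp only
    rw [← map_smul (S.f r), ← h1, ← map_smul (S.f (c + 1)), ← h2, S.comm r (c + 1) (by omega) (by omega) (by omega)
      (by omega) hcar]
  · obtain rfl : c = 0 := by omega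
    simp only [D_zero]
    exact S.comm r (0 + 1) (by omega) (by omega) (by omega) (by omega) hcar y

/-- The generator e_0 removes the single letter f_0 of each word and multiplies by the weight to its
right. The three words with the same m all become D_m E_m y, with factors [r + 2], [r + 1], [r] for
r = μ_0 − μ_1, and `A_zero` adds them up. -/
theorem e_zero_FL (hlo : lo = 0) (hy : S.HW 0 μ y) :
    S.e 0 (S.FL P (μ 1) y) = qnum hb (μ 0 + μ 1 + P) • S.Phi P y := by
  have hr := h.or
  have hy1 : S.HW 1 μ y := ⟨hy.wt.mono (by omega), fun j h1 h2 => hy.e_zero j (by omega) h2,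
    hy.f_zero, hy.zero⟩
  have he0 := hy.e_zero 0 le_rfl (by omega)
  have heD : ∀ m, m ≤ c + 1 → ∀ z, S.e 0 (S.D m z) = S.D m (S.e 0 z) := by
    intro m hm z
    apply S.e_W (by omega) (by omega)
    intro k hk
    rw [mem_down] at hk
    omega
  have heE : ∀ m, m ≤ c + 1 → ∀ z, S.e 0 (S.E m z) = S.E m (S.e 0 z) := by
    intro m hm z
    apply S.e_W (by omega) (by omega)
    intro k hk
    simp only [List.mem_append, List.mem_cons, mem_up, mem_down] at hk
    omega
  have hwE : ∀ m, 1 ≤ m → m ≤ c + 1 → S.Wt 0 (μ - δ 1 - δ (m + 1)) (S.E m y) :=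
    fun m hm hmc => hy.wt.E hr (by omega) (by omega) hm hmc
  have h1 : ∀ m ∈ Finset.Icc 1 (c + 1), A1 hb P (μ 1) m • S.e 0 (S.f 0 (S.D m (S.E m y))) +
      B2 hb P (μ 1) m • S.e 0 (S.D m (S.f 0 (S.E m y))) +
      A3 hb P (μ 1) m • S.e 0 (S.D m (S.E m (S.f 0 y))) =
      qnum hb (μ 0 + μ 1 + P) • (A0 hb P m • S.D m (S.E m y)) := by
    intro m hm
    rw [Finset.mem_Icc] at hm
    rw [S.e_f_wt ((hwE m hm.1 hm.2).D hr (by omega) (by omega) hm.2) (by omega) le_rfl (by omega),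
      heD m hm.2, heD m hm.2, heD m hm.2, heE m hm.2, heE m hm.2, he0,
      S.e_f_wt (hwE m hm.1 hm.2) (by omega) le_rfl (by omega),
      S.e_f_wt hy.wt (by omega) le_rfl (by omega), heE m hm.2, he0]
    have := A_zero hq (P := P) (μ 1) (μ 0 - μ 1) hm.1
    rw [show μ 0 - μ 1 + 2 * μ 1 + P = μ 0 + μ 1 + P by ring] at this
    simp only [map_zero, map_smul, zero_add, hp, δ, Pi.add_apply, Pi.sub_apply, if_pos (Nat.zero_le c)]
    have hm0 : m ≠ 0 := by omega
    simp [hm0]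
    rw [show μ 0 - (μ 1 - 1 - 1) = μ 0 - μ 1 + 2 by ring, show μ 0 - (μ 1 - 1) = μ 0 - μ 1 + 1 by ring]
    linear_combination (norm := module) this • S.D m (S.E m y)
  rw [FL_eq S h hlo, Phi_eq S h, Finset.smul_sum, ← Finset.sum_congr rfl h1]
  by_cases hr2 : r = c + 2
  · rw [if_pos hr2]
    have hlast : S.e 0 (S.f r (S.D c (S.f 0 (S.f (c + 1) (S.D c y))))) =
        S.e 0 (S.D (c + 1) (S.f 0 (S.E (c + 1) y))) := by
      have hw := (hy.wt.D hr (by omega) (by omega) (b := c) (by omega)).f hr (by omega) (k := c + 1)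
        (by omega) (by omega)
      have hcar : hp c r (μ - δ 1 + δ (c + 1) - rt c (c + 1)) 0 =
          hp c r (μ - δ 1 - δ (c + 1 + 1)) 0 := by
        simp [hp, rt, δ]
      rw [heD _ le_rfl, S.e_f_wt (hwE (c + 1) (by omega) le_rfl) (by omega) le_rfl (by omega),
        heE _ le_rfl, he0, S.e_f_ne 0 r (by omega) (by omega) (by omega) (by omega) (by omega),
        heD c (by omega), S.e_f_wt hw (by omega) le_rfl (by omega),
        S.e_f_ne 0 (c + 1) (by omega) (by omega) (by omega) (by omega) (by omega),
        heD c (by omega), he0]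
      simp only [map_zero, map_smul, zero_add]
      rw [f_D_f_D_comm hq h (by omega) hr2 hy1, hcar]
    -- The extra word has just been shown to give the same vector as the term m = c + 1; together
    -- they carry the generic coefficient.
    have hB := two_mul_A2 h hb (μ 1) hr2 (m := c + 1) le_rfl
    simp only [map_add, map_sum, map_smul, hlast]
    simp only [Finset.sum_add_distrib]
    rw [add_assoc (∑ i ∈ Finset.Icc 1 (c + 1), A1 hb P (μ 1) i • S.e 0 (S.f 0 (S.D i (S.E i y))))]
    congr 2
    rw [Finset.sum_Icc_succ_top (by omega), Finset.sum_Icc_succ_top (by omega), add_assoc,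
      ← add_smul, hB]
    congr 1
    refine Finset.sum_congr rfl fun m hm => ?_
    rw [Finset.mem_Icc] at hm
    rw [A2_eq_B2 h hb _ (by omega)]
  · rw [if_neg hr2]
    simp only [map_add, map_sum, map_smul, add_zero]
    simp only [Finset.sum_add_distrib]
    congr 2
    refine Finset.sum_congr rfl fun m hm => ?_
    rw [A2_eq_B2 h hb _ (by omega)]

end

end QSys

/-! ### From U_q(so(N)) to systems of operators. -/

theorem qfact_zero (hb : ℂ) : qfact hb 0 = 1 := by simp [qfact]

theorem qfact_one (hb : ℂ) : qfact hb 1 = qnum hb 1 := by simp [qfact]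

theorem qfact_two (hb : ℂ) : qfact hb 2 = qnum hb 1 * qnum hb 2 := by
  norm_num [qfact, Finset.prod_range_succ]

theorem serre_eq_comm {A : Type} [Ring A] [Algebra ℂ A] {hb : ℂ} (hq : Generic hb) {N : ℕ}
    {a b : Fin (N / 2)} (h1 : ip (simpleRoot N a) (simpleRoot N a) = 1 ∨
      ip (simpleRoot N a) (simpleRoot N a) = 2)
    (h2 : ip (simpleRoot N a) (simpleRoot N b) = 0) (x y : A) :
    serre hb N a b x y = x * y - y * x := by
  unfold serre
  rw [h2]
  generalize hv : hb * (ip (simpleRoot N a) (simpleRoot N a) : ℂ) / 2 = v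
  have h3 : qfact v 1 ≠ 0 := by
    have hm : ∃ m : ℕ, 0 < m ∧ v = hb * ((m : ℂ) / 2) := by
      rcases h1 with h1 | h1 <;> rw [h1] at hv <;> subst hv
      · exact ⟨1, by norm_num, by push_cast; ring⟩
      · exact ⟨2, by norm_num, by push_cast; ring⟩
    obtain ⟨m, hm, rfl⟩ := hm
    have h4 := hq.sub_ne_zero hm
    have h5 : ∀ z, qpow (hb * ((m : ℂ) / 2)) z = qpow hb ((m : ℂ) / 2 * z) := fun z => by
      unfold qpow; ring_nf
    rw [qfact_one]
    apply div_ne_zero <;> rw [h5, h5, mul_neg, mul_one] <;> exact h4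
  simp [Finset.sum_range_succ, qbinom, qfact_zero, div_self h3]
  abel

theorem serre_eq_cubic {A : Type} [Ring A] [Algebra ℂ A] {hb : ℂ} (hq : Generic hb) {N : ℕ}
    {a b : Fin (N / 2)} (h1 : ip (simpleRoot N a) (simpleRoot N a) = 2)
    (h2 : ip (simpleRoot N a) (simpleRoot N b) = -1) (x y : A) :
    serre hb N a b x y = x * x * y - qnum hb 2 • (x * y * x) + y * (x * x) := by
  have h3 := hq.qnum_two_ne_zero
  unfold serre
  rw [h2, h1]
  have h4 : (1 - 2 * -1 / 2 : ℤ).toNat = 2 := rfl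
  have h5 : hb * ((2 : ℤ) : ℂ) / 2 = hb := by push_cast; ring
  simp only [h4, h5]
  norm_num [Finset.sum_range_succ, qbinom, qfact_zero, qfact_one, qfact_two, hq.qnum_one, div_self h3,
    pow_two]
  rw [sub_eq_add_neg]

theorem map_serre {A B : Type} [Ring A] [Algebra ℂ A] [Ring B] [Algebra ℂ B] (φ : A →ₐ[ℂ] B)
    (hb : ℂ) (N : ℕ) (a b : Fin (N / 2)) (x y : A) :
    φ (serre hb N a b x y) = serre hb N a b (φ x) (φ y) := by
  unfold serre
  simp only [map_sum, map_smul, map_mul, map_pow]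

section Relations

variable (hb : ℂ) (N : ℕ)

theorem gen_t_mul_tinv (a : Fin (N / 2)) : gen hb (Gen.t a) * gen hb (Gen.tinv a) = 1 := by
  simpa [gen] using RingQuot.mkAlgHom_rel (S := ℂ) (Rel.t_tinv (hb := hb) a)

theorem gen_tinv_mul_t (a : Fin (N / 2)) : gen hb (Gen.tinv a) * gen hb (Gen.t a) = 1 := by
  simpa [gen] using RingQuot.mkAlgHom_rel (S := ℂ) (Rel.tinv_t (hb := hb) a)

theorem gen_t_mul_f (a b : Fin (N / 2)) : gen hb (Gen.t a) * gen hb (Gen.f b) =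
    qpow hb (-ip (simpleRoot N a) (simpleRoot N b)) • (gen hb (Gen.f b) * gen hb (Gen.t a)) := by
  simpa [gen] using RingQuot.mkAlgHom_rel (S := ℂ) (Rel.t_f (hb := hb) a b)

theorem gen_tinv_mul_f (a b : Fin (N / 2)) : gen hb (Gen.tinv a) * gen hb (Gen.f b) =
    qpow hb (ip (simpleRoot N a) (simpleRoot N b)) • (gen hb (Gen.f b) * gen hb (Gen.tinv a)) := by
  have h := gen_t_mul_f hb N a b
  have h1 : gen hb (Gen.f b) = qpow hb (-ip (simpleRoot N a) (simpleRoot N b)) •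
      (gen hb (Gen.tinv a) * gen hb (Gen.f b) * gen hb (Gen.t a)) := by
    rw [mul_assoc, ← mul_smul_comm, ← h, ← mul_assoc, gen_tinv_mul_t, one_mul]
  nth_rewrite 2 [h1]
  rw [smul_mul_assoc, mul_assoc _ (gen hb (Gen.t a)), gen_t_mul_tinv, mul_one, smul_smul,
    ← qpow_add, add_neg_cancel, qpow_zero, one_smul]

theorem gen_e_mul_f (a : Fin (N / 2)) : gen hb (Gen.e a) * gen hb (Gen.f a) =
    gen hb (Gen.f a) * gen hb (Gen.e a) +
      (qpow hb 1 - qpow hb (-1))⁻¹ • (gen hb (Gen.t a) - gen hb (Gen.tinv a)) := by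
  have := RingQuot.mkAlgHom_rel (S := ℂ) (Rel.e_f (hb := hb) a)
  simp only [map_sub, map_mul, map_smul] at this
  rw [gen, gen, gen, gen, ← this]
  abel

theorem gen_e_mul_f_ne {a b : Fin (N / 2)} (h : a ≠ b) :
    gen hb (Gen.e a) * gen hb (Gen.f b) = gen hb (Gen.f b) * gen hb (Gen.e a) := by
  simpa [gen] using RingQuot.mkAlgHom_rel (S := ℂ) (Rel.e_f_ne (hb := hb) a b h)

theorem serre_gen_f {a b : Fin (N / 2)} (h : a ≠ b) :
    serre hb N a b (gen hb (Gen.f a)) (gen hb (Gen.f b)) = 0 := by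
  have := RingQuot.mkAlgHom_rel (S := ℂ) (Rel.serre_f (hb := hb) a b h)
  rwa [map_serre, map_zero] at this

end Relations

/-- The image in `U_q` of the generator of type `G` at the `k`-th simple root, zero if there is
no such root. -/
def genAt (hb : ℂ) (N : ℕ) (G : Fin (N / 2) → Gen N) (k : ℕ) : Uq hb N :=
  if h : 1 ≤ k ∧ k ≤ N / 2 then gen hb (G ⟨k - 1, by omega⟩) else 0

theorem genAt_eq {hb : ℂ} {N : ℕ} {G : Fin (N / 2) → Gen N} {k : ℕ} (h1 : 1 ≤ k)
    (h2 : k ≤ N / 2) : genAt hb N G k = gen hb (G ⟨k - 1, by omega⟩) :=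
  dif_pos ⟨h1, h2⟩

theorem fAt_eq_genAt (hb : ℂ) (N k : ℕ) : fAt hb N k = genAt hb N Gen.f k := rfl

theorem genAt_succ {hb : ℂ} {N : ℕ} (G : Fin (N / 2) → Gen N) (a : Fin (N / 2)) :
    genAt hb N G (a + 1) = gen hb (G a) :=
  genAt_eq (Nat.le_add_left _ _) a.2

theorem simpleRoot_mk {N k : ℕ} (h1 : 1 ≤ k) (h2 : k - 1 < N / 2) :
    simpleRoot N ⟨k - 1, h2⟩ = simpleRootAt N k := by
  unfold simpleRoot
  rw [show ((⟨k - 1, h2⟩ : Fin (N / 2)) : ℕ) + 1 = k from Nat.sub_add_cancel h1]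

theorem IsDim.ip_mk {N c r j k : ℕ} (h : IsDim N c r) (hj : 1 ≤ j) (hjr : j ≤ r) (hk : 1 ≤ k)
    (hkr : k ≤ r) (h1 : j - 1 < N / 2) (h2 : k - 1 < N / 2) :
    ip (simpleRoot N ⟨j - 1, h1⟩) (simpleRoot N ⟨k - 1, h2⟩) = car c r j k := by
  rw [simpleRoot_mk hj, simpleRoot_mk hk, ip_simpleRootAt h hj hjr hk hkr]

theorem car_add (l c r j k : ℕ) : car (l + c) (l + r) (l + j) (l + k) = car c r j k := by
  unfold car
  split_ifs <;> omega

theorem hp_add_left (l c r : ℕ) (μ : ℕ → ℂ) (k : ℕ) :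
    hp (l + c) (l + r) μ (l + k) = hp c r (fun i => μ (l + i)) k := by
  unfold hp
  simp only [add_le_add_iff_left, add_assoc, add_right_inj]

theorem car_self_eq (c r j : ℕ) : car c r j j = 1 ∨ car c r j j = 2 := by
  unfold car
  split_ifs <;> omega

/-- The operators of the generators at the simple roots `α_{l+lo}, α_{l+lo+1}, ...` on a module over
`U_q`. -/
def uqSys {hb : ℂ} (hq : Generic hb) {N l c r lo : ℕ} (h : IsDim N (l + c) (l + r))
    (hlo : 1 ≤ l + lo) (M : Type) [AddCommGroup M] [Module ℂ M] [Module (Uq hb N) M]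
    [IsScalarTower ℂ (Uq hb N) M] : QSys hb c r lo M where
  e k := Algebra.lsmul ℂ ℂ M (genAt hb N Gen.e (l + k))
  f k := Algebra.lsmul ℂ ℂ M (fAt hb N (l + k))
  t k := Algebra.lsmul ℂ ℂ M (genAt hb N Gen.t (l + k))
  ti k := Algebra.lsmul ℂ ℂ M (genAt hb N Gen.tinv (l + k))
  t_f j k h1 h2 h3 h4 y := by
    have hN := h.half
    simp only [Algebra.lsmul_coe, fAt_eq_genAt]
    rw [genAt_eq (by omega) (by omega), genAt_eq (by omega) (by omega), ← mul_smul,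
      gen_t_mul_f, h.ip_mk (by omega) (by omega) (by omega) (by omega), car_add, smul_assoc,
      mul_smul]
  ti_f j k h1 h2 h3 h4 y := by
    have hN := h.half
    simp only [Algebra.lsmul_coe, fAt_eq_genAt]
    rw [genAt_eq (by omega) (by omega), genAt_eq (by omega) (by omega), ← mul_smul,
      gen_tinv_mul_f, h.ip_mk (by omega) (by omega) (by omega) (by omega), car_add, smul_assoc,
      mul_smul]
  e_f j h1 h2 y := by
    have hN := h.half
    simp only [Algebra.lsmul_coe, fAt_eq_genAt]
    rw [genAt_eq (by omega) (by omega), genAt_eq (by omega) (by omega),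
      genAt_eq (by omega) (by omega), genAt_eq (by omega) (by omega), ← mul_smul,
      gen_e_mul_f, add_smul, mul_smul, smul_assoc, sub_smul]
  e_f_ne j k h1 h2 h3 h4 hjk y := by
    have hN := h.half
    simp only [Algebra.lsmul_coe, fAt_eq_genAt]
    rw [genAt_eq (by omega) (by omega), genAt_eq (by omega) (by omega), ← mul_smul,
      gen_e_mul_f_ne, mul_smul]
    simp only [ne_eq, Fin.mk.injEq]
    omega
  comm j k h1 h2 h3 h4 hjk y := by
    have hN := h.half
    simp only [Algebra.lsmul_coe, fAt_eq_genAt]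
    rw [genAt_eq (by omega) (by omega), genAt_eq (by omega) (by omega), ← mul_smul, ← mul_smul]
    congr 1
    have hne : j ≠ k := by
      rintro rfl
      rcases car_self_eq c r j with h' | h' <;> omega
    rw [← sub_eq_zero, ← serre_eq_comm hq, serre_gen_f]
    · simp only [ne_eq, Fin.mk.injEq]
      omega
    · rw [h.ip_mk (by omega) (by omega) (by omega) (by omega)]
      exact car_self_eq _ _ _
    · rw [h.ip_mk (by omega) (by omega) (by omega) (by omega), car_add, hjk]
  serre j k h1 h2 h3 h4 hjj hjk y := by
    have hN := h.half
    simp only [Algebra.lsmul_coe, fAt_eq_genAt]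
    rw [genAt_eq (by omega) (by omega), genAt_eq (by omega) (by omega)]
    simp only [← mul_smul]
    have hne : j ≠ k := by
      rintro rfl
      omega
    rw [← smul_assoc, ← sub_smul, ← add_smul, ← mul_assoc, ← mul_assoc, ← serre_eq_cubic hq,
      serre_gen_f, zero_smul]
    · simp only [ne_eq, Fin.mk.injEq]
      omega
    · rw [h.ip_mk (by omega) (by omega) (by omega) (by omega), car_add, hjj]
    · rw [h.ip_mk (by omega) (by omega) (by omega) (by omega), car_add, hjk]

section

variable {hb : ℂ} (hq : Generic hb) {N l c r lo : ℕ} (h : IsDim N (l + c) (l + r))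
  (hlo : 1 ≤ l + lo) (M : Type) [AddCommGroup M] [Module ℂ M] [Module (Uq hb N) M]
  [IsScalarTower ℂ (Uq hb N) M]

theorem uqSys_W (L : List ℕ) (y : M) : (uqSys hq h hlo M).W L y = word hb N l L • y := by
  induction L with
  | nil => simp [word, QSys.W]
  | cons a L ih =>
    rw [QSys.W_cons, ih]
    exact (mul_smul _ _ _).symm

theorem uqSys_Phi (P : ℕ) (lam : Fin (N / 2) → ℂ) (y : M) :
    (uqSys hq h hlo M).Phi P y = fRoot hb N l P lam 0 • y := by
  unfold QSys.Phi fRoot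
  simp only [uqSys_W, Finset.sum_smul, smul_assoc]

theorem uqSys_FL (P : ℕ) (lam : Fin (N / 2) → ℂ) (y : M) :
    (uqSys hq h hlo M).FL P (coord lam (l + 1)) y = fRoot hb N l P lam 1 • y := by
  unfold QSys.FL fRoot
  simp only [uqSys_W, Finset.sum_smul, smul_assoc, add_smul]

end

theorem QSys.Wt.add {hb : ℂ} {c r lo : ℕ} {M : Type} [AddCommGroup M] [Module ℂ M]
    {S : QSys hb c r lo M} {a : ℕ} {μ : ℕ → ℂ} {y z : M} (hy : S.Wt a μ y) (hz : S.Wt a μ z) :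
    S.Wt a μ (y + z) := fun j h1 h2 => by
  rw [map_add, map_add, (hy j h1 h2).1, (hz j h1 h2).1, (hy j h1 h2).2, (hz j h1 h2).2, smul_add,
    smul_add]
  exact ⟨rfl, rfl⟩

theorem QSys.Wt.smul {hb : ℂ} {c r lo : ℕ} {M : Type} [AddCommGroup M] [Module ℂ M]
    {S : QSys hb c r lo M} {a : ℕ} {μ : ℕ → ℂ} {y : M} (hy : S.Wt a μ y) (z : ℂ) :
    S.Wt a μ (z • y) := fun j h1 h2 => by
  rw [map_smul, map_smul, (hy j h1 h2).1, (hy j h1 h2).2, smul_comm z, smul_comm z]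
  exact ⟨rfl, rfl⟩

theorem QSys.Wt.zero {hb : ℂ} {c r lo : ℕ} {M : Type} [AddCommGroup M] [Module ℂ M]
    {S : QSys hb c r lo M} {a : ℕ} {μ : ℕ → ℂ} : S.Wt a μ 0 := fun j h1 h2 => by simp

theorem QSys.Wt.sum {hb : ℂ} {c r lo : ℕ} {M : Type} [AddCommGroup M] [Module ℂ M]
    {S : QSys hb c r lo M} {a : ℕ} {μ : ℕ → ℂ} {s : Finset ℕ} {y : ℕ → M}
    (hy : ∀ i ∈ s, S.Wt a μ (y i)) : S.Wt a μ (∑ i ∈ s, y i) := by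
  induction s using Finset.induction_on with
  | empty => exact QSys.Wt.zero
  | insert i s hi ih =>
    rw [Finset.sum_insert hi]
    exact (hy i (by simp)).add (ih fun j hj => hy j (by simp [hj]))

theorem one_le_of_mem_phi {P m k : ℕ} (hP : 1 ≤ P) (hm : 1 ≤ m) (h : k ∈ phi P m) : 1 ≤ k := by
  unfold phi at h
  dsimp only at h
  split_ifs at h with h1 h2 h3 <;>
    simp only [List.mem_append, List.mem_cons, mem_up, mem_down, List.not_mem_nil, or_false] at h
  · omega
  · omega
  · omega
  · rw [Nat.not_odd_iff_even] at h1
    obtain ⟨a, ha⟩ := h1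
    omega

theorem word_mem {hb : ℂ} {N l : ℕ} (S : Subalgebra ℂ (Uq hb N)) {L : List ℕ}
    (h : ∀ k ∈ L, fAt hb N (l + k) ∈ S) : word hb N l L ∈ S := by
  apply Subalgebra.list_prod_mem
  intro x hx
  rw [List.mem_map] at hx
  obtain ⟨k, hk, rfl⟩ := hx
  exact h k hk

theorem fRoot_mem {hb : ℂ} {N l P : ℕ} (hP : 1 ≤ P) (lam : Fin (N / 2) → ℂ)
    (S : Subalgebra ℂ (Uq hb N)) {d : ℕ} (hd : d ≤ l)
    (h : ∀ k, l + 1 ≤ k + d → fAt hb N k ∈ S) : fRoot hb N l P lam d ∈ S := by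
  induction d using Nat.twoStepInduction with
  | zero =>
    unfold fRoot
    refine Subalgebra.sum_mem _ fun m hm => Subalgebra.smul_mem _ (word_mem S fun k hk => h _ ?_) _
    have := one_le_of_mem_phi hP (Finset.mem_Icc.1 hm).1 hk
    omega
  | one =>
    unfold fRoot
    refine Subalgebra.add_mem _ (Subalgebra.add_mem _ ?_ ?_) ?_ <;>
    refine Subalgebra.sum_mem _ fun m hm => Subalgebra.smul_mem _ (word_mem S fun k hk => h _ ?_) _ <;>
    omega
  | more d _ ih =>
    have h1 := ih (by omega) fun k hk => h k (by omega)
    have h2 := h (l + 1 - (d + 2)) (by omega)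
    unfold fRoot
    exact Subalgebra.sub_mem _ (Subalgebra.smul_mem _ (Subalgebra.mul_mem _ h2 h1) _)
      (Subalgebra.smul_mem _ (Subalgebra.mul_mem _ h1 h2) _)

/-- Only letters f_k with k ≥ l + 1 − d occur in `fRoot d`. This is applied to e_j and f_j with j so
small that they commute with all of these letters. -/
theorem commute_fRoot {hb : ℂ} {N l P : ℕ} (hP : 1 ≤ P) (lam : Fin (N / 2) → ℂ) {d : ℕ} (hd : d ≤ l)
    {z : Uq hb N} (h : ∀ k, l + 1 ≤ k + d → fAt hb N k * z = z * fAt hb N k) :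
    z * fRoot hb N l P lam d = fRoot hb N l P lam d * z := by
  have := fRoot_mem hP lam (Subalgebra.centralizer ℂ {z}) hd fun k hk => by
    rw [Subalgebra.mem_centralizer_iff]
    rintro g rfl
    exact (h k hk).symm
  rw [Subalgebra.mem_centralizer_iff] at this
  exact this z rfl

/-! ### The elements of weight −ε_k − ε_{l+1} under all generators. -/

section

variable {hb : ℂ} (hq : Generic hb) {N l c r : ℕ} (h : IsDim N (l + c) (l + r))
  (M : Type) [AddCommGroup M] [Module ℂ M] [Module (Uq hb N) M] [IsScalarTower ℂ (Uq hb N) M]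

/-- The operators of all generators. -/
def allSys : QSys hb (l + c) (l + r) 1 M :=
  uqSys hq (l := 0) (by simpa using h) (by norm_num) M

variable {M}

theorem allSys_e (k : ℕ) (y : M) : (allSys hq h M).e k y = genAt hb N Gen.e k • y := by
  simp [allSys, uqSys]

theorem allSys_f (k : ℕ) (y : M) : (allSys hq h M).f k y = fAt hb N k • y := by
  simp [allSys, uqSys]

theorem allSys_t (k : ℕ) (y : M) : (allSys hq h M).t k y = genAt hb N Gen.t k • y := by
  simp [allSys, uqSys]

theorem allSys_ti (k : ℕ) (y : M) : (allSys hq h M).ti k y = genAt hb N Gen.tinv k • y := by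
  simp [allSys, uqSys]

theorem uqSys_e {lo : ℕ} (hlo : 1 ≤ l + lo) (k : ℕ) (y : M) :
    (uqSys hq h hlo M).e k y = genAt hb N Gen.e (l + k) • y := rfl

theorem uqSys_f {lo : ℕ} (hlo : 1 ≤ l + lo) (k : ℕ) (y : M) :
    (uqSys hq h hlo M).f k y = fAt hb N (l + k) • y := rfl

/-- `y` is a highest weight vector of weight `μ` for the simple roots `α_a, α_{a+1}, ...`, and it is
killed by the generators `f_α` of `so(P)`. -/
structure IsHW (a : ℕ) (μ : ℕ → ℂ) (y : M) : Prop where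
  wt : (allSys hq h M).Wt a μ y
  e_zero : ∀ j, a ≤ j → j ≤ l + r → genAt hb N Gen.e j • y = 0
  f_zero : 1 ≤ c → ∀ j, l + 2 ≤ j → j ≤ l + r → fAt hb N j • y = 0
  zero : ∀ i, l + 2 ≤ i → i ≤ l + r → μ i = 0

variable {hq h}

theorem Wt_local {lo a b : ℕ} {μ : ℕ → ℂ} {y : M} (hy : (allSys hq h M).Wt a μ y)
    (hlo : 1 ≤ l + lo) (hab : a ≤ l + b) :
    (uqSys hq h hlo M).Wt b (fun i => μ (l + i)) y := by
  intro j h1 h2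
  have := hy (l + j) (by omega) (by omega)
  rwa [allSys_t, allSys_ti, hp_add_left] at this

theorem IsHW.local {lo a b : ℕ} {μ : ℕ → ℂ} {y : M} (hy : IsHW hq h a μ y) (hlo : 1 ≤ l + lo)
    (hab : a ≤ l + b) : (uqSys hq h hlo M).HW b (fun i => μ (l + i)) y :=
  ⟨Wt_local hy.wt hlo hab, fun j h1 h2 => hy.e_zero (l + j) (by omega) (by omega),
    fun hc j h1 h2 => hy.f_zero hc (l + j) (by omega) (by omega),
    fun i h1 h2 => hy.zero (l + i) (by omega) (by omega)⟩

theorem IsHW.mono {a b : ℕ} {μ : ℕ → ℂ} {y : M} (hy : IsHW hq h a μ y) (hab : a ≤ b) :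
    IsHW hq h b μ y :=
  ⟨hy.wt.mono hab, fun j h1 h2 => hy.e_zero j (by omega) h2, hy.f_zero, hy.zero⟩

include hq h in
theorem e_smul_f_smul {j k : ℕ} (hj : 1 ≤ j) (hjr : j ≤ l + r) (hk : 1 ≤ k) (hkr : k ≤ l + r)
    (hjk : j ≠ k) (y : M) :
    genAt hb N Gen.e j • fAt hb N k • y = fAt hb N k • genAt hb N Gen.e j • y := by
  have := (allSys hq h M).e_f_ne j k hj hjr hk hkr hjk y
  rwa [allSys_e, allSys_e, allSys_f, allSys_f] at this

include hq h in
theorem f_smul_f_smul {j k : ℕ} (hj : 1 ≤ j) (hjr : j ≤ l + r) (hk : 1 ≤ k) (hkr : k ≤ l + r)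
    (hjk : car (l + c) (l + r) j k = 0) (y : M) :
    fAt hb N j • fAt hb N k • y = fAt hb N k • fAt hb N j • y := by
  have := (allSys hq h M).comm j k hj hjr hk hkr hjk y
  rwa [allSys_f, allSys_f, allSys_f, allSys_f] at this

theorem e_smul_f_smul_self {a j : ℕ} {μ : ℕ → ℂ} {y : M} (hy : (allSys hq h M).Wt a μ y)
    (ha : 1 ≤ a) (hj : a ≤ j) (hjr : j ≤ l + r) :
    genAt hb N Gen.e j • fAt hb N j • y =
      fAt hb N j • genAt hb N Gen.e j • y + qnum hb (hp (l + c) (l + r) μ j) • y := by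
  have := (allSys hq h M).e_f_wt hy ha hj hjr
  rwa [allSys_f, allSys_e, allSys_e, allSys_f] at this

theorem Wt_f_smul {a k : ℕ} {μ : ℕ → ℂ} {y : M} (hy : (allSys hq h M).Wt a μ y)
    (hr : r = c + 1 ∨ r = c + 2) (ha : 1 ≤ a) (hk : 1 ≤ k) (hkr : k ≤ l + r) :
    (allSys hq h M).Wt a (μ - rt (l + c) k) (fAt hb N k • y) := by
  have := hy.f (k := k) (by omega) ha hk hkr
  rwa [allSys_f] at this

theorem IsHW.f_smul {a : ℕ} {μ : ℕ → ℂ} {y : M} (hy : IsHW hq h (a + 1) μ y)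
    (hr : r = c + 1 ∨ r = c + 2) (ha : 1 ≤ a) (hal : a ≤ l) :
    IsHW hq h (a + 1) (μ - δ a + δ (a + 1)) (fAt hb N a • y) := by
  refine ⟨(Wt_f_smul hy.wt hr (by omega) ha (by omega)).congr ?_, fun j h1 h2 => ?_,
    fun hc j h1 h2 => ?_, fun i h1 h2 => ?_⟩
  · intro j _ _
    rw [rt, if_pos (by omega)]
    congr 1
    abel
  · rw [e_smul_f_smul (hq := hq) (h := h) (by omega) h2 ha (by omega) (by omega),
      hy.e_zero j h1 h2, smul_zero]
  · rw [f_smul_f_smul (hq := hq) (h := h) (by omega) h2 ha (by omega)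
      (by unfold car; split_ifs <;> omega), hy.f_zero hc j h1 h2, smul_zero]
  · simp only [δ, Pi.add_apply, Pi.sub_apply]
    rw [hy.zero i h1 h2, if_neg (by omega), if_neg (by omega)]
    ring

theorem Wt_D {lo a b : ℕ} {μ : ℕ → ℂ} {y : M} (hy : (allSys hq h M).Wt a μ y)
    (hr : r = c + 1 ∨ r = c + 2) (ha : 1 ≤ a) (hlo : 1 ≤ l + lo) (hb' : b ≤ c + 1) :
    (allSys hq h M).Wt a (μ - δ (l + 1) + δ (l + b + 1)) ((uqSys hq h hlo M).D b y) := by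
  induction b with
  | zero => rw [QSys.D_zero]; simpa using hy
  | succ b ih =>
    rw [QSys.D_succ, uqSys_f]
    refine (Wt_f_smul (ih (by omega)) hr ha (by omega) (by omega)).congr ?_
    intro j _ _
    rw [rt, if_pos (by omega)]
    congr 1
    simp only [← add_assoc]
    abel

theorem Wt_E {lo a m : ℕ} {μ : ℕ → ℂ} {y : M} (hy : (allSys hq h M).Wt a μ y)
    (hr : r = c + 1 ∨ r = c + 2) (ha : 1 ≤ a) (hlo : 1 ≤ l + lo) (hm : 1 ≤ m) (hmc : m ≤ c + 1) :
    (allSys hq h M).Wt a (μ - δ (l + 1) - δ (l + m + 1)) ((uqSys hq h hlo M).E m y) := by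
  obtain ⟨i, hi⟩ : ∃ i, m + i = c + 1 := ⟨c + 1 - m, by omega⟩
  induction i generalizing m with
  | zero =>
    obtain rfl : m = c + 1 := by omega
    rw [QSys.E_top, uqSys_f]
    refine (Wt_f_smul (Wt_D hy hr ha hlo (by omega)) hr ha (by omega) (by omega)).congr ?_
    intro j h1 h2
    have := hp_top (c := l + c) (r := l + r) (j := j) (by omega) h2
    simp only [hp_sub, hp_add, ← add_assoc] at this ⊢
    linear_combination this
  | succ i ih =>
    rw [QSys.E_eq _ (by omega), uqSys_f]
    refine (Wt_f_smul (ih (m := m + 1) (by omega) (by omega) (by omega)) hr ha (by omega)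
      (by omega)).congr ?_
    intro j h1 h2
    rw [rt, if_pos (by omega)]
    congr 1
    simp only [← add_assoc]
    abel

theorem fRoot_add_two_smul {P : ℕ} (lam : Fin (N / 2) → ℂ) {d k : ℕ} (hk : k + (d + 1) = l)
    (y : M) : fRoot hb N l P lam (d + 2) • y =
      qnum hb (coord lam (k + 1) + coord lam (l + 1) + P + d + 1) •
        (fAt hb N k • fRoot hb N l P lam (d + 1) • y) -
      qnum hb (coord lam (k + 1) + coord lam (l + 1) + P + d) •
        (fRoot hb N l P lam (d + 1) • fAt hb N k • y) := by
  have h1 : l + 1 - (d + 2) = k := by omega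
  have h2 : (l : ℂ) - k = d + 1 := by rw [← hk]; push_cast; ring
  rw [fRoot]
  simp only [h1, add_sub_assoc, h2]
  rw [sub_smul, smul_assoc, smul_assoc, mul_smul, mul_smul]
  ring_nf

theorem Wt_fRoot {P : ℕ} (hP : IsRank P c r) (lam : Fin (N / 2) → ℂ) {a d : ℕ} {μ : ℕ → ℂ} {y : M}
    (hy : (allSys hq h M).Wt a μ y) (ha : 1 ≤ a) (hd : d ≤ l) :
    (allSys hq h M).Wt a (μ - δ (l + 1 - d) - δ (l + 1)) (fRoot hb N l P lam d • y) := by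
  have hr := hP.or
  induction d using Nat.twoStepInduction generalizing μ y with
  | zero =>
    rw [← uqSys_Phi hq h (lo := 1) (by omega), QSys.Phi_eq _ hP]
    refine QSys.Wt.sum fun m hm => QSys.Wt.smul ?_ _
    rw [Finset.mem_Icc] at hm
    refine (Wt_D (Wt_E hy hr ha _ hm.1 hm.2) hr ha _ hm.2).congr ?_
    intro j _ _
    congr 1
    rw [Nat.sub_zero]
    abel
  | one =>
    rw [← uqSys_FL hq h (lo := 0) (by omega), QSys.FL_eq _ hP rfl]
    have h0 : ∀ {ν : ℕ → ℂ} {z : M}, (allSys hq h M).Wt a ν z →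
        (allSys hq h M).Wt a (ν - δ l + δ (l + 1))
          ((uqSys hq h (lo := 0) (by omega) M).f 0 z) := fun hz => by
      refine (Wt_f_smul hz hr ha (k := l + 0) (by omega) (by omega)).congr ?_
      intro j _ _
      rw [rt, if_pos (by omega)]
      congr 1
      simp only [add_zero]
      abel
    refine (QSys.Wt.add (QSys.Wt.add ?_ ?_) ?_).add ?_
    · refine QSys.Wt.sum fun m hm => QSys.Wt.smul ?_ _
      rw [Finset.mem_Icc] at hm
      refine (h0 (Wt_D (Wt_E hy hr ha _ hm.1 hm.2) hr ha _ hm.2)).congr ?_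
      intro j _ _
      congr 1
      rw [Nat.add_sub_cancel]
      abel
    · refine QSys.Wt.sum fun m hm => QSys.Wt.smul ?_ _
      rw [Finset.mem_Icc] at hm
      refine (Wt_D (h0 (Wt_E hy hr ha _ hm.1 hm.2)) hr ha _ hm.2).congr ?_
      intro j _ _
      congr 1
      rw [Nat.add_sub_cancel]
      abel
    · split_ifs with h2
      · refine QSys.Wt.smul ?_ _
        refine (Wt_f_smul (Wt_D (h0 (Wt_f_smul (Wt_D hy hr ha _ (b := c) (by omega)) hr ha
          (k := l + (c + 1)) (by omega) (by omega))) hr ha _ (b := c) (by omega)) hr ha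
          (k := l + r) (by omega) (by omega)).congr ?_
        intro j h3 h4
        have := hp_top (c := l + c) (r := l + r) (j := j) (by omega) h4
        rw [Nat.add_sub_cancel, rt, if_pos (by omega)]
        simp only [hp_sub, hp_add, ← add_assoc] at this ⊢
        linear_combination this
      · exact QSys.Wt.zero
    · refine QSys.Wt.sum fun m hm => QSys.Wt.smul ?_ _
      rw [Finset.mem_Icc] at hm
      refine (Wt_D (Wt_E (h0 hy) hr ha _ hm.1 hm.2) hr ha _ hm.2).congr ?_
      intro j _ _
      congr 1
      rw [Nat.add_sub_cancel]
      abel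
  | more d _ ih =>
    have h0 : ∀ {ν : ℕ → ℂ} {z : M}, (allSys hq h M).Wt a ν z →
        (allSys hq h M).Wt a (ν - δ (l + 1 - (d + 2)) + δ (l + 1 - (d + 1)))
          (fAt hb N (l + 1 - (d + 2)) • z) := fun hz => by
      refine (Wt_f_smul hz hr ha (by omega) (by omega)).congr ?_
      intro j _ _
      rw [rt, if_pos (by omega), show l + 1 - (d + 2) + 1 = l + 1 - (d + 1) by omega]
      congr 1
      abel
    rw [fRoot_add_two_smul lam (k := l + 1 - (d + 2)) (by omega),
      sub_eq_add_neg (_ • _), ← neg_smul]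
    refine QSys.Wt.add (QSys.Wt.smul ?_ _) (QSys.Wt.smul ?_ _)
    · refine (h0 (ih hy (by omega))).congr ?_
      intro j _ _
      congr 1
      abel
    · refine (ih (h0 hy) (by omega)).congr ?_
      intro j _ _
      congr 1
      abel

end

section

variable {hb : ℂ} {hq : Generic hb} {N l c r : ℕ} {h : IsDim N (l + c) (l + r)}
  {M : Type} [AddCommGroup M] [Module ℂ M] [Module (Uq hb N) M] [IsScalarTower ℂ (Uq hb N) M]

include hq h in
theorem e_smul_fRoot_smul_comm {P : ℕ} (hP : IsRank P c r) (lam : Fin (N / 2) → ℂ) {d j : ℕ}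
    (hd : d ≤ l) (hj : 1 ≤ j) (hjd : j + d ≤ l) (y : M) :
    genAt hb N Gen.e j • fRoot hb N l P lam d • y =
      fRoot hb N l P lam d • genAt hb N Gen.e j • y := by
  have hr := hP.or
  have hN := h.half
  rw [← mul_smul, ← mul_smul, commute_fRoot (by rcases hP with hP | hP <;> omega) lam hd]
  intro k hk
  by_cases hkr : k ≤ l + r
  · rw [fAt_eq_genAt, genAt_eq (by omega) (by omega), genAt_eq (by omega) (by omega),
      gen_e_mul_f_ne]
    simp only [ne_eq, Fin.mk.injEq]
    omega
  · rw [fAt, dif_neg (by omega), zero_mul, mul_zero]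

include hq h in
theorem f_smul_fRoot_smul_comm {P : ℕ} (hP : IsRank P c r) (lam : Fin (N / 2) → ℂ) {d j : ℕ}
    (hd : d ≤ l) (hj : 1 ≤ j) (hjd : j + d + 1 ≤ l) (y : M) :
    fAt hb N j • fRoot hb N l P lam d • y = fRoot hb N l P lam d • fAt hb N j • y := by
  have hr := hP.or
  have hN := h.half
  rw [← mul_smul, ← mul_smul, commute_fRoot (by rcases hP with hP | hP <;> omega) lam hd]
  intro k hk
  by_cases hkr : k ≤ l + r
  · have := f_smul_f_smul (hq := hq) (h := h) (M := Uq hb N) (j := k) (k := j) (by omega) (by omega)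
      (by omega) (by omega) (by unfold car; split_ifs <;> omega) 1
    simpa using this
  · rw [fAt, dif_neg (by omega), zero_mul, mul_zero]

/-- Both claims are proved together, for any highest weight vector whose weight agrees with λ on the
coordinates from l + 1 − d to l + 1. This freedom is needed because the recursion also applies F to
f_{α_k} y, whose weight is changed at k and k + 1. Under e_{k+1} the two terms of the recursion
become multiples of the same vector f_{α_k} F′ y, with F′ the element before F, and the products of
q-numbers cancel. Under e_k both give F y, and `Generic.qnum_mul_sub_mul` evaluates the difference.
-/
theorem e_fRoot_succ {P : ℕ} (hP : IsRank P c r) (lam : Fin (N / 2) → ℂ) {d : ℕ} (hd : d + 1 ≤ l) :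
    (∀ (μ : ℕ → ℂ) (y : M), (∀ i, l + 1 - d ≤ i → i ≤ l + 1 → μ i = coord lam i) →
      IsHW hq h (l + 1 - d) μ y → ∀ j, l + 1 - d ≤ j → j ≤ l + r →
        genAt hb N Gen.e j • fRoot hb N l P lam (d + 1) • y = 0) ∧
    (∀ (μ : ℕ → ℂ) (y : M), (∀ i, l + 1 - d ≤ i → i ≤ l + 1 → μ i = coord lam i) →
      IsHW hq h (l - d) μ y → genAt hb N Gen.e (l - d) • fRoot hb N l P lam (d + 1) • y =
        qnum hb (μ (l - d) + coord lam (l + 1) + P + d) • fRoot hb N l P lam d • y) := by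
  have hr := hP.or
  induction d with
  | zero =>
    refine ⟨fun μ y hμ hy j h1 h2 => ?_, fun μ y hμ hy => ?_⟩
    · rw [← uqSys_FL hq h (lo := 0) (by omega)]
      have h3 := QSys.e_FL hq hP rfl (hy.local (lo := 0) (b := 1) (by omega) (by omega))
        (j := j - l) (by omega) (by omega)
      rw [hμ (l + 1) (by omega) le_rfl, uqSys_e, show l + (j - l) = j by omega] at h3
      exact h3
    · rw [← uqSys_FL hq h (lo := 0) (by omega), ← uqSys_Phi hq h (lo := 0) (by omega)]
      have h3 := QSys.e_zero_FL hq hP rfl (hy.local (lo := 0) (b := 0) (by omega) (by omega))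
      rw [hμ (l + 1) (by omega) le_rfl, uqSys_e] at h3
      rw [Nat.cast_zero, add_zero]
      exact h3
  | succ d ih =>
    obtain ⟨ih1, ih2⟩ := ih (by omega)
    obtain ⟨k, hk⟩ : ∃ k, k + (d + 1) = l := ⟨l - (d + 1), by omega⟩
    have hk1 : 1 ≤ k := by omega
    rw [show l + 1 - (d + 1) = k + 1 by omega, show l - (d + 1) = k by omega]
    rw [show l + 1 - d = k + 2 by omega] at ih1 ih2
    rw [show l - d = k + 1 by omega] at ih2
    refine ⟨fun μ y hμ hy j h1 h2 => ?_, fun μ y hμ hy => ?_⟩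
    · have hy' := hy.f_smul hr hk1 (by omega)
      have hμ' : ∀ i, k + 2 ≤ i → i ≤ l + 1 → (μ - δ k + δ (k + 1)) i = coord lam i := by
        intro i h3 h4
        simp only [δ, Pi.add_apply, Pi.sub_apply]
        rw [if_neg (by omega), if_neg (by omega), hμ i (by omega) h4]
        ring
      rw [fRoot_add_two_smul lam hk, smul_sub, smul_comm _ (qnum hb _), smul_comm _ (qnum hb _),
        e_smul_f_smul (hq := hq) (h := h) (by omega) h2 hk1 (by omega) (by omega)]
      rcases Nat.lt_or_ge (k + 1) j with h3 | h3
      · rw [ih1 μ y (fun i h3 => hμ i (by omega)) (hy.mono (by omega)) j (by omega) h2,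
          ih1 _ _ hμ' (hy'.mono (by omega)) j (by omega) h2]
        simp
      · obtain rfl : j = k + 1 := by omega
        rw [ih2 μ y (fun i h3 => hμ i (by omega)) hy, ih2 _ _ hμ' hy', smul_comm _ (qnum hb _),
          -- The element F′ contains no neighbour of α_k, so f_{α_k} can be pulled through it.
          f_smul_fRoot_smul_comm (hq := hq) (h := h) hP lam (by omega) hk1 (by omega),
          hμ (k + 1) le_rfl (by omega)]
        simp only [δ, Pi.add_apply, Pi.sub_apply, if_true]
        rw [if_neg (by omega), hμ (k + 1) le_rfl (by omega), sub_zero,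
          show coord lam (k + 1) + 1 + coord lam (l + 1) + P + d =
            coord lam (k + 1) + coord lam (l + 1) + P + d + 1 by ring, sub_eq_zero]
        exact smul_comm _ _ _
    · have hw := Wt_fRoot hP lam hy.wt hk1 (d := d + 1) (by omega)
      rw [fRoot_add_two_smul lam hk, smul_sub, smul_comm _ (qnum hb _), smul_comm _ (qnum hb _),
        e_smul_f_smul_self hw hk1 le_rfl (by omega),
        e_smul_fRoot_smul_comm (hq := hq) (h := h) hP lam (by omega) hk1 (by omega),
        e_smul_fRoot_smul_comm (hq := hq) (h := h) hP lam (by omega) hk1 (by omega),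
        hy.e_zero k le_rfl (by omega), e_smul_f_smul_self hy.wt hk1 le_rfl (by omega),
        hy.e_zero k le_rfl (by omega)]
      have h3 : hp (l + c) (l + r) (μ - δ (l + 1 - (d + 1)) - δ (l + 1)) k = μ k - μ (k + 1) + 1 := by
        unfold hp
        rw [if_pos (by omega), show l + 1 - (d + 1) = k + 1 by omega]
        simp only [δ, Pi.sub_apply, if_true]
        rw [if_neg (by omega), if_neg (by omega), if_neg (by omega)]
        ring
      have h4 : hp (l + c) (l + r) μ k = μ k - μ (k + 1) := by
        unfold hp
        rw [if_pos (by omega)]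
      rw [h3, h4]
      rw [smul_zero, smul_zero, zero_add, zero_add,
        smul_comm (fRoot hb N l P lam (d + 1)), smul_smul, smul_smul, ← sub_smul, hμ (k + 1) le_rfl (by omega)]
      congr 1
      have := hq.qnum_mul_sub_mul (coord lam (k + 1) + coord lam (l + 1) + P + d + 1)
        (μ k - coord lam (k + 1))
      rw [show coord lam (k + 1) + coord lam (l + 1) + P + d + 1 - 1 =
        coord lam (k + 1) + coord lam (l + 1) + P + d by ring] at this
      rw [this]
      push_cast
      ring_nf

end

/-! ### The e_j, including e_1, on the remaining coefficients of the singular vector. -/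

namespace QSys

section

variable {hb : ℂ} {c r lo : ℕ} {M : Type} [AddCommGroup M] [Module ℂ M] {S : QSys hb c r lo M}

/-- `e_{b+1} D_{b+1} y` for a highest weight vector `y` of weight `μ`. -/
def DX (S : QSys hb c r lo M) (x : ℂ) (b : ℕ) (y : M) : M :=
  if b = 0 then qnum hb x • y else S.D b y

variable {y : M} {μ : ℕ → ℂ} (hq : Generic hb) (hr : r = c + 1 ∨ r = c + 2) (hlo : lo ≤ 1)
  (hy : S.HW 1 μ y)
include hq hr hlo hy

theorem e_D_HW {j b : ℕ} (hj : 1 ≤ j) (hjr : j ≤ r) (hb1 : 1 ≤ b) (hbc : b ≤ c) :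
    S.e j (S.D b y) = if j = b then S.DX (μ 1) (b - 1) y else 0 := by
  have hL := hy.levi (by omega) hr (by omega)
  rcases Nat.lt_or_ge 1 j with h | h
  · rw [e_D hq hr hlo (by omega) hL h hjr hbc, DX]
    by_cases h' : j = b
    · rw [if_pos h', if_pos h', if_neg (by omega)]
    · rw [if_neg h', if_neg h']
  · obtain rfl : j = 1 := by omega
    rw [e_one_D hr hlo hy.wt (hy.e_zero 1 le_rfl (by omega)) hb1 (by omega)]
    by_cases h' : 1 = b
    · subst h'
      rw [if_pos rfl, DX, if_pos rfl, down_nil (by omega), W_nil, hp, if_pos hbc,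
        hy.zero 2 le_rfl (by omega), sub_zero]
    · rw [if_neg h', W_levi_zero hq hr hlo (by omega) hL _ _, smul_zero]
      · obtain ⟨b, rfl⟩ : ∃ i, b = i + 1 := ⟨b - 1, by omega⟩
        rw [down_cons (by omega)]
        simp
      · intro k hk
        rw [mem_down] at hk
        omega

theorem e_E_HW {j m : ℕ} (hj : 1 ≤ j) (hjr : j ≤ r) (hm : 1 ≤ m) (hmc : m ≤ c) :
    S.e j (S.E m y) = if j = m + 1 then S.E (m + 1) y else
      if r = c + 2 ∧ j = r ∧ m = c then S.f (c + 1) (S.D c y) else 0 := by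
  have hc : 1 ≤ c := by omega
  have hL := hy.levi (by omega) hr hc
  rcases Nat.lt_or_ge 1 j with h | h
  · rcases Nat.lt_or_ge c j with h1 | h1
    · rw [e_E_center hq hr hlo hc hL (by omega) hm hmc]
      by_cases h2 : m = c
      · subst h2
        rw [if_pos rfl]
        by_cases h3 : j = m + 1
        · rw [if_pos h3, if_pos h3, E_top]
        · rw [if_neg h3, if_neg h3, if_pos (by omega)]
      · rw [if_neg h2, if_neg (by omega), if_neg (by omega)]
    · rw [e_E hq hr hlo hc hL h h1 hm (by omega)]
      by_cases h3 : j = m + 1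
      · rw [if_pos h3, if_pos h3]
      · rw [if_neg h3, if_neg h3, if_neg (by omega)]
  · obtain rfl : j = 1 := by omega
    rw [e_one_E hq hr hlo hc hy hm, if_neg (by omega), if_neg (by omega)]

theorem e_f_D_HW {j b : ℕ} (hj : 1 ≤ j) (hjr : j ≤ r) (hb' : b = c + 1 ∨ b = r) :
    S.e j (S.f b (S.D c y)) = if j = b then S.DX (μ 1) c y else 0 := by
  rcases Nat.eq_zero_or_pos c with hc | hc
  · subst hc
    rw [D_zero, DX, if_pos rfl]
    by_cases h : j = b
    · subst h
      rw [if_pos rfl, S.e_f_wt hy.wt (by omega) hj hjr, hy.e_zero j hj hjr, map_zero, zero_add]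
      congr 2
      unfold hp
      rw [if_neg (by omega)]
      split_ifs
      · rfl
      · rw [zero_add, hy.zero 2 le_rfl (by omega), sub_zero]
      · rw [zero_add, hy.zero 2 le_rfl (by omega), add_zero]
    · rw [if_neg h, S.e_f_ne j b (by omega) hjr (by omega) (by omega) h, hy.e_zero j hj hjr, map_zero]
  · have hL := hy.levi (by omega) hr hc
    rcases Nat.lt_or_ge 1 j with h | h
    · rw [e_f_D hq hr hlo hc hL h hjr hb', DX, if_neg (show ¬ c = 0 by omega)]
    · obtain rfl : j = 1 := by omega
      rw [if_neg (by omega), S.e_f_ne 1 b (by omega) hjr (by omega) (by omega) (by omega),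
        e_one_D hr hlo hy.wt (hy.e_zero 1 le_rfl (by omega)) hc (by omega), map_smul, ← W_cons,
        W_levi_zero hq hr hlo hc hL (by simp), smul_zero]
      intro k hk
      rw [List.mem_cons, mem_down] at hk
      omega

end

end QSys

/-! ### The coefficients of the singular vector and their equations. -/

section

variable {hb : ℂ} {hq : Generic hb} {N l c r : ℕ} {h : IsDim N (l + c) (l + r)}
  {M : Type} [AddCommGroup M] [Module ℂ M] [Module (Uq hb N) M] [IsScalarTower ℂ (Uq hb N) M]

variable (hq h) in
/-- The operators of the generators at `α_{l+1}, α_{l+2}, ...`. -/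
def locSys (M : Type) [AddCommGroup M] [Module ℂ M] [Module (Uq hb N) M]
    [IsScalarTower ℂ (Uq hb N) M] : QSys hb c r 1 M :=
  uqSys hq h (Nat.le_add_left 1 l) M

theorem locSys_e (k : ℕ) (y : M) : (locSys hq h M).e k y = genAt hb N Gen.e (l + k) • y := rfl

theorem locSys_f (k : ℕ) (y : M) : (locSys hq h M).f k y = fAt hb N (l + k) • y := rfl

theorem e_smul_locSys_W {a : ℕ} (ha : 1 ≤ a) (hal : a ≤ l) {L : List ℕ}
    (hL : ∀ k ∈ L, 1 ≤ k ∧ k ≤ r) (y : M) :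
    genAt hb N Gen.e a • (locSys hq h M).W L y = (locSys hq h M).W L (genAt hb N Gen.e a • y) := by
  have := (locSys hq h M).W_comm (Algebra.lsmul ℂ ℂ M (genAt hb N Gen.e a)) L (fun k hk y => by
    have := hL k hk
    simp only [Algebra.lsmul_coe, locSys_f]
    exact e_smul_f_smul (hq := hq) (h := h) ha (by omega) (by omega) (by omega) (by omega) y) y
  exact this

/-- The coefficient of `f_{ε_{k+1} + ε_{l+1}}` in the singular vector. -/
def chain (hb : ℂ) (l P : ℕ) (μ : ℕ → ℂ) (k : ℕ) : ℂ :=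
  ∏ i ∈ Finset.range k, -(qpow hb 1 * qnum hb (μ (i + 1) + μ (l + 1) + P + l - (i + 1)))

/-- The coefficient of the lower half of the singular vector. -/
def kap (hb : ℂ) (l P : ℕ) (μ : ℕ → ℂ) : ℂ :=
  chain hb l P μ l * qnum hb (μ (l + 1) + (P : ℂ) / 2 - 1)

variable (hq h) in
/-- The coefficients of the singular vector. -/
def sing (P : ℕ) (lam : Fin (N / 2) → ℂ) (v : M) (j : ℕ) : M :=
  -- In the upper half y_{a+1} = −q e_a y_a: each step down to y_{l+1} contributes −q times the
  -- q-number of `e_fRoot_succ`, and the step to y_{l+2} contributes [x + P/2 − 1], which is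
  -- absorbed in `kap`. Beyond the centre the factor is q instead of −q, because of the sign
  -- convention of the natural module. The third branch is the second middle vector for even N, and
  -- the last non-zero coefficient, at j = N − l, is a multiple of v.
  if j ≤ l + 1 then chain hb l P (coord lam) (j - 1) • fRoot hb N l P lam (l + 1 - j) • v
  else if j ≤ l + c + 2 then
    (kap hb l P (coord lam) * (-qpow hb 1) ^ (j - l - 1)) • (locSys hq h M).E (j - l - 1) v
  else if r = c + 2 ∧ j = l + c + 3 then
    (kap hb l P (coord lam) * (-qpow hb 1) ^ (c + 1)) •
      (locSys hq h M).f (c + 1) ((locSys hq h M).D c v)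
  else if j ≤ l + r + c + 2 then
    (kap hb l P (coord lam) * (-qpow hb 1) ^ (c + 1) * qpow hb 1 ^ (j - (l + c + 3))) •
      (locSys hq h M).DX (coord lam (l + 1)) (l + r + c + 2 - j) v
  else 0

variable {P : ℕ} {lam : Fin (N / 2) → ℂ} {v : M}

theorem sing_low {k : ℕ} (hk : k ≤ l) : sing hq h P lam v (k + 1) =
    chain hb l P (coord lam) k • fRoot hb N l P lam (l - k) • v := by
  rw [sing, if_pos (by omega), Nat.add_sub_cancel, Nat.add_sub_add_right]

theorem sing_E {m : ℕ} (hm : 1 ≤ m) (hmc : m ≤ c + 1) : sing hq h P lam v (l + 1 + m) =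
    (kap hb l P (coord lam) * (-qpow hb 1) ^ m) • (locSys hq h M).E m v := by
  rw [sing, if_neg (by omega), if_pos (by omega), show l + 1 + m - l - 1 = m by omega]

theorem sing_alt (hr : r = c + 2) : sing hq h P lam v (l + c + 3) =
    (kap hb l P (coord lam) * (-qpow hb 1) ^ (c + 1)) •
      (locSys hq h M).f (c + 1) ((locSys hq h M).D c v) := by
  rw [sing, if_neg (by omega), if_neg (by omega), if_pos ⟨hr, rfl⟩]

theorem sing_D (hr : r = c + 1 ∨ r = c + 2) {b j : ℕ} (hbc : b ≤ c) (hj : j + b = l + r + c + 2) :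
    sing hq h P lam v j =
    (kap hb l P (coord lam) * (-qpow hb 1) ^ (c + 1) * qpow hb 1 ^ (j - (l + c + 3))) •
      (locSys hq h M).DX (coord lam (l + 1)) b v := by
  rw [sing, if_neg (by omega), if_neg (by omega), if_neg (by omega), if_pos (by omega),
    show l + r + c + 2 - j = b by omega]

theorem sing_zero {j : ℕ} (hj : l + r + c + 2 < j) :
    sing hq h P lam v j = 0 := by
  rw [sing, if_neg (by omega), if_neg (by omega), if_neg (by omega), if_neg (by omega)]

/-- The value of `e_{α_a}` on the coefficients `Y` of a vector in the tensor product that is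
annihilated by `e_{α_a}`. -/
def SingEq (hb : ℂ) (N c r : ℕ) {M : Type} [AddCommGroup M] [Module ℂ M] [Module (Uq hb N) M]
    (Y : ℕ → M) (a j : ℕ) : Prop :=
  genAt hb N Gen.e a • Y j =
    -- The w_j-component of e_a u is (−1)^{ϵ_j} y_k + q^{(α_a, ε_j)} e_a y_j with ε_k = ε_j − α_a.
    -- The exponent is 1 except at the zero weight for odd N. The last two non-trivial branches are
    -- the steps of length 2 made by the end root of even N.
    if j = a ∧ ¬ (r = c + 2 ∧ a = r) then -(qpow hb 1)⁻¹ • Y (j + 1)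
    else if j + a = N ∧ a < r then (qpow hb 1)⁻¹ • Y (j + 1)
    else if r = c + 1 ∧ a = r ∧ j = r + 1 then Y (j + 1)
    else if r = c + 2 ∧ a = r ∧ j + 1 = r then -(qpow hb 1)⁻¹ • Y (j + 2)
    else if r = c + 2 ∧ a = r ∧ j = r then (qpow hb 1)⁻¹ • Y (j + 2)
    else 0

/-- The factor −q[…] in the definition of `chain` is the one by which `e_fRoot_succ` passes from one
element to the next, multiplied by the −q of the equation. The other e_a either commute with the
element and reach v, or annihilate it. -/
theorem singEq_low (hP : IsRank P c r) (hv : IsHW hq h 1 (coord lam) v) {k a : ℕ} (hk : k < l)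
    (ha : 1 ≤ a) (har : a ≤ l + r) : SingEq hb N (l + c) (l + r) (sing hq h P lam v) a (k + 1) := by
  have hr := hP.or
  have hN : N = 2 * l + r + c + 2 := by rcases h with h | h <;> omega
  rw [SingEq, sing_low (by omega), smul_comm]
  have hd := e_fRoot_succ (hq := hq) (h := h) (M := M) hP lam (d := l - k - 1) (by omega)
  rw [show l - k - 1 + 1 = l - k by omega, show l + 1 - (l - k - 1) = k + 2 by omega,
    show l - (l - k - 1) = k + 1 by omega] at hd
  by_cases h1 : k + 1 = a
  · subst h1
    rw [hd.2 (coord lam) v (fun i _ _ => rfl) (hv.mono (by omega))]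
    split_ifs <;> try omega
    rw [sing_low (by omega), chain, chain, Finset.prod_range_succ, show l - (k + 1) = l - k - 1 by omega]
    have hq1 := qpow_ne_zero hb 1
    simp only [smul_smul]
    congr 1
    have h2 : ((l - k - 1 : ℕ) : ℂ) = l - (k + 1) := by
      rw [Nat.sub_sub, Nat.cast_sub (by omega)]
      push_cast
      ring
    rw [h2, show ∀ a b : ℂ, coord lam (k + 1) + a + P + (l - b) = coord lam (k + 1) + a + P + l - b
      from fun a b => by ring]
    generalize Finset.prod (M := ℂ) (Finset.range k) _ = R
    field_simp
  · rcases Nat.lt_or_ge a (k + 1) with h3 | h3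
    · rw [e_smul_fRoot_smul_comm (hq := hq) (h := h) hP lam (by omega) ha (by omega),
        hv.e_zero a ha har, smul_zero, smul_zero]
      split_ifs <;> first | omega | rfl
    · rw [hd.1 (coord lam) v (fun i _ _ => rfl) (hv.mono (by omega)) a (by omega) har, smul_zero]
      split_ifs <;> first | omega | rfl

theorem IsHW.locHW {μ : ℕ → ℂ} {a : ℕ} (hv : IsHW hq h a μ v) (ha : a ≤ l + 1) :
    (locSys hq h M).HW 1 (fun i => μ (l + i)) v :=
  hv.local _ ha

/-- Passage from f_{2ε} to the lower half. For P = 2 both end nodes are attached to w_{l+1}, and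
α_{l+2} leads directly to the second middle vector. -/
theorem singEq_mid (hP : IsRank P c r) (hv : IsHW hq h 1 (coord lam) v) {a : ℕ}
    (ha : 1 ≤ a) (har : a ≤ l + r) : SingEq hb N (l + c) (l + r) (sing hq h P lam v) a (l + 1) := by
  have hr := hP.or
  have hN : N = 2 * l + r + c + 2 := by rcases h with h | h <;> omega
  have hloc := hv.locHW (by omega)
  have hq1 := qpow_ne_zero hb 1
  rw [SingEq, sing_low (by omega), smul_comm, Nat.sub_self]
  rcases Nat.lt_or_ge l a with h1 | h1
  · obtain ⟨b, rfl⟩ : ∃ b, a = l + b := ⟨a - l, by omega⟩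
    rw [← uqSys_Phi hq h (Nat.le_add_left 1 l), ← locSys, ← locSys_e (hq := hq) (h := h)]
    by_cases h2 : b = 1
    · subst h2
      rw [QSys.e_one_Phi hq hP le_rfl hloc]
      split_ifs <;> try omega
      rw [sing_E le_rfl (by omega)]
      simp only [smul_smul]
      congr 1
      rw [kap]
      field_simp
    · by_cases hc : 1 ≤ c
      · rw [QSys.e_Phi_levi_of_pos hq hP le_rfl hc hloc (by omega) (by omega), smul_zero]
        split_ifs <;> first | omega | rfl
      · obtain rfl : b = 2 := by omega
        have h3 : l + 1 + 2 = l + c + 3 := by omega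
        rw [QSys.e_two_Phi hq hP le_rfl (by omega) hloc (by omega)]
        split_ifs <;> try omega
        rw [h3, sing_alt (by omega)]
        obtain rfl : c = 0 := by omega
        simp only [smul_smul, QSys.D_zero]
        congr 1
        rw [kap]
        field_simp
        ring
  · rw [e_smul_fRoot_smul_comm (hq := hq) (h := h) hP lam (by omega) ha (by omega),
      hv.e_zero a ha har, smul_zero, smul_zero]
    split_ifs <;> first | omega | rfl

theorem e_smul_D_of_le (hv : IsHW hq h 1 (coord lam) v) (hr : r = c + 1 ∨ r = c + 2) {a b : ℕ}
    (ha : 1 ≤ a) (hal : a ≤ l) (hbc : b ≤ c) :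
    genAt hb N Gen.e a • (locSys hq h M).D b v = 0 := by
  rw [QSys.D, e_smul_locSys_W ha hal, hv.e_zero a ha (by omega), map_zero]
  intro k hk
  rw [mem_down] at hk
  omega

theorem e_smul_E_of_le (hv : IsHW hq h 1 (coord lam) v) (hr : r = c + 1 ∨ r = c + 2) {a m : ℕ}
    (ha : 1 ≤ a) (hal : a ≤ l) :
    genAt hb N Gen.e a • (locSys hq h M).E m v = 0 := by
  rw [QSys.E, e_smul_locSys_W ha hal, hv.e_zero a ha (by omega), map_zero]
  intro k hk
  simp only [List.mem_append, List.mem_cons, mem_up, mem_down] at hk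
  omega

theorem singEq_E (hP : IsRank P c r) (hv : IsHW hq h 1 (coord lam) v) {a m : ℕ} (hm : 1 ≤ m)
    (hmc : m ≤ c) (ha : 1 ≤ a) (har : a ≤ l + r) :
    SingEq hb N (l + c) (l + r) (sing hq h P lam v) a (l + 1 + m) := by
  have hr := hP.or
  have hN : N = 2 * l + r + c + 2 := by rcases h with h | h <;> omega
  have hloc := hv.locHW (by omega)
  have hq1 := qpow_ne_zero hb 1
  rw [SingEq, sing_E hm (by omega), smul_comm]
  rcases Nat.lt_or_ge l a with h1 | h1
  · obtain ⟨b, rfl⟩ : ∃ b, a = l + b := ⟨a - l, by omega⟩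
    rw [← locSys_e (hq := hq) (h := h), QSys.e_E_HW hq hr le_rfl hloc (by omega) (by omega) hm hmc]
    by_cases h2 : b = m + 1
    · rw [if_pos h2]
      split_ifs <;> try omega
      rw [add_assoc (l + 1), sing_E (by omega) (by omega)]
      simp only [smul_smul]
      congr 1
      field_simp
      ring
    · rw [if_neg h2]
      by_cases h3 : r = c + 2 ∧ b = r ∧ m = c
      · obtain ⟨h4, rfl, rfl⟩ := h3
        rw [if_pos ⟨h4, rfl, rfl⟩]
        split_ifs <;> try omega
        rw [show l + 1 + m + 2 = l + m + 3 by omega, sing_alt h4]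
        simp only [smul_smul]
        congr 1
        field_simp
        ring
      · rw [if_neg h3, smul_zero]
        split_ifs <;> first | omega | rfl
  · rw [e_smul_E_of_le hv hr ha h1, smul_zero]
    split_ifs <;> first | omega | rfl

theorem singEq_E_top (hP : IsRank P c r) (hv : IsHW hq h 1 (coord lam) v) {a : ℕ}
    (ha : 1 ≤ a) (har : a ≤ l + r) :
    SingEq hb N (l + c) (l + r) (sing hq h P lam v) a (l + 1 + (c + 1)) := by
  have hr := hP.or
  have hN : N = 2 * l + r + c + 2 := by rcases h with h | h <;> omega
  have hloc := hv.locHW (by omega)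
  have hq1 := qpow_ne_zero hb 1
  rw [SingEq, sing_E (by omega) le_rfl, smul_comm]
  rcases Nat.lt_or_ge l a with h1 | h1
  · obtain ⟨b, rfl⟩ : ∃ b, a = l + b := ⟨a - l, by omega⟩
    rw [← locSys_e (hq := hq) (h := h), QSys.E_top, QSys.e_f_D_HW hq hr le_rfl hloc (by omega) (by omega) (Or.inr rfl)]
    by_cases h2 : b = r
    · rw [if_pos h2]
      rcases hP.or with hr' | hr'
      · split_ifs <;> try omega
        rw [sing_D hr (b := c) le_rfl (by omega),
          show l + 1 + (c + 1) + 1 - (l + c + 3) = 0 by omega, pow_zero, mul_one]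
      · split_ifs <;> try omega
        rw [sing_D hr (b := c) le_rfl (by omega),
          show l + 1 + (c + 1) + 2 - (l + c + 3) = 1 by omega, pow_one]
        simp only [smul_smul]
        congr 1
        field_simp
    · rw [if_neg h2, smul_zero]
      split_ifs <;> first | omega | rfl
  · rw [e_smul_E_of_le hv hr ha h1, smul_zero]
    split_ifs <;> first | omega | rfl

theorem singEq_alt (hP : IsRank P c r) (hv : IsHW hq h 1 (coord lam) v) {a : ℕ}
    (hr2 : r = c + 2) (ha : 1 ≤ a) (har : a ≤ l + r) :
    SingEq hb N (l + c) (l + r) (sing hq h P lam v) a (l + c + 3) := by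
  have hr := hP.or
  have hN : N = 2 * l + r + c + 2 := by rcases h with h | h <;> omega
  have hloc := hv.locHW (by omega)
  have hq1 := qpow_ne_zero hb 1
  rw [SingEq, sing_alt hr2, smul_comm]
  rcases Nat.lt_or_ge l a with h1 | h1
  · obtain ⟨b, rfl⟩ : ∃ b, a = l + b := ⟨a - l, by omega⟩
    rw [← locSys_e (hq := hq) (h := h), QSys.e_f_D_HW hq hr le_rfl hloc (by omega) (by omega) (Or.inl rfl)]
    by_cases h2 : b = c + 1
    · rw [if_pos h2]
      split_ifs <;> try omega
      rw [sing_D hr (b := c) le_rfl (by omega),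
        show l + c + 3 + 1 - (l + c + 3) = 1 by omega, pow_one]
      simp only [smul_smul]
      congr 1
      field_simp
    · rw [if_neg h2, smul_zero]
      split_ifs <;> first | omega | rfl
  · rw [locSys_f, e_smul_f_smul (hq := hq) (h := h) ha har (by omega) (by omega) (by omega),
      e_smul_D_of_le hv hr ha h1 le_rfl, smul_zero, smul_zero]
    split_ifs <;> first | omega | rfl

theorem singEq_D (hP : IsRank P c r) (hv : IsHW hq h 1 (coord lam) v) {a b j : ℕ}
    (hbc : b ≤ c) (hj : j + b = l + r + c + 2) (ha : 1 ≤ a) (har : a ≤ l + r) :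
    SingEq hb N (l + c) (l + r) (sing hq h P lam v) a j := by
  have hr := hP.or
  have hN : N = 2 * l + r + c + 2 := by rcases h with h | h <;> omega
  have hloc := hv.locHW (by omega)
  have hq1 := qpow_ne_zero hb 1
  rw [SingEq, sing_D hr hbc hj, smul_comm, if_neg (show ¬ (j = a ∧ ¬ (l + r = l + c + 2 ∧ a = l + r)) by omega),
    if_neg (show ¬ (l + r = l + c + 1 ∧ a = l + r ∧ j = l + r + 1) by omega),
    if_neg (show ¬ (l + r = l + c + 2 ∧ a = l + r ∧ j + 1 = l + r) by omega),
    if_neg (show ¬ (l + r = l + c + 2 ∧ a = l + r ∧ j = l + r) by omega), QSys.DX]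
  by_cases hb0 : b = 0
  · rw [if_pos hb0, smul_comm _ (qnum hb _), hv.e_zero a ha har, smul_zero, smul_zero]
    split_ifs
    · rw [sing_zero (by omega), smul_zero]
    · rfl
  · rw [if_neg hb0]
    rcases Nat.lt_or_ge l a with h1 | h1
    · obtain ⟨i, rfl⟩ : ∃ i, a = l + i := ⟨a - l, by omega⟩
      rw [← locSys_e (hq := hq) (h := h), QSys.e_D_HW hq hr le_rfl hloc (by omega) (by omega) (by omega) hbc]
      by_cases h2 : i = b
      · subst h2
        rw [if_pos rfl]
        split_ifs <;> try omega
        rw [sing_D hr (b := i - 1) (by omega) (by omega),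
          show j + 1 - (l + c + 3) = j - (l + c + 3) + 1 by omega, pow_succ (qpow hb 1)]
        simp only [smul_smul]
        congr 1
        field_simp
      · rw [if_neg h2, smul_zero]
        split_ifs <;> first | omega | rfl
    · rw [e_smul_D_of_le hv hr ha h1 hbc, smul_zero]
      split_ifs
      · omega
      · rfl

theorem singEq_sing (hP : IsRank P c r) (hv : IsHW hq h 1 (coord lam) v) {a j : ℕ}
    (ha : 1 ≤ a) (har : a ≤ l + r) (hj : 1 ≤ j) :
    SingEq hb N (l + c) (l + r) (sing hq h P lam v) a j := by
  have hr := hP.or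
  have hN : N = 2 * l + r + c + 2 := by rcases h with h | h <;> omega
  rcases Nat.lt_or_ge l j with h1 | h1
  · rcases Nat.lt_or_ge (l + c + 2) j with h2 | h2
    · by_cases h3 : r = c + 2 ∧ j = l + c + 3
      · rw [h3.2]
        exact singEq_alt hP hv h3.1 ha har
      · rcases Nat.lt_or_ge (l + r + c + 2) j with h4 | h4
        · rw [SingEq, sing_zero h4, sing_zero (by omega), sing_zero (by omega)]
          simp
        · exact singEq_D hP hv (b := l + r + c + 2 - j) (by omega) (by omega) ha har
    · obtain ⟨m, rfl⟩ : ∃ m, j = l + 1 + m := ⟨j - l - 1, by omega⟩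
      rcases Nat.eq_zero_or_pos m with h3 | h3
      · subst h3
        exact singEq_mid hP hv ha har
      · rcases Nat.lt_or_ge c m with h4 | h4
        · obtain rfl : m = c + 1 := by omega
          exact singEq_E_top hP hv ha har
        · exact singEq_E hP hv h3 h4 ha har
  · obtain ⟨k, rfl⟩ : ∃ k, j = k + 1 := ⟨j - 1, by omega⟩
    exact singEq_low hP hv (by omega) ha har

end

/-! ### Components of a vector in the tensor product. -/

section Coefficients

variable {hb : ℂ} {N : ℕ} {M : Type} [AddCommGroup M] [Module ℂ M] [Module (Uq hb N) M]
  [IsScalarTower ℂ (Uq hb N) M]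

/-- The tensor product of the natural representation with a module. -/
abbrev NatTens (N : ℕ) (M : Type) [AddCommGroup M] [Module ℂ M] : Type := (Fin N → ℂ) ⊗[ℂ] M

variable (M) in
/-- The action of a generator on a module. -/
def modAct (x : Gen N) : M →ₗ[ℂ] M := Algebra.lsmul ℂ ℂ M (gen hb x)

variable (M) in
/-- The action of a generator on the tensor product of the natural representation with a
module. -/
def tensAct : Gen N → (NatTens N M →ₗ[ℂ] NatTens N M)
  | Gen.e a => TensorProduct.map (nat hb N (Gen.e a)) LinearMap.id
      + TensorProduct.map (nat hb N (Gen.t a)) (modAct (hb := hb) M (Gen.e a))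
  | Gen.f a => TensorProduct.map (nat hb N (Gen.f a)) (modAct (hb := hb) M (Gen.tinv a))
      + TensorProduct.map LinearMap.id (modAct (hb := hb) M (Gen.f a))
  | Gen.t a => TensorProduct.map (nat hb N (Gen.t a)) (modAct (hb := hb) M (Gen.t a))
  | Gen.tinv a => TensorProduct.map (nat hb N (Gen.tinv a)) (modAct (hb := hb) M (Gen.tinv a))

theorem tact_eq_tensAct {l : ℕ} {lam : Fin (N / 2) → ℂ} (x : Gen N) :
    tact hb N l lam x = tensAct (hb := hb) (Verma hb N l lam) x := by
  cases x <;> rfl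

variable (N M) in
/-- The coefficient `y_i` in the expansion `u = ∑ i, w_i ⊗ y_i`. -/
def coeff (i : ℕ) : NatTens N M →ₗ[ℂ] M :=
  (TensorProduct.lid ℂ M).toLinearMap ∘ₗ
    LinearMap.rTensor M (∑ j : Fin N, w N i j • LinearMap.proj j)

theorem firstCoeff_eq (hb : ℂ) (N l : ℕ) (lam : Fin (N / 2) → ℂ) :
    firstCoeff hb N l lam = coeff N (Verma hb N l lam) 1 := rfl

theorem w_apply_succ (N : ℕ) (i j : Fin N) : w N (i + 1) j = if j = i then 1 else 0 := by
  unfold w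
  simp [Fin.ext_iff]

theorem coeff_tmul (i : Fin N) (x : Fin N → ℂ) (y : M) :
    coeff N M (i + 1) (x ⊗ₜ y) = x i • y := by
  simp [coeff, w_apply_succ]

theorem coeff_one_tmul_w {i j : ℕ} (hi : 1 ≤ i) (hiN : i ≤ N) (y : M) :
    coeff N M i (w N j ⊗ₜ y) = if i = j then y else 0 := by
  obtain ⟨k, rfl⟩ : ∃ k, i = k + 1 := ⟨i - 1, by omega⟩
  have := coeff_tmul (⟨k, by omega⟩ : Fin N) (w N j) y
  simp only at this
  rw [this, w]
  split_ifs <;> simp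

theorem sum_w_tmul_coeff (u : NatTens N M) :
    ∑ i : Fin N, w N (i + 1) ⊗ₜ[ℂ] coeff N M (i + 1) u = u := by
  induction u using TensorProduct.induction_on with
  | zero => simp
  | tmul x y =>
    simp only [coeff_tmul]
    rw [Finset.sum_congr rfl fun i _ => (TensorProduct.smul_tmul (x i) (w N (i + 1)) y).symm,
      ← TensorProduct.sum_tmul]
    congr 1
    ext j
    simp [w_apply_succ, Finset.sum_apply]
  | add u v hu hv =>
    simp only [map_add, TensorProduct.tmul_add, Finset.sum_add_distrib, hu, hv]

theorem eq_zero_of_coeff (u : NatTens N M)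
    (h : ∀ i, 1 ≤ i → i ≤ N → coeff N M i u = 0) : u = 0 := by
  rw [← sum_w_tmul_coeff u]
  exact Finset.sum_eq_zero fun i _ => by
    rw [h _ (Nat.le_add_left _ _) i.2, TensorProduct.tmul_zero]

variable (N) in
/-- The vector with the given coefficients. -/
def ofCoeff (Y : ℕ → M) : NatTens N M := ∑ i : Fin N, w N (i + 1) ⊗ₜ[ℂ] Y (i + 1)

theorem coeff_ofCoeff (Y : ℕ → M) {i : ℕ} (hi : 1 ≤ i) (hiN : i ≤ N) :
    coeff N M i (ofCoeff N Y) = Y i := by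
  obtain ⟨k, rfl⟩ : ∃ k, i = k + 1 := ⟨i - 1, by omega⟩
  rw [ofCoeff, map_sum, Finset.sum_eq_single ⟨k, by omega⟩]
  · rw [coeff_one_tmul_w hi hiN, if_pos rfl]
  · intro j _ hj
    rw [coeff_one_tmul_w hi hiN, if_neg]
    intro h
    exact hj (Fin.ext (by simpa using h.symm))
  · intro h
    exact absurd (Finset.mem_univ _) h

theorem coeff_tensAct_t (a : Fin (N / 2)) (i : Fin N) (u : NatTens N M) :
    coeff N M (i + 1) (tensAct (hb := hb) M (Gen.t a) u) =
      qpow hb (ip (simpleRoot N a) (natWeight N (i + 1))) •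
        gen hb (Gen.t a) • coeff N M (i + 1) u := by
  induction u using TensorProduct.induction_on with
  | zero => simp
  | tmul x y =>
    rw [tensAct, TensorProduct.map_tmul, coeff_tmul, coeff_tmul, nat, natMatrix,
      Matrix.toLin'_apply, Matrix.mulVec_diagonal, modAct, Algebra.lsmul_coe,
      smul_comm _ (x i), smul_smul]
  | add u v hu hv => simp only [map_add, smul_add, hu, hv]

theorem coeff_tensAct_e (a : Fin (N / 2)) (i : Fin N) (u : NatTens N M) :
    coeff N M (i + 1) (tensAct (hb := hb) M (Gen.e a) u) =
      ∑ k : Fin N, (if natWeight N (i + 1) - natWeight N (k + 1) = simpleRoot N a then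
        sgn N (i + 1) else 0) • coeff N M (k + 1) u +
      qpow hb (ip (simpleRoot N a) (natWeight N (i + 1))) •
        gen hb (Gen.e a) • coeff N M (i + 1) u := by
  induction u using TensorProduct.induction_on with
  | zero => simp
  | tmul x y =>
    simp only [tensAct, LinearMap.add_apply, TensorProduct.map_tmul, map_add, coeff_tmul]
    congr 1
    · simp only [nat, natMatrix, Matrix.toLin'_apply, Matrix.mulVec, dotProduct, Matrix.of_apply,
        LinearMap.id_apply, Finset.sum_smul, mul_smul]
    · simp only [nat, natMatrix, Matrix.toLin'_apply, Matrix.mulVec_diagonal, modAct,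
        Algebra.lsmul_coe]
      rw [smul_comm _ (x i), smul_smul]
  | add u v hu hv => simp only [map_add, smul_add, hu, hv, Finset.sum_add_distrib]; abel

end Coefficients

/-- The coordinates of the weight `ε_j`. -/
def natC (N j : ℕ) : ℕ → ℂ := fun k => natZ N j k

theorem hp_natC {N c r : ℕ} (h : IsDim N c r) {k : ℕ} (hk : 1 ≤ k) (hkr : k ≤ r) (j : ℕ) :
    hp c r (natC N j) k = ip (simpleRootAt N k) (natWeight N j) := by
  rw [ip_simpleRootAt_natWeight h hk hkr, hp]
  unfold natC
  split_ifs <;> push_cast <;> rfl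

theorem hp_congr_of_le {c r k : ℕ} {μ ν : ℕ → ℂ} (hr : r = c + 1 ∨ r = c + 2) (hk : 1 ≤ k)
    (h : ∀ i, 1 ≤ i → i ≤ r → μ i = ν i) : hp c r μ k = hp c r ν k := by
  unfold hp
  split_ifs
  · rw [h k hk (by omega), h (k + 1) (by omega) (by omega)]
  · rw [h (c + 1) (by omega) (by omega)]
  · rw [h (c + 1) (by omega) (by omega), h (c + 2) (by omega) (by omega)]
  · rw [h (c + 1) (by omega) (by omega), h (c + 2) (by omega) (by omega)]

theorem pair_natWeight_left {N c r : ℕ} (h : IsDim N c r) {k : ℕ} (hk : 1 ≤ k) (hkr : k ≤ r)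
    (lam : Fin (N / 2) → ℂ) (j : ℕ) :
    pair (fun i => lam i - (natWeight N j i : ℂ)) (simpleRootAt N k) =
      hp c r (coord lam) k - hp c r (natC N j) k := by
  rw [← pair_simpleRootAt h hk hkr, hp_natC h hk hkr]
  unfold pair ip
  push_cast
  rw [← Finset.sum_sub_distrib]
  refine Finset.sum_congr rfl fun i _ => ?_
  ring

section Wt

variable {hb : ℂ} {hq : Generic hb} {N l c r : ℕ} {h : IsDim N (l + c) (l + r)}
  {M : Type} [AddCommGroup M] [Module ℂ M] [Module (Uq hb N) M] [IsScalarTower ℂ (Uq hb N) M]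
  {P : ℕ} {lam : Fin (N / 2) → ℂ} {v : M}

theorem wt_sing (hP : IsRank P c r) (hv : IsHW hq h 1 (coord lam) v) {j : ℕ}
    (hj : 1 ≤ j) : (allSys hq h M).Wt 1 (coord lam - natC N (l + 1) - natC N j)
      (sing hq h P lam v j) := by
  have hr := hP.or
  have hN : N = 2 * l + r + c + 2 := by rcases h with h | h <;> omega
  have hcong : ∀ {ν : ℕ → ℂ} {z : M}, (allSys hq h M).Wt 1 ν z →
      (∀ i, 1 ≤ i → i ≤ l + r → ν i = coord lam i - δ (l + 1) i - natC N j i) →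
      (allSys hq h M).Wt 1 (coord lam - natC N (l + 1) - natC N j) z := fun hz hν => by
    refine hz.congr fun k h1 h2 => hp_congr_of_le (by omega) h1 fun i h3 h4 => ?_
    rw [hν i h3 h4, Pi.sub_apply, Pi.sub_apply]
    congr 2
    unfold δ natC natZ
    split_ifs <;> first | omega | simp
  rw [sing]
  split_ifs with h1 h2 h3 h4
  · refine hcong ((Wt_fRoot hP lam hv.wt le_rfl (d := l + 1 - j) (by omega)).smul _) ?_
    intro i h5 h6
    rw [show l + 1 - (l + 1 - j) = j by omega]
    simp only [δ, natC, natZ, Pi.sub_apply]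
    split_ifs <;> first | omega | (push_cast; ring)
  · refine hcong ((Wt_E hv.wt hr le_rfl _ (m := j - l - 1) (by omega) (by omega)).smul _) ?_
    intro i h5 h6
    rw [show l + (j - l - 1) + 1 = j by omega]
    simp only [δ, natC, natZ, Pi.sub_apply]
    split_ifs <;> first | omega | (push_cast; ring)
  · refine hcong ((Wt_f_smul (Wt_D hv.wt hr le_rfl _ (b := c) (by omega)) hr le_rfl
      (k := l + (c + 1)) (by omega) (by omega)).smul _) ?_
    intro i h5 h6
    rw [rt, if_pos (by omega)]
    simp only [δ, natC, natZ, Pi.sub_apply, Pi.add_apply]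
    split_ifs <;> first | omega | (push_cast; ring)
  · rw [QSys.DX]
    split_ifs with h5
    · refine hcong ((hv.wt.smul _).smul _) ?_
      intro i h6 h7
      simp only [δ, natC, natZ]
      split_ifs <;> first | omega | (push_cast; ring)
    · refine hcong ((Wt_D hv.wt hr le_rfl _ (b := l + r + c + 2 - j) (by omega)).smul _) ?_
      intro i h6 h7
      simp only [δ, natC, natZ, Pi.sub_apply, Pi.add_apply]
      split_ifs <;> first | omega | (push_cast; ring)
  · exact QSys.Wt.zero

end Wt

/-! ### The canonical generator as a highest weight vector. -/

section Vacuum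

variable {hb : ℂ} {N l : ℕ} {lam : Fin (N / 2) → ℂ}

theorem smul_vacuum_eq_zero {x : Uq hb N} (hx : x ∈ vermaIdeal hb N l lam) :
    x • vacuum hb N l lam = 0 := by
  rw [vacuum, ← Submodule.Quotient.mk_smul, Submodule.Quotient.mk_eq_zero]
  simpa using hx

theorem gen_e_smul_vacuum (a : Fin (N / 2)) : gen hb (Gen.e a) • vacuum hb N l lam = 0 :=
  smul_vacuum_eq_zero (Submodule.subset_span (Or.inl (Or.inl ⟨a, rfl⟩)))

theorem gen_t_smul_vacuum (a : Fin (N / 2)) : gen hb (Gen.t a) • vacuum hb N l lam =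
    qpow hb (pair lam (simpleRoot N a)) • vacuum hb N l lam := by
  have := smul_vacuum_eq_zero (lam := lam) (l := l) (x := gen hb (Gen.t a) -
    algebraMap ℂ (Uq hb N) (qpow hb (pair lam (simpleRoot N a))))
    (Submodule.subset_span (Or.inl (Or.inr ⟨a, rfl⟩)))
  rwa [sub_smul, sub_eq_zero, algebraMap_smul] at this

theorem gen_tinv_smul_of_gen_t_smul {M : Type} [AddCommGroup M] [Module ℂ M]
    [Module (Uq hb N) M] [IsScalarTower ℂ (Uq hb N) M] {a : Fin (N / 2)} {x : ℂ} {v : M}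
    (h : gen hb (Gen.t a) • v = qpow hb x • v) : gen hb (Gen.tinv a) • v = qpow hb (-x) • v := by
  have h1 : v = qpow hb (-x) • gen hb (Gen.t a) • v := by
    rw [h, smul_smul, ← qpow_add, neg_add_cancel, qpow_zero, one_smul]
  nth_rewrite 1 [h1]
  rw [smul_comm, ← mul_smul, gen_tinv_mul_t, one_smul]

theorem gen_tinv_smul_vacuum (a : Fin (N / 2)) : gen hb (Gen.tinv a) • vacuum hb N l lam =
    qpow hb (-pair lam (simpleRoot N a)) • vacuum hb N l lam :=
  gen_tinv_smul_of_gen_t_smul (gen_t_smul_vacuum a)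

theorem gen_f_smul_vacuum {a : Fin (N / 2)} (ha : IsLevi N l a) :
    gen hb (Gen.f a) • vacuum hb N l lam = 0 :=
  smul_vacuum_eq_zero (Submodule.subset_span (Or.inr ⟨a, ha, rfl⟩))

theorem isHW_vacuum {hq : Generic hb} {c r : ℕ} {h : IsDim N (l + c) (l + r)}
    (hlam : ∀ i, l + 2 ≤ i → i ≤ N / 2 → coord lam i = 0) :
    IsHW hq h 1 (coord lam) (vacuum hb N l lam) := by
  have hN := h.half
  refine ⟨fun j h1 h2 => ?_, fun j h1 h2 => ?_, fun hc j h1 h2 => ?_, fun i h1 h2 => ?_⟩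
  · rw [allSys_t, allSys_ti, genAt_eq h1 (by omega), genAt_eq h1 (by omega), gen_t_smul_vacuum,
      gen_tinv_smul_vacuum, simpleRoot_mk h1, pair_simpleRootAt h h1 h2]
    exact ⟨rfl, rfl⟩
  · rw [genAt_eq h1 (by omega), gen_e_smul_vacuum]
  · rw [fAt_eq_genAt, genAt_eq (by omega) (by omega)]
    exact gen_f_smul_vacuum (isLevi_of_lt h (by omega) (by simp only; omega))
  · exact hlam i h1 (by omega)

end Vacuum

/-! ### The equations for singular vectors, and uniqueness. -/

section Singular

variable {hb : ℂ} {N l c r : ℕ} {lam : Fin (N / 2) → ℂ} 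

theorem sum_ite_index {M : Type*} [AddCommGroup M] [Module ℂ M] {N : ℕ} {p : ℕ → Prop}
    [DecidablePred p] (s : ℂ) (Y : ℕ → M) {i : ℕ} (hi : 1 ≤ i) (hiN : i ≤ N)
    (hp : ∀ k, 1 ≤ k → k ≤ N → (p k ↔ k = i)) :
    ∑ k : Fin N, (if p (k + 1) then s else 0) • Y (k + 1) = s • Y i := by
  rw [Finset.sum_eq_single ⟨i - 1, by omega⟩]
  · simp only
    rw [show i - 1 + 1 = i by omega, if_pos ((hp i hi hiN).2 rfl)]
  · intro k _ hk
    rw [if_neg, zero_smul]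
    intro hk'
    have := (hp (k + 1) (Nat.le_add_left _ _) k.2).1 hk'
    exact hk (Fin.ext (by simp only; omega))
  · intro h
    exact absurd (Finset.mem_univ _) h

-- For each a and j at most one k satisfies ε_j − ε_k = α_a, so the sum over k has at most one
-- non-zero term, and the equation can be solved for e_a y_j.
open Classical in
theorem singEq_iff (h : IsDim N c r) {M : Type} [AddCommGroup M] [Module ℂ M]
    [Module (Uq hb N) M] (Y : ℕ → M) {a j : ℕ} (ha : 1 ≤ a) (har : a ≤ r) (hj : 1 ≤ j)
    (hjN : j ≤ N) : SingEq hb N c r Y a j ↔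
      ∑ k : Fin N, (if rootPair N a j (k + 1) then sgn N j else 0) • Y (k + 1) +
        qpow hb (ip (simpleRootAt N a) (natWeight N j)) • genAt hb N Gen.e a • Y j = 0 := by
  have hq1 := qpow_ne_zero hb 1
  have hr : r = c + 1 ∨ r = c + 2 := by rcases h with h | h <;> omega
  have hhalf := h.half
  have hip := ip_simpleRootAt_natWeight h ha har j
  have hNr : N = r + c + 2 := by rcases h with h | h <;> omega
  have hev : Even N ↔ r = c + 2 := by
    rw [Nat.even_iff]
    omega
  have hq0 := qpow_ne_zero hb (ip (simpleRootAt N a) (natWeight N j) : ℂ)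
  unfold natZ at hip
  have key : ∀ (i : ℕ) (s : ℂ), 1 ≤ i → i ≤ N →
      (∀ k, 1 ≤ k → k ≤ N → (rootPair N a j k ↔ k = i)) →
      qpow hb (ip (simpleRootAt N a) (natWeight N j)) * s = -sgn N j →
      (genAt hb N Gen.e a • Y j = s • Y i ↔
      ∑ k : Fin N, (if rootPair N a j (k + 1) then sgn N j else 0) • Y (k + 1) +
        qpow hb (ip (simpleRootAt N a) (natWeight N j)) • genAt hb N Gen.e a • Y j = 0) := by
    intro i s hi hiN hp hs
    rw [sum_ite_index (sgn N j) Y hi hiN hp, ← neg_neg (sgn N j), ← hs, neg_smul, mul_smul,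
      neg_add_eq_sub, ← smul_sub, smul_eq_zero, sub_eq_zero, or_iff_right hq0]
  rw [SingEq]
  split_ifs with h1 h2 h3 h4 h5
  · have h6 : ip (simpleRootAt N a) (natWeight N j) = 1 := by
      rw [hip]
      split_ifs <;> omega
    refine key _ _ (by omega) (by omega) (fun k _ _ => ?_) ?_
    · simp only [rootPair, hev, hhalf]
      split_ifs <;> omega
    · rw [h6, sgn]
      split_ifs <;> first | omega | (push_cast; field_simp)
  · have h6 : ip (simpleRootAt N a) (natWeight N j) = 1 := by
      rw [hip]
      split_ifs <;> omega
    refine key _ _ (by omega) (by omega) (fun k _ _ => ?_) ?_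
    · simp only [rootPair, hev, hhalf]
      split_ifs <;> omega
    · rw [h6, sgn]
      split_ifs <;> first | omega | (push_cast; field_simp)
  · have h6 : ip (simpleRootAt N a) (natWeight N j) = 0 := by
      rw [hip]
      split_ifs <;> omega
    rw [← one_smul ℂ (Y (j + 1))]
    refine key _ _ (by omega) (by omega) (fun k _ _ => ?_) ?_
    · simp only [rootPair, hev, hhalf]
      split_ifs <;> omega
    · rw [h6, sgn]
      split_ifs <;> first | omega | (push_cast; rw [qpow_zero]; ring)
  · have h6 : ip (simpleRootAt N a) (natWeight N j) = 1 := by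
      rw [hip]
      split_ifs <;> omega
    refine key _ _ (by omega) (by omega) (fun k _ _ => ?_) ?_
    · simp only [rootPair, hev, hhalf]
      split_ifs <;> omega
    · rw [h6, sgn]
      split_ifs <;> first | omega | (push_cast; field_simp)
  · have h6 : ip (simpleRootAt N a) (natWeight N j) = 1 := by
      rw [hip]
      split_ifs <;> omega
    refine key _ _ (by omega) (by omega) (fun k _ _ => ?_) ?_
    · simp only [rootPair, hev, hhalf]
      split_ifs <;> omega
    · rw [h6, sgn]
      split_ifs <;> first | omega | (push_cast; field_simp)
  · rw [Finset.sum_eq_zero, zero_add, smul_eq_zero_iff_right hq0]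
    intro k _
    have hk := k.2
    rw [if_neg, zero_smul]
    simp only [rootPair, hev, hhalf]
    split_ifs <;> omega

theorem tact_e_eq_zero_iff (h : IsDim N c r) (hN : 3 ≤ N) {u : Tens hb N l lam} :
    (∀ a, tact hb N l lam (Gen.e a) u = 0) ↔
      ∀ a j, 1 ≤ a → a ≤ r → 1 ≤ j → j ≤ N →
        SingEq hb N c r (fun i => coeff N (Verma hb N l lam) i u) a j := by
  classical
  have hhalf := h.half
  have key : ∀ a j (ha : 1 ≤ a) (har : a ≤ r) (hj : 1 ≤ j) (hjN : j ≤ N),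
      SingEq hb N c r (fun i => coeff N (Verma hb N l lam) i u) a j ↔
        coeff N (Verma hb N l lam) j (tact hb N l lam (Gen.e ⟨a - 1, by omega⟩) u) = 0 := by
    intro a j ha har hj hjN
    rw [singEq_iff h _ ha har hj hjN, tact_eq_tensAct]
    have := coeff_tensAct_e (hb := hb) (M := Verma hb N l lam) ⟨a - 1, by omega⟩ (⟨j - 1, by omega⟩ : Fin N) u
    rw [simpleRoot_mk ha] at this
    simp only [Nat.sub_add_cancel hj] at this
    rw [this, genAt_eq ha (by omega)]
    simp only [natWeight_sub_eq_iff ha (by omega) hN hj hjN (Nat.le_add_left 1 _) (Fin.is_lt _)]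
  constructor
  · intro hu a j ha har hj hjN
    rw [key a j ha har hj hjN, hu, map_zero]
  · intro hu a
    refine eq_zero_of_coeff _ fun j hj hjN => ?_
    exact (key (a + 1) j (Nat.le_add_left 1 _) (by have := a.2; omega) hj hjN).1
      (hu _ _ (Nat.le_add_left 1 _) (by have := a.2; omega) hj hjN)

/-- Each y_k with k > 1 occurs, with a non-zero factor, on the right of the equation of some earlier
y_j. Since that y_j vanishes by induction, so does y_k. -/
theorem eq_zero_of_singEq (h : IsDim N c r) {M : Type} [AddCommGroup M] [Module ℂ M]
    [Module (Uq hb N) M] {Y : ℕ → M} (hc : 1 ≤ r)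
    (hY : ∀ a j, 1 ≤ a → a ≤ r → 1 ≤ j → j ≤ N → SingEq hb N c r Y a j) (h1 : Y 1 = 0) {k : ℕ}
    (hk : 1 ≤ k) (hkN : k ≤ N) (hN : 3 ≤ N) : Y k = 0 := by
  have hq1 := qpow_ne_zero hb 1
  have hr : r = c + 1 ∨ r = c + 2 := by rcases h with h | h <;> omega
  have hNr : N = r + c + 2 := by rcases h with h | h <;> omega
  induction k using Nat.strong_induction_on with
  | _ k ih =>
    rcases Nat.lt_or_ge 1 k with h2 | h2
    · by_cases h3 : k ≤ r ∨ (k = r + 1 ∧ r = c + 1)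
      · have := hY (k - 1) (k - 1) (by omega) (by omega) (by omega) (by omega)
        rw [SingEq, ih (k - 1) (by omega) (by omega) (by omega), smul_zero, if_pos (by omega),
          Nat.sub_add_cancel hk] at this
        simpa [hq1] using this.symm
      · by_cases h4 : k = r + 1
        -- For even N the vectors w_r and w_{r+1} are not joined by a simple root; w_{r+1} is
        -- reached from w_{r−1} through the last one.
        · have := hY r (r - 1) (by omega) (by omega) (by omega) (by omega)
          rw [SingEq, ih (r - 1) (by omega) (by omega) (by omega), smul_zero,
            if_neg (show ¬ (r - 1 = r ∧ ¬ (r = c + 2 ∧ r = r)) by omega),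
            if_neg (show ¬ (r - 1 + r = N ∧ r < r) by omega),
            if_neg (show ¬ (r = c + 1 ∧ r = r ∧ r - 1 = r + 1) by omega), if_pos (by omega),
            show r - 1 + 2 = k by omega] at this
          simpa [hq1] using this.symm
        -- In the lower half the root leading from w_{k−1} to w_k is α_{N+1−k}.
        · have := hY (N + 1 - k) (k - 1) (by omega) (by omega) (by omega) (by omega)
          rw [SingEq, ih (k - 1) (by omega) (by omega) (by omega), smul_zero,
            if_neg (show ¬ (k - 1 = N + 1 - k ∧ ¬ (r = c + 2 ∧ N + 1 - k = r)) by omega),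
            Nat.sub_add_cancel hk] at this
          by_cases h5 : N + 1 - k < r
          · rw [if_pos (by omega)] at this
            simpa [hq1] using this.symm
          · rw [if_neg (show ¬ (k - 1 + (N + 1 - k) = N ∧ N + 1 - k < r) by omega),
              if_pos (by omega)] at this
            exact this.symm
    · obtain rfl : k = 1 := by omega
      exact h1

theorem eq_of_singular (h : IsDim N c r) (hN : 3 ≤ N) (hr : 1 ≤ r) {mu : Fin (N / 2) → ℂ}
    {u u' : Tens hb N l lam}
    (hu : IsSingular hb N l lam mu u) (hu' : IsSingular hb N l lam mu u')
    (h1 : firstCoeff hb N l lam u = firstCoeff hb N l lam u') : u = u' := by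
  rw [← sub_eq_zero]
  have h2 : ∀ a, tact hb N l lam (Gen.e a) (u - u') = 0 := fun a => by
    rw [map_sub, hu.2.2, hu'.2.2, sub_zero]
  rw [tact_e_eq_zero_iff h hN] at h2
  refine eq_zero_of_coeff _ fun i hi hiN => eq_zero_of_singEq h hr h2 ?_ hi hiN hN
  rw [← firstCoeff_eq, map_sub, h1, sub_self]

end Singular

section

variable {hb : ℂ} {hq : Generic hb} {N l c r : ℕ} {h : IsDim N (l + c) (l + r)}
  {P : ℕ} {lam : Fin (N / 2) → ℂ}

theorem sing_one (M : Type) [AddCommGroup M] [Module ℂ M] [Module (Uq hb N) M]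
    [IsScalarTower ℂ (Uq hb N) M] (v : M) :
    sing hq h P lam v 1 = fRoot hb N l P lam l • v := by
  have := sing_low (hq := hq) (h := h) (P := P) (lam := lam) (v := v) (Nat.zero_le l)
  rwa [chain, Finset.prod_range_zero, one_smul, Nat.sub_zero, zero_add] at this

variable (hq h) in
theorem isSingularHat_sing (hP : IsRank P c r)
    (hlam : ∀ i, l + 2 ≤ i → i ≤ N / 2 → coord lam i = 0) (hne : genCoeff hb N l P lam ≠ 0) :
    IsSingularHat hb N l P lam (ofCoeff N (sing hq h P lam (vacuum hb N l lam))) := by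
  have hr := hP.or
  have hhalf := h.half
  have hNr : N = 2 * l + r + c + 2 := by rcases h with h | h <;> omega
  have hv := isHW_vacuum (hq := hq) (h := h) (lam := lam) hlam
  have h1 : firstCoeff hb N l lam (ofCoeff N (sing hq h P lam (vacuum hb N l lam))) =
      genCoeff hb N l P lam := by
    rw [firstCoeff_eq, coeff_ofCoeff _ le_rfl (by omega), sing_one, genCoeff]
  refine ⟨⟨fun h2 => hne ?_, fun a => ?_, ?_⟩, h1⟩
  · rw [← h1, h2, map_zero]
  · rw [← sub_eq_zero]
    refine eq_zero_of_coeff _ fun j hj hjN => ?_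
    have h2 := coeff_tensAct_t (hb := hb) (M := Verma hb N l lam) a (⟨j - 1, by omega⟩ : Fin N)
      (ofCoeff N (sing hq h P lam (vacuum hb N l lam)))
    simp only [Nat.sub_add_cancel hj] at h2
    have ha := a.2
    have h3 := (wt_sing hP hv hj (a + 1) (Nat.le_add_left 1 _) (by omega)).1
    rw [allSys_t, genAt_succ] at h3
    rw [map_sub, map_smul, tact_eq_tensAct, h2, coeff_ofCoeff _ hj hjN, h3, simpleRoot,
      pair_natWeight_left h (Nat.le_add_left 1 _) (by omega), ← hp_natC h (Nat.le_add_left 1 _)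
      (by omega), smul_smul, ← qpow_add, hp_sub, hp_sub, add_sub_cancel, sub_self]
  · rw [tact_e_eq_zero_iff h (by omega)]
    intro a j ha har hj hjN
    have h2 := singEq_sing hP hv ha har hj
    rw [singEq_iff h _ ha har hj hjN] at h2 ⊢
    rw [coeff_ofCoeff _ hj hjN, ← h2]
    congr 1
    refine Finset.sum_congr rfl fun k _ => ?_
    rw [coeff_ofCoeff _ (Nat.le_add_left 1 _) k.2]

end

/-! ### Moving letters f from the Verma module to the natural module. -/

section

variable {hb : ℂ} {N c r : ℕ}

/-- The height of the weight `ε_1 - ε_i`, increased by one. -/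
def level (N i : ℕ) : ℕ := if Even N ∧ N / 2 < i then i - 1 else i

theorem level_of_rootPair {a i k : ℕ} (ha : 1 ≤ a) (haN : a ≤ N / 2) (h : rootPair N a i k) :
    level N k = level N i + 1 := by
  unfold rootPair at h
  unfold level
  rcases Nat.even_or_odd N with hN | hN
  · simp only [hN, and_true, true_and] at h ⊢
    rw [Nat.even_iff] at hN
    split_ifs at h ⊢ <;> omega
  · rw [← Nat.not_even_iff_odd] at hN
    simp only [hN, and_false, false_and, if_false] at h ⊢
    rw [Nat.even_iff] at hN
    omega

/-- The bound l + 2c + 3 is the level of N − l. The level increases with the index, except that N/2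
and N/2 + 1 share a level for even N. -/
theorem level_lt {l i : ℕ} (h : IsDim N (l + c) (l + r)) (hi : level N i < l + 2 * c + 3) :
    i + l < N := by
  unfold level at hi
  rcases h with ⟨h1, h2⟩ | ⟨h1, h2⟩
  · have : ¬ Even N := by rw [Nat.even_iff]; omega
    simp only [this, false_and, if_false] at hi
    omega
  · have : Even N := by rw [Nat.even_iff]; omega
    simp only [this, true_and] at hi
    split_ifs at hi <;> omega

open Classical in
theorem nat_f_w {a i : ℕ} (ha : 1 ≤ a) (haN : a ≤ N / 2) (hN : 3 ≤ N) (hi : 1 ≤ i) (hiN : i ≤ N) :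
    nat hb N (Gen.f ⟨a - 1, by omega⟩) (w N i) =
      ∑ k : Fin N, (if rootPair N a i (k + 1) then sgn N i else 0) • w N (k + 1) := by
  ext j
  obtain ⟨i, rfl⟩ : ∃ m, i = m + 1 := ⟨i - 1, by omega⟩
  rw [nat, Matrix.toLin'_apply, Matrix.mulVec, dotProduct,
    Finset.sum_eq_single (⟨i, by omega⟩ : Fin N), Finset.sum_apply, Finset.sum_eq_single j]
  · have := natWeight_sub_eq_iff ha haN hN hi hiN (Nat.le_add_left 1 j) j.2
    simp only [natMatrix, Matrix.of_apply, simpleRoot_mk ha, this, Pi.smul_apply, smul_eq_mul, w]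
  · intro k _ hk
    rw [Pi.smul_apply, w_apply_succ, if_neg hk.symm, smul_zero]
  · intro hj
    exact absurd (Finset.mem_univ _) hj
  · intro k _ hk
    rw [w, if_neg, mul_zero]
    intro h
    exact hk (Fin.ext (by simpa using h))
  · intro hj
    exact absurd (Finset.mem_univ _) hj

end

section

variable {hb : ℂ} {hq : Generic hb} {N l c r : ℕ} {h : IsDim N (l + c) (l + r)}
  {M : Type} [AddCommGroup M] [Module ℂ M] [Module (Uq hb N) M] [IsScalarTower ℂ (Uq hb N) M]
  {S : Submodule ℂ (NatTens N M)}

/-- By the coproduct, Δ(f_a)(w_i ⊗ x) = f_a w_i ⊗ t_a⁻¹ x + w_i ⊗ f_a x lies in S. Hence w_i ⊗ f_a x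
is, modulo S, a multiple of w_k ⊗ x if f_a takes w_i to a multiple of w_k, and lies in S if f_a w_i
= 0. The power of q comes from t_a⁻¹ on x. -/
theorem tmul_f_smul_mem (hN : 3 ≤ N) (hS : ∀ a, ∀ u ∈ S, tensAct (hb := hb) M (Gen.f a) u ∈ S)
    {ν : ℕ → ℂ} {x : M} (hx : (allSys hq h M).Wt 1 ν x) {a i : ℕ} (ha : 1 ≤ a)
    (har : a ≤ l + r) (hi : 1 ≤ i) (hiN : i ≤ N) (hix : w N i ⊗ₜ x ∈ S) :
    (∀ k, 1 ≤ k → k ≤ N → rootPair N a i k → w N i ⊗ₜ[ℂ] (fAt hb N a • x) +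
      (qpow hb (-hp (l + c) (l + r) ν a) * sgn N i) • (w N k ⊗ₜ x) ∈ S) ∧
    ((∀ k, 1 ≤ k → k ≤ N → ¬ rootPair N a i k) → w N i ⊗ₜ[ℂ] (fAt hb N a • x) ∈ S) := by
  classical
  have hhalf := h.half
  have ha' : a ≤ N / 2 := by omega
  have h1 := hS ⟨a - 1, by omega⟩ _ hix
  rw [tensAct, LinearMap.add_apply, TensorProduct.map_tmul, TensorProduct.map_tmul, modAct, modAct,
    Algebra.lsmul_coe, Algebra.lsmul_coe, LinearMap.id_apply, nat_f_w ha ha' hN hi hiN,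
    ← genAt_eq ha (by omega), ← genAt_eq ha (by omega), ← fAt_eq_genAt] at h1
  have h2 := (hx a ha har).2
  rw [allSys_ti] at h2
  beta_reduce at h1
  rw [h2] at h1
  constructor
  · intro k hk hkN hp
    rw [sum_ite_index (p := rootPair N a i) (sgn N i) (fun k => w N k) hk hkN] at h1
    · rw [TensorProduct.tmul_smul, ← TensorProduct.smul_tmul', smul_smul, add_comm] at h1
      exact h1
    · intro j hj hjN
      constructor
      · intro hj'
        unfold rootPair at hp hj'
        split_ifs at hp hj' with h3
        · omega
        · have : ¬ (a = N / 2 ∧ N = 2 * a) := fun h4 => h3 ⟨h4.1, by rw [Nat.even_iff]; omega⟩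
          omega
      · rintro rfl
        exact hp
  · intro hk
    rw [Finset.sum_eq_zero, TensorProduct.zero_tmul, zero_add] at h1
    · exact h1
    · intro k _
      rw [if_neg (hk _ (Nat.le_add_left 1 k) k.2), zero_smul]

/-- The vectors `x` such that the submodule `S` contains `w_i ⊗ x` whenever the level of `i` is
less than `L - k`. -/
def lowSub (L : ℕ) (S : Submodule ℂ (NatTens N M)) (k : ℕ) : Submodule ℂ M where
  carrier := {x | ∀ i, 1 ≤ i → i ≤ N → level N i + k < L → w N i ⊗ₜ x ∈ S}
  zero_mem' := fun i _ _ _ => by rw [TensorProduct.tmul_zero]; exact S.zero_mem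
  add_mem' := fun ha hb i h1 h2 h3 => by
    rw [TensorProduct.tmul_add]
    exact S.add_mem (ha i h1 h2 h3) (hb i h1 h2 h3)
  smul_mem' := fun s x hx i h1 h2 h3 => by
    rw [TensorProduct.tmul_smul]
    exact S.smul_mem s (hx i h1 h2 h3)

variable (hN : 3 ≤ N) (hS : ∀ a, ∀ u ∈ S, tensAct (hb := hb) M (Gen.f a) u ∈ S)
  (hr : r = c + 1 ∨ r = c + 2) {L : ℕ} {ν : ℕ → ℂ} {x : M} (hx : (allSys hq h M).Wt 1 ν x)
include hN hS hx

/-- The letter f_a moved to the left raises the level of w_i by one, so one unit of the bound is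
spent on each letter. -/
theorem f_smul_mem_lowSub {a k : ℕ} (ha : 1 ≤ a) (har : a ≤ l + r) (hk : x ∈ lowSub L S k) :
    fAt hb N a • x ∈ lowSub L S (k + 1) := by
  intro i hi hiN hik
  have hhalf := h.half
  have h1 := tmul_f_smul_mem hN hS hx ha har hi hiN (hk i hi hiN (by omega))
  by_cases h2 : ∃ j, 1 ≤ j ∧ j ≤ N ∧ rootPair N a i j
  · obtain ⟨j, h3, h4, h5⟩ := h2
    have h6 := level_of_rootPair ha (by omega) h5
    exact (S.add_mem_iff_left (S.smul_mem _ (hk j h3 h4 (by omega)))).1 (h1.1 j h3 h4 h5)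
  · push Not at h2
    exact h1.2 h2

include hr

theorem D_mem_lowSub {lo b k : ℕ} (hlo : 1 ≤ l + lo) (hbc : b ≤ c + 1) (hk : x ∈ lowSub L S k) :
    (uqSys hq h hlo M).D b x ∈ lowSub L S (k + b) := by
  induction b with
  | zero => exact hk
  | succ b ih =>
    rw [QSys.D_succ, uqSys_f]
    exact f_smul_mem_lowSub hN hS (Wt_D hx hr le_rfl hlo (by omega)) (by omega) (by omega)
      (ih (by omega))

theorem E_mem_lowSub {lo m k j : ℕ} (hlo : 1 ≤ l + lo) (hm : 1 ≤ m) (hmc : m ≤ c + 1)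
    (hk : x ∈ lowSub L S k) (hj : k + 2 * c + 2 = j + m) :
    (uqSys hq h hlo M).E m x ∈ lowSub L S j := by
  obtain ⟨i, hi⟩ : ∃ i, m + i = c + 1 := ⟨c + 1 - m, by omega⟩
  induction i generalizing m j with
  | zero =>
    obtain rfl : m = c + 1 := by omega
    obtain rfl : j = k + c + 1 := by omega
    rw [QSys.E_top, uqSys_f]
    exact f_smul_mem_lowSub hN hS (Wt_D hx hr le_rfl hlo (by omega)) (by omega) (by omega)
      (D_mem_lowSub hN hS hr hx hlo (by omega) hk)
  | succ i ih =>
    rw [QSys.E_eq _ (by omega), uqSys_f]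
    obtain ⟨j, rfl⟩ : ∃ j', j = j' + 1 := ⟨j - 1, by omega⟩
    exact f_smul_mem_lowSub hN hS (Wt_E hx hr le_rfl hlo (by omega) (by omega)) (by omega)
      (by omega) (ih (m := m + 1) (by omega) (by omega) (by omega) (by omega))

-- All words of `fRoot d` have 2c + 2 + d letters. This is the number of levels between w_{l+1−d}
-- and w_{N−l}, so such a word has just enough letters to bring w_{l+1−d} to w_{N−l}.
omit hr in
theorem fRoot_mem_lowSub {P : ℕ} (hP : IsRank P c r) (lam : Fin (N / 2) → ℂ) {d k : ℕ} (hd : d ≤ l)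
    (hk : x ∈ lowSub L S k) : fRoot hb N l P lam d • x ∈ lowSub L S (k + 2 * c + 2 + d) := by
  have hr := hP.or
  induction d using Nat.twoStepInduction generalizing ν x k with
  | zero =>
    rw [← uqSys_Phi hq h (lo := 1) (by omega), QSys.Phi_eq _ hP]
    refine Submodule.sum_mem _ fun m hm => Submodule.smul_mem _ _ ?_
    rw [Finset.mem_Icc] at hm
    have := D_mem_lowSub hN hS hr (Wt_E hx hr le_rfl (lo := 1) (by omega) hm.1 hm.2)
      (lo := 1) (by omega) hm.2 (E_mem_lowSub hN hS hr hx (by omega) hm.1 hm.2 hk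
        (j := k + 2 * c + 2 - m) (by omega))
    rwa [Nat.sub_add_cancel (by omega)] at this
  | one =>
    rw [← uqSys_FL hq h (lo := 0) (by omega), QSys.FL_eq _ hP rfl]
    have h0 : ∀ {ν : ℕ → ℂ} {z : M} {i : ℕ}, (allSys hq h M).Wt 1 ν z → z ∈ lowSub L S i →
        (uqSys hq h (lo := 0) (by omega) M).f 0 z ∈ lowSub L S (i + 1) := fun hz hi =>
      f_smul_mem_lowSub hN hS hz (a := l + 0) (by omega) (by omega) hi
    have h0' : ∀ {ν : ℕ → ℂ} {z : M}, (allSys hq h M).Wt 1 ν z → (allSys hq h M).Wt 1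
        (ν - rt (l + c) l) ((uqSys hq h (lo := 0) (by omega) M).f 0 z) := fun hz =>
      Wt_f_smul hz hr le_rfl (k := l + 0) (by omega) (by omega)
    have hD : ∀ {ν : ℕ → ℂ} {z : M} {i j m : ℕ}, (allSys hq h M).Wt 1 ν z → z ∈ lowSub L S i →
        m ≤ c + 1 → i + m = j → (uqSys hq h (lo := 0) (by omega) M).D m z ∈ lowSub L S j := by
      rintro ν z i j m hz hi hm rfl
      exact D_mem_lowSub hN hS hr hz _ hm hi
    have hE : ∀ {ν : ℕ → ℂ} {z : M} {i j m : ℕ}, (allSys hq h M).Wt 1 ν z → z ∈ lowSub L S i →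
        1 ≤ m → m ≤ c + 1 → i + 2 * c + 2 = j + m →
        (uqSys hq h (lo := 0) (by omega) M).E m z ∈ lowSub L S j :=
      fun hz hi h1 h2 h3 => E_mem_lowSub hN hS hr hz _ h1 h2 hi h3
    refine Submodule.add_mem _ (Submodule.add_mem _ (Submodule.add_mem _ ?_ ?_) ?_) ?_
    · refine Submodule.sum_mem _ fun m hm => Submodule.smul_mem _ _ ?_
      rw [Finset.mem_Icc] at hm
      exact h0 (Wt_D (Wt_E hx hr le_rfl _ hm.1 hm.2) hr le_rfl _ hm.2)
        (hD (Wt_E hx hr le_rfl _ hm.1 hm.2) (hE hx hk hm.1 hm.2 (j := k + 2 * c + 2 - m) (by omega))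
          hm.2 (by omega))
    · refine Submodule.sum_mem _ fun m hm => Submodule.smul_mem _ _ ?_
      rw [Finset.mem_Icc] at hm
      exact hD (h0' (Wt_E hx hr le_rfl _ hm.1 hm.2)) (h0 (Wt_E hx hr le_rfl _ hm.1 hm.2)
        (hE hx hk hm.1 hm.2 (j := k + 2 * c + 2 - m) (by omega))) hm.2 (by omega)
    · split_ifs with h2
      · refine Submodule.smul_mem _ _ ?_
        have w1 := Wt_D hx hr le_rfl (lo := 0) (by omega) (b := c) (by omega)
        have w2 := Wt_f_smul w1 hr le_rfl (k := l + (c + 1)) (by omega) (by omega)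
        have w3 := Wt_D (h0' w2) hr le_rfl (lo := 0) (by omega) (b := c) (by omega)
        exact f_smul_mem_lowSub hN hS w3 (a := l + r) (by omega) (by omega)
          (hD (h0' w2) (h0 w2 (f_smul_mem_lowSub hN hS w1 (a := l + (c + 1)) (by omega) (by omega)
            (hD hx hk (by omega) rfl))) (j := k + 2 * c + 2) (by omega) (by omega))
      · exact Submodule.zero_mem _
    · refine Submodule.sum_mem _ fun m hm => Submodule.smul_mem _ _ ?_
      rw [Finset.mem_Icc] at hm
      exact hD (Wt_E (h0' hx) hr le_rfl _ hm.1 hm.2) (hE (h0' hx) (h0 hx hk) hm.1 hm.2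
        (j := k + 1 + 2 * c + 2 - m) (by omega)) hm.2 (by omega)
  | more d _ ih =>
    rw [fRoot_add_two_smul lam (k := l + 1 - (d + 2)) (by omega)]
    refine Submodule.sub_mem _ (Submodule.smul_mem _ _ ?_) (Submodule.smul_mem _ _ ?_)
    · exact f_smul_mem_lowSub hN hS (Wt_fRoot hP lam hx le_rfl (by omega)) (by omega) (by omega)
        (ih hx (by omega) hk)
    · have := ih (Wt_f_smul hx hr le_rfl (k := l + 1 - (d + 2)) (by omega) (by omega)) (by omega)
        (f_smul_mem_lowSub hN hS hx (by omega) (by omega) hk)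
      rwa [show k + 1 + 2 * c + 2 + (d + 1) = k + 2 * c + 2 + (d + 2) by omega] at this

end

/-- `u` is congruent to `s • Z` modulo `S`. -/
def EqMod {V : Type} [AddCommGroup V] [Module ℂ V] (S : Submodule ℂ V) (Z u : V) (s : ℂ) : Prop :=
  u - s • Z ∈ S

namespace EqMod

variable {V : Type} [AddCommGroup V] [Module ℂ V] {S : Submodule ℂ V} {Z u u' : V} {s s' : ℂ}

theorem add (h : EqMod S Z u s) (h' : EqMod S Z u' s') : EqMod S Z (u + u') (s + s') := by
  have := S.add_mem h h'
  rwa [← add_sub_add_comm, ← add_smul] at this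

theorem smul (h : EqMod S Z u s) (t : ℂ) : EqMod S Z (t • u) (t * s) := by
  have := S.smul_mem t h
  rwa [smul_sub, smul_smul] at this

theorem of_mem (h : u ∈ S) : EqMod S Z u 0 := by
  rwa [EqMod, zero_smul, sub_zero]

theorem of_add_mem (h : EqMod S Z u s) (h' : u' + s' • u ∈ S) : EqMod S Z u' (-s' * s) := by
  have := S.sub_mem h' (S.smul_mem s' h)
  have h1 : u' + s' • u - s' • (u - s • Z) = u' - (-s' * s) • Z := by
    module
  rwa [h1] at this

end EqMod

theorem sgn_of_lt {N i : ℕ} (h : 2 * i < N) : sgn N i = 1 := if_pos h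

theorem sgn_of_le {N i : ℕ} (h : N ≤ 2 * i) : sgn N i = -1 := if_neg (by omega)

/-! ### The terms of the singular vector modulo the submodule. -/

section

variable {hb : ℂ} {hq : Generic hb} {N l c r : ℕ} {h : IsDim N (l + c) (l + r)}
  {M : Type} [AddCommGroup M] [Module ℂ M] [Module (Uq hb N) M] [IsScalarTower ℂ (Uq hb N) M]
  {S : Submodule ℂ (NatTens N M)}
  (hN : 3 ≤ N) (hS : ∀ a, ∀ u ∈ S, tensAct (hb := hb) M (Gen.f a) u ∈ S)
  (hr : r = c + 1 ∨ r = c + 2)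

section

variable {ν : ℕ → ℂ} {x : M} (hx : (allSys hq h M).Wt 1 ν x) {a i k : ℕ}
  (hk : x ∈ lowSub (l + 2 * c + 3) S k) (ha : 1 ≤ a) (har : a ≤ l + r) (hi : 1 ≤ i)
include hN hS hx hk ha har hi

theorem EqMod.tmul_f_smul {Z : NatTens N M} {j : ℕ} {s s' : ℂ}
    (hiN : i ≤ N) (hik : level N i + k < l + 2 * c + 3)
    (hj : 1 ≤ j) (hjN : j ≤ N) (hpr : rootPair N a i j)
    (hs : EqMod S Z (w N j ⊗ₜ x) s)
    (hs' : s' = -(qpow hb (-hp (l + c) (l + r) ν a) * sgn N i) * s) :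
    EqMod S Z (w N i ⊗ₜ[ℂ] (fAt hb N a • x)) s' := by
  rw [hs']
  exact hs.of_add_mem
    ((tmul_f_smul_mem hN hS hx ha har hi hiN (hk i hi hiN hik)).1 j hj hjN hpr)

/-- For i ≤ l + 1 only f_i moves w_i, apart from the fork at the end of the diagram for even N. Any
other leading letter puts the tensor into S, provided that w_i ⊗ x itself is already in S. -/
theorem tmul_f_smul_mem_of_ne (hil : i ≤ l + 1) (hia : i ≠ a) (hia' : ¬ (r = c + 2 ∧ a = l + r ∧ i + 1 = a))
    (hik : i + k < l + 2 * c + 3) :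
    w N i ⊗ₜ[ℂ] (fAt hb N a • x) ∈ S := by
  have hhalf := h.half
  have hNr : N = 2 * l + r + c + 2 := by rcases h with h | h <;> omega
  have hiN : i ≤ N := by omega
  have hlev : level N i = i := if_neg (by omega)
  refine (tmul_f_smul_mem hN hS hx ha har hi hiN (hk i hi hiN (by omega))).2 ?_
  intro j hj hjN hp
  unfold rootPair at hp
  split_ifs at hp with h3
  · have := Nat.even_iff.1 h3.2
    omega
  · have : ¬ (a = N / 2 ∧ N = 2 * a) := fun h4 => h3 ⟨h4.1, by rw [Nat.even_iff]; omega⟩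
    omega

end

theorem mem_lowSub_zero (h : IsDim N (l + c) (l + r)) {v : M}
    (hSv : ∀ i, 1 ≤ i → i + l < N → w N i ⊗ₜ v ∈ S) :
    v ∈ lowSub (l + 2 * c + 3) S 0 := fun i hi _ hik => hSv i hi (level_lt h (by omega))

include hN hS hr

/-- The leading letter of D_m is f_{l+m}, which kills w_i when i < l + m. -/
theorem tmul_D_mem {ν : ℕ → ℂ} {x : M} (hx : (allSys hq h M).Wt 1 ν x) {lo i k m : ℕ}
    (hlo : 1 ≤ l + lo) (hk : x ∈ lowSub (l + 2 * c + 3) S k) (hi : 1 ≤ i) (hil : i < l + m)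
    (hil' : i ≤ l + 1) (hm : 1 ≤ m) (hmc : m ≤ c + 1) (hik : i + k + m ≤ l + 2 * c + 3) :
    w N i ⊗ₜ[ℂ] (uqSys hq h hlo M).D m x ∈ S := by
  obtain ⟨m, rfl⟩ : ∃ j, m = j + 1 := ⟨m - 1, by omega⟩
  rw [QSys.D_succ, uqSys_f]
  exact tmul_f_smul_mem_of_ne hN hS (Wt_D hx hr le_rfl hlo (b := m) (by omega))
    (D_mem_lowSub hN hS hr hx hlo (by omega) hk) (by omega) (by omega) hi hil' (by omega) (by omega)
    (by omega)

-- All words have leading letters of index larger than i, except in the terms F f_{α_k} of the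
-- recursion, where the induction is applied to F acting on f_{α_k} x.
omit hr in
theorem tmul_fRoot_mem {P : ℕ} (hP : IsRank P c r) (lam : Fin (N / 2) → ℂ) {ν : ℕ → ℂ} {x : M}
    (hx : (allSys hq h M).Wt 1 ν x) {i d k : ℕ} (hd : d ≤ l) (hk : x ∈ lowSub (l + 2 * c + 3) S k)
    (hi : 1 ≤ i) (hid : i + d ≤ l) (hik : i + k + d ≤ l + 1) :
    w N i ⊗ₜ[ℂ] (fRoot hb N l P lam d • x) ∈ S := by
  have hr := hP.or
  induction d using Nat.twoStepInduction generalizing ν x k with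
  | zero =>
    rw [← uqSys_Phi hq h (lo := 1) (by omega), QSys.Phi_eq _ hP, TensorProduct.tmul_sum]
    refine Submodule.sum_mem _ fun m hm => ?_
    rw [Finset.mem_Icc] at hm
    rw [TensorProduct.tmul_smul]
    exact Submodule.smul_mem _ _ (tmul_D_mem hN hS hr (Wt_E hx hr le_rfl _ hm.1 hm.2) _
      (E_mem_lowSub hN hS hr hx _ hm.1 hm.2 hk (j := k + 2 * c + 2 - m) (by omega)) hi (by omega)
      (by omega) hm.1 hm.2 (by omega))
  | one =>
    rw [← uqSys_FL hq h (lo := 0) (by omega), QSys.FL_eq _ hP rfl]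
    have h0 : ∀ {ν : ℕ → ℂ} {z : M} {i : ℕ}, (allSys hq h M).Wt 1 ν z →
        z ∈ lowSub (l + 2 * c + 3) S i →
        (uqSys hq h (lo := 0) (by omega) M).f 0 z ∈ lowSub (l + 2 * c + 3) S (i + 1) :=
      fun hz hi =>
      f_smul_mem_lowSub hN hS hz (a := l + 0) (by omega) (by omega) hi
    have h0' : ∀ {ν : ℕ → ℂ} {z : M}, (allSys hq h M).Wt 1 ν z → (allSys hq h M).Wt 1
        (ν - rt (l + c) l) ((uqSys hq h (lo := 0) (by omega) M).f 0 z) := fun hz =>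
      Wt_f_smul hz hr le_rfl (k := l + 0) (by omega) (by omega)
    simp only [TensorProduct.tmul_add, TensorProduct.tmul_sum, TensorProduct.tmul_smul]
    have hlo : 1 ≤ l + 0 := by omega
    refine Submodule.add_mem _ (Submodule.add_mem _ (Submodule.add_mem _ ?_ ?_) ?_) ?_
    · refine Submodule.sum_mem _ fun m hm => Submodule.smul_mem _ _ ?_
      rw [Finset.mem_Icc] at hm
      exact tmul_f_smul_mem_of_ne hN hS (Wt_D (Wt_E hx hr le_rfl hlo hm.1 hm.2) hr le_rfl hlo hm.2)
        (D_mem_lowSub hN hS hr (Wt_E hx hr le_rfl hlo hm.1 hm.2) hlo hm.2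
          (E_mem_lowSub hN hS hr hx hlo hm.1 hm.2 hk (j := k + 2 * c + 2 - m) (by omega)))
        (a := l + 0) (by omega) (by omega) hi (by omega) (by omega) (by omega) (by omega)
    · refine Submodule.sum_mem _ fun m hm => Submodule.smul_mem _ _ ?_
      rw [Finset.mem_Icc] at hm
      exact tmul_D_mem hN hS hr (h0' (Wt_E hx hr le_rfl hlo hm.1 hm.2)) hlo
        (h0 (Wt_E hx hr le_rfl hlo hm.1 hm.2) (E_mem_lowSub hN hS hr hx hlo hm.1 hm.2 hk
          (j := k + 2 * c + 2 - m) (by omega)))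
        hi (by omega) (by omega) hm.1 hm.2 (by omega)
    · split_ifs with h2
      · rw [TensorProduct.tmul_smul]
        refine Submodule.smul_mem _ _ ?_
        have w1 := Wt_D hx hr le_rfl hlo (b := c) (by omega)
        have w2 := Wt_f_smul w1 hr le_rfl (k := l + (c + 1)) (by omega) (by omega)
        have w3 := Wt_D (h0' w2) hr le_rfl hlo (b := c) (by omega)
        exact tmul_f_smul_mem_of_ne hN hS w3 (D_mem_lowSub hN hS hr (h0' w2) hlo (by omega)
          (h0 w2 (f_smul_mem_lowSub hN hS w1 (a := l + (c + 1)) (by omega) (by omega)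
            (D_mem_lowSub hN hS hr hx hlo (by omega) hk)))) (a := l + r) (by omega) (by omega) hi
            (by omega) (by omega) (by omega) (by omega)
      · rw [TensorProduct.tmul_zero]
        exact Submodule.zero_mem _
    · refine Submodule.sum_mem _ fun m hm => Submodule.smul_mem _ _ ?_
      rw [Finset.mem_Icc] at hm
      exact tmul_D_mem hN hS hr (Wt_E (h0' hx) hr le_rfl hlo hm.1 hm.2) hlo
        (E_mem_lowSub hN hS hr (h0' hx) hlo hm.1 hm.2 (h0 hx hk)
          (j := k + 1 + 2 * c + 2 - m) (by omega)) hi (by omega) (by omega) hm.1 hm.2 (by omega)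
  | more d _ ih =>
    rw [fRoot_add_two_smul lam (k := l + 1 - (d + 2)) (by omega), TensorProduct.tmul_sub,
      TensorProduct.tmul_smul (qnum hb _), TensorProduct.tmul_smul (qnum hb _)]
    refine Submodule.sub_mem _ (Submodule.smul_mem _ _ ?_) (Submodule.smul_mem _ _ ?_)
    · exact tmul_f_smul_mem_of_ne hN hS (Wt_fRoot hP lam hx le_rfl (by omega))
        (fRoot_mem_lowSub hN hS hx hP lam (by omega) hk) (by omega) (by omega) hi
        (by omega) (by omega) (by omega) (by omega)
    · exact ih (Wt_f_smul hx hr le_rfl (k := l + 1 - (d + 2)) (by omega) (by omega)) (by omega)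
        (f_smul_mem_lowSub hN hS hx (by omega) (by omega) hk) (by omega) (by omega)

variable {μ : ℕ → ℂ} {v : M} (hv : IsHW hq h 1 μ v) (hSv : ∀ i, 1 ≤ i → i + l < N → w N i ⊗ₜ v ∈ S)
include hv hSv

/-- The letters are moved off one by one and take w_i to w_{N−l}. The signs of the lower half cancel
the minus sign of the move. The letter f_{l+1} next to v contributes q^{−μ_{l+1}}, every further
letter q^{−1}. -/
theorem eqMod_D {b i : ℕ} (hbc : b ≤ c) (hi : i + b + l = N) :
    EqMod S (w N (N - l) ⊗ₜ v) (w N i ⊗ₜ[ℂ] (locSys hq h M).D b v)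
      (if b = 0 then 1 else qpow hb (-μ (l + 1) - b + 1)) := by
  have hNr : N = 2 * l + r + c + 2 := by rcases h with h | h <;> omega
  have hhalf := h.half
  induction b generalizing i with
  | zero =>
    rw [if_pos rfl, QSys.D_zero, EqMod, one_smul, show i = N - l by omega, sub_self]
    exact S.zero_mem
  | succ b ih =>
    have hD := Wt_D hv.wt hr le_rfl (lo := 1) (Nat.le_add_left 1 l) (b := b) (by omega)
    have hlev : level N i ≤ l + 2 * c + 3 - (b + 1) := by
      unfold level
      split_ifs with h1
      · omega
      · have : r ≠ c + 2 := fun h2 => h1 ⟨by rw [Nat.even_iff]; omega, by omega⟩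
        omega
    rw [QSys.D_succ, if_neg (by omega)]
    refine EqMod.tmul_f_smul hN hS hD
      (D_mem_lowSub hN hS hr hv.wt (Nat.le_add_left 1 l) (by omega) (mem_lowSub_zero h hSv))
      (by omega) (by omega) (by omega) (by omega) (by omega) (j := i + 1) (by omega) (by omega) ?_
      (ih (by omega) (by omega)) ?_
    · rw [rootPair, if_neg (by omega)]
      omega
    · rw [sgn_of_le (by omega), hp, if_pos (by omega)]
      simp only [Pi.add_apply, Pi.sub_apply, δ]
      rw [hv.zero (l + (b + 1) + 1) (by omega) (by omega)]
      by_cases hb0 : b = 0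
      · subst hb0
        simp
      · rw [hv.zero (l + (b + 1)) (by omega) (by omega), if_neg hb0]
        rw [if_neg (by omega), if_pos (by omega), if_neg (by omega), if_neg (by omega), mul_neg_one,
          neg_neg, ← qpow_add]
        congr 1
        push_cast
        ring

theorem eqMod_f_D {b i : ℕ} (hb' : (b = r ∧ i = l + c + 2) ∨ (r = c + 2 ∧ b = c + 1 ∧ i = l + c + 3)) :
    EqMod S (w N (N - l) ⊗ₜ v) (w N i ⊗ₜ[ℂ] (locSys hq h M).f b ((locSys hq h M).D c v))
      (qpow hb (-μ (l + 1) - c)) := by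
  have hNr : N = 2 * l + r + c + 2 := by rcases h with h | h <;> omega
  have hhalf := h.half
  have hD := Wt_D hv.wt hr le_rfl (lo := 1) (Nat.le_add_left 1 l) (b := c) (by omega)
  have hlev : level N i ≤ l + c + 2 := by
    unfold level
    split_ifs with h1
    · omega
    · have : r ≠ c + 2 ∨ i = l + c + 2 := by
        by_contra! h2
        exact h1 ⟨by rw [Nat.even_iff]; omega, by omega⟩
      omega
  refine EqMod.tmul_f_smul hN hS hD
      (D_mem_lowSub hN hS hr hv.wt (Nat.le_add_left 1 l) (by omega) (mem_lowSub_zero h hSv))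
      (by omega) (by omega) (by omega) (by omega) (by omega) (j := N - l - c) (by omega) (by omega) ?_
      (eqMod_D hN hS hr hv hSv le_rfl (i := N - l - c) (by omega)) ?_
  · simp only [rootPair, Nat.even_iff]
    split_ifs <;> omega
  · have hz := hv.zero
    rw [sgn_of_le (by omega), mul_neg_one, neg_neg]
    -- For c = 0 the letter f_b acts directly on v and sees μ_{l+1}; otherwise it sees the weight
    -- ε_{l+c+1} of D_c v within so(P).
    have : hp (l + c) (l + r) (μ - δ (l + 1) + δ (l + c + 1)) (l + b) = 
        if c = 0 then μ (l + 1) else 1 := by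
      unfold hp
      simp only [Pi.add_apply, Pi.sub_apply, δ]
      by_cases hc : c = 0
      · subst hc
        have hz2 : r = 2 → μ (l + 2) = 0 := fun _ => hz _ (by omega) (by omega)
        rcases hr with hr | hr
        · rw [if_neg (by omega), if_pos (by omega)]
          simp
        · rw [if_neg (by omega), if_neg (by omega), add_zero, hz2 hr]
          simp
      · have hz1 : μ (l + c + 1) = 0 := hz _ (by omega) (by omega)
        rcases hr with hr | hr
        · rw [if_neg (by omega), if_pos (by omega)]
          simp [hz1, hc]
        · have hz2 : μ (l + c + 2) = 0 := hz _ (by omega) (by omega)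
          rw [if_neg (by omega), if_neg (by omega)]
          rw [hz1, hz2]
          split_ifs <;> first | omega | norm_num
    rw [this]
    by_cases hc : c = 0
    · rw [if_pos hc, if_pos hc, hc]
      simp
    · rw [if_neg hc, if_neg hc, ← qpow_add]
      congr 1
      ring

end

theorem hp_low {c r k : ℕ} {μ : ℕ → ℂ} (hk : k ≤ c) : hp c r μ k = μ k - μ (k + 1) := if_pos hk

theorem hp_odd {c r k : ℕ} {μ : ℕ → ℂ} (hk : c < k) (hr : r = c + 1) : hp c r μ k = μ (c + 1) := by
  rw [hp, if_neg (by omega), if_pos hr]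

theorem hp_mid {c r k : ℕ} {μ : ℕ → ℂ} (hk : k = c + 1) (hr : r = c + 2) :
    hp c r μ k = μ (c + 1) - μ (c + 2) := by
  rw [hp, if_neg (by omega), if_neg (by omega), if_pos hk]

section

variable {hb : ℂ} {hq : Generic hb} {N l c r : ℕ} {h : IsDim N (l + c) (l + r)}
  {M : Type} [AddCommGroup M] [Module ℂ M] [Module (Uq hb N) M] [IsScalarTower ℂ (Uq hb N) M]
  {S : Submodule ℂ (NatTens N M)}
  (hN : 3 ≤ N) (hS : ∀ a, ∀ u ∈ S, tensAct (hb := hb) M (Gen.f a) u ∈ S)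
  {P : ℕ} (hP : IsRank P c r)
  {μ : ℕ → ℂ} {v : M} (hv : IsHW hq h 1 μ v) (hSv : ∀ i, 1 ≤ i → i + l < N → w N i ⊗ₜ v ∈ S)
include hN hS hP hv hSv

theorem eqMod_E {m : ℕ} (hm : 1 ≤ m) (hmc : m ≤ c) :
    EqMod S (w N (N - l) ⊗ₜ v) (w N (l + 1 + m) ⊗ₜ[ℂ] (locSys hq h M).E m v)
      ((-1) ^ (c + 1 - m) * qpow hb (-μ (l + 1) - P + 1 + m)) := by
  have hr := hP.or
  have hNr : N = 2 * l + r + c + 2 := by rcases h with h | h <;> omega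
  have hhalf := h.half
  obtain ⟨i, hi⟩ : ∃ i, m + i = c := ⟨c - m, by omega⟩
  have hroot : ∀ m, m ≤ c → rootPair N (l + (m + 1)) (l + 1 + m) (l + 1 + (m + 1)) := by
    intro m hmc
    simp only [rootPair, Nat.even_iff]
    split_ifs <;> omega
  -- Each letter of E_m gives weight 1, except the second short root letter for odd P, which meets a
  -- vector of weight zero. This missing power of q is why P rather than 2c + 2 appears in the
  -- exponent.
  have hwt : ∀ m, 1 ≤ m → m ≤ c → hp (l + c) (l + r) (μ - δ (l + 1) - δ (l + (m + 1) + 1)) (l + (m + 1)) =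
      if r = c + 1 ∧ m = c then 0 else 1 := by
    intro m hm hmc
    have hz := hv.zero
    have hz1 := hz (l + (m + 1)) (by omega) (by omega)
    by_cases h1 : m = c
    · rcases hr with hr | hr
      · rw [hp_odd (by omega) (by omega), if_pos ⟨hr, h1⟩]
        simp only [Pi.sub_apply, δ]
        rw [show l + c + 1 = l + (m + 1) by omega, hz1]
        split_ifs <;> first | omega | norm_num
      · have hz2 := hz (l + c + 2) (by omega) (by omega)
        rw [hp_mid (by omega) (by omega), if_neg (by omega)]
        simp only [Pi.sub_apply, δ]
        rw [show l + c + 1 = l + (m + 1) by omega, hz1, hz2]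
        split_ifs <;> first | omega | norm_num
    · have hz2 := hz (l + (m + 1) + 1) (by omega) (by omega)
      rw [hp_low (by omega), if_neg (by omega)]
      simp only [Pi.sub_apply, δ]
      rw [hz1, hz2]
      split_ifs <;> first | omega | norm_num
  have hlev : ∀ m, m ≤ c → level N (l + 1 + m) = l + 1 + m := fun m hmc => if_neg (by omega)
  have hE : ∀ m, 1 ≤ m → m ≤ c + 1 → (locSys hq h M).E m v ∈
      lowSub (l + 2 * c + 3) S (2 * c + 2 - m) := fun m hm hmc =>
    E_mem_lowSub hN hS hr hv.wt (Nat.le_add_left 1 l) hm hmc (mem_lowSub_zero h hSv) (by omega)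
  have hP' : (P : ℂ) = 2 * c + (if r = c + 1 then 1 else 2) := by
    rcases hP with ⟨h1, h2⟩ | ⟨h1, h2⟩
    · rw [h2, if_pos h1]; push_cast; ring
    · rw [h2, if_neg (by omega)]; push_cast; ring
  have hstep : ∀ m, 1 ≤ m → m ≤ c → ∀ s, EqMod S (w N (N - l) ⊗ₜ v)
      (w N (l + 1 + (m + 1)) ⊗ₜ[ℂ] (locSys hq h M).E (m + 1) v) s →
      EqMod S (w N (N - l) ⊗ₜ v) (w N (l + 1 + m) ⊗ₜ[ℂ] (locSys hq h M).E m v)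
        (-qpow hb (if r = c + 1 ∧ m = c then 0 else -1) * s) := by
    intro m hm hmc s hs
    rw [QSys.E_eq _ hmc]
    refine EqMod.tmul_f_smul hN hS (Wt_E hv.wt hr le_rfl (Nat.le_add_left 1 l)
      (by omega) (by omega)) (hE (m + 1) (by omega) (by omega)) (by omega) (by omega) (by omega)
      (by omega) (by rw [hlev m hmc]; omega) (by omega) (by omega) (hroot m hmc) hs ?_
    -- In the upper half the sign of w_i is +1, so every letter moved contributes a minus sign;
    -- together they give (−1)^{c+1−m}.
    rw [sgn_of_lt (by omega), hwt m hm hmc, mul_one]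
    split_ifs <;> simp
  induction i generalizing m with
  | zero =>
    obtain rfl : m = c := by omega
    have h1 := eqMod_f_D hN hS hr hv hSv (b := r) (i := l + m + 2) (Or.inl ⟨rfl, rfl⟩)
    have h2 := hstep m hm le_rfl (qpow hb (-μ (l + 1) - m)) (by
      rw [QSys.E_top, show l + 1 + (m + 1) = l + m + 2 by omega]
      exact h1)
    convert h2 using 1
    rw [show m + 1 - m = 1 by omega, pow_one, hP', neg_one_mul, neg_mul, ← qpow_add]
    congr 2
    split_ifs <;> first | omega | ring
  | succ i ih =>
    convert hstep m hm hmc _ (ih (m := m + 1) (by omega) (by omega) (by omega)) using 1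
    rw [if_neg (by omega), show c + 1 - m = c + 1 - (m + 1) + 1 by omega, pow_succ, mul_neg_one,
      mul_left_comm, neg_mul, neg_mul, ← qpow_add, mul_neg]
    congr 3
    push_cast
    ring

theorem eqMod_D_E :
    EqMod S (w N (N - l) ⊗ₜ v) (w N (l + 1) ⊗ₜ[ℂ] (locSys hq h M).D 1 ((locSys hq h M).E 1 v))
      ((-1) ^ (c + 1) * qpow hb (-2 * μ (l + 1) - P + 2)) := by
  have hr := hP.or
  have hNr : N = 2 * l + r + c + 2 := by rcases h with h | h <;> omega
  have hhalf := h.half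
  have hlev : level N (l + 1) = l + 1 := if_neg (by omega)
  have hE : (locSys hq h M).E 1 v ∈ lowSub (l + 2 * c + 3) S (2 * c + 1) :=
    E_mem_lowSub hN hS hr hv.wt (Nat.le_add_left 1 l) le_rfl (by omega) (mem_lowSub_zero h hSv)
      (by omega)
  have hroot : rootPair N (l + (0 + 1)) (l + 1) (l + 2) := by
    rw [rootPair, if_neg (by rw [Nat.even_iff]; omega)]
    exact Or.inl ⟨rfl, rfl⟩
  rw [QSys.D_succ, QSys.D_zero]
  have hwt := Wt_E hv.wt hr le_rfl (Nat.le_add_left 1 l) (m := 1) le_rfl (by omega)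
  have hz := hv.zero
  by_cases hc : c = 0
  · have h1 := eqMod_f_D hN hS hr hv hSv (b := r) (i := l + 2) (Or.inl ⟨rfl, by omega⟩)
    rw [← QSys.E_top, show c + 1 = 1 by omega] at h1
    refine EqMod.tmul_f_smul hN hS hwt hE (by omega) (by omega) (by omega) (by omega) (by omega)
      (by omega) (by omega) hroot h1 ?_
    rw [sgn_of_lt (by omega), mul_one, hc, zero_add, pow_one, neg_one_mul, neg_mul (qpow _ _), ← qpow_add]
    congr 2
    rcases hP with ⟨h2, h3⟩ | ⟨h2, h3⟩
    · rw [hp_odd (by omega) (by omega), h3, hc]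
      simp [δ]
      ring
    · have hz2 := hz (l + 0 + 2) (by omega) (by omega)
      rw [hp_mid (by omega) (by omega), h3, hc]
      simp [δ, hz2]
      ring
  · have h1 := eqMod_E hN hS hP hv hSv (m := 1) le_rfl (by omega)
    refine EqMod.tmul_f_smul hN hS hwt hE (by omega) (by omega) (by omega) (by omega) (by omega)
      (by omega) (by omega) hroot h1 ?_
    have hz1 := hz (l + 2) (by omega) (by omega)
    have h2 : hp (l + c) (l + r) (μ - δ (l + 1) - δ (l + 1 + 1)) (l + (0 + 1)) = μ (l + 1) := by
      rw [hp_low (by omega)]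
      simp [δ, add_assoc, hz1]
    rw [h2, sgn_of_lt (by omega), mul_one, Nat.add_sub_cancel, pow_succ,
      show -2 * μ (l + 1) - P + 2 = -μ (l + 1) + (-μ (l + 1) - P + 1 + (1 : ℕ)) by push_cast; ring,
      qpow_add]
    ring

/-- Only m = 1 counts: for m ≥ 2 the leading letter f_{l+m} of D_m kills w_{l+1}. -/
theorem eqMod_Phi :
    EqMod S (w N (N - l) ⊗ₜ v) (w N (l + 1) ⊗ₜ[ℂ] (locSys hq h M).Phi P v)
      (qnum hb ((P : ℂ) / 2) * ((-1) ^ (c + 1) * qpow hb (-2 * μ (l + 1) - P + 2))) := by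
  have hr := hP.or
  have hNr : N = 2 * l + r + c + 2 := by rcases h with h | h <;> omega
  rw [QSys.Phi_eq _ hP, TensorProduct.tmul_sum, ← Finset.add_sum_Ioc_eq_sum_Icc (by omega),
    TensorProduct.tmul_smul, ← add_zero (_ * _)]
  refine EqMod.add ?_ (EqMod.of_mem (Submodule.sum_mem _ fun m hm => ?_))
  · convert (eqMod_D_E hN hS hP hv hSv).smul (A0 hb P 1) using 2
    rw [A0]
    simp
  · rw [Finset.mem_Ioc] at hm
    rw [TensorProduct.tmul_smul]
    exact Submodule.smul_mem _ _ (tmul_D_mem hN hS hr (Wt_E hv.wt hr le_rfl (Nat.le_add_left 1 l)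
      (by omega) hm.2) _ (E_mem_lowSub hN hS hr hv.wt _ (by omega) hm.2 (mem_lowSub_zero h hSv)
      (j := 2 * c + 2 - m) (by omega)) (by omega) (by omega) le_rfl (by omega) hm.2 (by omega))

end

/-! ### The upper terms of the singular vector. -/

section

variable {hb : ℂ} {hq : Generic hb} {N l c r : ℕ} {h : IsDim N (l + c) (l + r)}
  {M : Type} [AddCommGroup M] [Module ℂ M] [Module (Uq hb N) M] [IsScalarTower ℂ (Uq hb N) M]
  {S : Submodule ℂ (NatTens N M)}
  (hN : 3 ≤ N) (hS : ∀ a, ∀ u ∈ S, tensAct (hb := hb) M (Gen.f a) u ∈ S)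
  {P : ℕ} (hP : IsRank P c r) {lam : Fin (N / 2) → ℂ}
  {v : M} (hv : IsHW hq h 1 (coord lam) v) (hSv : ∀ i, 1 ≤ i → i + l < N → w N i ⊗ₜ v ∈ S)

/-- The coefficient of `w_{N-l} ⊗ v` in the sum of the last terms of the singular vector. -/
def tailCoeff (hb : ℂ) (l P c : ℕ) (μ : ℕ → ℂ) (d : ℕ) : ℂ :=
  (-1) ^ (c + 1) * qnum hb (μ (l + 1) + (P : ℂ) / 2) * qnum hb (μ (l + 1) + P - 1) *
    ∏ j ∈ Finset.range d, -qnum hb (μ (l - j) + μ (l + 1) + P + j + 1)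

theorem tailCoeff_succ (hb : ℂ) (l P c : ℕ) (μ : ℕ → ℂ) (d : ℕ) : tailCoeff hb l P c μ (d + 1) =
    tailCoeff hb l P c μ d * -qnum hb (μ (l - d) + μ (l + 1) + P + d + 1) := by
  rw [tailCoeff, Finset.prod_range_succ, ← mul_assoc]
  rfl

theorem uqSys_D_eq {lo : ℕ} (hlo : 1 ≤ l + lo) (m : ℕ) (y : M) :
    (uqSys hq h hlo M).D m y = (locSys hq h M).D m y :=
  (uqSys_W _ _ _ _ _ _).trans (uqSys_W _ _ (Nat.le_add_left 1 l) _ _ _).symm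

theorem uqSys_E_eq {lo : ℕ} (hlo : 1 ≤ l + lo) (m : ℕ) (y : M) :
    (uqSys hq h hlo M).E m y = (locSys hq h M).E m y :=
  (uqSys_W _ _ _ _ _ _).trans (uqSys_W _ _ (Nat.le_add_left 1 l) _ _ _).symm

include hN hS hP hv hSv

theorem eqMod_f_D_E (hl : 1 ≤ l) {m : ℕ} (hm : 1 ≤ m) (hmc : m ≤ c + 1) {s : ℂ}
    (hs : EqMod S (w N (N - l) ⊗ₜ v)
      (w N (l + 1) ⊗ₜ[ℂ] (locSys hq h M).D m ((locSys hq h M).E m v)) s) :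
    EqMod S (w N (N - l) ⊗ₜ v)
      (w N l ⊗ₜ[ℂ] (fAt hb N l • (locSys hq h M).D m ((locSys hq h M).E m v)))
      (-qpow hb (-(coord lam l - coord lam (l + 1) + 2)) * s) := by
  have hr := hP.or
  have hNr : N = 2 * l + r + c + 2 := by rcases h with h | h <;> omega
  have hhalf := h.half
  have hE := Wt_E hv.wt hr le_rfl (Nat.le_add_left 1 l) hm hmc
  refine EqMod.tmul_f_smul hN hS (Wt_D hE hr le_rfl (Nat.le_add_left 1 l) hmc)
    (D_mem_lowSub hN hS hr hE (Nat.le_add_left 1 l) hmc (E_mem_lowSub hN hS hr hv.wt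
      (Nat.le_add_left 1 l) hm hmc (mem_lowSub_zero h hSv) (j := 2 * c + 2 - m) (by omega)))
    hl (by omega) hl (by omega)
    (by rw [level, if_neg (by omega)]; omega) (j := l + 1) (by omega) (by omega) ?_ hs ?_
  · rw [rootPair, if_neg (by omega)]
    exact Or.inl ⟨rfl, rfl⟩
  · rw [sgn_of_lt (by omega), mul_one, hp_low (by omega)]
    congr 4
    simp only [δ, Pi.sub_apply, Pi.add_apply]
    split_ifs <;> first | omega | (norm_num; ring)

/-- To bring w_l down to w_{N−l} a word has to begin with f_l, followed by f_{l+1}. Among all words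
of f_{ε_l+ε_{l+1}} only φ¹_1 does so, and its coefficient is A1_1 = [x + P − 1][x + P/2]. -/
theorem eqMod_fRoot_one (hl : 1 ≤ l) :
    EqMod S (w N (N - l) ⊗ₜ v) (w N l ⊗ₜ[ℂ] (fRoot hb N l P lam 1 • v))
      (-qpow hb (-(coord lam l + coord lam (l + 1) + P)) * tailCoeff hb l P c (coord lam) 0) := by
  have hr := hP.or
  have hNr : N = 2 * l + r + c + 2 := by rcases h with h | h <;> omega
  have hhalf := h.half
  have hk := mem_lowSub_zero h hSv
  have hlo : 1 ≤ l + 1 := by omega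
  have h0 : ∀ {ν : ℕ → ℂ} {z : M} {i : ℕ}, (allSys hq h M).Wt 1 ν z →
      z ∈ lowSub (l + 2 * c + 3) S i → fAt hb N l • z ∈ lowSub (l + 2 * c + 3) S (i + 1) :=
    fun hz hi => f_smul_mem_lowSub hN hS hz hl (by omega) hi
  have h0' : ∀ {ν : ℕ → ℂ} {z : M}, (allSys hq h M).Wt 1 ν z → (allSys hq h M).Wt 1
      (ν - rt (l + c) l) (fAt hb N l • z) := fun hz => Wt_f_smul hz hr le_rfl hl (by omega)
  have hE : ∀ m, 1 ≤ m → m ≤ c + 1 → (locSys hq h M).E m v ∈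
      lowSub (l + 2 * c + 3) S (2 * c + 2 - m) := fun m hm hmc =>
    E_mem_lowSub hN hS hr hv.wt hlo hm hmc hk (by omega)
  have hFL : fRoot hb N l P lam 1 • v = ∑ m ∈ Finset.Icc 1 (c + 1), A1 hb P (coord lam (l + 1)) m •
        fAt hb N l • (locSys hq h M).D m ((locSys hq h M).E m v)
      + ∑ m ∈ Finset.Icc 1 (c + 1), A2 hb P (coord lam (l + 1)) m •
        (locSys hq h M).D m (fAt hb N l • (locSys hq h M).E m v)
      + (if r = c + 2 then A2 hb P (coord lam (l + 1)) (c + 1) • fAt hb N (l + r) •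
        (locSys hq h M).D c (fAt hb N l • fAt hb N (l + (c + 1)) • (locSys hq h M).D c v) else 0)
      + ∑ m ∈ Finset.Icc 1 (c + 1), A3 hb P (coord lam (l + 1)) m •
        (locSys hq h M).D m ((locSys hq h M).E m (fAt hb N l • v)) := by
    rw [← uqSys_FL hq h (lo := 0) (by omega), QSys.FL_eq _ hP rfl]
    simp only [uqSys_D_eq, uqSys_E_eq, uqSys_f, add_zero]
  have h1 : EqMod S (w N (N - l) ⊗ₜ v) (w N l ⊗ₜ[ℂ] ∑ m ∈ Finset.Icc 1 (c + 1),
      A1 hb P (coord lam (l + 1)) m • fAt hb N l •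
        (locSys hq h M).D m ((locSys hq h M).E m v))
      (-qpow hb (-(coord lam l + coord lam (l + 1) + P)) * tailCoeff hb l P c (coord lam) 0) := by
    rw [← Finset.add_sum_Ioc_eq_sum_Icc (by omega), TensorProduct.tmul_add,
      TensorProduct.tmul_smul, TensorProduct.tmul_sum, ← add_zero (_ * tailCoeff _ _ _ _ _ _)]
    refine EqMod.add ?_ (EqMod.of_mem (Submodule.sum_mem _ fun m hm => ?_))
    · convert (eqMod_f_D_E hN hS hP hv hSv hl le_rfl (by omega)
        (eqMod_D_E hN hS hP hv hSv)).smul (A1 hb P (coord lam (l + 1)) 1) using 1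
      rw [A1, tailCoeff, Finset.prod_range_zero, show -(coord lam l + coord lam (l + 1) + P) =
        -(coord lam l - coord lam (l + 1) + 2) + (-2 * coord lam (l + 1) - P + 2) by ring,
        qpow_add]
      push_cast
      ring
    · rw [Finset.mem_Ioc] at hm
      have h1 := eqMod_f_D_E hN hS hP hv hSv hl (m := m) (by omega) hm.2
        (EqMod.of_mem (tmul_D_mem hN hS hr (Wt_E hv.wt hr le_rfl hlo (by omega) hm.2) hlo
        (hE m (by omega) hm.2) (by omega) (by omega) le_rfl (by omega) hm.2 (by omega)))
      rw [mul_zero, EqMod, zero_smul, sub_zero] at h1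
      rw [TensorProduct.tmul_smul]
      exact Submodule.smul_mem _ _ h1
  rw [hFL, TensorProduct.tmul_add, TensorProduct.tmul_add, TensorProduct.tmul_add, add_assoc,
    add_assoc, ← add_zero (_ * tailCoeff _ _ _ _ _ _)]
  refine EqMod.add h1 (EqMod.of_mem (Submodule.add_mem _ ?_ (Submodule.add_mem _ ?_ ?_)))
  · rw [TensorProduct.tmul_sum]
    refine Submodule.sum_mem _ fun m hm => ?_
    rw [Finset.mem_Icc] at hm
    rw [TensorProduct.tmul_smul]
    exact Submodule.smul_mem _ _ (tmul_D_mem hN hS hr (h0' (Wt_E hv.wt hr le_rfl hlo hm.1 hm.2)) hlo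
      (h0 (Wt_E hv.wt hr le_rfl hlo hm.1 hm.2) (hE m hm.1 hm.2))
      hl (by omega) (by omega) hm.1 hm.2 (by omega))
  · split_ifs with h2
    · have w1 := Wt_D hv.wt hr le_rfl hlo (b := c) (by omega)
      have w2 := Wt_f_smul w1 hr le_rfl (k := l + (c + 1)) (by omega) (by omega)
      have w3 := Wt_D (h0' w2) hr le_rfl hlo (b := c) (by omega)
      rw [TensorProduct.tmul_smul]
      exact Submodule.smul_mem _ _ (tmul_f_smul_mem_of_ne hN hS w3
        (D_mem_lowSub hN hS hr (h0' w2) hlo (by omega)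
          (h0 w2 (f_smul_mem_lowSub hN hS w1 (a := l + (c + 1)) (by omega) (by omega)
            (D_mem_lowSub hN hS hr hv.wt hlo (by omega) hk)))) (a := l + r) (by omega) (by omega) hl
            (by omega) (by omega) (by omega) (by omega))
    · rw [TensorProduct.tmul_zero]
      exact Submodule.zero_mem _
  · rw [TensorProduct.tmul_sum]
    refine Submodule.sum_mem _ fun m hm => ?_
    rw [Finset.mem_Icc] at hm
    rw [TensorProduct.tmul_smul]
    exact Submodule.smul_mem _ _ (tmul_D_mem hN hS hr (Wt_E (h0' hv.wt) hr le_rfl hlo hm.1 hm.2) hlo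
      (E_mem_lowSub hN hS hr (h0' hv.wt) hlo hm.1 hm.2 (h0 hv.wt hk)
        (j := 1 + 2 * c + 2 - m) (by omega)) hl (by omega) (by omega) hm.1 hm.2 (by omega))

/-- In the recursion only the term f_{α_k} F matters, because in F f_{α_k} the leading letters do
not move w_k. The q-number in front of it is the next factor of `tailCoeff`, up to sign. -/
theorem eqMod_fRoot {d k : ℕ} (hk : 1 ≤ k) (hkd : k + d = l) :
    EqMod S (w N (N - l) ⊗ₜ v) (w N k ⊗ₜ[ℂ] (fRoot hb N l P lam (d + 1) • v))
      (-qpow hb (-(coord lam k + coord lam (l + 1) + P + d)) *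
        tailCoeff hb l P c (coord lam) d) := by
  have hr := hP.or
  have hNr : N = 2 * l + r + c + 2 := by rcases h with h | h <;> omega
  have hhalf := h.half
  induction d generalizing k with
  | zero =>
    obtain rfl : k = l := by omega
    simpa using eqMod_fRoot_one hN hS hP hv hSv hk
  | succ d ih =>
    have h0 := mem_lowSub_zero h hSv
    rw [fRoot_add_two_smul lam (k := k) (by omega), TensorProduct.tmul_sub,
      TensorProduct.tmul_smul (qnum hb _), TensorProduct.tmul_smul (qnum hb _), sub_eq_add_neg,
      ← add_zero (_ * tailCoeff _ _ _ _ _ _)]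
    refine EqMod.add ?_ (EqMod.of_mem (Submodule.neg_mem _ (Submodule.smul_mem _ _ ?_)))
    · have h1 := EqMod.tmul_f_smul hN hS (Wt_fRoot hP lam hv.wt le_rfl (d := d + 1) (by omega))
        (fRoot_mem_lowSub hN hS hv.wt hP lam (d := d + 1) (by omega) h0) hk (by omega) hk
        (i := k) (by omega)
        (by rw [level, if_neg (by omega)]; omega) (j := k + 1) (by omega) (by omega)
        (by rw [rootPair, if_neg (by omega)]; exact Or.inl ⟨rfl, rfl⟩)
        (ih (k := k + 1) (by omega) (by omega)) rfl
      convert h1.smul _ using 1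
      have h2 : hp (l + c) (l + r) (coord lam - δ (l + 1 - (d + 1)) - δ (l + 1)) k =
          coord lam k - coord lam (k + 1) + 1 := by
        rw [hp_low (by omega)]
        simp only [δ, Pi.sub_apply]
        split_ifs <;> first | omega | (norm_num; ring)
      rw [h2, sgn_of_lt (by omega), mul_one, tailCoeff_succ, show l - d = k + 1 by omega,
        show -(coord lam k + coord lam (l + 1) + P + (d + 1 : ℕ)) =
          -(coord lam k - coord lam (k + 1) + 1) +
          -(coord lam (k + 1) + coord lam (l + 1) + P + d) by push_cast; ring, qpow_add]
      ring
    · exact tmul_fRoot_mem hN hS hP lam (Wt_f_smul hv.wt hr le_rfl hk (by omega)) (by omega)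
        (f_smul_mem_lowSub hN hS hv.wt hk (by omega) h0) hk (by omega) (by omega)

end

/-! ### Summation of the terms of the singular vector. -/

theorem Generic.qnum_add_one {hb : ℂ} (hq : Generic hb) (x : ℂ) :
    qnum hb (x + 1) = qpow hb 1 * qnum hb x + qpow hb (-x) := by
  have h1 := qpow_ne_zero hb 1
  have h2 := hq.sq_ne_one
  have h3 := qpow_ne_zero hb x
  simp only [qnum, qpow_neg, qpow_add]
  field_simp
  ring

theorem Generic.qnum_add {hb : ℂ} (hq : Generic hb) (a y : ℂ) :
    qnum hb (y + a) = qpow hb a * qnum hb y + qpow hb (-y) * qnum hb a := by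
  have h1 := qpow_ne_zero hb 1
  have h2 := hq.sq_ne_one
  have h3 := qpow_ne_zero hb a
  have h4 := qpow_ne_zero hb y
  simp only [qnum, qpow_neg, qpow_add]
  field_simp
  ring

theorem EqMod.congr {V : Type} [AddCommGroup V] [Module ℂ V] {S : Submodule ℂ V} {Z u : V}
    {s s' : ℂ} (h : EqMod S Z u s) (hs : s = s') : EqMod S Z u s' := hs ▸ h

section

variable {hb : ℂ} {hq : Generic hb} {N l c r : ℕ} {h : IsDim N (l + c) (l + r)}
  {M : Type} [AddCommGroup M] [Module ℂ M] [Module (Uq hb N) M] [IsScalarTower ℂ (Uq hb N) M]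
  {S : Submodule ℂ (NatTens N M)}
  (hN : 3 ≤ N) (hS : ∀ a, ∀ u ∈ S, tensAct (hb := hb) M (Gen.f a) u ∈ S)
  {P : ℕ} (hP : IsRank P c r) {lam : Fin (N / 2) → ℂ}
  {v : M} (hv : IsHW hq h 1 (coord lam) v) (hSv : ∀ i, 1 ≤ i → i + l < N → w N i ⊗ₜ v ∈ S)

variable (hq h) in
/-- The sum of the terms `w_i ⊗ y_i`, `j ≤ i`, of the singular vector. -/
def singTail (P : ℕ) (lam : Fin (N / 2) → ℂ) (v : M) (j : ℕ) : NatTens N M :=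
  ∑ i ∈ Finset.Ico j (N + 1), w N i ⊗ₜ[ℂ] sing hq h P lam v i

theorem singTail_eq {j : ℕ} (hj : j ≤ N) : singTail hq h P lam v j =
    w N j ⊗ₜ[ℂ] sing hq h P lam v j + singTail hq h P lam v (j + 1) :=
  Finset.sum_eq_sum_Ico_succ_bot (by omega) _

theorem singTail_one : singTail hq h P lam v 1 = ofCoeff N (sing hq h P lam v) := by
  rw [singTail, ofCoeff, Fin.sum_univ_eq_sum_range
    (fun i => w N (i + 1) ⊗ₜ[ℂ] sing hq h P lam v (i + 1)), Finset.range_eq_Ico,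
    Finset.sum_Ico_add' (fun i => w N i ⊗ₜ[ℂ] sing hq h P lam v i), zero_add]

include hN hS hP hv hSv

theorem eqMod_singTail_D {b j : ℕ} (hbc : b ≤ c) (hj : j + b = l + r + c + 2) :
    EqMod S (w N (N - l) ⊗ₜ v) (singTail hq h P lam v j)
      (kap hb l P (coord lam) * (-qpow hb 1) ^ (c + 1) * (qpow hb 1 ^ (j - (l + c + 3)) *
        qnum hb (coord lam (l + 1) + b))) := by
  have hr := hP.or
  have hNr : N = 2 * l + r + c + 2 := by rcases h with h | h <;> omega
  have h1 := eqMod_D hN hS hr hv hSv hbc (i := j) (by omega)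
  rw [singTail_eq (by omega), sing_D hr hbc hj, TensorProduct.tmul_smul]
  induction b generalizing j with
  | zero =>
    have h0 : singTail hq h P lam v (j + 1) = 0 := Finset.sum_eq_zero fun i hi => by
      rw [Finset.mem_Ico] at hi
      rw [sing_zero (by omega), TensorProduct.tmul_zero]
    rw [h0, add_zero, QSys.DX, if_pos rfl, TensorProduct.tmul_smul]
    refine ((h1.smul _).smul _).congr ?_
    rw [if_pos rfl]
    push_cast
    rw [add_zero, mul_one]
    ring
  | succ b ih =>
    have h2 := ih (j := j + 1) (by omega) (by omega) (eqMod_D hN hS hr hv hSv (by omega) (by omega))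
    rw [← TensorProduct.tmul_smul, ← sing_D hr (by omega) (show j + 1 + b = l + r + c + 2 by omega),
      ← singTail_eq (by omega)] at h2
    rw [QSys.DX, if_neg (by omega)]
    -- The new term adds q^{−(x+b)} to q[x + b], which makes [x + b + 1]: the sum telescopes at
    -- every step.
    refine ((h1.smul _).add h2).congr ?_
    rw [if_neg (by omega), show j + 1 - (l + c + 3) = j - (l + c + 3) + 1 by omega,
      show coord lam (l + 1) + (b + 1 : ℕ) = coord lam (l + 1) + b + 1 by push_cast; ring,
      hq.qnum_add_one, show -coord lam (l + 1) - (b + 1 : ℕ) + 1 = -(coord lam (l + 1) + b) by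
        push_cast; ring]
    ring

/-- For odd P this is already the sum of the terms D_b; for even P the second middle vector adds one
more step. The result is the same expression in P and c. -/
theorem eqMod_singTail_center :
    EqMod S (w N (N - l) ⊗ₜ v) (singTail hq h P lam v (l + c + 3))
      (kap hb l P (coord lam) * (-qpow hb 1) ^ (c + 1) *
        qnum hb (coord lam (l + 1) + P - (c + 1))) := by
  have hr := hP.or
  have hNr : N = 2 * l + r + c + 2 := by rcases h with h | h <;> omega
  have hP' := hP
  rcases hP' with ⟨h1, h2⟩ | ⟨h1, h2⟩
  · have h3 := eqMod_singTail_D hN hS hP hv hSv le_rfl (j := l + c + 3) (by omega)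
    refine h3.congr ?_
    rw [Nat.sub_self, pow_zero, one_mul, h2]
    congr 2
    push_cast
    ring
  · have h3 := eqMod_singTail_D hN hS hP hv hSv le_rfl (j := l + c + 4) (by omega)
    rw [singTail_eq (by omega), sing_alt h1, TensorProduct.tmul_smul]
    refine (((eqMod_f_D hN hS hr hv hSv (Or.inr ⟨h1, rfl, rfl⟩)).smul _).add h3).congr ?_
    rw [show l + c + 4 - (l + c + 3) = 1 by omega, pow_one, h2,
      show coord lam (l + 1) + (2 * c + 2 : ℕ) - (c + 1) = coord lam (l + 1) + c + 1 by
        push_cast; ring, hq.qnum_add_one,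
      show -coord lam (l + 1) - (c : ℂ) = -(coord lam (l + 1) + c) by ring]
    ring

/-- The first q-number telescopes as before. The term w_{l+c+2} ⊗ y_{l+c+2}, which starts the upper
half, leaves a separate power of q that is carried along until f_{2ε} v is added. -/
theorem eqMod_singTail_E {m : ℕ} (hm : 1 ≤ m) (hmc : m ≤ c + 1) :
    EqMod S (w N (N - l) ⊗ₜ v) (singTail hq h P lam v (l + 1 + m))
      (kap hb l P (coord lam) * ((-1) ^ (c + 1) * qpow hb 1 ^ m *
        (qnum hb (coord lam (l + 1) + P - m) + qpow hb (-coord lam (l + 1) - m + 1)))) := by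
  have hr := hP.or
  have hNr : N = 2 * l + r + c + 2 := by rcases h with h | h <;> omega
  obtain ⟨i, hi⟩ : ∃ i, m + i = c + 1 := ⟨c + 1 - m, by omega⟩
  induction i generalizing m with
  | zero =>
    obtain rfl : m = c + 1 := by omega
    have h1 := eqMod_singTail_center hN hS hP hv hSv
    have h2 := eqMod_f_D hN hS hr hv hSv (b := r) (i := l + 1 + (c + 1)) (Or.inl ⟨rfl, by omega⟩)
    rw [← QSys.E_top] at h2
    rw [singTail_eq (by omega), sing_E hm hmc, TensorProduct.tmul_smul,
      show l + 1 + (c + 1) + 1 = l + c + 3 by omega]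
    refine ((h2.smul _).add h1).congr ?_
    rw [show -coord lam (l + 1) - (c + 1 : ℕ) + 1 = -coord lam (l + 1) - c by push_cast; ring,
      neg_pow]
    push_cast
    ring
  | succ i ih =>
    have h2 := eqMod_E hN hS hP hv hSv hm (by omega)
    rw [singTail_eq (by omega), sing_E hm hmc, TensorProduct.tmul_smul]
    refine ((h2.smul _).add (ih (m := m + 1) (by omega) (by omega) (by omega))).congr ?_
    have h3 : ((-1 : ℂ) ^ m) * (-1) ^ (c + 1 - m) = (-1) ^ (c + 1) := by
      rw [← pow_add]
      congr 1
      omega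
    have h4 := hq.qnum_add_one (coord lam (l + 1) + P - (m + 1))
    have h5 : qpow hb (-coord lam (l + 1) - m + 1) =
        qpow hb 1 * qpow hb (-coord lam (l + 1) - (m + 1) + 1) := by
      rw [← qpow_add]
      congr 1
      ring
    rw [show coord lam (l + 1) + P - (m + 1) + 1 = coord lam (l + 1) + P - m by ring] at h4
    rw [h4, h5, neg_pow, ← h3, show -(coord lam (l + 1) + P - (m + 1)) =
      -coord lam (l + 1) - P + 1 + (m : ℂ) by ring]
    push_cast
    ring

theorem eqMod_singTail_low {d k : ℕ} (hkd : k + d = l) :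
    EqMod S (w N (N - l) ⊗ₜ v) (singTail hq h P lam v (k + 1))
      (chain hb l P (coord lam) k * tailCoeff hb l P c (coord lam) d) := by
  have hr := hP.or
  have hNr : N = 2 * l + r + c + 2 := by rcases h with h | h <;> omega
  induction d generalizing k with
  | zero =>
    obtain rfl : k = l := by omega
    have h1 := eqMod_singTail_E hN hS hP hv hSv le_rfl (Nat.le_add_left 1 c)
    have h2 := eqMod_Phi hN hS hP hv hSv
    rw [show (locSys hq h M).Phi P v = fRoot hb N k P lam 0 • v from
      uqSys_Phi hq h (lo := 1) (by omega) M P lam v] at h2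
    rw [singTail_eq (by omega), sing_low le_rfl, TensorProduct.tmul_smul, Nat.sub_self]
    refine ((h2.smul _).add h1).congr ?_
    rw [kap, tailCoeff, Finset.prod_range_zero, mul_one, mul_assoc, ← mul_add]
    congr 1
    -- With X = x + P/2 − 1, the expansions of [X + 1] and of [X + P/2] = [x + P − 1] show that [X +
    -- 1][x + P − 1] is the sum of the contributions from f_{2ε} v, from the telescoped q-number and
    -- from the separate power of q.
    have h3 := hq.qnum_add_one (coord lam (k + 1) + P / 2 - 1)
    have h4 := hq.qnum_add (P / 2) (coord lam (k + 1) + P / 2 - 1)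
    have h5 : qpow hb (-2 * coord lam (k + 1) - P + 2) =
        qpow hb (-(coord lam (k + 1) + P / 2 - 1)) * (qpow hb (-(coord lam (k + 1) + P / 2 - 1))) := by
      rw [← qpow_add]
      congr 1
      ring
    have h6 : qpow hb (-coord lam (k + 1) - (1 : ℕ) + 1) =
        qpow hb (-(coord lam (k + 1) + P / 2 - 1)) * qpow hb (P / 2) * qpow hb (-1) := by
      rw [← qpow_add, ← qpow_add]
      congr 1
      push_cast
      ring
    rw [sub_add_cancel] at h3
    rw [show coord lam (k + 1) + (P : ℂ) / 2 - 1 + P / 2 = coord lam (k + 1) + P - 1 by ring] at h4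
    rw [h5, h6, h3, Nat.cast_one, h4, qpow_neg hb 1]
    have h7 := qpow_ne_zero hb 1
    field_simp
    ring
  | succ d ih =>
    have h1 := eqMod_fRoot hN hS hP hv hSv (k := k + 1) (d := d) (by omega) (by omega)
    have h2 := ih (k := k + 1) (by omega)
    rw [singTail_eq (by omega), sing_low (by omega), TensorProduct.tmul_smul,
      show l - k = d + 1 by omega]
    -- With A = λ_{k+1} + x + P + d the term w_{k+1} ⊗ y_{k+1} contributes −q^{−A} and the rest
    -- −q[A], which together give −[A + 1].
    refine ((h1.smul _).add h2).congr ?_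
    rw [tailCoeff_succ, hq.qnum_add_one, chain, chain, Finset.prod_range_succ,
      show l - d = k + 1 by omega, ← hkd]
    push_cast
    rw [show coord lam (k + 1) + coord lam (k + (d + 1) + 1) + (P : ℂ) + (k + (d + 1)) - (k + 1) =
      coord lam (k + 1) + coord lam (k + (d + 1) + 1) + (P : ℂ) + d by ring]
    ring

theorem ofCoeff_sing_sub_mem :
    ofCoeff N (sing hq h P lam v) - Chat hb N l P lam • (w N (N - l) ⊗ₜ[ℂ] v) ∈ S := by
  have h1 := eqMod_singTail_low hN hS hP hv hSv (k := 0) (zero_add l)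
  rw [zero_add, singTail_one, chain, Finset.prod_range_zero, one_mul] at h1
  suffices h2 : Chat hb N l P lam = tailCoeff hb l P c (coord lam) l by
    rw [h2]
    exact h1
  have hdim : dim0 P = c + 1 := hP.dim0
  -- For P = 1 the index l + 2 is that of the zero weight w_{n+1}; in all other cases λ_{l+2}
  -- vanishes by the hypothesis on λ.
  have hz : coord lam (l + 2) = 0 := by
    rcases h with ⟨h2, h3⟩ | ⟨h2, h3⟩
    · by_cases hc : c = 0
      · have h4 : natWeight N (l + 2) = 0 := by
          rw [show l + 2 = N / 2 + 1 by omega]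
          exact natWeight_center (by rw [Nat.odd_iff]; omega)
        simp [coord, h4, pair]
      · exact hv.zero _ le_rfl (by omega)
    · exact hv.zero _ le_rfl (by omega)
  have herase : (Finset.Icc 1 (l + 2)).erase (l + 1) = insert (l + 2) (Finset.Icc 1 l) := by
    ext i
    simp only [Finset.mem_erase, Finset.mem_Icc, Finset.mem_insert]
    omega
  rw [Chat, tailCoeff, herase, Finset.prod_insert (by simp), hz, Finset.prod_neg,
    Finset.card_range, show (P + 1) / 2 = c + 1 from hdim, pow_add _ (c + 1) l]
  have hprod : ∏ j ∈ Finset.Icc 1 l, qnum hb (coord lam j + coord lam (l + 1) + P + 1 + l - j) =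
      ∏ j ∈ Finset.range l, qnum hb (coord lam (l - j) + coord lam (l + 1) + P + j + 1) := by
    rw [← Finset.prod_range_reflect, ← Finset.Ico_add_one_right_eq_Icc, Finset.prod_Ico_eq_prod_range]
    refine Finset.prod_congr (by simp) fun j hj => ?_
    rw [Finset.mem_range] at hj
    rw [show l - (l - 1 - j) = 1 + j by omega]
    congr 1
    have : ((l - 1 - j : ℕ) : ℂ) = l - 1 - j := by
      rw [Nat.cast_sub (by omega), Nat.cast_sub (by omega)]
      simp
    rw [this]
    push_cast
    ring
  rw [hprod]
  push_cast
  rw [show (0 : ℂ) + coord lam (l + 1) + P + 1 + l - (l + 2) = coord lam (l + 1) + P - 1 by ring]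
  ring

end

/-! ### q-Serre elements as iterated q-commutators -/

section Adjoint

variable {A : Type} [Ring A] [Algebra ℂ A]

/-- The iterated q-commutator of `x` with `y`. -/
def qad (σ d : ℂ) (x y : A) : ℕ → A
  | 0 => y
  | k + 1 => x * qad σ d x y k - (σ * d ^ k)⁻¹ • (qad σ d x y k * x)

theorem qad_mul_of_commute {σ d α β : ℂ} {x y t : A} (hx : t * x = α • (x * t))
    (hy : t * y = β • (y * t)) (k : ℕ) :
    t * qad σ d x y k = (β * α ^ k) • (qad σ d x y k * t) := by
  induction k with
  | zero => simpa [qad] using hy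
  | succ k ih =>
    generalize hz : qad σ d x y k = z at ih
    have a1 : t * x * z = (β * α ^ (k + 1)) • (x * z * t) := by
      rw [hx, smul_mul_assoc, mul_assoc, ih, mul_smul_comm, smul_smul, mul_assoc x z]
      congr 1; ring
    have a2 : t * z * x = (β * α ^ (k + 1)) • (z * x * t) := by
      rw [ih, smul_mul_assoc, mul_assoc, hx, mul_smul_comm, smul_smul, ← mul_assoc]
      congr 1; ring
    rw [qad, hz]
    simp only [mul_sub, sub_mul, mul_smul_comm, smul_mul_assoc, ← mul_assoc]
    rw [a1, a2, smul_sub, smul_comm]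

/-- One step of the induction in `qad_comm_left`: z is an iterated commutator, w the previous one,
and s = τ⁻¹ is the scalar for which the terms with ti cancel. -/
theorem qad_comm_step {e x z w t ti : A} {κ c d τ s : ℂ} (hex : e * x = x * e + κ • (t - ti))
    (hez : e * z = z * e + c • (w * t)) (htx : t * x = d • (x * t)) (htz : t * z = τ • (z * t))
    (hiz : ti * z = τ⁻¹ • (z * ti)) (hw : c • (x * w - (s * d) • (w * x)) = c • z)
    (hs : s = τ⁻¹) :
    e * (x * z - s • (z * x)) =
      (x * z - s • (z * x)) * e + (c + κ * (τ - τ⁻¹)) • (z * t) := by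
  have a1 : e * x * z = x * z * e + c • (x * w * t) + κ • (τ • (z * t) - τ⁻¹ • (z * ti)) := by
    rw [hex, add_mul, smul_mul_assoc, sub_mul, htz, hiz, mul_assoc, hez, mul_add, mul_smul_comm]
    simp only [← mul_assoc]
  have a2 : e * z * x = z * x * e + κ • (z * t - z * ti) + (c * d) • (w * x * t) := by
    rw [hez, add_mul, smul_mul_assoc, mul_assoc w, htx, mul_assoc, hex, mul_add, mul_smul_comm,
      mul_smul_comm, smul_smul, mul_sub]
    simp only [← mul_assoc]
  have a3 := congrArg (· * t) hw
  simp only [mul_sub, sub_mul, mul_smul_comm, smul_mul_assoc, ← mul_assoc] at a3 ⊢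
  subst hs
  linear_combination (norm := module) a1 - τ⁻¹ • a2 + a3

theorem qad_comm_left {σ d κ : ℂ} (hd : d ≠ 0) {e x y t ti : A}
    (hex : e * x = x * e + κ • (t - ti)) (hey : e * y = y * e)
    (htx : t * x = d • (x * t)) (hty : t * y = σ • (y * t))
    (hix : ti * x = d⁻¹ • (x * ti)) (hiy : ti * y = σ⁻¹ • (y * ti)) (k : ℕ) :
    e * qad σ d x y (k + 1) = qad σ d x y (k + 1) * e +
      (κ * ∑ i ∈ Finset.range (k + 1), (σ * d ^ i - (σ * d ^ i)⁻¹)) • (qad σ d x y k * t) := by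
  induction k with
  | zero =>
    have := qad_comm_step (w := 0) (c := 0) (z := y) (s := σ⁻¹) hex (by simp [hey]) htx hty hiy (by simp) rfl
    simpa [qad] using this
  | succ k ih =>
    have := qad_comm_step hex ih htx (qad_mul_of_commute htx hty (k + 1)) ?_
      (s := (σ * d ^ (k + 1))⁻¹) ?_ rfl
    · rw [Finset.sum_range_succ, mul_add]
      exact this
    · rw [qad_mul_of_commute hix hiy, mul_inv, inv_pow]
    · have : (σ * d ^ (k + 1))⁻¹ * d = (σ * d ^ k)⁻¹ := by
        rw [pow_succ, ← mul_assoc, mul_inv, mul_assoc, inv_mul_cancel₀ hd, mul_one]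
      rw [this, qad]

/-- The q-commutators of `x` with the Cartan part of `[e, y]`. -/
theorem qad_comm_right {σ d κ : ℂ} (hσ : σ ≠ 0) {e x y t ti : A} (hex : e * x = x * e)
    (hey : e * y = y * e + κ • (t - ti)) (htx : t * x = σ • (x * t))
    (hix : ti * x = σ⁻¹ • (x * ti)) (k : ℕ) :
    ∃ a : ℂ, e * qad σ d x y (k + 1) = qad σ d x y (k + 1) * e +
      ((1 - (σ * d ^ k)⁻¹ * σ⁻¹) * a) • (x ^ (k + 1) * ti) := by
  have key : ∀ (s a b : ℂ) (n : ℕ) (z : A),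
      e * z = z * e + a • (x ^ n * ti) + b • t → b * (1 - s * σ) = 0 →
      e * (x * z - s • (z * x)) = (x * z - s • (z * x)) * e +
        ((1 - s * σ⁻¹) * a) • (x ^ (n + 1) * ti) := by
    intro s a b n z hz hs
    have a1 : e * x * z = x * z * e + a • (x ^ (n + 1) * ti) + b • (x * t) := by
      rw [hex, mul_assoc, hz, mul_add, mul_add, mul_smul_comm, mul_smul_comm, pow_succ']
      simp only [← mul_assoc]
    have a2 : e * z * x = z * x * e + (a * σ⁻¹) • (x ^ (n + 1) * ti) + (b * σ) • (x * t) := by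
      rw [hz, add_mul, add_mul, smul_mul_assoc, smul_mul_assoc, mul_assoc z, hex, mul_assoc _ ti, hix,
        mul_smul_comm, htx, smul_smul, smul_smul, pow_succ]
      simp only [← mul_assoc]
    have a3 : (b * (1 - s * σ)) • (x * t) = 0 := by rw [hs, zero_smul]
    simp only [mul_sub, sub_mul, mul_smul_comm, smul_mul_assoc, ← mul_assoc]
    linear_combination (norm := module) a1 - s • a2 + a3
  induction k with
  | zero =>
    refine ⟨-κ, ?_⟩
    rw [qad, qad]
    refine key _ _ κ 0 y ?_ ?_
    · rw [hey, pow_zero, one_mul]; module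
    · rw [pow_zero, mul_one, inv_mul_cancel₀ hσ, sub_self, mul_zero]
  | succ k ih =>
    obtain ⟨a, ha⟩ := ih
    exact ⟨_, key _ _ 0 _ _ (ha.trans (by rw [zero_smul ℂ t, add_zero])) (zero_mul _)⟩

theorem qad_comm_of_comm {σ d : ℂ} {e x y : A} (hex : e * x = x * e) (hey : e * y = y * e) (k : ℕ) :
    e * qad σ d x y k = qad σ d x y k * e := by
  have := qad_mul_of_commute (σ := σ) (d := d) (α := 1) (β := 1) (t := e) (x := x)
    (y := y) (by simpa using hex) (by simpa using hey) k
  simpa using this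

/-- Since (σ d^i)(σ d^{m−i}) = σ² d^m = 1, the sum of σ d^i − (σ d^i)⁻¹ over 0 ≤ i ≤ m is
antisymmetric under i ↦ m − i and vanishes. For m = −2(α, β)/(α, α) this is the commutation of a
q-Serre element with e_α. -/
theorem qad_commute_left {σ d κ : ℂ} (hd : d ≠ 0) {e x y t ti : A} {m : ℕ}
    (hσ : σ ^ 2 * d ^ m = 1)
    (hex : e * x = x * e + κ • (t - ti)) (hey : e * y = y * e)
    (htx : t * x = d • (x * t)) (hty : t * y = σ • (y * t))
    (hix : ti * x = d⁻¹ • (x * ti)) (hiy : ti * y = σ⁻¹ • (y * ti)) :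
    e * qad σ d x y (m + 1) = qad σ d x y (m + 1) * e := by
  rw [qad_comm_left hd hex hey htx hty hix hiy, Finset.sum_sub_distrib,
    ← Finset.sum_range_reflect (fun i => (σ * d ^ i)⁻¹), Finset.sum_congr rfl
      (g := fun i => (σ * d ^ (m + 1 - 1 - i))⁻¹), sub_self, mul_zero, zero_smul, add_zero]
  intro i hi
  rw [Finset.mem_range] at hi
  apply eq_inv_of_mul_eq_one_left
  rw [mul_mul_mul_comm, ← pow_add, ← pow_two, show i + (m + 1 - 1 - i) = m by omega, hσ]

/-- Here e meets y, and the first q-commutator removes the part with t. What remains carries the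
factor 1 − (σ² d^m)⁻¹ = 0. -/
theorem qad_commute_right {σ d κ : ℂ} (hσ0 : σ ≠ 0) {e x y t ti : A} {m : ℕ}
    (hσ : σ ^ 2 * d ^ m = 1) (hex : e * x = x * e)
    (hey : e * y = y * e + κ • (t - ti)) (htx : t * x = σ • (x * t))
    (hix : ti * x = σ⁻¹ • (x * ti)) :
    e * qad σ d x y (m + 1) = qad σ d x y (m + 1) * e := by
  obtain ⟨a, ha⟩ := qad_comm_right (d := d) hσ0 hex hey htx hix m
  rw [ha, ← mul_inv, mul_right_comm, ← pow_two, hσ, inv_one, sub_self, zero_mul, zero_smul,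
    add_zero]

end Adjoint

theorem serre_eq_quartic {A : Type} [Ring A] [Algebra ℂ A] {hb : ℂ} (hq : Generic hb) {N : ℕ}
    {a b : Fin (N / 2)} (h1 : ip (simpleRoot N a) (simpleRoot N a) = 1)
    (h2 : ip (simpleRoot N a) (simpleRoot N b) = -1) (x y : A) :
    serre hb N a b x y = x * x * x * y - (qpow hb 1 + 1 + qpow hb (-1)) • (x * x * y * x)
      + (qpow hb 1 + 1 + qpow hb (-1)) • (x * y * x * x) - y * x * x * x := by
  have hu : ∀ z, qpow (hb / 2) z = qpow hb (z / 2) := fun z => by unfold qpow; ring_nf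
  have hq1 : ∀ m : ℕ, 0 < m → qnum (hb / 2) m ≠ 0 := fun m hm => by
    unfold qnum
    rw [hu, hu, hu, hu, neg_div, neg_div]
    refine div_ne_zero (hq.sub_ne_zero hm) ?_
    have := hq.sub_ne_zero (m := 1) one_pos
    simpa using this
  have e1 : qnum (hb / 2) 1 ≠ 0 := by simpa using hq1 1 one_pos
  have e2 : qnum (hb / 2) 2 ≠ 0 := by simpa using hq1 2 two_pos
  have e3 : qnum (hb / 2) 3 ≠ 0 := by simpa using hq1 3 three_pos
  have e0 : qnum (hb / 2) 1 = 1 := by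
    unfold qnum at e1 ⊢
    exact div_self fun h => e1 (by rw [h, div_zero])
  have e4 : qnum (hb / 2) 3 = qpow hb 1 + 1 + qpow hb (-1) := by
    have h3 : qpow (hb / 2) 1 - (qpow (hb / 2) 1)⁻¹ ≠ 0 := by
      rw [← qpow_neg]
      intro h
      apply e1
      rw [qnum, h, div_zero]
    have h4 : qpow hb 1 = qpow (hb / 2) 1 * qpow (hb / 2) 1 := by
      rw [← qpow_add, hu]; norm_num
    have h5 := qpow_ne_zero (hb / 2) 1
    rw [qnum, qpow_neg, qpow_neg, qpow_neg, h4, show (3 : ℂ) = 1 + 1 + 1 by norm_num, qpow_add,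
      qpow_add, div_eq_iff h3]
    field_simp
    ring
  unfold serre
  rw [h2, h1]
  have h4 : (1 - 2 * -1 / 1 : ℤ).toNat = 3 := rfl
  have h5 : hb * ((1 : ℤ) : ℂ) / 2 = hb / 2 := by push_cast; ring
  have f0 : qfact (hb / 2) 0 = 1 := qfact_zero _
  have f1 : qfact (hb / 2) 1 = 1 := by rw [qfact_one, e0]
  have f2 : qfact (hb / 2) 2 = qnum (hb / 2) 2 := by rw [qfact_two, e0, one_mul]
  have f3 : qfact (hb / 2) 3 = qnum (hb / 2) 2 * qnum (hb / 2) 3 := by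
    norm_num [qfact, Finset.prod_range_succ, e0]
  have b0 : qbinom (hb / 2) 3 0 = 1 := by
    rw [qbinom, f0, one_mul, div_self]
    rw [f3]; exact mul_ne_zero e2 e3
  have b3 : qbinom (hb / 2) 3 3 = 1 := by
    rw [qbinom, Nat.sub_self, f0, mul_one, div_self]
    rw [f3]; exact mul_ne_zero e2 e3
  have b1 : qbinom (hb / 2) 3 1 = qpow hb 1 + 1 + qpow hb (-1) := by
    rw [qbinom, f1, f2, f3, ← e4, one_mul, mul_div_cancel_left₀ _ e2]
  have b2 : qbinom (hb / 2) 3 2 = qpow hb 1 + 1 + qpow hb (-1) := by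
    rw [qbinom, f2, f1, f3, ← e4, mul_one, mul_div_cancel_left₀ _ e2]
  simp only [h4, h5, Finset.sum_range_succ, Finset.sum_range_zero, b0, b1, b2, b3]
  norm_num [pow_succ, ← mul_assoc]
  module

/-- The q-Serre element is an iterated q-commutator. -/
theorem serre_eq_qad {A : Type} [Ring A] [Algebra ℂ A] {hb : ℂ} (hq : Generic hb) {N c r : ℕ}
    (h : IsDim N c r) {a b : Fin (N / 2)} (hab : a ≠ b) : ∃ m : ℕ,
    (qpow hb (-ip (simpleRoot N a) (simpleRoot N b))) ^ 2 *
      (qpow hb (-ip (simpleRoot N a) (simpleRoot N a))) ^ m = 1 ∧ ∀ x y : A,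
    serre hb N a b x y = qad (qpow hb (-ip (simpleRoot N a) (simpleRoot N b)))
      (qpow hb (-ip (simpleRoot N a) (simpleRoot N a))) x y (m + 1) := by
  have hh := h.half
  have ha := a.2
  have hb' := b.2
  have c1 : ip (simpleRoot N a) (simpleRoot N a) = car c r (a + 1) (a + 1) :=
    ip_simpleRootAt h (by omega) (by omega) (by omega) (by omega)
  have c2 : ip (simpleRoot N a) (simpleRoot N b) = car c r (a + 1) (b + 1) :=
    ip_simpleRootAt h (by omega) (by omega) (by omega) (by omega)
  have hne : (a : ℕ) ≠ b := fun h => hab (Fin.ext h)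
  have d1 : car c r (a + 1) (b + 1) = 0 ∨ car c r (a + 1) (b + 1) = -1 := by
    unfold car; split_ifs <;> omega
  have q1 := qpow_ne_zero hb 1
  rcases d1 with d1 | d1
  · refine ⟨0, by rw [c2, d1]; simp [qpow_zero], fun x y => ?_⟩
    rw [serre_eq_comm hq (by rw [c1]; exact car_self_eq _ _ _) (c2.trans d1), c2, d1]
    simp [qad, qpow_zero]
  · rcases car_self_eq c r (a + 1) with d2 | d2
    · refine ⟨2, ?_, fun x y => ?_⟩
      · rw [c2, d1, c1, d2]
        norm_num [qpow_neg]
        field_simp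
      · rw [serre_eq_quartic hq (c1.trans d2) (c2.trans d1), c2, d1, c1, d2]
        norm_num [qad, qpow_neg, mul_sub, sub_mul, smul_sub, ← mul_assoc, smul_smul]
        have : (qpow hb 1)⁻¹ * qpow hb 1 = 1 := inv_mul_cancel₀ q1
        match_scalars <;> field_simp <;> ring
    · refine ⟨1, ?_, fun x y => ?_⟩
      · rw [c2, d1, c1, d2]
        norm_num [qpow_neg, qpow_two]
        field_simp
      · rw [serre_eq_cubic hq (c1.trans d2) (c2.trans d1), c2, d1, c1, d2, hq.qnum_two]
        norm_num [qad, qpow_neg, qpow_two, mul_sub, sub_mul, smul_sub, ← mul_assoc, smul_smul]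
        match_scalars <;> field_simp
        ring

/-! ### The Verma module of the algebra without Serre relations -/

/-- The space of words in the `f_α`. -/
abbrev Words (N : ℕ) : Type := List (Fin (N / 2)) →₀ ℂ

theorem ip_comm {N : ℕ} (x y : Fin (N / 2) → ℤ) : ip x y = ip y x := by
  unfold ip
  exact Finset.sum_congr rfl fun _ _ => mul_comm _ _

namespace Words

variable {N : ℕ}

theorem hom_ext {V : Type} [AddCommGroup V] [Module ℂ V] {φ ψ : Words N →ₗ[ℂ] V}
    (h : ∀ L, φ (Finsupp.single L 1) = ψ (Finsupp.single L 1)) : φ = ψ :=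
  Finsupp.lhom_ext' fun L => LinearMap.ext_ring (h L)

/-- The value of the weight of a word on the coroot of `α_a`. -/
def ht (lam : Fin (N / 2) → ℂ) (a : Fin (N / 2)) (L : List (Fin (N / 2))) : ℂ :=
  pair lam (simpleRoot N a) - (L.map fun b => (ip (simpleRoot N a) (simpleRoot N b) : ℂ)).sum

theorem ht_cons (lam : Fin (N / 2) → ℂ) (a b : Fin (N / 2)) (L : List (Fin (N / 2))) :
    ht lam a (b :: L) = ht lam a L - ip (simpleRoot N a) (simpleRoot N b) := by
  simp only [ht, List.map_cons, List.sum_cons]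
  ring

/-- The action of `f_α` on words. -/
def F (b : Fin (N / 2)) : Module.End ℂ (Words N) := Finsupp.lmapDomain ℂ ℂ (List.cons b)

theorem F_single (b : Fin (N / 2)) (L : List (Fin (N / 2))) (z : ℂ) :
    F b (Finsupp.single L z) = Finsupp.single (b :: L) z := by
  simp [F, Finsupp.mapDomain_single]

variable (hb : ℂ) (lam : Fin (N / 2) → ℂ)

/-- The action of `t_α ^ s` on words. -/
def T (s : ℂ) (a : Fin (N / 2)) : Module.End ℂ (Words N) :=
  Finsupp.linearCombination ℂ fun L => qpow hb (s * ht lam a L) • Finsupp.single L 1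

theorem T_single (s : ℂ) (a : Fin (N / 2)) (L : List (Fin (N / 2))) :
    T hb lam s a (Finsupp.single L 1) = qpow hb (s * ht lam a L) • Finsupp.single L 1 := by
  rw [T, Finsupp.linearCombination_single, one_smul]

/-- The action of `e_α` on a word. -/
def eWord (a : Fin (N / 2)) : List (Fin (N / 2)) → Words N
  | [] => 0
  | b :: L => F b (eWord a L) + if a = b then qnum hb (ht lam a L) • Finsupp.single L 1 else 0

/-- The action of `e_α` on words. -/
def E (a : Fin (N / 2)) : Module.End ℂ (Words N) := Finsupp.linearCombination ℂ (eWord hb lam a)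

theorem E_single (a : Fin (N / 2)) (L : List (Fin (N / 2))) :
    E hb lam a (Finsupp.single L 1) = eWord hb lam a L := by
  rw [E, Finsupp.linearCombination_single, one_smul]

theorem T_mul_T (s s' : ℂ) (a b : Fin (N / 2)) :
    T hb lam s a * T hb lam s' b = T hb lam s' b * T hb lam s a := hom_ext fun L => by
  simp only [Module.End.mul_apply, T_single, map_smul]
  exact smul_comm _ _ _

theorem T_mul_T_of_add_eq_zero {s s' : ℂ} (hs : s + s' = 0) (a : Fin (N / 2)) :
    T hb lam s a * T hb lam s' a = 1 := hom_ext fun L => by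
  simp only [Module.End.mul_apply, T_single, map_smul, Module.End.one_apply]
  rw [smul_smul, ← qpow_add, ← add_mul, add_comm, hs, zero_mul, qpow_zero, one_smul]

theorem T_mul_F (s : ℂ) (a b : Fin (N / 2)) : T hb lam s a * F b =
    qpow hb (-s * ip (simpleRoot N a) (simpleRoot N b)) • (F b * T hb lam s a) :=
  hom_ext fun L => by
    simp only [Module.End.mul_apply, LinearMap.smul_apply, T_single, F_single, map_smul]
    rw [smul_smul, ← qpow_add, ht_cons]
    congr 2
    ring

theorem T_mul_E (s : ℂ) (a b : Fin (N / 2)) : T hb lam s a * E hb lam b =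
    qpow hb (s * ip (simpleRoot N a) (simpleRoot N b)) • (E hb lam b * T hb lam s a) :=
  hom_ext fun L => by
    simp only [Module.End.mul_apply, LinearMap.smul_apply, T_single, E_single, map_smul]
    rw [smul_smul, ← qpow_add]
    induction L with
    | nil => simp [eWord]
    | cons c L ih =>
      have h1 := LinearMap.congr_fun (T_mul_F hb lam s a c) (eWord hb lam b L)
      simp only [Module.End.mul_apply, LinearMap.smul_apply] at h1
      rw [eWord, map_add, h1, ih, map_smul, smul_smul, ← qpow_add, smul_add, ht_cons]
      congr 1
      · congr 2
        ring
      · split_ifs with h2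
        · subst h2
          rw [map_smul, T_single, smul_comm]
          congr 2
          ring
        · simp

theorem E_mul_F (a : Fin (N / 2)) : E hb lam a * F a = F a * E hb lam a +
    (qpow hb 1 - qpow hb (-1))⁻¹ • (T hb lam 1 a - T hb lam (-1) a) := hom_ext fun L => by
  simp only [Module.End.mul_apply, LinearMap.smul_apply, LinearMap.add_apply, LinearMap.sub_apply,
    T_single, E_single, F_single, eWord, if_true]
  rw [← sub_smul, smul_smul, one_mul, neg_one_mul, qnum, div_eq_inv_mul]

theorem E_mul_F_ne {a b : Fin (N / 2)} (hab : a ≠ b) : E hb lam a * F b = F b * E hb lam a :=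
  hom_ext fun L => by
    simp only [Module.End.mul_apply, E_single, F_single, eWord, if_neg hab, add_zero]

section Serre

variable {hb} (hq : Generic hb) {c r : ℕ} (h : IsDim N c r)
include hq h

theorem T_mul_serre (s : ℂ) {a b : Fin (N / 2)} (hab : a ≠ b) (k : Fin (N / 2)) : ∃ z : ℂ,
    T hb lam s k * serre hb N a b (F a) (F b) = z • (serre hb N a b (F a) (F b) * T hb lam s k) := by
  obtain ⟨m, -, h2⟩ := serre_eq_qad (A := Module.End ℂ (Words N)) hq h hab
  exact ⟨_, by rw [h2]; exact qad_mul_of_commute (T_mul_F hb lam s k a) (T_mul_F hb lam s k b) _⟩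

/-- The reason why the q-Serre relations for the f_α can be imposed on words: their left multiples
are carried along by every e_k. -/
theorem E_mul_serre {a b : Fin (N / 2)} (hab : a ≠ b) (k : Fin (N / 2)) :
    E hb lam k * serre hb N a b (F a) (F b) = serre hb N a b (F a) (F b) * E hb lam k := by
  obtain ⟨m, h1, h2⟩ := serre_eq_qad (A := Module.End ℂ (Words N)) hq h hab
  rw [h2]
  have hT : ∀ i j, T hb lam 1 i * F j = qpow hb (-ip (simpleRoot N i) (simpleRoot N j)) •
      (F j * T hb lam 1 i) := fun i j => by rw [T_mul_F, neg_one_mul]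
  have hT' : ∀ i j, T hb lam (-1) i * F j =
      (qpow hb (-ip (simpleRoot N i) (simpleRoot N j)))⁻¹ • (F j * T hb lam (-1) i) := fun i j => by
    rw [T_mul_F, ← qpow_neg, neg_neg, neg_neg, one_mul]
  rcases eq_or_ne k a with rfl | hka
  · exact qad_commute_left (qpow_ne_zero _ _) h1 (E_mul_F hb lam k) (E_mul_F_ne hb lam hab)
      (hT _ _) (hT _ _) (hT' _ _) (hT' _ _)
  · rcases eq_or_ne k b with rfl | hkb
    · rw [ip_comm (simpleRoot N a) (simpleRoot N k)] at h1 ⊢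
      exact qad_commute_right (qpow_ne_zero _ _) h1 (E_mul_F_ne hb lam hka) (E_mul_F hb lam k)
        (hT _ _) (hT' _ _)
    · exact qad_comm_of_comm (E_mul_F_ne hb lam hka) (E_mul_F_ne hb lam hkb) _

/-- The same commutator computation with e and f, and t and t⁻¹, exchanged. -/
theorem serre_E_mul_F {a b : Fin (N / 2)} (hab : a ≠ b) (k : Fin (N / 2)) :
    F k * serre hb N a b (E hb lam a) (E hb lam b) =
      serre hb N a b (E hb lam a) (E hb lam b) * F k := by
  obtain ⟨m, h1, h2⟩ := serre_eq_qad (A := Module.End ℂ (Words N)) hq h hab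
  rw [h2]
  have hT : ∀ i j, T hb lam (-1) i * E hb lam j =
      qpow hb (-ip (simpleRoot N i) (simpleRoot N j)) • (E hb lam j * T hb lam (-1) i) :=
    fun i j => by rw [T_mul_E, neg_one_mul]
  have hT' : ∀ i j, T hb lam 1 i * E hb lam j =
      (qpow hb (-ip (simpleRoot N i) (simpleRoot N j)))⁻¹ • (E hb lam j * T hb lam 1 i) :=
    fun i j => by rw [T_mul_E, ← qpow_neg, neg_neg, one_mul]
  have hF : F k * E hb lam k = E hb lam k * F k +
      (qpow hb 1 - qpow hb (-1))⁻¹ • (T hb lam (-1) k - T hb lam 1 k) := by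
    rw [E_mul_F]; module
  rcases eq_or_ne k a with rfl | hka
  · exact qad_commute_left (qpow_ne_zero _ _) h1 hF (E_mul_F_ne hb lam hab.symm).symm
      (hT _ _) (hT _ _) (hT' _ _) (hT' _ _)
  · rcases eq_or_ne k b with rfl | hkb
    · rw [ip_comm (simpleRoot N a) (simpleRoot N k)] at h1 ⊢
      exact qad_commute_right (qpow_ne_zero _ _) h1 (E_mul_F_ne hb lam hka.symm).symm hF
        (hT _ _) (hT' _ _)
    · exact qad_comm_of_comm (E_mul_F_ne hb lam hka.symm).symm (E_mul_F_ne hb lam hkb.symm).symm _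

/-- The q-Serre element in the e_α commutes with all f_k and kills the empty word, hence every word.
So these relations hold before anything is divided out. -/
theorem serre_E {a b : Fin (N / 2)} (hab : a ≠ b) :
    serre hb N a b (E hb lam a) (E hb lam b) = 0 := hom_ext fun L => by
  induction L with
  | nil =>
    have h1 : ∀ k, E hb lam k (Finsupp.single [] 1) = 0 := fun k => E_single hb lam k []
    have h2 : ∀ k, qad (qpow hb (-ip (simpleRoot N a) (simpleRoot N b)))
        (qpow hb (-ip (simpleRoot N a) (simpleRoot N a))) (E hb lam a) (E hb lam b) k
        (Finsupp.single [] 1) = 0 := fun k => by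
      induction k with
      | zero => exact h1 b
      | succ k ih =>
        simp only [qad, LinearMap.sub_apply, LinearMap.smul_apply, Module.End.mul_apply, ih, h1,
          map_zero, smul_zero, sub_zero]
    obtain ⟨m, -, h3⟩ := serre_eq_qad (A := Module.End ℂ (Words N)) hq h hab
    rw [h3, h2, LinearMap.zero_apply]
  | cons k L ih =>
    have := LinearMap.congr_fun (serre_E_mul_F lam hq h hab k) (Finsupp.single L 1)
    rw [Module.End.mul_apply, Module.End.mul_apply, ih, F_single] at this
    rw [← this, LinearMap.zero_apply, LinearMap.zero_apply, map_zero]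

end Serre

end Words

theorem pair_simpleRoot_of_isLevi {N l : ℕ} {lam : Fin (N / 2) → ℂ}
    (hlam : ∀ i, l + 2 ≤ i → i ≤ N / 2 → coord lam i = 0) {a : Fin (N / 2)} (ha : IsLevi N l a) :
    pair lam (simpleRoot N a) = 0 := by
  unfold pair
  refine Finset.sum_eq_zero fun k _ => ?_
  rcases le_or_gt (k : ℕ) l with hk | hk
  · rw [ha k hk, Int.cast_zero, mul_zero]
  · have h1 : coord lam (k + 1) = lam k := by
      unfold coord pair
      rw [Finset.sum_eq_single k]
      · simp [natWeight]
      · intro b _ hb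
        have h2 : (k : ℕ) ≠ b := fun h => hb (Fin.ext h.symm)
        have h3 := k.2
        have h4 := b.2
        rw [natWeight, if_neg (by omega), if_neg (by omega), Int.cast_zero, mul_zero]
      · simp
    rw [← h1, hlam _ (by omega) (by omega), zero_mul]

namespace Words

variable (hb : ℂ) (N l : ℕ)

/-- The submodules of the space of words that contain the q-Serre relations and the relations of the
Levi subalgebra. -/
structure IsIdeal (S : Submodule ℂ (Words N)) : Prop where
  f_mem : ∀ a, ∀ v ∈ S, F a v ∈ S
  serre_mem : ∀ a b, a ≠ b → ∀ v, serre hb N a b (F a) (F b) v ∈ S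
  levi_mem : ∀ a, IsLevi N l a → Finsupp.single [a] 1 ∈ S

/-- The subspace of relations. -/
def relSub : Submodule ℂ (Words N) := sInf {S | IsIdeal hb N l S}

theorem isIdeal_relSub : IsIdeal hb N l (relSub hb N l) where
  f_mem a v hv := by
    rw [relSub, Submodule.mem_sInf] at *
    exact fun S hS => hS.f_mem a v (hv S hS)
  serre_mem a b hab v := by
    rw [relSub, Submodule.mem_sInf]
    exact fun S hS => hS.serre_mem a b hab v
  levi_mem a ha := by
    rw [relSub, Submodule.mem_sInf]
    exact fun S hS => hS.levi_mem a ha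

variable {hb N l} {lam : Fin (N / 2) → ℂ}

theorem relSub_le {S : Submodule ℂ (Words N)} (hS : IsIdeal hb N l S) : relSub hb N l ≤ S :=
  sInf_le hS

section

variable (hq : Generic hb) {c r : ℕ} (h : IsDim N c r)
include hq h

theorem T_mem_relSub (s : ℂ) (a : Fin (N / 2)) {v : Words N} (hv : v ∈ relSub hb N l) :
    T hb lam s a v ∈ relSub hb N l := by
  have hJ := isIdeal_relSub hb N l
  have : IsIdeal hb N l ((relSub hb N l).comap (T hb lam s a)) := by
    refine ⟨fun b v hv => ?_, fun b b' hbb v => ?_, fun b hb => ?_⟩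
    · rw [Submodule.mem_comap, ← Module.End.mul_apply, T_mul_F]
      exact Submodule.smul_mem _ _ (hJ.f_mem b _ hv)
    · obtain ⟨z, hz⟩ := T_mul_serre lam hq h s hbb a
      rw [Submodule.mem_comap, ← Module.End.mul_apply, hz]
      exact Submodule.smul_mem _ _ (hJ.serre_mem b b' hbb _)
    · rw [Submodule.mem_comap, T_single]
      exact Submodule.smul_mem _ _ (hJ.levi_mem b hb)
  exact relSub_le this hv

theorem E_mem_relSub (hlam : ∀ i, l + 2 ≤ i → i ≤ N / 2 → coord lam i = 0) (a : Fin (N / 2))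
    {v : Words N} (hv : v ∈ relSub hb N l) : E hb lam a v ∈ relSub hb N l := by
  have hJ := isIdeal_relSub hb N l
  -- The commutator of e_a and f_a brings in t_a^{±1} v, which lies in the subspace of relations
  -- only if v does; hence the intersection with that subspace. A Levi relation f_b gives [(λ, α_b)]
  -- = 0 because λ is orthogonal to the roots of so(P).
  have : IsIdeal hb N l (relSub hb N l ⊓ (relSub hb N l).comap (E hb lam a)) := by
    refine ⟨fun b v hv => ⟨hJ.f_mem b v hv.1, ?_⟩, fun b b' hbb v => ⟨hJ.serre_mem b b' hbb v, ?_⟩,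
      fun b hb => ⟨hJ.levi_mem b hb, ?_⟩⟩
    · rw [SetLike.mem_coe, Submodule.mem_comap, ← Module.End.mul_apply]
      have h1 := hJ.f_mem b _ hv.2
      rcases eq_or_ne a b with rfl | hab
      · rw [E_mul_F]
        exact Submodule.add_mem _ h1 (Submodule.smul_mem _ _ (Submodule.sub_mem _
          (T_mem_relSub hq h _ _ hv.1) (T_mem_relSub hq h _ _ hv.1)))
      · rw [E_mul_F_ne hb lam hab]
        exact h1
    · rw [SetLike.mem_coe, Submodule.mem_comap, ← Module.End.mul_apply, E_mul_serre lam hq h hbb]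
      exact hJ.serre_mem b b' hbb _
    · rw [SetLike.mem_coe, Submodule.mem_comap, E_single, eWord, eWord, map_zero, zero_add]
      split_ifs with hab
      · subst hab
        rw [ht, List.map_nil, List.sum_nil, sub_zero, pair_simpleRoot_of_isLevi hlam hb,
          qnum_zero, zero_smul]
        exact Submodule.zero_mem _
      · exact Submodule.zero_mem _
  exact (relSub_le this hv).2

end

/-- The action of the generators on words. -/
def op (hb : ℂ) (lam : Fin (N / 2) → ℂ) : Gen N → Module.End ℂ (Words N)
  | Gen.e a => E hb lam a
  | Gen.f a => F a
  | Gen.t a => T hb lam 1 a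
  | Gen.tinv a => T hb lam (-1) a

variable (hq : Generic hb) {c r : ℕ} (h : IsDim N c r)
  (hlam : ∀ i, l + 2 ≤ i → i ≤ N / 2 → coord lam i = 0)

include hq h hlam in
theorem op_mem_relSub (x : Gen N) {v : Words N} (hv : v ∈ relSub hb N l) :
    op hb lam x v ∈ relSub hb N l := by
  cases x with
  | e a => exact E_mem_relSub hq h hlam a hv
  | f a => exact (isIdeal_relSub hb N l).f_mem a v hv
  | t a => exact T_mem_relSub hq h _ a hv
  | tinv a => exact T_mem_relSub hq h _ a hv

/-- The space of words modulo relations. -/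
abbrev Quot (hb : ℂ) (N l : ℕ) : Type := Words N ⧸ relSub hb N l

/-- The action of the free algebra on words modulo relations. -/
def freeRep : FreeAlgebra ℂ (Gen N) →ₐ[ℂ] Module.End ℂ (Quot hb N l) :=
  FreeAlgebra.lift ℂ fun x => (relSub hb N l).mapQ _ (op hb lam x)
    fun _ hv => op_mem_relSub hq h hlam x hv

theorem freeRep_mk (x : FreeAlgebra ℂ (Gen N)) (v : Words N) :
    freeRep hq h hlam x ((relSub hb N l).mkQ v) =
      (relSub hb N l).mkQ (FreeAlgebra.lift ℂ (op hb lam) x v) := by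
  induction x using FreeAlgebra.induction generalizing v with
  | grade0 z => simp [Module.algebraMap_end_apply]
  | grade1 x => simp [freeRep]
  | mul x y hx hy => rw [map_mul, map_mul, Module.End.mul_apply, Module.End.mul_apply, hy, hx]
  | add x y hx hy => rw [map_add, map_add, LinearMap.add_apply, LinearMap.add_apply, hx, hy, map_add]

/-- All relations except the q-Serre relations for the f_α already hold on the space of words; only
those need the quotient. -/
theorem freeRep_rel {x y : FreeAlgebra ℂ (Gen N)} (hxy : Rel hb N x y) :
    freeRep hq h hlam x = freeRep hq h hlam y := by
  have key : FreeAlgebra.lift ℂ (op hb lam) x = FreeAlgebra.lift ℂ (op hb lam) y →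
      freeRep hq h hlam x = freeRep hq h hlam y := fun h1 =>
    Submodule.linearMap_qext _ (LinearMap.ext fun v => by
      rw [LinearMap.comp_apply, LinearMap.comp_apply, freeRep_mk, freeRep_mk, h1])
  cases hxy with
  | t_tinv a => exact key (by simpa [op] using T_mul_T_of_add_eq_zero hb lam (add_neg_cancel 1) a)
  | tinv_t a => exact key (by simpa [op] using T_mul_T_of_add_eq_zero hb lam (neg_add_cancel 1) a)
  | t_t a b => exact key (by simpa [op] using T_mul_T hb lam 1 1 a b)
  | t_e a b => exact key (by simpa [op] using T_mul_E hb lam 1 a b)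
  | t_f a b => exact key (by simpa [op] using T_mul_F hb lam 1 a b)
  | e_f a => exact key (by simpa [op, sub_eq_iff_eq_add'] using E_mul_F hb lam a)
  | e_f_ne a b hab => exact key (by simpa [op] using E_mul_F_ne hb lam hab)
  | serre_e a b hab =>
    refine key ?_
    refine (map_serre (FreeAlgebra.lift ℂ (op hb lam)) hb N a b _ _).trans ?_
    rw [map_zero, FreeAlgebra.lift_ι_apply, FreeAlgebra.lift_ι_apply]
    exact serre_E lam hq h hab
  | serre_f a b hab =>
    refine Submodule.linearMap_qext _ (LinearMap.ext fun v => ?_)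
    have h1 := map_serre (FreeAlgebra.lift ℂ (op hb lam)) hb N a b (FreeAlgebra.ι ℂ (Gen.f a))
      (FreeAlgebra.ι ℂ (Gen.f b))
    rw [FreeAlgebra.lift_ι_apply, FreeAlgebra.lift_ι_apply] at h1
    rw [LinearMap.comp_apply, LinearMap.comp_apply, freeRep_mk, map_zero, LinearMap.zero_apply]
    refine (congrArg (fun φ => (relSub hb N l).mkQ (φ v)) h1).trans ?_
    rw [Submodule.mkQ_apply, Submodule.Quotient.mk_eq_zero]
    exact (isIdeal_relSub hb N l).serre_mem a b hab v

/-- The action of `U_q` on words modulo relations. -/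
def rep : Uq hb N →ₐ[ℂ] Module.End ℂ (Quot hb N l) :=
  RingQuot.liftAlgHom ℂ ⟨freeRep hq h hlam, fun _ _ hxy => freeRep_rel hq h hlam hxy⟩

theorem rep_gen (x : Gen N) (v : Words N) : rep hq h hlam (gen hb x) ((relSub hb N l).mkQ v) =
    (relSub hb N l).mkQ (op hb lam x v) := by
  rw [rep, gen, RingQuot.liftAlgHom_mkAlgHom_apply, freeRep_mk, FreeAlgebra.lift_ι_apply]

theorem rep_vermaIdeal {x : Uq hb N} (hx : x ∈ vermaIdeal hb N l lam) :
    rep hq h hlam x ((relSub hb N l).mkQ (Finsupp.single [] 1)) = 0 := by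
  refine Submodule.span_induction (p := fun x _ => rep hq h hlam x _ = 0) ?_ ?_ ?_ ?_ hx
  · rintro x ((⟨a, rfl⟩ | ⟨a, rfl⟩) | ⟨a, ha, rfl⟩)
    · dsimp only
      rw [rep_gen, op, E_single, eWord, map_zero]
    · dsimp only
      rw [map_sub, LinearMap.sub_apply, rep_gen, op, T_single, AlgHom.commutes,
        Module.algebraMap_end_apply, ht, List.map_nil, List.sum_nil, sub_zero, one_mul, map_smul,
        sub_self]
    · dsimp only
      rw [rep_gen, op, F_single, Submodule.mkQ_apply, Submodule.Quotient.mk_eq_zero]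
      exact (isIdeal_relSub hb N l).levi_mem a ha
  · rw [map_zero, LinearMap.zero_apply]
  · intro x y _ _ hx hy
    rw [map_add, LinearMap.add_apply, hx, hy, add_zero]
  · intro x y _ hy
    rw [smul_eq_mul, map_mul, Module.End.mul_apply, hy, map_zero]

section Universal

variable {K : Type} [AddCommGroup K] [Module ℂ K] (FK : Fin (N / 2) → Module.End ℂ K) (k0 : K)

/-- The evaluation of words on a vector. -/
def eval : Words N →ₗ[ℂ] K :=
  Finsupp.linearCombination ℂ fun L => (L.map FK).prod k0

theorem eval_F (a : Fin (N / 2)) (v : Words N) : eval FK k0 (F a v) = FK a (eval FK k0 v) := by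
  have : eval FK k0 ∘ₗ F a = FK a ∘ₗ eval FK k0 := hom_ext fun L => by
    simp [eval, F_single]
  exact LinearMap.congr_fun this v

theorem isIdeal_ker_eval (hs : ∀ a b, a ≠ b → serre hb N a b (FK a) (FK b) = 0)
    (hk : ∀ a, IsLevi N l a → FK a k0 = 0) : IsIdeal hb N l (LinearMap.ker (eval FK k0)) := by
  refine ⟨fun a v hv => ?_, fun a b hab v => ?_, fun a ha => ?_⟩
  · rw [LinearMap.mem_ker] at hv ⊢
    rw [eval_F, hv, map_zero]
  · have h1 : ∀ (a : Fin (N / 2)) (n : ℕ) v, eval FK k0 ((F a ^ n) v) = (FK a ^ n) (eval FK k0 v) := by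
      intro a n v
      induction n with
      | zero => rfl
      | succ n ih => rw [pow_succ', pow_succ', Module.End.mul_apply, Module.End.mul_apply, eval_F, ih]
    rw [LinearMap.mem_ker]
    have h2 : eval FK k0 (serre hb N a b (F a) (F b) v) =
        serre hb N a b (FK a) (FK b) (eval FK k0 v) := by
      simp only [serre, LinearMap.sum_apply, LinearMap.smul_apply, Module.End.mul_apply, map_sum,
        map_smul, h1, eval_F]
    rw [h2, hs a b hab, LinearMap.zero_apply]
  · rw [LinearMap.mem_ker]
    simpa [eval] using hk a ha

end Universal

end Words

/-- The universal property of the parabolic Verma module as a module over the subalgebra generated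
by the `f_α`. -/
theorem exists_hom_verma {hb : ℂ} (hq : Generic hb) {N l c r : ℕ} (h : IsDim N c r)
    {lam : Fin (N / 2) → ℂ} (hlam : ∀ i, l + 2 ≤ i → i ≤ N / 2 → coord lam i = 0)
    {K : Type} [AddCommGroup K] [Module ℂ K] (FK : Fin (N / 2) → Module.End ℂ K) (k0 : K)
    (hs : ∀ a b, a ≠ b → serre hb N a b (FK a) (FK b) = 0)
    (hk : ∀ a, IsLevi N l a → FK a k0 = 0) :
    ∃ p : Verma hb N l lam →ₗ[ℂ] K, p (vacuum hb N l lam) = k0 ∧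
      ∀ a w, p (gen hb (Gen.f a) • w) = FK a (p w) := by
  have hJ : Words.relSub hb N l ≤ LinearMap.ker (Words.eval FK k0) :=
    Words.relSub_le (Words.isIdeal_ker_eval FK k0 hs hk)
  let p0 : Words.Quot hb N l →ₗ[ℂ] K := (Words.relSub hb N l).liftQ (Words.eval FK k0) hJ
  let w0 : Words.Quot hb N l := (Words.relSub hb N l).mkQ (Finsupp.single [] 1)
  let φ : Uq hb N →ₗ[ℂ] K := p0 ∘ₗ (LinearMap.applyₗ w0) ∘ₗ (Words.rep hq h hlam).toLinearMap
  have hφ : ∀ x, φ x = p0 (Words.rep hq h hlam x w0) := fun x => rfl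
  -- The map sends x to the evaluation of x applied to the empty word. It factors through the Verma
  -- module because the generators of the left ideal kill the class of the empty word.
  have hker : (vermaIdeal hb N l lam).restrictScalars ℂ ≤ LinearMap.ker φ := fun x hx => by
    rw [LinearMap.mem_ker, hφ, Words.rep_vermaIdeal hq h hlam hx, map_zero]
  have hp0 : ∀ a v, p0 (Words.rep hq h hlam (gen hb (Gen.f a)) v) = FK a (p0 v) := fun a v => by
    obtain ⟨v, rfl⟩ := Submodule.mkQ_surjective _ v
    rw [Words.rep_gen]
    exact Words.eval_F FK k0 a v
  refine ⟨((vermaIdeal hb N l lam).restrictScalars ℂ).liftQ φ hker, ?_, fun a w => ?_⟩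
  · change φ 1 = k0
    rw [hφ, map_one]
    change Words.eval FK k0 (Finsupp.single [] 1) = k0
    simp [Words.eval]
  · obtain ⟨x, rfl⟩ := Submodule.Quotient.mk_surjective _ w
    change φ (gen hb (Gen.f a) * x) = FK a (φ x)
    rw [hφ, hφ, map_mul, Module.End.mul_apply, hp0]

/-! ### A monomial module over the subalgebra generated by the `f_α` -/

section Monomial

variable {X : Type} (u : X → ℂ) (σ : X → X)

/-- The operator that sends a basis vector to a multiple of another one. -/
def monomialOp : Module.End ℂ (X →₀ ℂ) :=
  Finsupp.linearCombination ℂ fun s => Finsupp.single (σ s) (u s)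

theorem monomialOp_single (s : X) (z : ℂ) :
    monomialOp u σ (Finsupp.single s z) = Finsupp.single (σ s) (u s * z) := by
  rw [monomialOp, Finsupp.linearCombination_single, Finsupp.smul_single, smul_eq_mul, mul_comm]

theorem monomial_ext {φ ψ : Module.End ℂ (X →₀ ℂ)}
    (h : ∀ s, φ (Finsupp.single s 1) = ψ (Finsupp.single s 1)) : φ = ψ :=
  Finsupp.lhom_ext' fun s => LinearMap.ext_ring (h s)

end Monomial

/-- The basis of the test module: a set of simple roots `α_k`, `k ≤ l`, and a basis vector of
the natural module of `so(P + 2)`. -/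
abbrev State : Type := Finset ℕ × ℕ

section Test

variable (hb : ℂ) (l c r : ℕ)

/-- The states on which `f_{α_a}` is not zero. -/
def Moves (a : ℕ) (s : State) : Prop :=
  -- For k ≤ l the letter f_k may be used once. The letters with index above l walk through the
  -- weights 1, …, r + c + 2 of the natural module of so(P + 2), the end root of even type in steps
  -- of 2.
  if a ≤ l then a ∉ s.1 else if r = c + 2 ∧ a = l + r then s.2 = c + 1 ∨ s.2 = c + 2
    else s.2 + l = a ∨ s.2 + a = r + c + 2 + l

instance (a : ℕ) (s : State) : Decidable (Moves l c r a s) := by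
  unfold Moves; infer_instance

/-- The target of `f_{α_a}`. -/
def target (a : ℕ) (s : State) : State :=
  if a ≤ l then (insert a s.1, s.2) else (s.1, s.2 + if r = c + 2 ∧ a = l + r then 2 else 1)

/-- The matrix coefficient of `f_{α_a}` where it is not zero. -/
def factor (a : ℕ) (s : State) : ℂ :=
  -- The power of q counts how many letters attached to α_a on the right have already been applied:
  -- at most one for a < l, up to two for a = l. It makes the different orders of the letters in the
  -- generating element distinguishable, so that its terms do not cancel.
  if a < l then (if a + 1 ∈ s.1 then qpow hb 1 else 1)
  else if a = l then (if s.2 = 1 then 1 else if s.2 = r + c + 2 then qpow hb 2 else qpow hb 1)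
  else 1

/-- The action of `f_{α_a}` on the test module. -/
def testOp (a : ℕ) : Module.End ℂ (State →₀ ℂ) :=
  monomialOp (fun s => if Moves l c r a s then factor hb l c r a s else 0) (target l c r a)

variable {l c r}

theorem testOp_single {a : ℕ} {s : State} (h : Moves l c r a s) (z : ℂ) :
    testOp hb l c r a (Finsupp.single s z) =
      Finsupp.single (target l c r a s) (factor hb l c r a s * z) := by
  rw [testOp, monomialOp_single, if_pos h]

theorem testOp_single_zero {a : ℕ} {s : State} (h : ¬ Moves l c r a s) (z : ℂ) :
    testOp hb l c r a (Finsupp.single s z) = 0 := by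
  rw [testOp, monomialOp_single, if_neg h, zero_mul, Finsupp.single_zero]

theorem target_comm (a b : ℕ) (s : State) :
    target l c r a (target l c r b s) = target l c r b (target l c r a s) := by
  unfold target
  by_cases ha : a ≤ l <;> by_cases hb : b ≤ l
  · simp only [if_pos ha, if_pos hb]
    rw [Finset.insert_comm]
  · simp only [if_pos ha, if_neg hb]
  · simp only [if_neg ha, if_pos hb]
  · simp only [if_neg ha, if_neg hb]
    rw [add_right_comm]

theorem moves_target_iff_of_car {a b : ℕ} (hr : r = c + 1 ∨ r = c + 2) (ha : a ≤ l + r)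
    (hb' : b ≤ l + r) (hab : a ≠ b) (h : car (l + c) (l + r) a b = 0) (s : State) :
    (Moves l c r b s ∧ Moves l c r a (target l c r b s)) ↔
      (Moves l c r a s ∧ Moves l c r b (target l c r a s)) := by
  unfold Moves target
  by_cases h1 : a ≤ l <;> by_cases h2 : b ≤ l
  · simp only [if_pos h1, if_pos h2, Finset.mem_insert, not_or]
    tauto
  · simp only [if_pos h1, if_neg h2]
    tauto
  · simp only [if_neg h1, if_pos h2]
    tauto
  · simp only [if_neg h1, if_neg h2]
    unfold car at h
    rcases hr with rfl | rfl
    · split_ifs at h ⊢ <;> omega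
    · split_ifs at h ⊢ <;> omega

theorem factor_target_of_car {a b : ℕ} (ha : a ≤ l + r)
    (hb' : b ≤ l + r) (hab : a ≠ b) (h : car (l + c) (l + r) a b = 0) {s : State}
    (hm : Moves l c r b s) :
    factor hb l c r a (target l c r b s) = factor hb l c r a s := by
  unfold factor target
  by_cases h2 : b ≤ l
  · simp only [if_pos h2, Finset.mem_insert]
    by_cases h3 : a < l
    · have : a + 1 ≠ b := by
        rintro rfl
        unfold car at h
        split_ifs at h <;> omega
      simp only [this, false_or]
    · simp only [if_neg h3]
  · simp only [if_neg h2]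
    rcases eq_or_ne a l with rfl | h3
    · unfold car at h
      unfold Moves at hm
      rw [if_neg h2] at hm
      have h4 : s.2 ≠ 1 ∧ s.2 + (if r = c + 2 ∧ b = a + r then 2 else 1) ≠ 1 ∧ s.2 ≠ r + c + 2 ∧
          s.2 + (if r = c + 2 ∧ b = a + r then 2 else 1) ≠ r + c + 2 := by
        split_ifs at h hm ⊢ <;> omega
      simp only [if_neg h4.1, if_neg h4.2.1, if_neg h4.2.2.1, if_neg h4.2.2.2]
    · simp only [if_neg h3]

theorem testOp_comm {a b : ℕ} (hr : r = c + 1 ∨ r = c + 2) (ha : a ≤ l + r)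
    (hb' : b ≤ l + r) (hab : a ≠ b) (h : car (l + c) (l + r) a b = 0) :
    testOp hb l c r a * testOp hb l c r b = testOp hb l c r b * testOp hb l c r a :=
  monomial_ext fun s => by
    have h1 := moves_target_iff_of_car hr ha hb' hab h s
    rw [Module.End.mul_apply, Module.End.mul_apply]
    have h0 : ∀ {x y : ℕ}, ¬ (Moves l c r y s ∧ Moves l c r x (target l c r y s)) →
        testOp hb l c r x (testOp hb l c r y (Finsupp.single s 1)) = 0 := fun {x y} hn => by
      by_cases h2 : Moves l c r y s
      · rw [testOp_single hb h2, testOp_single_zero hb (fun h3 => hn ⟨h2, h3⟩)]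
      · rw [testOp_single_zero hb h2, map_zero]
    by_cases h2 : Moves l c r b s ∧ Moves l c r a (target l c r b s)
    · have h3 := h1.1 h2
      rw [testOp_single hb h2.1, testOp_single hb h2.2, testOp_single hb h3.1,
        testOp_single hb h3.2, target_comm, factor_target_of_car hb ha hb' hab h h2.1,
        factor_target_of_car hb hb' ha hab.symm (by rw [car_comm, h]) h3.1]
      congr 1
      ring
    · rw [h0 h2, h0 (fun h3 => h2 (h1.2 h3))]

theorem testOp_mul_eq_zero {a b : ℕ}
    (h : ∀ s, Moves l c r b s → ¬ Moves l c r a (target l c r b s)) :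
    testOp hb l c r a * testOp hb l c r b = 0 := monomial_ext fun s => by
  rw [Module.End.mul_apply]
  by_cases h1 : Moves l c r b s
  · rw [testOp_single hb h1, testOp_single_zero hb (h s h1), LinearMap.zero_apply]
  · rw [testOp_single_zero hb h1, map_zero, LinearMap.zero_apply]

theorem testOp_mul_mul_eq_zero {a b d : ℕ}
    (h : ∀ s, Moves l c r d s → Moves l c r b (target l c r d s) →
      ¬ Moves l c r a (target l c r b (target l c r d s))) :
    testOp hb l c r a * testOp hb l c r b * testOp hb l c r d = 0 := monomial_ext fun s => by
  rw [Module.End.mul_apply, Module.End.mul_apply]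
  by_cases h1 : Moves l c r d s
  · rw [testOp_single hb h1]
    by_cases h2 : Moves l c r b (target l c r d s)
    · rw [testOp_single hb h2, testOp_single_zero hb (h s h1 h2), LinearMap.zero_apply]
    · rw [testOp_single_zero hb h2, map_zero, LinearMap.zero_apply]
  · rw [testOp_single_zero hb h1, map_zero, map_zero, LinearMap.zero_apply]

theorem testOp_sq {a : ℕ} (hr : r = c + 1 ∨ r = c + 2) (ha : a ≤ l + r)
    (h : car (l + c) (l + r) a a = 2) : testOp hb l c r a * testOp hb l c r a = 0 :=
  testOp_mul_eq_zero hb fun s h1 h2 => by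
    unfold Moves target at *
    unfold car at h
    by_cases h3 : a ≤ l
    · simp [if_pos h3] at h2
    · simp only [if_neg h3] at h1 h2
      split_ifs at h h1 h2 <;> omega

/-- Together with `testOp_sq` this makes every monomial of the cubic relation vanish separately,
whatever the factors are. -/
theorem testOp_mul_mul {a b : ℕ} (hr : r = c + 1 ∨ r = c + 2) (ha : a ≤ l + r) (hb' : b ≤ l + r)
    (h : car (l + c) (l + r) a a = 2) (hab : a ≠ b) :
    testOp hb l c r a * testOp hb l c r b * testOp hb l c r a = 0 :=
  testOp_mul_mul_eq_zero hb fun s h1 h4 h2 => by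
    unfold Moves target at *
    unfold car at h
    by_cases h3 : a ≤ l
    · by_cases h5 : b ≤ l
      · simp [if_pos h3, if_pos h5] at h2
      · simp [if_pos h3, if_neg h5] at h2
    · by_cases h5 : b ≤ l
      · simp only [if_neg h3, if_pos h5] at h1 h2
        split_ifs at h h1 h2 <;> omega
      · simp only [if_neg h3, if_neg h5] at h1 h2 h4
        split_ifs at h h1 h2 h4 <;> omega

theorem testOp_mul_mul_mul_eq_zero {a b d e : ℕ}
    (h : ∀ s, Moves l c r e s → Moves l c r d (target l c r e s) →
      Moves l c r b (target l c r d (target l c r e s)) →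
      ¬ Moves l c r a (target l c r b (target l c r d (target l c r e s)))) :
    testOp hb l c r a * testOp hb l c r b * testOp hb l c r d * testOp hb l c r e = 0 :=
  monomial_ext fun s => by
    rw [mul_assoc, mul_assoc, Module.End.mul_apply, Module.End.mul_apply, Module.End.mul_apply]
    by_cases h1 : Moves l c r e s
    · rw [testOp_single hb h1]
      by_cases h2 : Moves l c r d (target l c r e s)
      · rw [testOp_single hb h2]
        by_cases h3 : Moves l c r b (target l c r d (target l c r e s))
        · rw [testOp_single hb h3, testOp_single_zero hb (h s h1 h2 h3), LinearMap.zero_apply]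
        · rw [testOp_single_zero hb h3, map_zero, LinearMap.zero_apply]
      · rw [testOp_single_zero hb h2, map_zero, map_zero, LinearMap.zero_apply]
    · rw [testOp_single_zero hb h1, map_zero, map_zero, map_zero, LinearMap.zero_apply]

/-- The monomials of the q-Serre relation at the short simple root. -/
theorem testOp_short {a b : ℕ} (hr : r = c + 1 ∨ r = c + 2) (h : car (l + c) (l + r) a a = 1)
    (hab : car (l + c) (l + r) a b = -1) (hb' : b ≤ l + r) :
    testOp hb l c r a * testOp hb l c r a * testOp hb l c r a = 0 ∧
    testOp hb l c r a * testOp hb l c r a * testOp hb l c r b * testOp hb l c r a = 0 ∧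
    testOp hb l c r a * testOp hb l c r b * testOp hb l c r a * testOp hb l c r a = 0 := by
  have h1 : r = c + 1 ∧ a = l + c + 1 := by
    unfold car at h
    split_ifs at h <;> omega
  obtain ⟨rfl, rfl⟩ := h1
  have h2 : b = l + c := by
    unfold car at hab
    split_ifs at hab <;> omega
  subst h2
  have h0 : ¬ (l + c + 1 ≤ l) := by omega
  refine ⟨testOp_mul_mul_eq_zero hb fun s h1 h2 h3 => ?_,
    testOp_mul_mul_mul_eq_zero hb fun s h1 h2 h3 h4 => ?_,
    testOp_mul_mul_mul_eq_zero hb fun s h1 h2 h3 h4 => ?_⟩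
  · unfold Moves target at *
    simp only [if_neg h0] at h1 h2 h3
    split_ifs at h1 h2 h3 <;> omega
  all_goals
    unfold Moves target at *
    by_cases h5 : l + c ≤ l
    · simp only [if_neg h0, if_pos h5] at h1 h2 h3 h4
      split_ifs at h1 h2 h3 h4 <;> omega
    · simp only [if_neg h0, if_neg h5] at h1 h2 h3 h4
      split_ifs at h1 h2 h3 h4 <;> omega

/-- The action of the `f_α` on the test module. -/
def testF (hb : ℂ) (N l c r : ℕ) (a : Fin (N / 2)) : Module.End ℂ (State →₀ ℂ) :=
  testOp hb l c r (a + 1)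

theorem serre_testF {hb : ℂ} (hq : Generic hb) {N : ℕ} (h : IsDim N (l + c) (l + r))
    {a b : Fin (N / 2)} (hab : a ≠ b) :
    serre hb N a b (testF hb N l c r a) (testF hb N l c r b) = 0 := by
  have hh := h.half
  have ha := a.2
  have hb' := b.2
  have hr : r = c + 1 ∨ r = c + 2 := by rcases h with h | h <;> omega
  have c1 : ip (simpleRoot N a) (simpleRoot N a) = car (l + c) (l + r) (a + 1) (a + 1) :=
    ip_simpleRootAt h (by omega) (by omega) (by omega) (by omega)
  have c2 : ip (simpleRoot N a) (simpleRoot N b) = car (l + c) (l + r) (a + 1) (b + 1) :=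
    ip_simpleRootAt h (by omega) (by omega) (by omega) (by omega)
  have hne : (a : ℕ) + 1 ≠ b + 1 := fun h => hab (Fin.ext (by omega))
  have d1 : car (l + c) (l + r) (a + 1) (b + 1) = 0 ∨
      car (l + c) (l + r) (a + 1) (b + 1) = -1 := by
    unfold car; split_ifs <;> omega
  unfold testF
  rcases d1 with d1 | d1
  · rw [serre_eq_comm hq (by rw [c1]; exact car_self_eq _ _ _) (c2.trans d1), sub_eq_zero]
    exact testOp_comm hb hr (by omega) (by omega) hne d1
  · rcases car_self_eq (l + c) (l + r) (a + 1) with d2 | d2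
    · obtain ⟨h1, h2, h3⟩ := testOp_short hb hr d2 d1 (by omega)
      rw [serre_eq_quartic hq (c1.trans d2) (c2.trans d1), h2, h3, h1,
        mul_assoc, mul_assoc, ← mul_assoc (testOp hb l c r (a + 1)) (testOp hb l c r (a + 1)), h1]
      simp
    · rw [serre_eq_cubic hq (c1.trans d2) (c2.trans d1), testOp_sq hb hr (by omega) d2,
        testOp_mul_mul hb hr (by omega) (by omega) d2 hne]
      simp

theorem testF_of_isLevi {hb : ℂ} {N : ℕ} (h : IsDim N (l + c) (l + r)) {a : Fin (N / 2)}
    (ha : IsLevi N l a) : testF hb N l c r a (Finsupp.single (∅, 1) 1) = 0 := by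
  have hh := h.half
  have hr : r = c + 1 ∨ r = c + 2 := by rcases h with h | h <;> omega
  have ha2 := a.2
  have h1 := lt_of_isLevi h (Nat.le_add_right l c) ha
  refine testOp_single_zero hb ?_ 1
  unfold Moves
  split_ifs <;> omega

end Test

/-! ### The generating coefficient in the test module. -/

theorem Generic.qpow_mul_sub {hb : ℂ} (hq : Generic hb) (A : ℂ) :
    qpow hb 1 * qnum hb (A + 1) - qnum hb A = qpow hb (A + 1) := by
  have h1 := qpow_ne_zero hb 1
  have h2 := hq.sq_ne_one
  have h3 := qpow_ne_zero hb A
  simp only [qnum, qpow_neg, qpow_add]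
  field_simp
  ring

/-- The words φ¹_1, φ²_1, φ³_1 act on the test module with factors q², q, 1. Their coefficients then
add up to [P/2] q^{2x+P}, which is not zero. -/
theorem Generic.qnum_leading {hb : ℂ} (hq : Generic hb) (X μ : ℂ) :
    qpow hb 2 * (qnum hb (X + μ) * qnum hb X)
      - qpow hb 1 * ((qpow hb μ + qpow hb (-μ)) * qnum hb (X - 1) * qnum hb X)
      + qnum hb (X - 1 - μ) * qnum hb (X - 1) = qnum hb (μ + 1) * qpow hb (2 * X) := by
  have h1 := qpow_ne_zero hb 1
  have h2 := hq.sq_ne_one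
  have h3 := qpow_ne_zero hb X
  have h5 := qpow_ne_zero hb μ
  rw [two_mul]
  simp only [qnum, qpow_neg, qpow_add, qpow_sub, qpow_two]
  field_simp
  ring

theorem IsRank.A0_one_ne_zero {P c r : ℕ} (h : IsRank P c r) {hb : ℂ} (hq : Generic hb) :
    A0 hb P 1 ≠ 0 := by
  have : 0 < P := by rcases h with h | h <;> omega
  have h1 := hq.qnum_half_ne_zero this
  unfold A0
  norm_num
  exact h1

section Evaluation

variable {hb : ℂ} {l c r lo : ℕ} {M : Type} [AddCommGroup M] [Module ℂ M]
  {S : QSys hb c r lo M} {p : M →ₗ[ℂ] (State →₀ ℂ)}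
  (hS : ∀ j, lo ≤ j → j ≤ r → ∀ w, p (S.f j w) = testOp hb l c r (l + j) (p w))
include hS

theorem test_f {j i i' : ℕ} {B : Finset ℕ} {z : ℂ} {w : M} (hw : p w = Finsupp.single (B, i) z)
    (hlo : lo ≤ 1) (hj : 1 ≤ j) (hjr : j ≤ r)
    (hm : if r = c + 2 ∧ j = r then (i = c + 1 ∨ i = c + 2) ∧ i' = i + 2 else
      (i = j ∨ i + j = r + c + 2) ∧ i' = i + 1) :
    p (S.f j w) = Finsupp.single (B, i') z := by
  rw [hS j (by omega) hjr, hw, testOp_single]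
  · unfold target factor
    simp only [if_neg (show ¬ l + j ≤ l by omega), if_neg (show ¬ l + j < l by omega),
      if_neg (show l + j ≠ l by omega), one_mul]
    congr 2
    split_ifs at hm ⊢ <;> omega
  · unfold Moves
    split_ifs at hm ⊢ <;> omega

theorem test_f_zero {j i : ℕ} {B : Finset ℕ} {z : ℂ} {w : M} (hw : p w = Finsupp.single (B, i) z)
    (hlo : lo ≤ 1) (hj : 1 ≤ j) (hjr : j ≤ r)
    (hm : if r = c + 2 ∧ j = r then i ≠ c + 1 ∧ i ≠ c + 2 else i ≠ j ∧ i + j ≠ r + c + 2) :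
    p (S.f j w) = 0 := by
  rw [hS j (by omega) hjr, hw, testOp_single_zero]
  unfold Moves
  split_ifs at hm ⊢ <;> omega

variable (hr : r = c + 1 ∨ r = c + 2) (hlo : lo ≤ 1) {B : Finset ℕ} {z : ℂ} {w : M}
include hr hlo

theorem test_D (hw : p w = Finsupp.single (B, 1) z) {b : ℕ} (hb' : b ≤ c + 1) :
    p (S.D b w) = Finsupp.single (B, b + 1) z := by
  induction b with
  | zero => rw [QSys.D_zero, hw]
  | succ b ih =>
    rw [QSys.D_succ]
    refine test_f hS (ih (by omega)) hlo (by omega) (by omega) ?_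
    split_ifs <;> omega

theorem test_E (hw : p w = Finsupp.single (B, 1) z) {m i : ℕ} (hm : m ≤ c + 1)
    (hi : i + m = r + c + 2) : p (S.E m w) = Finsupp.single (B, i) z := by
  obtain ⟨k, hk⟩ : ∃ k, m + k = c + 1 := ⟨c + 1 - m, by omega⟩
  induction k generalizing m i with
  | zero =>
    obtain rfl : m = c + 1 := by omega
    rw [QSys.E_top]
    refine test_f hS (test_D hS hr hlo hw (by omega)) hlo (by omega) (by omega) ?_
    split_ifs <;> omega
  | succ k ih =>
    rw [QSys.E_eq _ (by omega)]
    refine test_f hS (ih (m := m + 1) (i := i - 1) (by omega) (by omega) (by omega)) hlo (by omega)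
      (by omega) ?_
    split_ifs <;> omega

theorem test_D_zero {i : ℕ} (hw : p w = Finsupp.single (B, i) z) (h1 : i ≠ 1)
    (h2 : i + 1 ≠ r + c + 2) {b : ℕ} (hb' : b + 1 ≤ c + 1) : p (S.D (b + 1) w) = 0 := by
  induction b with
  | zero =>
    rw [QSys.D_succ, QSys.D_zero]
    refine test_f_zero hS hw hlo le_rfl (by omega) ?_
    split_ifs <;> omega
  | succ b ih =>
    rw [QSys.D_succ, hS _ (by omega) (by omega), ih (by omega), map_zero]

/-- After E_m the state is r + c + 2 − m, and the first letter f_1 of D_m moves it only if it is r +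
c + 1. So of all the words φ_m only φ_1 survives. -/
theorem test_D_of_E {i m : ℕ} (hw : p w = Finsupp.single (B, i) z) (hi : i + m = r + c + 2)
    (hm : 1 ≤ m) (hmc : m ≤ c + 1) :
    p (S.D m w) = if m = 1 then Finsupp.single (B, r + c + 2) z else 0 := by
  obtain ⟨m, rfl⟩ : ∃ k, m = k + 1 := ⟨m - 1, by omega⟩
  split_ifs with h
  · rw [h, show (1 : ℕ) = 0 + 1 from rfl, QSys.D_succ, QSys.D_zero]
    refine test_f hS hw hlo le_rfl (by omega) ?_
    split_ifs <;> omega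
  · exact test_D_zero hS hr hlo hw (by omega) (by omega) hmc

theorem test_sum_D_E (A : ℕ → ℂ) (X : M →ₗ[ℂ] M) (y : ℂ)
    (hX : ∀ m i, 1 ≤ m → m ≤ c + 1 → i + m = r + c + 2 →
      p (X (S.E m w)) = Finsupp.single (B, i) y) :
    p (∑ m ∈ Finset.Icc 1 (c + 1), A m • S.D m (X (S.E m w))) =
      Finsupp.single (B, r + c + 2) (A 1 * y) := by
  rw [map_sum, Finset.sum_eq_single 1]
  · rw [map_smul, test_D_of_E hS hr hlo (hX 1 (r + c + 1) le_rfl (by omega) (by omega)) (by omega)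
      le_rfl (by omega), if_pos rfl, Finsupp.smul_single, smul_eq_mul]
  · intro m hm h1
    rw [Finset.mem_Icc] at hm
    rw [map_smul, test_D_of_E hS hr hlo (hX m (r + c + 2 - m) hm.1 hm.2 (by omega)) (by omega)
      hm.1 hm.2, if_neg h1, smul_zero]
  · intro h
    exact absurd (Finset.mem_Icc.2 ⟨le_rfl, by omega⟩) h

theorem test_Phi {P : ℕ} (hP : IsRank P c r) (hw : p w = Finsupp.single (B, 1) z) :
    p (S.Phi P w) = Finsupp.single (B, r + c + 2) (A0 hb P 1 * z) := by
  rw [QSys.Phi_eq _ hP]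
  exact test_sum_D_E hS hr hlo (A0 hb P) LinearMap.id z fun m i _ h2 h3 =>
    test_E hS hr hlo hw h2 h3

omit hr hlo in
theorem test_f_node (hlo : lo = 0) {i : ℕ} (hw : p w = Finsupp.single (B, i) z) (hl : l ∉ B) :
    p (S.f 0 w) = Finsupp.single (insert l B, i)
      ((if i = 1 then 1 else if i = r + c + 2 then qpow hb 2 else qpow hb 1) * z) := by
  rw [hS 0 (by omega) (by omega), hw, testOp_single]
  · unfold target factor
    simp
  · unfold Moves
    simpa using hl

omit hlo in
theorem test_FL (hq : Generic hb) (hlo : lo = 0) {P : ℕ} (hP : IsRank P c r) (x : ℂ)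
    (hw : p w = Finsupp.single (B, 1) z) (hl : l ∉ B) :
    p (S.FL P x w) = Finsupp.single (insert l B, r + c + 2)
      (qnum hb ((P : ℂ) / 2) * qpow hb (2 * (x + (P : ℂ) / 2)) * z) := by
  have hlo1 : lo ≤ 1 := by omega
  have hD : p (∑ m ∈ Finset.Icc 1 (c + 1), A1 hb P x m • S.D m (S.E m w)) =
      Finsupp.single (B, r + c + 2) (A1 hb P x 1 * z) :=
    test_sum_D_E hS hr hlo1 (A1 hb P x) LinearMap.id z fun m i _ h2 h3 => test_E hS hr hlo1 hw h2 h3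
  have e1 : p (∑ m ∈ Finset.Icc 1 (c + 1), A1 hb P x m • S.f 0 (S.D m (S.E m w))) =
      Finsupp.single (insert l B, r + c + 2) (qpow hb 2 * (A1 hb P x 1 * z)) := by
    have h1 : ∑ m ∈ Finset.Icc 1 (c + 1), A1 hb P x m • S.f 0 (S.D m (S.E m w)) =
        S.f 0 (∑ m ∈ Finset.Icc 1 (c + 1), A1 hb P x m • S.D m (S.E m w)) := by
      rw [map_sum]
      exact Finset.sum_congr rfl fun m _ => (map_smul _ _ _).symm
    rw [h1, test_f_node hS hlo hD hl, if_neg (by omega), if_pos rfl]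
  have e2 : p (∑ m ∈ Finset.Icc 1 (c + 1), A2 hb P x m • S.D m (S.f 0 (S.E m w))) =
      Finsupp.single (insert l B, r + c + 2) (A2 hb P x 1 * (qpow hb 1 * z)) :=
    test_sum_D_E hS hr hlo1 (A2 hb P x) (S.f 0) (qpow hb 1 * z) fun m i h1 h2 h3 => by
      rw [test_f_node hS hlo (test_E hS hr hlo1 hw h2 h3) hl, if_neg (by omega), if_neg (by omega)]
  have e4 : p (∑ m ∈ Finset.Icc 1 (c + 1), A3 hb P x m • S.D m (S.E m (S.f 0 w))) =
      Finsupp.single (insert l B, r + c + 2) (A3 hb P x 1 * z) := by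
    have h0 : p (S.f 0 w) = Finsupp.single (insert l B, 1) z := by
      rw [test_f_node hS hlo hw hl, if_pos rfl, one_mul]
    exact test_sum_D_E hS hr hlo1 (A3 hb P x) LinearMap.id z fun m i _ h2 h3 =>
      test_E hS hr hlo1 h0 h2 h3
  have e3 : p (if r = c + 2 then
      A2 hb P x (c + 1) • S.f r (S.D c (S.f 0 (S.f (c + 1) (S.D c w)))) else 0) =
      Finsupp.single (insert l B, r + c + 2)
        (if c = 0 ∧ r = 2 then A2 hb P x 1 * (qpow hb 1 * z) else 0) := by
    split_ifs with h1 h2 h2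
    · obtain rfl : c = 0 := by omega
      subst h1
      have h3 := test_f_node hS hlo (test_f hS hw hlo1 (j := 0 + 1) le_rfl (by omega) (i' := 2)
        (by split_ifs <;> omega)) hl
      rw [if_neg (by omega), if_neg (by omega)] at h3
      rw [map_smul, QSys.D_zero, QSys.D_zero, test_f hS h3 hlo1 (j := 0 + 2) (by omega) le_rfl (i' := 4)
        (by split_ifs <;> omega), Finsupp.smul_single, smul_eq_mul]
    · have h3 := test_f_node hS hlo (test_f hS (test_D hS hr hlo1 hw (b := c) (by omega)) hlo1
        (j := c + 1) (by omega) (by omega) (i' := c + 2) (by split_ifs <;> omega)) hl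
      obtain ⟨k, rfl⟩ : ∃ k, c = k + 1 := ⟨c - 1, by omega⟩
      rw [map_smul, hS r (by omega) le_rfl, test_D_zero hS hr hlo1 h3 (by omega) (by omega)
        (by omega), map_zero, smul_zero, Finsupp.single_zero]
    · omega
    · rw [map_zero, Finsupp.single_zero]
  have hB : A2 hb P x 1 + (if c = 0 ∧ r = 2 then A2 hb P x 1 else 0) = B2 hb P x 1 := by
    split_ifs with h2
    · obtain rfl : c = 0 := by omega
      exact two_mul_A2 hP hb x h2.2 le_rfl
    · rw [add_zero]
      exact A2_eq_B2 hP hb x (by omega)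
  have hsum : qpow hb 2 * A1 hb P x 1 + qpow hb 1 * B2 hb P x 1 + A3 hb P x 1 =
      qnum hb ((P : ℂ) / 2) * qpow hb (2 * (x + (P : ℂ) / 2)) := by
    have := hq.qnum_leading (x + (P : ℂ) / 2) ((P : ℂ) / 2 - 1)
    rw [sub_add_cancel] at this
    rw [← this]
    unfold A1 B2 A3
    have a1 : x + (P : ℂ) - (1 : ℕ) = x + (P : ℂ) / 2 + ((P : ℂ) / 2 - 1) := by push_cast; ring
    have a2 : x + ((1 : ℕ) : ℂ) - 1 = x + (P : ℂ) / 2 - 1 - ((P : ℂ) / 2 - 1) := by push_cast; ring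
    have a3 : ((1 : ℕ) : ℂ) - (P : ℂ) / 2 = -((P : ℂ) / 2 - 1) := by push_cast; ring
    have a4 : -((1 : ℕ) : ℂ) + (P : ℂ) / 2 = (P : ℂ) / 2 - 1 := by push_cast; ring
    rw [a1, a2, a3, a4]
    ring
  rw [QSys.FL_eq _ hP hlo, map_add, map_add, map_add, e1, e2, e3, e4, ← Finsupp.single_add,
    ← Finsupp.single_add, ← Finsupp.single_add, ← hsum, ← hB]
  congr 1
  split_ifs <;> ring

end Evaluation

section

variable {hb : ℂ} {N l c r : ℕ} (hq : Generic hb) (h : IsDim N (l + c) (l + r))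
  {M : Type} [AddCommGroup M] [Module ℂ M] [Module (Uq hb N) M] [IsScalarTower ℂ (Uq hb N) M]
  {p : M →ₗ[ℂ] (State →₀ ℂ)} (hp : ∀ a w, p (gen hb (Gen.f a) • w) = testF hb N l c r a (p w))
include h hp

omit [IsScalarTower ℂ (Uq hb N) M] in
theorem test_fAt {k : ℕ} (h1 : 1 ≤ k) (h2 : k ≤ l + r) (w : M) :
    p (fAt hb N k • w) = testOp hb l c r k (p w) := by
  have hh := h.half
  rw [fAt_eq_genAt, genAt_eq h1 (by omega), hp, testF]
  simp only [Nat.sub_add_cancel h1]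

-- The scalar C is [P/2] times a power of q, which is non-zero for every λ; no genericity of λ is
-- needed.
include hq in
theorem test_fRoot {P : ℕ} (hP : IsRank P c r) (lam : Fin (N / 2) → ℂ) {d : ℕ} (hd : d ≤ l) :
    ∃ C : ℂ, C ≠ 0 ∧ ∀ (w : M) (B : Finset ℕ) (z : ℂ), (∀ k ∈ Finset.Ioc (l - d) l, k ∉ B) →
      p w = Finsupp.single (B, 1) z →
      p (fRoot hb N l P lam d • w) =
        Finsupp.single (B ∪ Finset.Ioc (l - d) l, r + c + 2) (C * z) := by
  have hr := hP.or
  induction d using Nat.twoStepInduction with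
  | zero =>
    refine ⟨A0 hb P 1, hP.A0_one_ne_zero hq, fun w B z _ hw => ?_⟩
    rw [← uqSys_Phi hq h (lo := 1) (by omega), Nat.sub_zero, Finset.Ioc_self, Finset.union_empty]
    exact test_Phi (fun j h1 h2 w => test_fAt h hp (by omega) (by omega) w) hr le_rfl hP hw
  | one =>
    refine ⟨qnum hb ((P : ℂ) / 2) * qpow hb (2 * (coord lam (l + 1) + (P : ℂ) / 2)), ?_,
      fun w B z hB hw => ?_⟩
    · exact mul_ne_zero (hq.qnum_half_ne_zero (by rcases hP with h | h <;> omega))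
        (qpow_ne_zero _ _)
    · have hI : Finset.Ioc (l - 1) l = {l} := by
        ext k; rw [Finset.mem_Ioc, Finset.mem_singleton]; omega
      rw [hI] at hB ⊢
      rw [← uqSys_FL hq h (lo := 0) (by omega), Finset.union_comm, ← Finset.insert_eq]
      exact test_FL (fun j h1 h2 w => test_fAt h hp (by omega) (by omega) w) hr hq rfl hP _ hw
        (hB l (Finset.mem_singleton_self l))
  | more d _ ih =>
    obtain ⟨C, hC, ih⟩ := ih (by omega)
    obtain ⟨k, hk⟩ : ∃ k, k + (d + 1) = l := ⟨l - (d + 1), by omega⟩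
    have hk1 : l - (d + 1) = k := by omega
    have hk2 : Finset.Ioc (l - (d + 2)) l = insert k (Finset.Ioc k l) := by
      ext j; rw [Finset.mem_insert, Finset.mem_Ioc, Finset.mem_Ioc]; omega
    refine ⟨qpow hb (coord lam (k + 1) + coord lam (l + 1) + P + d + 1) * C,
      mul_ne_zero (qpow_ne_zero _ _) hC, fun w B z hB hw => ?_⟩
    rw [hk1] at ih
    rw [hk2] at hB ⊢
    have hkB : k ∉ B := hB k (Finset.mem_insert_self _ _)
    have hk1B : k + 1 ∉ B := hB _ (by rw [Finset.mem_insert, Finset.mem_Ioc]; omega)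
    have hB' : ∀ j ∈ Finset.Ioc k l, j ∉ B := fun j hj => hB j (Finset.mem_insert_of_mem hj)
    have e1 : p (fAt hb N k • fRoot hb N l P lam (d + 1) • w) =
        Finsupp.single (B ∪ insert k (Finset.Ioc k l), r + c + 2) (qpow hb 1 * (C * z)) := by
      rw [test_fAt h hp (by omega) (by omega), ih w B z hB' hw, testOp_single]
      · unfold target factor
        rw [if_pos (by omega), if_pos (by omega), if_pos (by simp; omega), Finset.union_insert]
      · unfold Moves
        rw [if_pos (by omega)]
        simpa using hkB
    have e2 : p (fRoot hb N l P lam (d + 1) • fAt hb N k • w) =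
        Finsupp.single (B ∪ insert k (Finset.Ioc k l), r + c + 2) (C * z) := by
      rw [ih (fAt hb N k • w) (insert k B) z, Finset.insert_union, Finset.union_insert]
      · intro j hj
        have := hB' j hj
        rw [Finset.mem_Ioc] at hj
        rw [Finset.mem_insert]
        rintro (rfl | h1)
        · omega
        · exact this h1
      · rw [test_fAt h hp (by omega) (by omega), hw, testOp_single]
        · unfold target factor
          rw [if_pos (by omega), if_pos (by omega), if_neg (by simpa using hk1B), one_mul]
        · unfold Moves
          rw [if_pos (by omega)]
          exact hkB
    -- The two orders f_{α_k} F and F f_{α_k} differ by a factor q, so the recursion multiplies C by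
    -- q[A + 1] − [A] = q^{A+1}.
    rw [fRoot_add_two_smul lam hk, map_sub, p.map_smul, p.map_smul, e1, e2, Finsupp.smul_single,
      Finsupp.smul_single, ← Finsupp.single_sub, ← hq.qpow_mul_sub, smul_eq_mul, smul_eq_mul]
    congr 1
    ring

end

/-- The generating coefficient is not zero. -/
theorem genCoeff_ne_zero {hb : ℂ} (hq : Generic hb) {N l c r P : ℕ}
    (h : IsDim N (l + c) (l + r)) (hP : IsRank P c r) {lam : Fin (N / 2) → ℂ}
    (hlam : ∀ i, l + 2 ≤ i → i ≤ N / 2 → coord lam i = 0) : genCoeff hb N l P lam ≠ 0 := by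
  obtain ⟨p, hp0, hp⟩ := exists_hom_verma hq h hlam (testF hb N l c r)
    (Finsupp.single ((∅ : Finset ℕ), 1) 1) (fun a b hab => serre_testF hq h hab)
    (fun a ha => testF_of_isLevi h ha)
  obtain ⟨C, hC, hF⟩ := test_fRoot hq h hp hP lam le_rfl
  have h1 := hF (vacuum hb N l lam) ∅ 1 (by simp) hp0
  intro h0
  rw [genCoeff] at h0
  rw [h0, map_zero, mul_one] at h1
  exact hC (Finsupp.single_eq_zero.1 h1.symm)

end BorderlineSO

end

theorem mainTheorem5 (hb : ℂ) (hq : ∀ m : ℕ, 0 < m → Complex.exp hb ^ m ≠ 1)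
    (N l P : ℕ) (hP : 1 ≤ P) (hN : N = 2 * l + 2 + P) (lam : Fin (N / 2) → ℂ)
    (hlam : ∀ i, l + 2 ≤ i → i ≤ N / 2 → BorderlineSO.coord lam i = 0) :
    ∃ u : BorderlineSO.Tens hb N l lam,
      BorderlineSO.IsSingularHat hb N l P lam u ∧
      (∀ u', BorderlineSO.IsSingularHat hb N l P lam u' → u' = u) ∧
      u - BorderlineSO.Chat hb N l P lam •
          (BorderlineSO.w N (N - l) ⊗ₜ[ℂ] BorderlineSO.vacuum hb N l lam)
        ∈ BorderlineSO.filt hb N l lam (N - l - 1) := by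
  -- The parameters are c = (P − 1)/2, rounded down, and the rank r of so(P + 2); for even P the
  -- subtraction k − 1 is harmless because P ≥ 1.
  have hc : ∃ c r, BorderlineSO.IsRank P c r := by
    rcases Nat.even_or_odd' P with ⟨k, rfl | rfl⟩
    · exact ⟨k - 1, k + 1, Or.inr (by omega)⟩
    · exact ⟨k, k + 1, Or.inl (by omega)⟩
  obtain ⟨c, r, hPr⟩ := hc
  have h : BorderlineSO.IsDim N (l + c) (l + r) := by
    rcases hPr with h | h
    · exact Or.inl (by omega)
    · exact Or.inr (by omega)
  have hN3 : 3 ≤ N := by omega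
  have hr : 1 ≤ l + r := by rcases hPr with h | h <;> omega
  have hs := BorderlineSO.isSingularHat_sing hq h hPr hlam
    (BorderlineSO.genCoeff_ne_zero hq h hPr hlam)
  refine ⟨_, hs, fun u' hu' => ?_, ?_⟩
  · exact BorderlineSO.eq_of_singular h hN3 hr hu'.1 hs.1 (hu'.2.trans hs.2.symm)
  -- The submodule is the intersection of all stable subspaces containing the given vectors, so the
  -- congruence is proved in each of them; only stability under the f_α is used.
  · refine Submodule.mem_sInf.2 fun S hS => ?_
    refine BorderlineSO.ofCoeff_sing_sub_mem hN3 (fun a u hu => ?_) hPr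
      (BorderlineSO.isHW_vacuum hlam) fun i h1 h2 => hS.1 i h1 (by omega)
    have := hS.2 (BorderlineSO.Gen.f a) u hu
    rwa [BorderlineSO.tact_eq_tensAct] at this
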